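/- **Setting.** Let $E$ be a separable real Banach space and $H$ a separable real Hilbert space, embedded continuously and densely in $E$; identify $E'$ with a subset of $H$ via $\langle l,k\rangle_H=l(k)$, $l\in E'$, $k\in H$. Let $\mu$ be a finite Borel measure on $E$, let $A(z)$, $z\in E$, be symmetric nonnegative bounded operators on $H$ with $z\mapsto A(z)h$ measurable for every $h\in H$, let $b:E\to H$ be measurable, and let $T>0$. Let $\mathcal FC_b^\infty$ be the set of functions $u=g(l_1,\dots,l_m)$ with $l_i\in E'$ and $g\in C^\infty(\mathbb R^m)$ bounded with all its derivatives, and define $\nabla u(z)\in H$ by $\langle\nabla u(z),k\rangle_H=\frac{d}{ds}u(z+sk)|_{s=0}$, $k\in H$. Write $\|\cdot\|_2$ for the norm of $L^2(\mu)$, and $bW$ for the set of essentially bounded elements of $W$. (A1) $\langle A(\cdot)k,k\rangle_H\in L^1(\mu)$ for $k\in E'$, and $\mathcal E^A(u,v)=\int\langle A\nabla u,\nabla v\rangle_H\,d\mu$, $u,v\in\mathcal FC_b^\infty$, is closable on $L^2(\mu)$. Under (A1) let $F$ be the closure of $\mathcal FC_b^\infty$ with respect to $\mathcal E^A_1=\mathcal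 E^A+(\cdot,\cdot)_{L^2(\mu)}$, let $D_{A^{1/2}}:F\to L^2(\mu;H)$ be the closure of $u\mapsto A^{1/2}\nabla u$, so that $\mathcal E^A(u):=\mathcal E^A(u,u)=\int|D_{A^{1/2}}u|_H^2\,d\mu$ on $F$, and set, for $u\in F$, $v\in bF$, $$\mathcal E(u,v)=\int\langle D_{A^{1/2}}u,D_{A^{1/2}}v\rangle_H\,d\mu+\int\langle A^{1/2}b,D_{A^{1/2}}u\rangle_H\,v\,d\mu .$$ (A2) $A^{1/2}b\in L^2(\mu;H)$, and for some $\alpha\ge0$, $\int\langle Ab,\nabla(u^2)\rangle_H\,d\mu\ge-\alpha\|u\|_2^2$ for all $0\le u\in\mathcal FC_b^\infty$. (A3) $(P_t)_{t\ge0}$ is a positivity preserving $C_0$-semigroup on $L^2(\mu)$ such that, for some $C_T>0$, $\|P_tv\|_\infty\le C_T\|v\|_\infty$ for all $v\in L^2(\mu)$ and $t\in[0,T]$. Its generator $(L,\mathcal D(L))$ satisfies $b\mathcal D(L)\subset bF$; for each $u\in bF$ there are uniformly bounded $u_n\in\mathcal D(L)$ with $\mathcal E^A_1(u_n-u,u_n-u)\to0$;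 and $\mathcal E(u,v)=-(Lu,v)_{L^2(\mu)}$ for $u,v\in b\mathcal D(L)$. Let $\hat F=C([0,T];L^2(\mu))\cap L^2(0,T;F)$, and for $u=(u^1,\dots,u^l)\in\hat F^l$ put $\|u\|_T^2=\sup_{t\le T}\sum_i\|u^i_t\|_2^2+\int_0^T\sum_i\mathcal E^A(u^i_t)\,dt$. On $H^l$ use $|z|_H=\sum_i|z^i|_H$. For measurable $f:[0,T]\times E\times\mathbb R^l\times H^l\to\mathbb R^l$ put $f^0(t,x)=f(t,x,0,0)$; given $C>0$, $m\in L^1([0,T])$ and $\phi\in L^2(\mu;\mathbb R^l)$, consider the following conditions, for all $t\in[0,T]$, $x\in E$, $y,y'\in\mathbb R^l$, $z,z'\in H^l$: (H1) $|f(t,x,y,z)-f(t,x,y,z')|\le C|z-z'|_H$. (H2) $\langle y-y',f(t,x,y,z)-f(t,x,y',z)\rangle\le m_t|y-y'|^2$. (H3) $y\mapsto f(t,x,y,z)$ is continuous. (H4) For every $r>0$, the function $(t,x)\mapsto\sup_{|y|\le r}|f(t,x,y,0)-f(t,x,0,0)|$ is in $L^1([0,T];L^2(\mu))$. (H5) $\|\phi\|_\infty<\infty$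 and $\|f^0\|_\infty<\infty$ (essential suprema for $\mu$ and $dt\otimes\mu$). **Solutions** of $$(\partial_t+L)u+f(\cdot,\cdot,u,D_{A^{1/2}}u)=0\ \text{ on }[0,T]\times E,\qquad u_T=\phi. \tag{1}$$ A *strong solution* of (1) is a $u$ with components in $\hat F\cap L^1(0,T;\mathcal D(L))$ that is $L^2$-differentiable on $[0,T]$ with $\partial_tu\in L^1(0,T;L^2)$ and satisfies (1) in $L^2(\mu)$ (the first equation for a.e. $t$), where $f(\cdot,\cdot,u,D_{A^{1/2}}u)\in L^1([0,T];L^2)$. A *generalized solution* is a $u\in\hat F^l$ with $f(\cdot,\cdot,u,D_{A^{1/2}}u)\in L^1([0,T];L^2)$ for which there are strong solutions $u_n$ of (1) with data $(\phi_n,f_n)$, $f_n$ measurable, in place of $(\phi,f)$, such that $\|u_n-u\|_T\to0$, $\|\phi_n-\phi\|_2\to0$ and $f_n(\cdot,\cdot,u_n,D_{A^{1/2}}u_n)\to f(\cdot,\cdot,u,D_{A^{1/2}}u)$ in $L^1([0,T];L^2)$. A *mild solution* is a $u\in\hat F^l$ with $f(\cdot,\cdot,u,D_{A^{1/2}}u)\in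 L^1([0,T];L^2)$ and, for $i=1,\dots,l$ and all $t\in[0,T]$, $$u^i_t=P_{T-t}\phi^i+\int_t^TP_{s-t}f^i(s,\cdot,u_s,D_{A^{1/2}}u_s)\,ds\quad\text{in }L^2(\mu).$$ **Theorem.** Assume (A1)–(A3), and fix $l\in\mathbb N$, $C>0$ and $m\in L^1([0,T])$. There are constants $K_1,K_2<\infty$ such that for all $f$ and $\phi$ satisfying (H1)–(H5) with these $C$ and $m$: a function is a generalized solution of (1) if and only if it is a mild solution; there exists exactly one generalized solution $u\in\hat F^l$ of (1); and $$\|u\|_T^2\le K_1\Big(\|\phi\|_2^2+\int_0^T\|f^0_t\|_2^2\,dt\Big),\qquad \sup_{t\in[0,T]}\|u_t\|_\infty\le K_2\big(\|\phi\|_\infty+\|f^0\|_\infty\big).$$ -/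

import Mathlib

open MeasureTheory Filter Topology Set
open scoped ENNReal NNReal RealInnerProductSpace

noncomputable section

/- Throughout: `E` is a separable Banach space, `H` a separable Hilbert space, `j : H →L[ℝ] E` the
(dense, injective) inclusion, `A : E → H →L[ℝ] H` the diffusion coefficient, `b : E → H` the drift,
`μ` a finite Borel measure on `E`, `P t` (`t ≥ 0`) a family of operators on `L²(E, μ)`. -/

/-- The square root `B^{1/2}` of a positive operator `B` on a real Hilbert space, i.e. the (unique)
positive operator `S` with `S S = B`. The value for non-positive `B` is irrelevant. -/
def opSqrt {H : Type*} [NormedAddCommGroup H] [InnerProductSpace ℝ H] [CompleteSpace H]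
    (B : H →L[ℝ] H) : H →L[ℝ] H :=
  open Classical in
  if h : ∃ S : H →L[ℝ] H, S.IsPositive ∧ S ∘L S = B then h.choose else 0

/-- `𝓕C_b^∞`: the functions `z ↦ g (l₁ z, …, l_m z)` with `l_i ∈ E'` and `g` a smooth function on
`ℝ^m` that is bounded together with all its derivatives. -/
def IsCylinder {E : Type*} [NormedAddCommGroup E] [NormedSpace ℝ E] (u : E → ℝ) : Prop :=
  ∃ (m : ℕ) (g : EuclideanSpace ℝ (Fin m) → ℝ) (L : Fin m → E →L[ℝ] ℝ),
    ContDiff ℝ (⊤ : ℕ∞) g ∧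
    (∀ k : ℕ, ∃ C : ℝ, ∀ x, ‖iteratedFDeriv ℝ k g x‖ ≤ C) ∧
    ∀ z, u z = g (WithLp.toLp 2 fun i => L i z)

section Form

variable {E H : Type*} [NormedAddCommGroup E] [NormedSpace ℝ E]
  [NormedAddCommGroup H] [InnerProductSpace ℝ H] [CompleteSpace H]

/-- A functional `L ∈ E'` as an element of `H`: `⟪dualToH j L, k⟫ = L (j k)` for `k ∈ H`. -/
def dualToH (j : H →L[ℝ] E) (L : E →L[ℝ] ℝ) : H :=
  (InnerProductSpace.toDual ℝ H).symm (L ∘L j)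

/-- The `H`-gradient: `⟪gradH j u z, k⟫` is the derivative of `u` at `z` in direction `k ∈ H`. -/
def gradH (j : H →L[ℝ] E) (u : E → ℝ) (z : E) : H :=
  dualToH j (fderiv ℝ u z)

variable [MeasurableSpace E]

/-- The form `𝓔^A(u, v) = ∫ ⟨A ∇u, ∇v⟩_H dμ` on cylinder functions. -/
def formCyl (j : H →L[ℝ] E) (A : E → H →L[ℝ] H) (μ : Measure E) (u v : E → ℝ) : ℝ :=
  ∫ z, ⟪A z (gradH j u z), gradH j v z⟫ ∂μ

/-- Condition (A1): `⟨A k, k⟩ ∈ L¹(μ)` for `k ∈ E' ⊆ H`, and `(𝓔^A, 𝓕C_b^∞)` is closable on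
`L²(E, μ)`. -/
structure CondA1 (j : H →L[ℝ] E) (A : E → H →L[ℝ] H) (μ : Measure E) : Prop where
  integrable : ∀ L : E →L[ℝ] ℝ,
    Integrable (fun z => ⟪A z (dualToH j L), dualToH j L⟫) μ
  closable : ∀ u : ℕ → E → ℝ, (∀ n, IsCylinder (u n)) →
    Tendsto (fun n => ∫ z, (u n z) ^ 2 ∂μ) atTop (𝓝 0) →
    Tendsto (fun p : ℕ × ℕ => formCyl j A μ (u p.1 - u p.2) (u p.1 - u p.2)) atTop (𝓝 0) →
    Tendsto (fun n => formCyl j A μ (u n) (u n)) atTop (𝓝 0)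

/-- Condition (A2): `A^{1/2} b ∈ L²(E, μ; H)`, and for some `α ≥ 0`,
`∫ ⟨A b, ∇(u²)⟩_H dμ ≥ -α ‖u‖₂²` for all nonnegative cylinder functions `u`. -/
structure CondA2 (j : H →L[ℝ] E) (A : E → H →L[ℝ] H) (b : E → H) (μ : Measure E) : Prop where
  memLp : MemLp (fun z => opSqrt (A z) (b z)) 2 μ
  lower : ∃ α : ℝ, 0 ≤ α ∧ ∀ u : E → ℝ, IsCylinder u → (∀ z, 0 ≤ u z) →
    -α * ∫ z, (u z) ^ 2 ∂μ ≤ ∫ z, ⟪A z (b z), gradH j (fun y => (u y) ^ 2) z⟫ ∂μ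

/-- The graph of `u ↦ A^{1/2} ∇u`, `u ∈ 𝓕C_b^∞`, in `L²(E, μ) × L²(E, μ; H)`. -/
def gradGraph (j : H →L[ℝ] E) (A : E → H →L[ℝ] H) (μ : Measure E) :
    Set (Lp ℝ 2 μ × Lp H 2 μ) :=
  {p | ∃ u : E → ℝ, IsCylinder u ∧ (p.1 : E → ℝ) =ᵐ[μ] u ∧
    (p.2 : E → H) =ᵐ[μ] fun z => opSqrt (A z) (gradH j u z)}

/-- `F`: the closure of `𝓕C_b^∞` in `L²(E, μ)` with respect to `𝓔^A_1`. As
`𝓔^A(u) = ∫ |A^{1/2}∇u|² dμ`, this is the domain of the closure of `u ↦ A^{1/2} ∇u`. -/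
def domF (j : H →L[ℝ] E) (A : E → H →L[ℝ] H) (μ : Measure E) : Set (Lp ℝ 2 μ) :=
  {u | ∃ ψ : Lp H 2 μ, (u, ψ) ∈ closure (gradGraph j A μ)}

/-- `D_{A^{1/2}} u` for `u ∈ F`: the closure of `u ↦ A^{1/2} ∇u` (single-valued under (A1)). The
value for `u ∉ F` is irrelevant. -/
def gradA (j : H →L[ℝ] E) (A : E → H →L[ℝ] H) (μ : Measure E) (u : Lp ℝ 2 μ) : Lp H 2 μ :=
  open Classical in
  if h : ∃ ψ : Lp H 2 μ, (u, ψ) ∈ closure (gradGraph j A μ) then h.choose else 0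

/-- Essentially bounded elements of `L²`. -/
def EssBdd {μ : Measure E} (u : Lp ℝ 2 μ) : Prop := ∃ M : ℝ, ∀ᵐ z ∂μ, |u z| ≤ M

/-- The form
`𝓔(u, v) = ∫ ⟨D_{A^{1/2}} u, D_{A^{1/2}} v⟩_H dμ + ∫ ⟨A^{1/2} b, D_{A^{1/2}} u⟩_H v dμ`
for `u ∈ F` and bounded `v ∈ F`. -/
def formE (j : H →L[ℝ] E) (A : E → H →L[ℝ] H) (b : E → H) (μ : Measure E)
    (u v : Lp ℝ 2 μ) : ℝ :=
  ⟪gradA j A μ u, gradA j A μ v⟫ +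
    ∫ z, ⟪opSqrt (A z) (b z), gradA j A μ u z⟫ * v z ∂μ

/-- `P` (restricted to `t ≥ 0`) is a `C₀`-semigroup of bounded operators on the space `X`. -/
structure IsC0Semigroup {X : Type*} [NormedAddCommGroup X] [NormedSpace ℝ X]
    (P : ℝ → X →L[ℝ] X) : Prop where
  zero : P 0 = ContinuousLinearMap.id ℝ X
  add : ∀ s t, 0 ≤ s → 0 ≤ t → P (s + t) = P s ∘L P t
  tendsto : ∀ x, Tendsto (fun t => P t x) (𝓝[>] 0) (𝓝 x)

/-- `u ∈ 𝓓(L)` and `L u = v`, where `L` is the infinitesimal generator of `P`. -/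
def IsGenerator {X : Type*} [NormedAddCommGroup X] [NormedSpace ℝ X]
    (P : ℝ → X →L[ℝ] X) (u v : X) : Prop :=
  Tendsto (fun t : ℝ => t⁻¹ • (P t u - u)) (𝓝[>] 0) (𝓝 v)

/-- Condition (A3): `P` is a positivity preserving `C₀`-semigroup on `L²(E, μ)`, uniformly bounded
in the `L^∞`-norm on `[0, T]`, whose generator `(L, 𝓓(L))` satisfies `b𝓓(L) ⊆ bF`, each `u ∈ bF`
is an `𝓔^A_1`-limit of uniformly bounded elements of `𝓓(L)`, and `𝓔(u, v) = -(Lu, v)` for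
`u, v ∈ b𝓓(L)`. -/
structure CondA3 (j : H →L[ℝ] E) (A : E → H →L[ℝ] H) (b : E → H) (μ : Measure E)
    (T : ℝ) (P : ℝ → Lp ℝ 2 μ →L[ℝ] Lp ℝ 2 μ) : Prop where
  semigroup : IsC0Semigroup P
  positivity : ∀ t, 0 ≤ t → ∀ u : Lp ℝ 2 μ, 0 ≤ u → 0 ≤ P t u
  bound : ∃ C : ℝ≥0, 0 < C ∧ ∀ t ∈ Icc 0 T, ∀ u : Lp ℝ 2 μ,
    eLpNorm (P t u) ∞ μ ≤ C * eLpNorm u ∞ μ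
  dom_sub : ∀ u v, IsGenerator P u v → EssBdd u → u ∈ domF j A μ
  dense : ∀ u ∈ domF j A μ, EssBdd u → ∃ (w : ℕ → Lp ℝ 2 μ) (M : ℝ),
    (∀ n, (∃ v, IsGenerator P (w n) v) ∧ ∀ᵐ z ∂μ, |w n z| ≤ M) ∧
    Tendsto (fun n => ‖gradA j A μ (w n - u)‖ ^ 2 + ‖w n - u‖ ^ 2) atTop (𝓝 0)
  assoc : ∀ u Lu v Lv, IsGenerator P u Lu → EssBdd u → IsGenerator P v Lv → EssBdd v →
    formE j A b μ u v = -⟪Lu, v⟫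

/-- `F̂ = C([0,T]; L²(μ)) ∩ L²(0,T; F)`. -/
structure InFhat (j : H →L[ℝ] E) (A : E → H →L[ℝ] H) (μ : Measure E) (T : ℝ)
    (u : ℝ → Lp ℝ 2 μ) : Prop where
  continuousOn : ContinuousOn u (Icc 0 T)
  mem : ∀ᵐ t ∂(volume.restrict (Icc 0 T)), u t ∈ domF j A μ
  memLp : MemLp (fun t => gradA j A μ (u t)) 2 (volume.restrict (Icc 0 T))

/-- `‖u‖_T² = sup_{t ∈ [0,T]} ‖u_t‖₂² + ∫₀ᵀ 𝓔^A(u_t) dt` for `u = (u¹, …, u^l)`, where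
`𝓔^A(v) = ∫ |D_{A^{1/2}} v|_H² dμ`. -/
def normTSq (j : H →L[ℝ] E) (A : E → H →L[ℝ] H) (μ : Measure E) (T : ℝ) {l : ℕ}
    (u : Fin l → ℝ → Lp ℝ 2 μ) : ℝ≥0∞ :=
  (⨆ t ∈ Icc 0 T, ∑ i, ‖u i t‖ₑ ^ 2) +
    ∫⁻ t in Icc 0 T, ∑ i, ‖gradA j A μ (u i t)‖ₑ ^ 2

/-- The vector `(v¹(x), …, v^l(x)) ∈ ℝ^l` of values of a system of `L²`-functions. -/
def vec {μ : Measure E} {l : ℕ} (v : Fin l → Lp ℝ 2 μ) (x : E) : EuclideanSpace ℝ (Fin l) :=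
  WithLp.toLp 2 fun i => v i x

/-- `g^i = f^i(·,·,u, D_{A^{1/2}} u)` and `g^i ∈ L¹([0,T]; L²(μ))` for `i = 1, …, l`. -/
def IsNonlinearTerm (j : H →L[ℝ] E) (A : E → H →L[ℝ] H) (μ : Measure E) (T : ℝ) {l : ℕ}
    (f : ℝ → E → EuclideanSpace ℝ (Fin l) → (Fin l → H) → EuclideanSpace ℝ (Fin l))
    (u g : Fin l → ℝ → Lp ℝ 2 μ) : Prop :=
  ∀ i, IntegrableOn (g i) (Icc 0 T) ∧
    ∀ᵐ t ∂(volume.restrict (Icc 0 T)), (g i t : E → ℝ) =ᵐ[μ]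
      fun x => f t x (vec (fun k => u k t) x) (fun k => gradA j A μ (u k t) x) i

/-- `u` is a strong solution of the linear equation `(∂_t + L) u + g = 0`, `u_T = φ`:
`u ∈ F̂ ∩ L¹(0,T; 𝓓(L))` is `L²`-differentiable on `[0,T]` with `∂_t u ∈ L¹(0,T; L²)`. -/
def IsStrongSolutionLin (j : H →L[ℝ] E) (A : E → H →L[ℝ] H) (μ : Measure E) (T : ℝ)
    (P : ℝ → Lp ℝ 2 μ →L[ℝ] Lp ℝ 2 μ) (φ : Lp ℝ 2 μ) (g u : ℝ → Lp ℝ 2 μ) : Prop :=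
  InFhat j A μ T u ∧ u T = φ ∧ ∃ du Lu : ℝ → Lp ℝ 2 μ,
    (∀ t ∈ Icc 0 T, HasDerivWithinAt u (du t) (Icc 0 T) t) ∧
    IntegrableOn du (Icc 0 T) ∧
    (∀ᵐ t ∂(volume.restrict (Icc 0 T)), IsGenerator P (u t) (Lu t)) ∧
    IntegrableOn Lu (Icc 0 T) ∧
    ∀ᵐ t ∂(volume.restrict (Icc 0 T)), du t + Lu t + g t = 0

/-- Joint measurability of `f : [0,T] × E × ℝ^l × H^l → ℝ^l` (values for `t ∉ [0,T]` play no
role). -/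
def MeasurableNonlinearity [MeasurableSpace H] (T : ℝ) {l : ℕ}
    (f : ℝ → E → EuclideanSpace ℝ (Fin l) → (Fin l → H) → EuclideanSpace ℝ (Fin l)) : Prop :=
  Measurable fun p : Icc (0 : ℝ) T × E × EuclideanSpace ℝ (Fin l) × (Fin l → H) =>
    f p.1 p.2.1 p.2.2.1 p.2.2.2

/-- `u` is a strong solution of the system `(∂_t + L) u + f(·,·,u, D_{A^{1/2}} u) = 0`, `u_T = φ`
with nonlinear term `g = f(·,·,u, D_{A^{1/2}} u)`. -/
def IsStrongSolution (j : H →L[ℝ] E) (A : E → H →L[ℝ] H) (μ : Measure E) (T : ℝ)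
    (P : ℝ → Lp ℝ 2 μ →L[ℝ] Lp ℝ 2 μ) {l : ℕ} (φ : Fin l → Lp ℝ 2 μ)
    (f : ℝ → E → EuclideanSpace ℝ (Fin l) → (Fin l → H) → EuclideanSpace ℝ (Fin l))
    (u g : Fin l → ℝ → Lp ℝ 2 μ) : Prop :=
  IsNonlinearTerm j A μ T f u g ∧ ∀ i, IsStrongSolutionLin j A μ T P (φ i) (g i) (u i)

/-- `u` is a generalized solution of `(∂_t + L) u + f(·,·,u, D_{A^{1/2}} u) = 0`, `u_T = φ`:
`u ∈ F̂^l`, `f(·,·,u, D_{A^{1/2}} u) ∈ L¹([0,T]; L²)`, and there are strong solutions `u_n` with data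
`(φ_n, f_n)` such that `‖u_n - u‖_T → 0`, `‖φ_n - φ‖₂ → 0` and
`f_n(·,·,u_n, D_{A^{1/2}} u_n) → f(·,·,u, D_{A^{1/2}} u)` in `L¹([0,T]; L²)`. -/
def IsGeneralizedSolution [MeasurableSpace H]
    (j : H →L[ℝ] E) (A : E → H →L[ℝ] H) (μ : Measure E) (T : ℝ)
    (P : ℝ → Lp ℝ 2 μ →L[ℝ] Lp ℝ 2 μ) {l : ℕ} (φ : Fin l → Lp ℝ 2 μ)
    (f : ℝ → E → EuclideanSpace ℝ (Fin l) → (Fin l → H) → EuclideanSpace ℝ (Fin l))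
    (u : Fin l → ℝ → Lp ℝ 2 μ) : Prop :=
  (∀ i, InFhat j A μ T (u i)) ∧
  ∃ g : Fin l → ℝ → Lp ℝ 2 μ, IsNonlinearTerm j A μ T f u g ∧
  ∃ (φn : ℕ → Fin l → Lp ℝ 2 μ)
    (fn : ℕ → ℝ → E → EuclideanSpace ℝ (Fin l) → (Fin l → H) → EuclideanSpace ℝ (Fin l))
    (un gn : ℕ → Fin l → ℝ → Lp ℝ 2 μ),
    (∀ n, MeasurableNonlinearity T (fn n)) ∧
    (∀ n, IsStrongSolution j A μ T P (φn n) (fn n) (un n) (gn n)) ∧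
    Tendsto (fun n => normTSq j A μ T (fun i t => un n i t - u i t)) atTop (𝓝 0) ∧
    (∀ i, Tendsto (fun n => φn n i) atTop (𝓝 (φ i))) ∧
    ∀ i, Tendsto (fun n => ∫⁻ t in Icc 0 T, ‖gn n i t - g i t‖ₑ) atTop (𝓝 0)

/-- `u` is a mild solution: `u ∈ F̂^l`, `f(·,·,u, D_{A^{1/2}} u) ∈ L¹([0,T]; L²)`, and
`u_t = P_{T-t} φ + ∫_t^T P_{s-t} f(s,·,u_s, D_{A^{1/2}} u_s) ds` componentwise in `L²(μ)`. -/
def IsMildSolution (j : H →L[ℝ] E) (A : E → H →L[ℝ] H) (μ : Measure E) (T : ℝ)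
    (P : ℝ → Lp ℝ 2 μ →L[ℝ] Lp ℝ 2 μ) {l : ℕ} (φ : Fin l → Lp ℝ 2 μ)
    (f : ℝ → E → EuclideanSpace ℝ (Fin l) → (Fin l → H) → EuclideanSpace ℝ (Fin l))
    (u : Fin l → ℝ → Lp ℝ 2 μ) : Prop :=
  (∀ i, InFhat j A μ T (u i)) ∧
  ∃ g : Fin l → ℝ → Lp ℝ 2 μ, IsNonlinearTerm j A μ T f u g ∧
    ∀ i, ∀ t ∈ Icc 0 T, u i t = P (T - t) (φ i) + ∫ s in t..T, P (s - t) (g i s)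

/-- Conditions (H1)–(H5) on the measurable nonlinearity `f : [0,T] × E × ℝ^l × H^l → ℝ^l` and the
terminal value `φ`, with Lipschitz constant `C` and monotonicity function `m ∈ L¹([0,T])`. -/
structure CondH [MeasurableSpace H] (μ : Measure E) (T : ℝ) {l : ℕ} (C : ℝ) (m : ℝ → ℝ)
    (f : ℝ → E → EuclideanSpace ℝ (Fin l) → (Fin l → H) → EuclideanSpace ℝ (Fin l))
    (φ : Fin l → Lp ℝ 2 μ) : Prop where
  measurable : MeasurableNonlinearity T f
  /-- (H1), with `|z|_H = ∑ |z^i|_H` on `H^l` -/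
  lipschitz : ∀ t ∈ Icc 0 T, ∀ x y z z', ‖f t x y z - f t x y z'‖ ≤ C * ∑ i, ‖z i - z' i‖
  /-- (H2) -/
  monotone : ∀ t ∈ Icc 0 T, ∀ x y y' z,
    ⟪y - y', f t x y z - f t x y' z⟫ ≤ m t * ‖y - y'‖ ^ 2
  /-- (H3) -/
  continuous : ∀ t ∈ Icc 0 T, ∀ x z, Continuous fun y => f t x y z
  /-- (H4) -/
  growth : ∀ r : ℝ, 0 < r →
    ∫⁻ t in Icc 0 T, (∫⁻ x, (⨆ y ∈ Metric.closedBall (0 : EuclideanSpace ℝ (Fin l)) r,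
      ‖f t x y 0 - f t x 0 0‖ₑ) ^ 2 ∂μ) ^ (1 / 2 : ℝ) < ∞
  /-- (H5), terminal value -/
  terminal_bdd : eLpNorm (vec φ) ∞ μ < ∞
  /-- (H5), `f⁰ = f(·,·,0,0)` -/
  zero_bdd : eLpNorm (fun p : ℝ × E => f p.1 p.2 0 0) ∞
    ((volume.restrict (Icc 0 T)).prod μ) < ∞

end Form

end

/-! Write D for `gradA`. Everything about the linear problem follows from one inequality. Testing
(A2) with √(Ψ(u)+ε) shows that the drift integral of D(Ψ(u)) is at least -α∫Ψ(u) for every smooth Ψ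
≥ 0 and bounded u ∈ F (`DriftLowerBound`). Inserted into 𝓔(u,v) = -(Lu,v), which extends from
bounded v in the domain of L to all bounded v ∈ F (`CondA3.form_eq`), it gives ‖Du‖² ≤ -(Lu,u) +
(α/2)‖u‖². With v = u_i Ξ'(|u|²), Ξ ≥ 0 smooth and convex, it gives the analogue for systems
(`sum_integral_generator_le`).

These inequalities hold only for bounded elements of the domain of L. Mild solutions are therefore
approximated by mild solutions whose data are truncated and then smoothed by h⁻¹∫₀ʰ P_r dr
(`NiceData`, `exists_niceApprox`); the latter are bounded, differentiable in L² and have a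
continuous Lu. In the limit this yields, for arbitrary mild solutions, an energy inequality with
weight exp(∫(k+α)) (`energy_system_le`) and, for bounded data, a maximum principle of Stampacchia
type for |u|² (`mild_ae_le_barrier`).

Generalized and mild solutions coincide for reasons unrelated to the nonlinearity. A strong solution
satisfies Duhamel's formula, which survives the limits in the definition. Conversely, a mild
solution with source g is a limit of strong solutions with sources g_n, and the nonlinearity f_n may
be taken to be g_n itself, independent of (y,z).

(H1) and (H2) give 2⟨y-y', f(y,z)-f(y',z')⟩ ≤ k|y-y'|² + Σ|z_i-z_i'|². The energy inequality has
2∫|Du-Du'|² on its left side, so the gradient term on the right is absorbed. This gives uniqueness,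
the constant K₁ and a stability estimate with a one-sided error term (`stability_le`). The same
bracket bound with y' = 0, z' = 0, put into the maximum principle, gives K₂.

Existence is reached in four stages. For f bounded and Lipschitz in y, with the gradient argument
frozen, the solution map is a contraction in a weighted L² (`exists_mild_of_lipschitz`). For f
bounded, continuous and one-sided Lipschitz in y, mollification in y reduces to the first stage, and
stability makes the approximate solutions converge (`exists_mild_of_monotone`). The dependence on
the gradient is restored by a contraction in a weighted L² of gradients (`exists_mild_of_bounded`).
Finally, a general f is cut off in y at radius r, in z at radius ρ, and where its oscillation
`oscSup` exceeds ρ. The a priori bounds depend on neither r nor ρ, so r can be chosen as the sup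
bound and the cutoff in y is never felt. As ρ → ∞ the solutions are Cauchy, because the defect
`truncError` is small in L¹ by (H4) and the uniform L² bound of the gradients
(`exists_limit_of_trunc`). The sources converge in L¹(0,T;L²), and the limit is a mild solution
(`exists_source_limit`, `exists_mild_of_condH`). -/

set_option linter.unusedSectionVars false


/-! ### Square roots of positive operators -/

section SquareRoot

variable {H : Type*} [NormedAddCommGroup H] [InnerProductSpace ℝ H] [CompleteSpace H]

/-- The nonnegative quadratic form of B is evaluated at x - ‖B‖⁻¹Bx, and its term of second order in
Bx is bounded by ‖B‖⁻¹‖Bx‖². -/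
lemma norm_sq_apply_le_of_isPositive {B : H →L[ℝ] H} (hB : B.IsPositive) (hB0 : 0 < ‖B‖) (x : H) :
    ‖B x‖ ^ 2 ≤ ‖B‖ * ⟪B x, x⟫ := by
  have h1 := hB.inner_nonneg_left (x - ‖B‖⁻¹ • B x)
  have h2 : ⟪B (B x), B x⟫ ≤ ‖B‖ * ‖B x‖ ^ 2 := by
    refine (real_inner_le_norm _ _).trans ?_
    have := B.le_opNorm (B x)
    nlinarith [norm_nonneg (B x)]
  have h3 : ⟪B (B x), x⟫ = ‖B x‖ ^ 2 := by
    rw [hB.inner_left_eq_inner_right, real_inner_self_eq_norm_sq]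
  simp only [map_sub, map_smul, inner_sub_left, inner_sub_right, real_inner_smul_left,
    real_inner_smul_right, h3, real_inner_self_eq_norm_sq] at h1
  have h4 : ‖B‖⁻¹ * (‖B‖⁻¹ * ⟪B (B x), B x⟫) ≤ ‖B‖⁻¹ * ‖B x‖ ^ 2 := by
    refine mul_le_mul_of_nonneg_left ?_ (by positivity)
    rw [inv_mul_le_iff₀ hB0]
    exact h2
  have h5 : ‖B‖⁻¹ * ‖B x‖ ^ 2 ≤ ⟪B x, x⟫ := by nlinarith
  rwa [inv_mul_le_iff₀ hB0] at h5

lemma norm_one_sub_inv_smul_le {B : H →L[ℝ] H} (hB : B.IsPositive) (hB0 : 0 < ‖B‖) :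
    ‖(1 : H →L[ℝ] H) - ‖B‖⁻¹ • B‖ ≤ 1 := by
  refine ContinuousLinearMap.opNorm_le_bound _ zero_le_one fun x => ?_
  rw [one_mul]
  have h1 := norm_sq_apply_le_of_isPositive hB hB0 x
  have h0 := hB.inner_nonneg_left x
  refine (sq_le_sq₀ (norm_nonneg _) (norm_nonneg _)).1 ?_
  have : ((1 : H →L[ℝ] H) - ‖B‖⁻¹ • B) x = x - ‖B‖⁻¹ • B x := rfl
  rw [this, @norm_sub_sq_real, real_inner_smul_right, norm_smul, real_inner_comm]
  have h2 : (‖‖B‖⁻¹‖ * ‖B x‖) ^ 2 ≤ ‖B‖⁻¹ * ⟪B x, x⟫ := by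
    rw [mul_pow, norm_inv, norm_norm]
    calc (‖B‖⁻¹) ^ 2 * ‖B x‖ ^ 2 ≤ (‖B‖⁻¹) ^ 2 * (‖B‖ * ⟪B x, x⟫) := by gcongr
      _ = _ := by field_simp
  have : 0 ≤ ‖B‖⁻¹ * ⟪B x, x⟫ := by positivity
  linarith

/-- The iteration `y ↦ (x + y²) / 2`, whose limit `y` satisfies `(1 - y)² = 1 - x`. -/
noncomputable def sqrtIter {R : Type*} [Ring R] [Module ℝ R] (x : R) : ℕ → R
  | 0 => 0
  | n + 1 => (1 / 2 : ℝ) • (x + sqrtIter x n * sqrtIter x n)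

lemma sqrtIter_real_mem (n : ℕ) : sqrtIter (1 : ℝ) n ∈ Icc (0 : ℝ) 1 := by
  induction n with
  | zero => simp [sqrtIter]
  | succ n ih =>
    obtain ⟨h0, h1⟩ := ih
    simp only [sqrtIter, smul_eq_mul, mem_Icc]
    constructor <;> nlinarith

/-- The iteration has nonnegative coefficients, so its run in ℝ with x = 1 majorizes every run with
‖x‖ ≤ 1. -/
lemma norm_sqrtIter_le {R : Type*} [NormedRing R] [NormedAlgebra ℝ R] {x : R} (hx : ‖x‖ ≤ 1)
    (n : ℕ) : ‖sqrtIter x n‖ ≤ sqrtIter (1 : ℝ) n := by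
  induction n with
  | zero => simp [sqrtIter]
  | succ n ih =>
    simp only [sqrtIter, norm_smul, smul_eq_mul]
    have h1 : ‖x + sqrtIter x n * sqrtIter x n‖ ≤ ‖x‖ + ‖sqrtIter x n‖ * ‖sqrtIter x n‖ :=
      (norm_add_le _ _).trans (by gcongr; exact norm_mul_le _ _)
    have h2 : ‖sqrtIter x n‖ * ‖sqrtIter x n‖ ≤ sqrtIter (1 : ℝ) n * sqrtIter (1 : ℝ) n := by
      gcongr; exact (sqrtIter_real_mem n).1
    norm_num
    linarith

lemma norm_sqrtIter_succ_sub_le {R : Type*} [NormedRing R] [NormedAlgebra ℝ R] {x : R}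
    (hx : ‖x‖ ≤ 1) (n : ℕ) : ‖sqrtIter x (n + 1) - sqrtIter x n‖ ≤
      sqrtIter (1 : ℝ) (n + 1) - sqrtIter (1 : ℝ) n := by
  induction n with
  | zero =>
    simp only [sqrtIter, mul_zero, add_zero, sub_zero, norm_smul, smul_eq_mul]
    norm_num
    exact hx
  | succ n ih =>
    -- The factorization a² - b² = a(a - b) + (a - b)b needs no commutativity.
    have key : sqrtIter x (n + 1 + 1) - sqrtIter x (n + 1) = (1 / 2 : ℝ) •
        (sqrtIter x (n + 1) * (sqrtIter x (n + 1) - sqrtIter x n) +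
          (sqrtIter x (n + 1) - sqrtIter x n) * sqrtIter x n) := by
      rw [sqrtIter]
      conv_lhs => rw [show sqrtIter x (n + 1) = (1 / 2 : ℝ) • (x + sqrtIter x n * sqrtIter x n)
        from rfl]
      simp only [← smul_sub]
      rw [show (1 / 2 : ℝ) • (x + sqrtIter x n * sqrtIter x n) = sqrtIter x (n + 1) from rfl]
      congr 1
      noncomm_ring
    have h1 := norm_sqrtIter_le hx n
    have h2 := norm_sqrtIter_le hx (n + 1)
    have h3 := (sqrtIter_real_mem n).1
    have h4 := (sqrtIter_real_mem (n + 1)).1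
    rw [key, norm_smul]
    have h5 : ‖sqrtIter x (n + 1) * (sqrtIter x (n + 1) - sqrtIter x n) +
          (sqrtIter x (n + 1) - sqrtIter x n) * sqrtIter x n‖ ≤
        sqrtIter (1 : ℝ) (n + 1) * (sqrtIter (1 : ℝ) (n + 1) - sqrtIter (1 : ℝ) n) +
          (sqrtIter (1 : ℝ) (n + 1) - sqrtIter (1 : ℝ) n) * sqrtIter (1 : ℝ) n := by
      refine (norm_add_le _ _).trans (add_le_add ?_ ?_)
      · refine (norm_mul_le _ _).trans ?_
        gcongr
      · refine (norm_mul_le _ _).trans ?_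
        gcongr
        exact (norm_nonneg _).trans ih
    have h6 : sqrtIter (1 : ℝ) (n + 1 + 1) - sqrtIter (1 : ℝ) (n + 1) = 1 / 2 *
        (sqrtIter (1 : ℝ) (n + 1) * (sqrtIter (1 : ℝ) (n + 1) - sqrtIter (1 : ℝ) n) +
          (sqrtIter (1 : ℝ) (n + 1) - sqrtIter (1 : ℝ) n) * sqrtIter (1 : ℝ) n) := by
      have e1 : sqrtIter (1 : ℝ) (n + 1 + 1) =
        1 / 2 * (1 + sqrtIter (1 : ℝ) (n + 1) * sqrtIter (1 : ℝ) (n + 1)) := rfl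
      have e2 : sqrtIter (1 : ℝ) (n + 1) =
        1 / 2 * (1 + sqrtIter (1 : ℝ) n * sqrtIter (1 : ℝ) n) := rfl
      rw [e1]
      linear_combination -e2
    rw [h6]
    norm_num
    linarith

/-- The increments are majorized by those of the scalar run, which telescope to at most 1. The limit
satisfies y = (x + y²)/2, which is the asserted identity. -/
lemma exists_one_sub_mul_self_eq {R : Type*} [NormedRing R] [NormedAlgebra ℝ R] [CompleteSpace R]
    {x : R} (hx : ‖x‖ ≤ 1) : ∃ y : R, Tendsto (sqrtIter x) atTop (𝓝 y) ∧ ‖y‖ ≤ 1 ∧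
      (1 - y) * (1 - y) = 1 - x := by
  have hsum : Summable fun n => sqrtIter (1 : ℝ) (n + 1) - sqrtIter (1 : ℝ) n := by
    refine summable_of_sum_range_le (c := 1)
      (fun n => (norm_nonneg _).trans (norm_sqrtIter_succ_sub_le hx n)) fun n => ?_
    rw [Finset.sum_range_sub]
    have := (sqrtIter_real_mem n).2
    simpa [sqrtIter] using this
  have hc : CauchySeq (sqrtIter x) := by
    refine cauchySeq_of_dist_le_of_summable _ (fun n => ?_) hsum
    rw [dist_comm, dist_eq_norm]
    exact norm_sqrtIter_succ_sub_le hx n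
  obtain ⟨y, hY⟩ := cauchySeq_tendsto_of_complete hc
  refine ⟨y, hY, le_of_tendsto hY.norm (Eventually.of_forall fun n =>
    (norm_sqrtIter_le hx n).trans (sqrtIter_real_mem n).2), ?_⟩
  have hYe : y = (1 / 2 : ℝ) • (x + y * y) :=
    tendsto_nhds_unique ((tendsto_add_atTop_iff_nat 1).2 hY)
      ((tendsto_const_nhds.add (hY.mul hY)).const_smul _)
  have h2 : (2 : ℝ) • y = x + y * y := by
    conv_lhs => rw [hYe]
    rw [smul_smul]; norm_num
  have h3 : (1 - y) * (1 - y) = 1 - (2 : ℝ) • y + y * y := by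
    rw [two_smul]; noncomm_ring
  rw [h3, h2]
  abel

lemma isSelfAdjoint_sqrtIter {X : H →L[ℝ] H} (hX : IsSelfAdjoint X) (n : ℕ) :
    IsSelfAdjoint (sqrtIter X n) := by
  induction n with
  | zero => exact IsSelfAdjoint.zero _
  | succ n ih =>
    have h := ih.pow 2
    rw [pow_two] at h
    exact IsSelfAdjoint.smul (IsSelfAdjoint.all _) (hX.add h)

lemma isPositive_one_sub {Y : H →L[ℝ] H} (hY : ‖Y‖ ≤ 1) (hYs : IsSelfAdjoint Y) :
    ((1 : H →L[ℝ] H) - Y).IsPositive := by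
  refine (ContinuousLinearMap.isPositive_iff' _).2 ⟨(IsSelfAdjoint.one _).sub hYs, fun x => ?_⟩
  have h1 : ⟪Y x, x⟫ ≤ ‖x‖ ^ 2 := by
    refine (real_inner_le_norm _ _).trans ?_
    have := Y.le_of_opNorm_le hY x
    nlinarith [norm_nonneg x]
  have : ((1 : H →L[ℝ] H) - Y) x = x - Y x := rfl
  rw [this, inner_sub_left, real_inner_self_eq_norm_sq]
  linarith

/-- The preceding lemma is applied to 1 - ‖B‖⁻¹B, whose norm is at most 1. The limit Y is
self-adjoint with ‖Y‖ ≤ 1, so √‖B‖(1 - Y) is positive. -/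
lemma exists_isPositive_sqrt {B : H →L[ℝ] H} (hB : B.IsPositive) :
    ∃ S : H →L[ℝ] H, S.IsPositive ∧ S ∘L S = B := by
  rcases eq_or_ne B 0 with rfl | hne
  · exact ⟨0, ContinuousLinearMap.isPositive_zero, by simp⟩
  have hB0 : 0 < ‖B‖ := norm_pos_iff.2 hne
  have hs : IsSelfAdjoint ((1 : H →L[ℝ] H) - ‖B‖⁻¹ • B) :=
    (IsSelfAdjoint.one _).sub (IsSelfAdjoint.smul (IsSelfAdjoint.all _) hB.isSelfAdjoint)
  obtain ⟨Y, hY, hYn, hsq⟩ := exists_one_sub_mul_self_eq (norm_one_sub_inv_smul_le hB hB0)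
  have hYs : IsSelfAdjoint Y := by
    have h := hY.star
    simp only [(isSelfAdjoint_sqrtIter hs _).star_eq] at h
    exact tendsto_nhds_unique h hY
  refine ⟨√‖B‖ • (1 - Y), (isPositive_one_sub hYn hYs).smul_of_nonneg (Real.sqrt_nonneg _), ?_⟩
  have : (√‖B‖ • ((1 : H →L[ℝ] H) - Y)) ∘L (√‖B‖ • (1 - Y)) =
      (√‖B‖ * √‖B‖) • (((1 : H →L[ℝ] H) - Y) * (1 - Y)) := by
    rw [ContinuousLinearMap.smul_comp, ContinuousLinearMap.comp_smul, smul_smul]; rfl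
  rw [this, hsq, Real.mul_self_sqrt hB0.le, sub_sub_cancel, smul_smul, mul_inv_cancel₀ hB0.ne',
    one_smul]

lemma opSqrt_spec {B : H →L[ℝ] H} (hB : B.IsPositive) :
    (opSqrt B).IsPositive ∧ opSqrt B ∘L opSqrt B = B := by
  have h := exists_isPositive_sqrt hB
  rw [opSqrt, dif_pos h]
  exact h.choose_spec

lemma inner_opSqrt_opSqrt {B : H →L[ℝ] H} (hB : B.IsPositive) (x y : H) :
    ⟪opSqrt B x, opSqrt B y⟫ = ⟪B x, y⟫ := by
  obtain ⟨h1, h2⟩ := opSqrt_spec hB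
  rw [← h1.inner_left_eq_inner_right]
  conv_rhs => rw [← h2]
  rfl

end SquareRoot

/-! ### Stability of cylinder functions under smooth operations -/

section Cylinder

/-- Smooth functions that are bounded together with all derivatives. -/
def SmoothBdd {V W : Type*} [NormedAddCommGroup V] [NormedSpace ℝ V] [NormedAddCommGroup W]
    [NormedSpace ℝ W] (g : V → W) : Prop :=
  ContDiff ℝ (⊤ : ℕ∞) g ∧ ∀ k : ℕ, ∃ C : ℝ, ∀ x, ‖iteratedFDeriv ℝ k g x‖ ≤ C

variable {V V' W W' : Type*} [NormedAddCommGroup V] [NormedSpace ℝ V] [NormedAddCommGroup W]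
    [NormedSpace ℝ W] [NormedAddCommGroup V'] [NormedSpace ℝ V'] [NormedAddCommGroup W']
    [NormedSpace ℝ W']

lemma SmoothBdd.comp_clm {g : V → W} (hg : SmoothBdd g) (p : V' →L[ℝ] V) :
    SmoothBdd fun y => g (p y) := by
  refine ⟨hg.1.comp p.contDiff, fun k => ?_⟩
  obtain ⟨C, hC⟩ := hg.2 k
  refine ⟨C * ∏ _i : Fin k, ‖p‖, fun x => ?_⟩
  have := p.iteratedFDeriv_comp_right (hg.1.of_le le_rfl) x (i := k) (by exact_mod_cast le_top)
  change ‖iteratedFDeriv ℝ k (g ∘ p) x‖ ≤ _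
  rw [this]
  refine (ContinuousMultilinearMap.norm_compContinuousLinearMap_le _ _).trans ?_
  gcongr
  exact hC _

lemma SmoothBdd.clm_comp {g : V → W} (hg : SmoothBdd g) (p : W →L[ℝ] W') :
    SmoothBdd fun y => p (g y) := by
  refine ⟨p.contDiff.comp hg.1, fun k => ?_⟩
  obtain ⟨C, hC⟩ := hg.2 k
  refine ⟨‖p‖ * C, fun x => ?_⟩
  refine (p.norm_iteratedFDeriv_comp_left (hg.1.contDiffAt)
    (by exact_mod_cast le_top)).trans ?_
  gcongr
  exact hC _

lemma SmoothBdd.add {g g' : V → W} (hg : SmoothBdd g) (hg' : SmoothBdd g') :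
    SmoothBdd fun y => g y + g' y := by
  refine ⟨hg.1.add hg'.1, fun k => ?_⟩
  obtain ⟨C, hC⟩ := hg.2 k
  obtain ⟨C', hC'⟩ := hg'.2 k
  refine ⟨C + C', fun x => ?_⟩
  have := iteratedFDeriv_add_apply (i := k) (x := x)
    (hg.1.contDiffAt.of_le (by exact_mod_cast le_top))
    (hg'.1.contDiffAt.of_le (by exact_mod_cast le_top))
  change ‖iteratedFDeriv ℝ k (g + g') x‖ ≤ _
  rw [this]
  exact (norm_add_le _ _).trans (add_le_add (hC _) (hC' _))

/-- No bound on Φ is needed: g takes values in a compact ball, on which every derivative of Φ is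
bounded. -/
lemma SmoothBdd.comp {Φ : W → W'} [FiniteDimensional ℝ W] (hΦ : ContDiff ℝ (⊤ : ℕ∞) Φ) {g : V → W}
    (hg : SmoothBdd g) : SmoothBdd fun y => Φ (g y) := by
  refine ⟨hΦ.comp hg.1, fun k => ?_⟩
  choose C hC using hg.2
  have hC0 : ∀ n, 0 ≤ C n := fun n => (norm_nonneg _).trans (hC n 0)
  have hK : ∀ i, ∃ B : ℝ, ∀ y ∈ Metric.closedBall (0 : W) (C 0), ‖iteratedFDeriv ℝ i Φ y‖ ≤ B := by
    intro i
    have : Continuous (iteratedFDeriv ℝ i Φ) :=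
      hΦ.continuous_iteratedFDeriv (by exact_mod_cast le_top)
    exact (isCompact_closedBall (0 : W) (C 0)).exists_bound_of_continuousOn this.continuousOn
  choose B hB using hK
  -- The Faà di Bruno estimate asks for ‖g⁽ⁱ⁾‖ ≤ Dⁱ, i ≥ 1. Since D ≥ 1 and D dominates each C i,
  -- this follows from C i ≤ D ≤ Dⁱ.
  set D : ℝ := 1 + ∑ i ∈ Finset.range (k + 1), C i
  set B' : ℝ := ∑ i ∈ Finset.range (k + 1), |B i|
  refine ⟨k.factorial * B' * D ^ k, fun x => ?_⟩
  have hmem : g x ∈ Metric.closedBall (0 : W) (C 0) := by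
    rw [mem_closedBall_zero_iff]
    simpa using hC 0 x
  refine norm_iteratedFDeriv_comp_le (N := (⊤ : ℕ∞)) hΦ hg.1 (by exact_mod_cast le_top) x
    (fun i hi => ?_) (fun i hi1 hi => ?_)
  · refine (hB i _ hmem).trans ((le_abs_self _).trans ?_)
    exact Finset.single_le_sum (f := fun i => |B i|) (fun _ _ => abs_nonneg _)
      (Finset.mem_range.2 (by omega))
  · have h1 : C i ≤ D := by
      have := Finset.single_le_sum (f := C) (fun n _ => hC0 n)
        (Finset.mem_range.2 (by omega : i < k + 1))
      linarith
    have h2 : (1 : ℝ) ≤ D := by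
      have := Finset.sum_nonneg (f := C) (s := Finset.range (k + 1)) fun n _ => hC0 n
      linarith
    exact (hC i x).trans (h1.trans (le_self_pow₀ h2 (by omega)))

variable {E : Type*} [NormedAddCommGroup E] [NormedSpace ℝ E]

/-- The two lists of functionals are concatenated, and the pair of outer functions becomes one
bounded smooth map into ℝ × ℝ. Sums, multiples and smooth functions of cylinder functions are
special cases. -/
lemma IsCylinder.comp₂ {Φ : ℝ × ℝ → ℝ} (hΦ : ContDiff ℝ (⊤ : ℕ∞) Φ) {u v : E → ℝ}
    (hu : IsCylinder u) (hv : IsCylinder v) : IsCylinder fun z => Φ (u z, v z) := by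
  obtain ⟨m₁, g₁, L₁, hg₁, hb₁, hu⟩ := hu
  obtain ⟨m₂, g₂, L₂, hg₂, hb₂, hv⟩ := hv
  let p₁ : EuclideanSpace ℝ (Fin (m₁ + m₂)) →L[ℝ] EuclideanSpace ℝ (Fin m₁) :=
    LinearMap.toContinuousLinearMap
      { toFun := fun y => WithLp.toLp 2 fun i => y (Fin.castAdd m₂ i)
        map_add' := fun x y => rfl
        map_smul' := fun c x => rfl }
  let p₂ : EuclideanSpace ℝ (Fin (m₁ + m₂)) →L[ℝ] EuclideanSpace ℝ (Fin m₂) :=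
    LinearMap.toContinuousLinearMap
      { toFun := fun y => WithLp.toLp 2 fun i => y (Fin.natAdd m₁ i)
        map_add' := fun x y => rfl
        map_smul' := fun c x => rfl }
  have hG : SmoothBdd fun y => (ContinuousLinearMap.inl ℝ ℝ ℝ) (g₁ (p₁ y)) +
      (ContinuousLinearMap.inr ℝ ℝ ℝ) (g₂ (p₂ y)) :=
    ((SmoothBdd.comp_clm ⟨hg₁, hb₁⟩ p₁).clm_comp _).add
      ((SmoothBdd.comp_clm ⟨hg₂, hb₂⟩ p₂).clm_comp _)
  have hG' := hG.comp hΦ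
  refine ⟨m₁ + m₂, _, Fin.append L₁ L₂, hG'.1, hG'.2, fun z => ?_⟩
  have e1 : p₁ (WithLp.toLp 2 fun i => Fin.append L₁ L₂ i z) = WithLp.toLp 2 fun i => L₁ i z := by
    ext i
    change Fin.append L₁ L₂ (Fin.castAdd m₂ i) z = _
    simp
  have e2 : p₂ (WithLp.toLp 2 fun i => Fin.append L₁ L₂ i z) = WithLp.toLp 2 fun i => L₂ i z := by
    ext i
    change Fin.append L₁ L₂ (Fin.natAdd m₁ i) z = _
    simp
  simp only [e1, e2, ← hu, ← hv]
  simp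

lemma IsCylinder.comp {χ : ℝ → ℝ} (hχ : ContDiff ℝ (⊤ : ℕ∞) χ) {u : E → ℝ}
    (hu : IsCylinder u) : IsCylinder fun z => χ (u z) :=
  IsCylinder.comp₂ (Φ := fun p => χ p.1) (hχ.comp contDiff_fst) hu hu

lemma IsCylinder.add {u v : E → ℝ} (hu : IsCylinder u) (hv : IsCylinder v) :
    IsCylinder (u + v) :=
  IsCylinder.comp₂ (Φ := fun p => p.1 + p.2) (contDiff_fst.add contDiff_snd) hu hv

lemma IsCylinder.const_smul {u : E → ℝ} (hu : IsCylinder u) (c : ℝ) : IsCylinder (c • u) :=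
  hu.comp (χ := fun x => c * x) (contDiff_const.mul contDiff_id)

lemma isCylinder_zero : IsCylinder (0 : E → ℝ) := by
  refine ⟨0, fun _ => 0, fun i => i.elim0, contDiff_const, fun k => ⟨0, fun x => ?_⟩, fun _ => rfl⟩
  have : iteratedFDeriv ℝ k (fun _ : EuclideanSpace ℝ (Fin 0) => (0 : ℝ)) = 0 :=
    iteratedFDeriv_fun_zero
  simp [this]

lemma IsCylinder.differentiable {u : E → ℝ} (hu : IsCylinder u) : Differentiable ℝ u := by
  obtain ⟨m, g, L, hg, -, hu⟩ := hu
  have : u = g ∘ fun z => (WithLp.toLp 2 fun i => L i z : EuclideanSpace ℝ (Fin m)) := funext hu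
  rw [this]
  refine (hg.differentiable (by simp)).comp ?_
  rw [differentiable_euclidean]
  intro i
  exact (L i).differentiable

lemma IsCylinder.bounded {u : E → ℝ} (hu : IsCylinder u) : ∃ C : ℝ, ∀ z, |u z| ≤ C := by
  obtain ⟨m, g, L, hg, hb, hu⟩ := hu
  obtain ⟨C, hC⟩ := hb 0
  refine ⟨C, fun z => ?_⟩
  have := hC (WithLp.toLp 2 fun i => L i z)
  rw [hu]
  simpa using this

end Cylinder

/-! ### Limits in L² by domination -/

section LpTools

variable {α F : Type*} [MeasurableSpace α] {μ : Measure α} [NormedAddCommGroup F]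

lemma Lp_norm_sq [InnerProductSpace ℝ F] (f : Lp F 2 μ) : ‖f‖ ^ 2 = ∫ z, ‖f z‖ ^ 2 ∂μ := by
  rw [← real_inner_self_eq_norm_sq, L2.inner_def]
  simp only [real_inner_self_eq_norm_sq]

lemma Lp_integrable_norm_sq (f : Lp F 2 μ) : Integrable (fun z => ‖f z‖ ^ 2) μ :=
  (memLp_two_iff_integrable_sq_norm (Lp.aestronglyMeasurable f)).1 (Lp.memLp f)

lemma Lp_tendsto_of_dominated [InnerProductSpace ℝ F] {f : ℕ → Lp F 2 μ} {g : Lp F 2 μ} {G : α → ℝ}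
    (hG : MemLp G 2 μ) (hb : ∀ n, ∀ᵐ z ∂μ, ‖f n z‖ ≤ G z)
    (hlim : ∀ᵐ z ∂μ, Tendsto (fun n => f n z) atTop (𝓝 (g z))) :
    Tendsto f atTop (𝓝 g) := by
  have hsq : Tendsto (fun n => ‖f n - g‖ ^ 2) atTop (𝓝 0) := by
    simp only [Lp_norm_sq]
    rw [← integral_zero α ℝ (μ := μ)]
    refine tendsto_integral_of_dominated_convergence (fun z => (2 * G z) ^ 2)
      (fun n => (Lp.aestronglyMeasurable (f n - g)).norm.pow 2) ?_ (fun n => ?_) ?_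
    · exact (memLp_two_iff_integrable_sq (hG.const_mul 2).1).1 (hG.const_mul 2)
    · filter_upwards [Lp.coeFn_sub (f n) g, hlim, ae_all_iff.2 hb] with z h1 h2 h3
      have h4 : ‖g z‖ ≤ G z := le_of_tendsto h2.norm (Eventually.of_forall h3)
      rw [h1, Pi.sub_apply, Real.norm_of_nonneg (by positivity)]
      gcongr
      exact (norm_sub_le _ _).trans (by linarith [h3 n])
    · filter_upwards [ae_all_iff.2 fun n => Lp.coeFn_sub (f n) g, hlim] with z h1 h2
      simp only [h1, Pi.sub_apply]
      have := (h2.sub_const (g z)).norm.pow 2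
      simpa using this
  rw [tendsto_iff_norm_sub_tendsto_zero]
  have := hsq.sqrt
  simpa [Real.sqrt_sq (norm_nonneg _)] using this

lemma Lp_exists_subseq_ae {f : ℕ → Lp F 2 μ} {g : Lp F 2 μ} (h : Tendsto f atTop (𝓝 g)) :
    ∃ ns : ℕ → ℕ, StrictMono ns ∧ ∀ᵐ z ∂μ, Tendsto (fun n => f (ns n) z) atTop (𝓝 (g z)) :=
  (tendstoInMeasure_of_tendsto_Lp h).exists_seq_tendsto_ae

lemma memLp_bdd_smul [NormedSpace ℝ F] {c : α → ℝ} {f : α → F} {B : ℝ}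
    (hc : AEStronglyMeasurable c μ) (hB : ∀ᵐ z ∂μ, |c z| ≤ B) (hf : MemLp f 2 μ) :
    MemLp (fun z => c z • f z) 2 μ := by
  refine MemLp.of_le_mul (c := B) hf (hc.smul hf.1) ?_
  filter_upwards [hB] with z hz
  rw [norm_smul, Real.norm_eq_abs]
  gcongr

/-- Split c_n f_n - c'f' into c_n(f_n - f') + (c_n - c')f'. The first part is controlled by the
uniform bound on c_n, the second by dominated convergence. Gradients of compositions pass to the
limit in this way. -/
lemma Lp_tendsto_bdd_smul [InnerProductSpace ℝ F] {c : ℕ → α → ℝ} {c' : α → ℝ} {B : ℝ}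
    {f θ : ℕ → Lp F 2 μ} {f' θ' : Lp F 2 μ} (hc : ∀ n, AEStronglyMeasurable (c n) μ)
    (hB : ∀ n, ∀ᵐ z ∂μ, |c n z| ≤ B) (hlim : ∀ᵐ z ∂μ, Tendsto (fun n => c n z) atTop (𝓝 (c' z)))
    (hf : Tendsto f atTop (𝓝 f')) (hθ : ∀ n, θ n =ᵐ[μ] fun z => c n z • f n z)
    (hθ' : θ' =ᵐ[μ] fun z => c' z • f' z) : Tendsto θ atTop (𝓝 θ') := by
  set η : ℕ → Lp F 2 μ := fun n => (memLp_bdd_smul (hc n) (hB n) (Lp.memLp f')).toLp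
  have hη : ∀ n, η n =ᵐ[μ] fun z => c n z • f' z := fun n => MemLp.coeFn_toLp _
  have h1 : Tendsto η atTop (𝓝 θ') := by
    refine Lp_tendsto_of_dominated (G := fun z => B * ‖f' z‖) ((Lp.memLp f').norm.const_mul B)
      (fun n => ?_) ?_
    · filter_upwards [hη n, hB n] with z h1 h2
      rw [h1, norm_smul, Real.norm_eq_abs]
      gcongr
    · filter_upwards [ae_all_iff.2 hη, hlim, hθ'] with z h1 h2 h3
      simp only [h1, h3]
      exact h2.smul_const _
  have h2 : Tendsto (fun n => θ n - η n) atTop (𝓝 0) := by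
    rw [tendsto_zero_iff_norm_tendsto_zero]
    refine squeeze_zero (g := fun n => |B| * ‖f n - f'‖) (fun n => norm_nonneg _) (fun n => ?_) ?_
    · refine Lp.norm_le_mul_norm_of_ae_le_mul ?_
      filter_upwards [Lp.coeFn_sub (θ n) (η n), Lp.coeFn_sub (f n) f', hθ n, hη n, hB n]
        with z h1 h2 h3 h4 h5
      rw [h1, h2, Pi.sub_apply, Pi.sub_apply, h3, h4, ← smul_sub, norm_smul, Real.norm_eq_abs]
      exact mul_le_mul_of_nonneg_right (h5.trans (le_abs_self _)) (norm_nonneg _)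
    · have := (tendsto_iff_norm_sub_tendsto_zero.1 hf).const_mul |B|
      simpa using this
  simpa using h2.add h1

lemma exists_bound_on_Icc {χ : ℝ → ℝ} (hχ : Continuous χ) (B : ℝ) :
    ∃ K, ∀ x, |x| ≤ B → |χ x| ≤ K := by
  obtain ⟨K, hK⟩ := (isCompact_Icc (a := -B) (b := B)).exists_bound_of_continuousOn hχ.continuousOn
  exact ⟨K, fun x hx => hK x (abs_le.1 hx)⟩

lemma exists_ae_eq_comp [IsFiniteMeasure μ] {u : Lp ℝ 2 μ} {M : ℝ} (hM : ∀ᵐ z ∂μ, |u z| ≤ M) {χ : ℝ → ℝ}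
    (hχ : Continuous χ) : ∃ v : Lp ℝ 2 μ, v =ᵐ[μ] fun z => χ (u z) := by
  obtain ⟨K, hK⟩ := exists_bound_on_Icc hχ M
  have : MemLp (fun z => χ (u z)) 2 μ := MemLp.of_bound
    (hχ.comp_aestronglyMeasurable (Lp.aestronglyMeasurable u)) K (hM.mono fun z hz => hK _ hz)
  exact ⟨this.toLp, this.coeFn_toLp⟩

lemma exists_ae_eq_smul [NormedSpace ℝ F] {c : α → ℝ}
    (hc : AEStronglyMeasurable c μ) {M : ℝ} (hM : ∀ᵐ z ∂μ, |c z| ≤ M) (ψ : Lp F 2 μ) :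
    ∃ θ : Lp F 2 μ, θ =ᵐ[μ] fun z => c z • ψ z :=
  ⟨(memLp_bdd_smul hc hM (Lp.memLp ψ)).toLp, MemLp.coeFn_toLp _⟩

end LpTools

/-! ### The closed gradient -/

section Gradient

variable {E H : Type*} [NormedAddCommGroup E] [NormedSpace ℝ E]
  [NormedAddCommGroup H] [InnerProductSpace ℝ H] [CompleteSpace H]

lemma dualToH_add (j : H →L[ℝ] E) (L L' : E →L[ℝ] ℝ) :
    dualToH j (L + L') = dualToH j L + dualToH j L' := by
  rw [dualToH, ContinuousLinearMap.add_comp, map_add]; rfl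

lemma dualToH_smul (j : H →L[ℝ] E) (c : ℝ) (L : E →L[ℝ] ℝ) :
    dualToH j (c • L) = c • dualToH j L := by
  rw [dualToH, ContinuousLinearMap.smul_comp, map_smulₛₗ]; rfl

lemma gradH_comp (j : H →L[ℝ] E) {χ : ℝ → ℝ} {u : E → ℝ} {z : E}
    (hχ : DifferentiableAt ℝ χ (u z)) (hu : DifferentiableAt ℝ u z) :
    gradH j (fun y => χ (u y)) z = deriv χ (u z) • gradH j u z := by
  have h := hχ.hasDerivAt.comp_hasFDerivAt z hu.hasFDerivAt
  rw [gradH, show (fun y => χ (u y)) = χ ∘ u from rfl, h.fderiv, dualToH_smul]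
  rfl

lemma gradH_add (j : H →L[ℝ] E) {u v : E → ℝ} {z : E}
    (hu : DifferentiableAt ℝ u z) (hv : DifferentiableAt ℝ v z) :
    gradH j (u + v) z = gradH j u z + gradH j v z := by
  rw [gradH, fderiv_add hu hv, dualToH_add]; rfl

lemma gradH_const_smul (j : H →L[ℝ] E) {u : E → ℝ} {z : E} (c : ℝ)
    (hu : DifferentiableAt ℝ u z) : gradH j (c • u) z = c • gradH j u z := by
  rw [gradH, fderiv_const_smul hu, dualToH_smul]; rfl

variable [MeasurableSpace E] {j : H →L[ℝ] E} {A : E → H →L[ℝ] H} {μ : Measure E}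

/-- `u ∈ F` and `D_{A^{1/2}} u = ψ`. -/
def HasGradA (j : H →L[ℝ] E) (A : E → H →L[ℝ] H) (μ : Measure E) (u : Lp ℝ 2 μ) (ψ : Lp H 2 μ) :
    Prop := (u, ψ) ∈ closure (gradGraph j A μ)

/-- The graph of `A^{1/2}∇` on cylinder functions, as a subspace. -/
def gradSubmodule (j : H →L[ℝ] E) (A : E → H →L[ℝ] H) (μ : Measure E) :
    Submodule ℝ (Lp ℝ 2 μ × Lp H 2 μ) where
  carrier := gradGraph j A μ
  zero_mem' := by
    refine ⟨0, isCylinder_zero, Lp.coeFn_zero _ _ _, ?_⟩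
    filter_upwards [Lp.coeFn_zero H 2 μ] with z hz
    have : gradH j (0 : E → ℝ) z = 0 := by
      rw [gradH]
      simp [dualToH]
    rw [Prod.snd_zero, hz, this, map_zero]; rfl
  add_mem' := by
    rintro ⟨p, q⟩ ⟨p', q'⟩ ⟨u, hu, hu1, hu2⟩ ⟨v, hv, hv1, hv2⟩
    refine ⟨u + v, hu.add hv, ?_, ?_⟩
    · exact (Lp.coeFn_add _ _).trans (hu1.add hv1)
    · filter_upwards [Lp.coeFn_add q q', hu2, hv2] with z h1 h2 h3
      rw [Prod.snd_add, h1, gradH_add j (hu.differentiable z) (hv.differentiable z), map_add,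
        Pi.add_apply]
      exact congr_arg₂ _ h2 h3
  smul_mem' := by
    rintro c ⟨p, q⟩ ⟨u, hu, hu1, hu2⟩
    refine ⟨c • u, hu.const_smul c, ?_, ?_⟩
    · exact (Lp.coeFn_smul _ _).trans (hu1.const_smul c)
    · filter_upwards [Lp.coeFn_smul c q, hu2] with z h1 h2
      rw [Prod.smul_snd, h1, gradH_const_smul j c (hu.differentiable z), map_smul, Pi.smul_apply]
      exact congr_arg _ h2

lemma hasGradA_iff {u : Lp ℝ 2 μ} {ψ : Lp H 2 μ} :
    HasGradA j A μ u ψ ↔ (u, ψ) ∈ (gradSubmodule j A μ).topologicalClosure := Iff.rfl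

lemma HasGradA.add {u v : Lp ℝ 2 μ} {ψ θ : Lp H 2 μ} (hu : HasGradA j A μ u ψ)
    (hv : HasGradA j A μ v θ) : HasGradA j A μ (u + v) (ψ + θ) := by
  rw [hasGradA_iff] at *
  exact Submodule.add_mem _ hu hv

lemma HasGradA.sub {u v : Lp ℝ 2 μ} {ψ θ : Lp H 2 μ} (hu : HasGradA j A μ u ψ)
    (hv : HasGradA j A μ v θ) : HasGradA j A μ (u - v) (ψ - θ) := by
  rw [hasGradA_iff] at *
  exact Submodule.sub_mem _ hu hv

lemma hasGradA_zero : HasGradA j A μ 0 0 := by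
  rw [hasGradA_iff]
  exact Submodule.zero_mem _

lemma HasGradA.sum {ι : Type*} (s : Finset ι) {u : ι → Lp ℝ 2 μ} {ψ : ι → Lp H 2 μ}
    (hu : ∀ i ∈ s, HasGradA j A μ (u i) (ψ i)) :
    HasGradA j A μ (∑ i ∈ s, u i) (∑ i ∈ s, ψ i) := by
  classical
  induction s using Finset.induction_on with
  | empty => simpa using hasGradA_zero
  | insert i s hi ih =>
    rw [Finset.sum_insert hi, Finset.sum_insert hi]
    exact (hu i (Finset.mem_insert_self _ _)).add (ih fun k hk => hu k (Finset.mem_insert_of_mem hk))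

lemma HasGradA.of_tendsto {u : ℕ → Lp ℝ 2 μ} {v : Lp ℝ 2 μ} {ψ : ℕ → Lp H 2 μ} {θ : Lp H 2 μ}
    (h : ∀ n, HasGradA j A μ (u n) (ψ n)) (hu : Tendsto u atTop (𝓝 v))
    (hψ : Tendsto ψ atTop (𝓝 θ)) : HasGradA j A μ v θ :=
  isClosed_closure.mem_of_tendsto (hu.prodMk_nhds hψ) (Eventually.of_forall h)

lemma formCyl_eq_norm_sq (hA : ∀ z, (A z).IsPositive) {u : E → ℝ} {ψ : Lp H 2 μ}
    (h : ψ =ᵐ[μ] fun z => opSqrt (A z) (gradH j u z)) : formCyl j A μ u u = ‖ψ‖ ^ 2 := by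
  rw [Lp_norm_sq, formCyl]
  refine integral_congr_ae ?_
  filter_upwards [h] with z hz
  rw [hz, ← inner_opSqrt_opSqrt (hA z), real_inner_self_eq_norm_sq]

/-- Closability in (A1) is stated for the form. Since 𝓔^A(u) = ‖A^{1/2}∇u‖², convergence of the
gradients makes the sequence form-Cauchy, and (A1) forces the limit of the gradients to be zero. -/
lemma HasGradA.eq_zero (hA : ∀ z, (A z).IsPositive) (hA1 : CondA1 j A μ) {ψ : Lp H 2 μ}
    (h : HasGradA j A μ 0 ψ) : ψ = 0 := by
  obtain ⟨p, hp, hlim⟩ := mem_closure_iff_seq_limit.1 h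
  choose u hu hu1 hu2 using hp
  have l1 : Tendsto (fun n => (p n).1) atTop (𝓝 0) := (continuous_fst.tendsto _).comp hlim
  have l2 : Tendsto (fun n => (p n).2) atTop (𝓝 ψ) := (continuous_snd.tendsto _).comp hlim
  have key := hA1.closable u hu ?_ ?_
  · have h3 : ∀ n, formCyl j A μ (u n) (u n) = ‖(p n).2‖ ^ 2 :=
      fun n => formCyl_eq_norm_sq hA (hu2 n)
    simp only [h3] at key
    have h4 := tendsto_nhds_unique key (l2.norm.pow 2)
    exact norm_eq_zero.1 (pow_eq_zero_iff two_ne_zero |>.1 h4.symm)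
  · have h3 : ∀ n, ∫ z, (u n z) ^ 2 ∂μ = ‖(p n).1‖ ^ 2 := fun n => by
      rw [Lp_norm_sq]
      refine integral_congr_ae ?_
      filter_upwards [hu1 n] with z hz
      rw [hz, Real.norm_eq_abs, sq_abs]
    simp only [h3]
    simpa using l1.norm.pow 2
  · have h3 : ∀ n m, formCyl j A μ (u n - u m) (u n - u m) = ‖(p n).2 - (p m).2‖ ^ 2 := by
      intro n m
      refine formCyl_eq_norm_sq hA ?_
      filter_upwards [Lp.coeFn_sub (p n).2 (p m).2, hu2 n, hu2 m] with z h1 h2 h3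
      have h4 : u n - u m = u n + (-1 : ℝ) • u m := by rw [neg_one_smul, sub_eq_add_neg]
      rw [h1, Pi.sub_apply, h2, h3, h4, gradH_add j (((hu n).differentiable) z)
        ((((hu m).const_smul (-1)).differentiable) z),
        gradH_const_smul j _ (((hu m).differentiable) z), neg_one_smul, ← sub_eq_add_neg, map_sub]
    simp only [h3]
    rw [← prod_atTop_atTop_eq]
    have := ((l2.comp (tendsto_fst (f := (atTop : Filter ℕ)) (g := (atTop : Filter ℕ)))).sub
      (l2.comp (tendsto_snd (f := (atTop : Filter ℕ)) (g := (atTop : Filter ℕ))))).norm.pow 2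
    simpa using this

lemma HasGradA.unique (hA : ∀ z, (A z).IsPositive) (hA1 : CondA1 j A μ) {u : Lp ℝ 2 μ}
    {ψ θ : Lp H 2 μ} (h : HasGradA j A μ u ψ) (h' : HasGradA j A μ u θ) : ψ = θ := by
  have := h.sub h'
  rw [sub_self] at this
  exact sub_eq_zero.1 (this.eq_zero hA hA1)

lemma hasGradA_gradA {u : Lp ℝ 2 μ} (h : u ∈ domF j A μ) : HasGradA j A μ u (gradA j A μ u) := by
  have h' : ∃ ψ : Lp H 2 μ, (u, ψ) ∈ closure (gradGraph j A μ) := h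
  rw [gradA, dif_pos h']
  exact h'.choose_spec

lemma HasGradA.mem {u : Lp ℝ 2 μ} {ψ : Lp H 2 μ} (h : HasGradA j A μ u ψ) : u ∈ domF j A μ := ⟨ψ, h⟩

lemma HasGradA.gradA_eq (hA : ∀ z, (A z).IsPositive) (hA1 : CondA1 j A μ) {u : Lp ℝ 2 μ}
    {ψ : Lp H 2 μ} (h : HasGradA j A μ u ψ) : gradA j A μ u = ψ :=
  (hasGradA_gradA h.mem).unique hA hA1 h

end Gradient

/-! ### Chain and product rules for bounded elements of F -/

section ChainRule

variable {E H : Type*} [NormedAddCommGroup E] [NormedSpace ℝ E]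
  [NormedAddCommGroup H] [InnerProductSpace ℝ H] [CompleteSpace H]
  [MeasurableSpace E] [BorelSpace E] {j : H →L[ℝ] E} {A : E → H →L[ℝ] H} {μ : Measure E}
  [IsFiniteMeasure μ]

lemma gradGraph_comp {v : E → ℝ} (hv : IsCylinder v) {ψ : Lp H 2 μ}
    (hψ : ψ =ᵐ[μ] fun z => opSqrt (A z) (gradH j v z)) {χ : ℝ → ℝ}
    (hχ : ContDiff ℝ (⊤ : ℕ∞) χ) {θ : Lp H 2 μ} (hθ : θ =ᵐ[μ] fun z => deriv χ (v z) • ψ z) :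
    θ =ᵐ[μ] fun z => opSqrt (A z) (gradH j (fun y => χ (v y)) z) := by
  filter_upwards [hψ, hθ] with z h1 h2
  rw [h2, h1, gradH_comp j (hχ.differentiable (by simp) _) (hv.differentiable z), map_smul]

lemma exists_truncation (M : ℝ) : ∃ (τ : ℝ → ℝ) (B : ℝ), ContDiff ℝ (⊤ : ℕ∞) τ ∧
    (∀ x, |τ x| ≤ B) ∧ (∀ x, |deriv τ x| ≤ B) ∧ ∀ x, |x| ≤ M → τ x = x ∧ deriv τ x = 1 := by
  -- The inner radius exceeds M strictly, so τ is the identity near every point of [-M, M] and its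
  -- derivative is 1 there.
  let f : ContDiffBump (0 : ℝ) := ⟨|M| + 1, |M| + 2, by positivity, by linarith⟩
  have hs : ContDiff ℝ (⊤ : ℕ∞) fun x : ℝ => x * f x := contDiff_id.mul f.contDiff
  have hc : HasCompactSupport fun x : ℝ => x * f x := f.hasCompactSupport.mul_left
  obtain ⟨B, hB⟩ := hc.exists_bound_of_continuous hs.continuous
  obtain ⟨B', hB'⟩ := hc.deriv.exists_bound_of_continuous (hs.continuous_deriv (by simp))
  refine ⟨fun x => x * f x, max B B', hs, fun x => (hB x).trans (le_max_left _ _),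
    fun x => (hB' x).trans (le_max_right _ _), fun x hx => ?_⟩
  have hev : (fun x : ℝ => x * f x) =ᶠ[𝓝 x] id := by
    have : Metric.ball (0 : ℝ) (|M| + 1) ∈ 𝓝 x := by
      refine Metric.isOpen_ball.mem_nhds ?_
      rw [mem_ball_zero_iff, Real.norm_eq_abs]
      linarith [le_abs_self M]
    filter_upwards [this] with y hy
    rw [f.one_of_mem_closedBall (Metric.ball_subset_closedBall hy), mul_one]; rfl
  exact ⟨hev.eq_of_nhds, by rw [hev.deriv_eq, deriv_id]⟩

/-- A smooth truncation is composed with the approximating cylinder functions. Along an a.e.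
convergent subsequence its derivative tends to 1, because |u| ≤ M, so the gradients keep their
limit. Uniformly bounded approximants are what allows composition with smooth functions of arbitrary
growth. -/
lemma HasGradA.exists_bdd_approx {u : Lp ℝ 2 μ} {ψ : Lp H 2 μ} (h : HasGradA j A μ u ψ) {M : ℝ}
    (hM : ∀ᵐ z ∂μ, |u z| ≤ M) : ∃ (B : ℝ) (v : ℕ → E → ℝ) (θ : ℕ → Lp H 2 μ),
      (∀ n, IsCylinder (v n)) ∧ (∀ n z, |v n z| ≤ B) ∧
      (∀ n, θ n =ᵐ[μ] fun z => opSqrt (A z) (gradH j (v n) z)) ∧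
      (∀ᵐ z ∂μ, Tendsto (fun n => v n z) atTop (𝓝 (u z))) ∧ Tendsto θ atTop (𝓝 ψ) := by
  obtain ⟨p, hp, hlim⟩ := mem_closure_iff_seq_limit.1 h
  choose w hw hw1 hw2 using hp
  have l1 : Tendsto (fun n => (p n).1) atTop (𝓝 u) := (continuous_fst.tendsto _).comp hlim
  have l2 : Tendsto (fun n => (p n).2) atTop (𝓝 ψ) := (continuous_snd.tendsto _).comp hlim
  obtain ⟨ns, hns, hae⟩ := Lp_exists_subseq_ae l1
  obtain ⟨τ, B, hτ, hB, hB', hid⟩ := exists_truncation M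
  have hm : ∀ n, AEStronglyMeasurable (fun z => deriv τ (w (ns n) z)) μ := fun n =>
    ((hτ.continuous_deriv (by simp)).comp
      (hw (ns n)).differentiable.continuous).aestronglyMeasurable
  have hmem : ∀ n, MemLp (fun z => deriv τ (w (ns n) z) • (p (ns n)).2 z) 2 μ := fun n =>
    memLp_bdd_smul (hm n) (Eventually.of_forall fun z => hB' _) (Lp.memLp _)
  have hae' : ∀ᵐ z ∂μ, Tendsto (fun n => w (ns n) z) atTop (𝓝 (u z)) := by
    filter_upwards [hae, ae_all_iff.2 hw1] with z h1 h2
    simpa only [h2] using h1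
  refine ⟨B, fun n z => τ (w (ns n) z), fun n => (hmem n).toLp, fun n => (hw _).comp hτ,
    fun n z => hB _, fun n => ?_, ?_, ?_⟩
  · exact gradGraph_comp (hw _) (hw2 _) hτ (MemLp.coeFn_toLp _)
  · filter_upwards [hae', hM] with z h1 h2
    have := (hτ.continuous.tendsto (u z)).comp h1
    rwa [(hid _ h2).1] at this
  · refine Lp_tendsto_bdd_smul (c := fun n z => deriv τ (w (ns n) z)) (c' := fun _ => 1) hm
      (fun n => Eventually.of_forall fun z => hB' _) ?_ (l2.comp hns.tendsto_atTop)
      (fun n => MemLp.coeFn_toLp _) (by simp)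
    filter_upwards [hae', hM] with z h1 h2
    have := ((hτ.continuous_deriv (by simp)).tendsto (u z)).comp h1
    rwa [(hid _ h2).2] at this

lemma HasGradA.comp {u : Lp ℝ 2 μ} {ψ : Lp H 2 μ} (h : HasGradA j A μ u ψ) {M : ℝ}
    (hM : ∀ᵐ z ∂μ, |u z| ≤ M) {χ : ℝ → ℝ} (hχ : ContDiff ℝ (⊤ : ℕ∞) χ) {v : Lp ℝ 2 μ}
    {θ : Lp H 2 μ} (hv : v =ᵐ[μ] fun z => χ (u z)) (hθ : θ =ᵐ[μ] fun z => deriv χ (u z) • ψ z) :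
    HasGradA j A μ v θ := by
  obtain ⟨B, w, η, hw, hB, hη, hlim, hηlim⟩ := h.exists_bdd_approx hM
  obtain ⟨K, hK⟩ := exists_bound_on_Icc hχ.continuous B
  have hdc : Continuous (deriv χ) := hχ.continuous_deriv (by simp)
  obtain ⟨K', hK'⟩ := exists_bound_on_Icc hdc B
  have hm1 : ∀ n, MemLp (fun z => χ (w n z)) 2 μ := fun n =>
    MemLp.of_bound (hχ.continuous.comp (hw n).differentiable.continuous).aestronglyMeasurable K
      (Eventually.of_forall fun z => hK _ (hB _ _))
  have hdm : ∀ n, AEStronglyMeasurable (fun z => deriv χ (w n z)) μ := fun n =>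
    (hdc.comp (hw n).differentiable.continuous).aestronglyMeasurable
  have hm2 : ∀ n, MemLp (fun z => deriv χ (w n z) • η n z) 2 μ := fun n =>
    memLp_bdd_smul (hdm n) (Eventually.of_forall fun z => hK' _ (hB _ _)) (Lp.memLp _)
  refine HasGradA.of_tendsto (u := fun n => (hm1 n).toLp) (ψ := fun n => (hm2 n).toLp)
    (fun n => subset_closure ?_) ?_ ?_
  · exact ⟨fun z => χ (w n z), (hw n).comp hχ, (hm1 n).coeFn_toLp,
      gradGraph_comp (hw n) (hη n) hχ (hm2 n).coeFn_toLp⟩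
  · refine Lp_tendsto_of_dominated (G := fun _ => K) (memLp_const _) (fun n => ?_) ?_
    · filter_upwards [(hm1 n).coeFn_toLp] with z hz
      rw [hz]
      exact hK _ (hB _ _)
    · filter_upwards [ae_all_iff.2 fun n => (hm1 n).coeFn_toLp, hlim, hv] with z h1 h2 h3
      simp only [h1, h3]
      exact (hχ.continuous.tendsto _).comp h2
  · refine Lp_tendsto_bdd_smul (c := fun n z => deriv χ (w n z)) hdm
      (fun n => Eventually.of_forall fun z => hK' _ (hB _ _)) ?_ hηlim
      (fun n => MemLp.coeFn_toLp _) hθ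
    filter_upwards [hlim] with z h2
    exact (hdc.tendsto _).comp h2

lemma HasGradA.exists_comp {u : Lp ℝ 2 μ} {ψ : Lp H 2 μ} (h : HasGradA j A μ u ψ) {M : ℝ}
    (hM : ∀ᵐ z ∂μ, |u z| ≤ M) {χ : ℝ → ℝ} (hχ : ContDiff ℝ (⊤ : ℕ∞) χ) :
    ∃ (v : Lp ℝ 2 μ) (θ : Lp H 2 μ), v =ᵐ[μ] (fun z => χ (u z)) ∧
      θ =ᵐ[μ] (fun z => deriv χ (u z) • ψ z) ∧ HasGradA j A μ v θ := by
  obtain ⟨v, hv⟩ := exists_ae_eq_comp hM hχ.continuous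
  have hdc : Continuous (deriv χ) := hχ.continuous_deriv (by simp)
  obtain ⟨K, hK⟩ := exists_bound_on_Icc hdc M
  obtain ⟨θ, hθ⟩ := exists_ae_eq_smul
    (hdc.comp_aestronglyMeasurable (Lp.aestronglyMeasurable u)) (hM.mono fun z hz => hK _ hz) ψ
  exact ⟨v, θ, hv, hθ, h.comp hM hχ hv hθ⟩

/-- Polarization reduces the product to the chain rule for x²/2, applied to u + v, u and v. -/
lemma HasGradA.mul {u v : Lp ℝ 2 μ} {ψ θ : Lp H 2 μ} (hu : HasGradA j A μ u ψ)
    (hv : HasGradA j A μ v θ) {M N : ℝ} (hM : ∀ᵐ z ∂μ, |u z| ≤ M) (hN : ∀ᵐ z ∂μ, |v z| ≤ N)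
    {p : Lp ℝ 2 μ} {q : Lp H 2 μ} (hp : p =ᵐ[μ] fun z => u z * v z)
    (hq : q =ᵐ[μ] fun z => u z • θ z + v z • ψ z) : HasGradA j A μ p q := by
  have hχ : ContDiff ℝ (⊤ : ℕ∞) fun x : ℝ => x ^ 2 / 2 := by fun_prop
  have hd : ∀ x : ℝ, deriv (fun x : ℝ => x ^ 2 / 2) x = x := fun x => by
    simp
  have hMN : ∀ᵐ z ∂μ, |(u + v) z| ≤ M + N := by
    filter_upwards [hM, hN, Lp.coeFn_add u v] with z h1 h2 h3
    rw [h3]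
    exact (abs_add_le _ _).trans (add_le_add h1 h2)
  obtain ⟨a, a', ha, ha', hga⟩ := (hu.add hv).exists_comp hMN hχ
  obtain ⟨b, b', hb, hb', hgb⟩ := hu.exists_comp hM hχ
  obtain ⟨c, c', hc, hc', hgc⟩ := hv.exists_comp hN hχ
  have e1 : p = a - b - c := by
    refine Lp.ext ?_
    filter_upwards [ha, hb, hc, hp, Lp.coeFn_sub (a - b) c, Lp.coeFn_sub a b, Lp.coeFn_add u v]
      with z h1 h2 h3 h4 h5 h6 h7
    rw [h5, Pi.sub_apply, h6, Pi.sub_apply, h1, h2, h3, h4, h7, Pi.add_apply]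
    ring
  have e2 : q = a' - b' - c' := by
    refine Lp.ext ?_
    filter_upwards [ha', hb', hc', hq, Lp.coeFn_sub (a' - b') c', Lp.coeFn_sub a' b',
      Lp.coeFn_add u v, Lp.coeFn_add ψ θ] with z h1 h2 h3 h4 h5 h6 h7 h8
    rw [h5, Pi.sub_apply, h6, Pi.sub_apply, h1, h2, h3, h4, h7, h8, hd, hd, hd]
    simp only [Pi.add_apply, add_smul, smul_add]
    abel
  rw [e1, e2]
  exact (hga.sub hgb).sub hgc

end ChainRule

/-! ### Drift lower bound and testing of the generator -/

section LowerBound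

variable {E H : Type*} [NormedAddCommGroup E] [NormedSpace ℝ E]
  [NormedAddCommGroup H] [InnerProductSpace ℝ H] [CompleteSpace H]
  [MeasurableSpace E] [BorelSpace E] {j : H →L[ℝ] E} {A : E → H →L[ℝ] H} {b : E → H}
  {μ : Measure E} [IsFiniteMeasure μ]

/-- The drift is bounded below by `-α` along nonnegative functions of bounded elements of `F`. -/
def DriftLowerBound (j : H →L[ℝ] E) (A : E → H →L[ℝ] H) (b : E → H) (μ : Measure E) (α : ℝ) :
    Prop :=
  ∀ (u : Lp ℝ 2 μ) (ψ : Lp H 2 μ) (M : ℝ) (Ψ : ℝ → ℝ), HasGradA j A μ u ψ →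
    (∀ᵐ z ∂μ, |u z| ≤ M) → ContDiff ℝ (⊤ : ℕ∞) Ψ → (∀ x, 0 ≤ Ψ x) →
    -α * ∫ z, Ψ (u z) ∂μ ≤ ∫ z, deriv Ψ (u z) * ⟪opSqrt (A z) (b z), ψ z⟫ ∂μ

/-- (A2) concerns squares, and Ψ + ε is the square of √(Ψ + ε). The constant ε > 0 keeps the root
smooth; it leaves the gradient unchanged and disappears from the left side as ε → 0. -/
lemma driftLowerBound_cylinder (hA : ∀ z, (A z).IsPositive)
    {α : ℝ} (hα : ∀ u : E → ℝ, IsCylinder u → (∀ z, 0 ≤ u z) →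
      -α * ∫ z, (u z) ^ 2 ∂μ ≤ ∫ z, ⟪A z (b z), gradH j (fun y => (u y) ^ 2) z⟫ ∂μ)
    {v : E → ℝ} (hv : IsCylinder v) {ψ : Lp H 2 μ}
    (hψ : ψ =ᵐ[μ] fun z => opSqrt (A z) (gradH j v z)) {Ψ : ℝ → ℝ}
    (hΨ : ContDiff ℝ (⊤ : ℕ∞) Ψ) (h0 : ∀ x, 0 ≤ Ψ x) :
    -α * ∫ z, Ψ (v z) ∂μ ≤ ∫ z, deriv Ψ (v z) * ⟪opSqrt (A z) (b z), ψ z⟫ ∂μ := by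
  obtain ⟨B, hB⟩ := hv.bounded
  obtain ⟨K, hK⟩ := exists_bound_on_Icc hΨ.continuous B
  have hint : Integrable (fun z => Ψ (v z)) μ := Integrable.of_bound
    (hΨ.continuous.comp hv.differentiable.continuous).aestronglyMeasurable K
    (Eventually.of_forall fun z => hK _ (hB z))
  have key : ∀ ε : ℝ, 0 < ε → -α * (∫ z, Ψ (v z) ∂μ + ε * μ.real univ) ≤
      ∫ z, deriv Ψ (v z) * ⟪opSqrt (A z) (b z), ψ z⟫ ∂μ := by
    intro ε hε
    have hs : ContDiff ℝ (⊤ : ℕ∞) fun x => √(Ψ x + ε) :=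
      (hΨ.add contDiff_const).sqrt fun x => (by linarith [h0 x] : (0 : ℝ) < Ψ x + ε).ne'
    have h := hα _ (hv.comp hs) fun z => Real.sqrt_nonneg _
    have e : ∀ y, √(Ψ (v y) + ε) ^ 2 = Ψ (v y) + ε := fun y =>
      Real.sq_sqrt (by linarith [h0 (v y)])
    simp only [e] at h
    rw [integral_add hint (integrable_const _), integral_const, smul_eq_mul,
      mul_comm (μ.real univ)] at h
    refine h.trans (le_of_eq (integral_congr_ae ?_))
    filter_upwards [hψ] with z hz
    have h1 := gradH_comp j (χ := fun x => Ψ x + ε) (u := v) (z := z)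
      ((hΨ.differentiable (by simp) _).add_const ε) (hv.differentiable z)
    rw [h1, deriv_add_const, hz, ← inner_opSqrt_opSqrt (hA z), map_smul, real_inner_smul_right]
  have hlim : Tendsto (fun ε : ℝ => -α * (∫ z, Ψ (v z) ∂μ + ε * μ.real univ)) (𝓝[>] 0)
      (𝓝 (-α * (∫ z, Ψ (v z) ∂μ + 0 * μ.real univ))) := by
    refine Tendsto.mono_left ?_ nhdsWithin_le_nhds
    exact Continuous.tendsto (by fun_prop) 0
  rw [zero_mul, add_zero] at hlim
  refine le_of_tendsto hlim ?_
  filter_upwards [self_mem_nhdsWithin] with ε hε using key ε hε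

lemma CondA2.exists_driftLowerBound (hA : ∀ z, (A z).IsPositive) (hA2 : CondA2 j A b μ) :
    ∃ α : ℝ, 0 ≤ α ∧ DriftLowerBound j A b μ α := by
  obtain ⟨α, hα0, hα⟩ := hA2.lower
  refine ⟨α, hα0, fun u ψ M Ψ h hM hΨ h0 => ?_⟩
  obtain ⟨B, v, θ, hv, hB, hθ, hlim, hθlim⟩ := h.exists_bdd_approx hM
  have hdc : Continuous (deriv Ψ) := hΨ.continuous_deriv (by simp)
  obtain ⟨K, hK⟩ := exists_bound_on_Icc hΨ.continuous B
  obtain ⟨K', hK'⟩ := exists_bound_on_Icc hdc B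
  have hBu : ∀ᵐ z ∂μ, |u z| ≤ B := by
    filter_upwards [hlim] with z hz
    exact le_of_tendsto hz.abs (Eventually.of_forall fun n => hB n z)
  have hdm : ∀ n, AEStronglyMeasurable (fun z => deriv Ψ (v n z)) μ := fun n =>
    (hdc.comp (hv n).differentiable.continuous).aestronglyMeasurable
  choose η hη using fun n => exists_ae_eq_smul (hdm n)
    (Eventually.of_forall fun z => hK' _ (hB n z)) (θ n)
  obtain ⟨η', hη'⟩ := exists_ae_eq_smul
    (hdc.comp_aestronglyMeasurable (Lp.aestronglyMeasurable u))
    (hBu.mono fun z hz => hK' _ hz) ψ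
  have hηlim : Tendsto η atTop (𝓝 η') := by
    refine Lp_tendsto_bdd_smul hdm (fun n => Eventually.of_forall fun z => hK' _ (hB n z)) ?_
      hθlim hη hη'
    filter_upwards [hlim] with z hz
    exact (hdc.tendsto _).comp hz
  -- The drift integral is the inner product of the fixed element A^{1/2}b ∈ L² with the weighted
  -- gradient, so L²-convergence of the latter suffices.
  have e : ∀ (c : E → ℝ) (ψ η : Lp H 2 μ), (η =ᵐ[μ] fun z => c z • ψ z) →
      ∫ z, c z * ⟪opSqrt (A z) (b z), ψ z⟫ ∂μ = ⟪hA2.memLp.toLp, η⟫ := by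
    intro c ψ η h
    rw [L2.inner_def]
    refine integral_congr_ae ?_
    filter_upwards [h, hA2.memLp.coeFn_toLp] with z h1 h2
    rw [h1, h2, real_inner_smul_right]
  have l1 : Tendsto (fun n => ∫ z, Ψ (v n z) ∂μ) atTop (𝓝 (∫ z, Ψ (u z) ∂μ)) := by
    refine tendsto_integral_of_dominated_convergence (fun _ => K)
      (fun n => (hΨ.continuous.comp (hv n).differentiable.continuous).aestronglyMeasurable)
      (integrable_const _) (fun n => Eventually.of_forall fun z => hK _ (hB n z)) ?_
    filter_upwards [hlim] with z hz
    exact (hΨ.continuous.tendsto _).comp hz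
  rw [e _ _ _ hη']
  refine le_of_tendsto_of_tendsto (l1.const_mul (-α)) (tendsto_const_nhds.inner hηlim)
    (Eventually.of_forall fun n => ?_)
  simp only []
  rw [← e _ _ _ (hη n)]
  exact driftLowerBound_cylinder hA hα (hv n) (hθ n) hΨ h0

variable {T : ℝ} {P : ℝ → Lp ℝ 2 μ →L[ℝ] Lp ℝ 2 μ}

/-- The identity of (A3) is extended to test functions that need not lie in the domain of L. The
uniform bound on the approximants in (A3) is essential: ⟨A^{1/2}b, ψ⟩ is only integrable, so the
drift term converges by domination along an a.e. convergent subsequence. -/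
lemma CondA3.form_eq (hA : ∀ z, (A z).IsPositive) (hA1 : CondA1 j A μ) (hA2 : CondA2 j A b μ)
    (hA3 : CondA3 j A b μ T P) {u Lu v : Lp ℝ 2 μ} {ψ θ : Lp H 2 μ} (hL : IsGenerator P u Lu)
    (hub : EssBdd u) (hu : HasGradA j A μ u ψ) (hvb : EssBdd v) (hv : HasGradA j A μ v θ) :
    ⟪ψ, θ⟫ + ∫ z, ⟪opSqrt (A z) (b z), ψ z⟫ * v z ∂μ = -⟪Lu, v⟫ := by
  obtain ⟨w, M, hw, hlim⟩ := hA3.dense v hv.mem hvb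
  choose hg hM using hw
  choose Lw hLw using hg
  have hwF : ∀ n, w n ∈ domF j A μ := fun n => hA3.dom_sub _ _ (hLw n) ⟨M, hM n⟩
  have hgr : ∀ n, gradA j A μ (w n - v) = gradA j A μ (w n) - θ := fun n =>
    ((hasGradA_gradA (hwF n)).sub hv).gradA_eq hA hA1
  have l1 : Tendsto w atTop (𝓝 v) := by
    rw [tendsto_iff_norm_sub_tendsto_zero]
    have : Tendsto (fun n => ‖w n - v‖ ^ 2) atTop (𝓝 0) :=
      squeeze_zero (fun n => by positivity) (fun n => le_add_of_nonneg_left (by positivity)) hlim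
    simpa [Real.sqrt_sq (norm_nonneg _)] using this.sqrt
  have l2 : Tendsto (fun n => gradA j A μ (w n)) atTop (𝓝 θ) := by
    rw [tendsto_iff_norm_sub_tendsto_zero]
    have : Tendsto (fun n => ‖gradA j A μ (w n - v)‖ ^ 2) atTop (𝓝 0) :=
      squeeze_zero (fun n => by positivity) (fun n => le_add_of_nonneg_right (by positivity)) hlim
    simpa [Real.sqrt_sq (norm_nonneg _), hgr] using this.sqrt
  obtain ⟨ns, hns, hae⟩ := Lp_exists_subseq_ae l1
  have hψ : gradA j A μ u = ψ := hu.gradA_eq hA hA1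
  have hint : Integrable (fun z => ⟪opSqrt (A z) (b z), ψ z⟫) μ := by
    refine (L2.integrable_inner (𝕜 := ℝ) hA2.memLp.toLp ψ).congr ?_
    filter_upwards [hA2.memLp.coeFn_toLp] with z hz
    rw [hz]
  have l3 : Tendsto (fun n => ∫ z, ⟪opSqrt (A z) (b z), ψ z⟫ * w (ns n) z ∂μ) atTop
      (𝓝 (∫ z, ⟪opSqrt (A z) (b z), ψ z⟫ * v z ∂μ)) := by
    refine tendsto_integral_of_dominated_convergence
      (fun z => ‖⟪opSqrt (A z) (b z), ψ z⟫‖ * M)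
      (fun n => hint.1.mul (Lp.aestronglyMeasurable _)) (hint.norm.mul_const _) (fun n => ?_) ?_
    · filter_upwards [hM (ns n)] with z hz
      rw [norm_mul]
      exact mul_le_mul_of_nonneg_left hz (norm_nonneg _)
    · filter_upwards [hae] with z hz
      exact hz.const_mul _
  have l4 := ((tendsto_const_nhds (x := ψ)).inner (𝕜 := ℝ) (l2.comp hns.tendsto_atTop)).add l3
  have l5 := ((tendsto_const_nhds (x := Lu)).inner (𝕜 := ℝ) (l1.comp hns.tendsto_atTop)).neg
  refine tendsto_nhds_unique (l4.congr fun n => ?_) l5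
  have := hA3.assoc u Lu (w (ns n)) (Lw (ns n)) hL hub (hLw _) ⟨M, hM _⟩
  rw [formE, hψ] at this
  exact this

/-- The form identity is tested with v = u. The drift term is then half of the one for u², hence at
least -(α/2)‖u‖². -/
lemma norm_sq_gradient_le (hA : ∀ z, (A z).IsPositive) (hA1 : CondA1 j A μ)
    (hA2 : CondA2 j A b μ) (hA3 : CondA3 j A b μ T P) {α : ℝ} (hα : DriftLowerBound j A b μ α)
    {u Lu : Lp ℝ 2 μ} {ψ : Lp H 2 μ} (hL : IsGenerator P u Lu) (hub : EssBdd u)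
    (hu : HasGradA j A μ u ψ) : ‖ψ‖ ^ 2 ≤ -⟪Lu, u⟫ + α / 2 * ‖u‖ ^ 2 := by
  obtain ⟨M, hM⟩ := hub
  have h1 := hA3.form_eq hA hA1 hA2 hL ⟨M, hM⟩ hu ⟨M, hM⟩ hu
  have h2 := hα u ψ M (fun x => x ^ 2) hu hM (by fun_prop) fun x => sq_nonneg x
  have h3 : ∫ z, deriv (fun x : ℝ => x ^ 2) (u z) * ⟪opSqrt (A z) (b z), ψ z⟫ ∂μ =
      2 * ∫ z, ⟪opSqrt (A z) (b z), ψ z⟫ * u z ∂μ := by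
    rw [← integral_const_mul]
    congr 1
    ext z
    simp
    ring
  have h4 : ∫ z, (u z) ^ 2 ∂μ = ‖u‖ ^ 2 := by
    rw [Lp_norm_sq]
    simp
  rw [h3, h4] at h2
  rw [real_inner_self_eq_norm_sq] at h1
  linarith

/-- Testing `L u` against `u Ξ'(|u|²)`. -/
lemma sum_integral_generator_le (hA : ∀ z, (A z).IsPositive) (hA1 : CondA1 j A μ)
    (hA2 : CondA2 j A b μ) (hA3 : CondA3 j A b μ T P) {α : ℝ} (hα : DriftLowerBound j A b μ α)
    {l : ℕ} {u Lu : Fin l → Lp ℝ 2 μ} {ψ : Fin l → Lp H 2 μ}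
    (hL : ∀ i, IsGenerator P (u i) (Lu i)) {M : ℝ} (hM : ∀ i, ∀ᵐ z ∂μ, |u i z| ≤ M)
    (hu : ∀ i, HasGradA j A μ (u i) (ψ i)) {Ξ : ℝ → ℝ} (hΞ : ContDiff ℝ (⊤ : ℕ∞) Ξ)
    (h0 : ∀ x, 0 ≤ Ξ x) (h2 : ∀ x, 0 ≤ deriv (deriv Ξ) x) :
    2 * ∑ i, ∫ z, Lu i z * (u i z * deriv Ξ (∑ k, (u k z) ^ 2)) ∂μ +
      2 * ∫ z, deriv Ξ (∑ k, (u k z) ^ 2) * ∑ i, ‖ψ i z‖ ^ 2 ∂μ ≤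
      α * ∫ z, Ξ (∑ k, (u k z) ^ 2) ∂μ := by
  have hχ : ContDiff ℝ (⊤ : ℕ∞) (deriv Ξ) := by
    have : ContDiff ℝ ((⊤ : ℕ∞) + 1) Ξ := by simpa using hΞ
    exact (contDiff_succ_iff_deriv.1 this).2.2
  have hsq : ∀ i, ∃ (p : Lp ℝ 2 μ) (q : Lp H 2 μ), p =ᵐ[μ] (fun z => (u i z) ^ 2) ∧
      q =ᵐ[μ] (fun z => (2 * u i z) • ψ i z) ∧ HasGradA j A μ p q := by
    intro i
    obtain ⟨p, q, h1, h2, h3⟩ := (hu i).exists_comp (hM i) (χ := fun x => x ^ 2) (by fun_prop)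
    refine ⟨p, q, h1, ?_, h3⟩
    simpa using h2
  choose p q hp hq hpq using hsq
  -- Here s = |u|², with gradient σ = 2Σ u_i ψ_i. Below, c = Ξ'(s), and the test functions are v_i =
  -- u_i c, with gradient θ_i = u_i Ξ''(s)σ + cψ_i.
  set s : Lp ℝ 2 μ := ∑ i, p i
  set σ : Lp H 2 μ := ∑ i, q i
  have hsσ : HasGradA j A μ s σ := HasGradA.sum _ fun i _ => hpq i
  have hs : s =ᵐ[μ] fun z => ∑ i, (u i z) ^ 2 := by
    refine (Lp.coeFn_fun_finsetSum _ _).trans ?_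
    filter_upwards [ae_all_iff.2 hp] with z hz
    simp only [hz]
  have hσ : σ =ᵐ[μ] fun z => ∑ i, (2 * u i z) • ψ i z := by
    refine (Lp.coeFn_fun_finsetSum _ _).trans ?_
    filter_upwards [ae_all_iff.2 hq] with z hz
    simp only [hz]
  have hsM : ∀ᵐ z ∂μ, |s z| ≤ l * M ^ 2 := by
    filter_upwards [hs, ae_all_iff.2 hM] with z h1 h2
    rw [h1, abs_of_nonneg (by positivity)]
    refine (Finset.sum_le_card_nsmul _ _ (M ^ 2) fun i _ => ?_).trans (by simp)
    exact sq_le_sq' (by linarith [(abs_le.1 (h2 i)).1]) (abs_le.1 (h2 i)).2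
  obtain ⟨c, γ, hc, hγ, hcγ⟩ := hsσ.exists_comp hsM hχ
  obtain ⟨N, hN⟩ := exists_bound_on_Icc hχ.continuous (l * M ^ 2)
  obtain ⟨N', hN'⟩ := exists_bound_on_Icc (hχ.continuous_deriv (by simp)) (l * M ^ 2)
  have hcN : ∀ᵐ z ∂μ, |c z| ≤ N := by
    filter_upwards [hc, hsM] with z h1 h2
    rw [h1]
    exact hN _ h2
  have hprod : ∀ i, ∃ (v : Lp ℝ 2 μ) (θ : Lp H 2 μ), v =ᵐ[μ] (fun z => u i z * c z) ∧
      θ =ᵐ[μ] (fun z => u i z • γ z + c z • ψ i z) ∧ HasGradA j A μ v θ ∧ EssBdd v := by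
    intro i
    obtain ⟨v, hv⟩ := exists_ae_eq_smul (Lp.aestronglyMeasurable (u i)) (hM i) c
    obtain ⟨θ₁, hθ₁⟩ := exists_ae_eq_smul (Lp.aestronglyMeasurable (u i)) (hM i) γ
    obtain ⟨θ₂, hθ₂⟩ := exists_ae_eq_smul (Lp.aestronglyMeasurable c) hcN (ψ i)
    have hθ : (θ₁ + θ₂ : Lp H 2 μ) =ᵐ[μ] fun z => u i z • γ z + c z • ψ i z := by
      filter_upwards [Lp.coeFn_add θ₁ θ₂, hθ₁, hθ₂] with z h1 h2 h3
      rw [h1, Pi.add_apply, h2, h3]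
    refine ⟨v, θ₁ + θ₂, hv, hθ, (hu i).mul hcγ (hM i) hcN hv hθ, |M| * N, ?_⟩
    filter_upwards [hv, hM i, hcN] with z h1 h2 h3
    rw [h1, smul_eq_mul, abs_mul]
    exact mul_le_mul (h2.trans (le_abs_self _)) h3 (abs_nonneg _) (abs_nonneg _)
  choose v θ hv hθ hvθ hvb using hprod
  have hform := fun i => hA3.form_eq hA hA1 hA2 (hL i) ⟨M, hM i⟩ (hu i) (hvb i) (hvθ i)
  have hdrift := hα s σ _ Ξ hsσ hsM hΞ h0
  have iβ : ∀ i, Integrable (fun z => ⟪opSqrt (A z) (b z), ψ i z⟫ * v i z) μ := by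
    intro i
    obtain ⟨K, hK⟩ := hvb i
    have h1 : Integrable (fun z => ⟪opSqrt (A z) (b z), ψ i z⟫) μ := by
      refine (L2.integrable_inner (𝕜 := ℝ) hA2.memLp.toLp (ψ i)).congr ?_
      filter_upwards [hA2.memLp.coeFn_toLp] with z hz
      rw [hz]
    exact h1.mul_bdd (c := K) (Lp.aestronglyMeasurable _) hK
  have iθ : ∀ i, Integrable (fun z => ⟪ψ i z, θ i z⟫) μ := fun i =>
    L2.integrable_inner (𝕜 := ℝ) (ψ i) (θ i)
  have iψ : Integrable (fun z => c z * ∑ i, ‖ψ i z‖ ^ 2) μ :=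
    (integrable_finsetSum _ fun i _ => Lp_integrable_norm_sq (ψ i)).bdd_mul
      (Lp.aestronglyMeasurable _) hcN
  have iσ : Integrable (fun z => deriv Ξ (s z) * ⟪opSqrt (A z) (b z), σ z⟫) μ := by
    have h1 : Integrable (fun z => ⟪opSqrt (A z) (b z), σ z⟫) μ := by
      refine (L2.integrable_inner (𝕜 := ℝ) hA2.memLp.toLp σ).congr ?_
      filter_upwards [hA2.memLp.coeFn_toLp] with z hz
      rw [hz]
    refine h1.bdd_mul (c := N) (hχ.continuous.comp_aestronglyMeasurable
      (Lp.aestronglyMeasurable _)) (hsM.mono fun z hz => hN _ hz)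
  -- Pointwise, Σ⟨ψ_i, θ_i⟩ = cΣ|ψ_i|² + ½Ξ''(s)|σ|², and the last term is dropped by convexity. The
  -- drift terms add up to half the drift of Ξ(s), for which `hdrift` gives the lower bound.
  have hsum : 2 * ∫ z, c z * ∑ i, ‖ψ i z‖ ^ 2 ∂μ +
      ∫ z, deriv Ξ (s z) * ⟪opSqrt (A z) (b z), σ z⟫ ∂μ ≤
      2 * ∑ i, (⟪ψ i, θ i⟫ + ∫ z, ⟪opSqrt (A z) (b z), ψ i z⟫ * v i z ∂μ) := by
    simp only [L2.inner_def]
    have e1 : ∀ i, ∫ z, ⟪ψ i z, θ i z⟫ ∂μ + ∫ z, ⟪opSqrt (A z) (b z), ψ i z⟫ * v i z ∂μ =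
        ∫ z, (⟪ψ i z, θ i z⟫ + ⟪opSqrt (A z) (b z), ψ i z⟫ * v i z) ∂μ := fun i =>
      (integral_add (iθ i) (iβ i)).symm
    have e0 : ∑ i, ∫ z, (⟪ψ i z, θ i z⟫ + ⟪opSqrt (A z) (b z), ψ i z⟫ * v i z) ∂μ =
        ∫ z, ∑ i, (⟪ψ i z, θ i z⟫ + ⟪opSqrt (A z) (b z), ψ i z⟫ * v i z) ∂μ :=
      (integral_finsetSum _ fun i _ => (iθ i).add (iβ i)).symm
    simp only [e1]
    rw [e0, ← integral_const_mul,
      ← integral_const_mul, ← integral_add (iψ.const_mul 2) iσ]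
    refine integral_mono_ae ((iψ.const_mul 2).add iσ)
      ((integrable_finsetSum _ fun i _ => (iθ i).add (iβ i)).const_mul 2) ?_
    filter_upwards [ae_all_iff.2 hv, ae_all_iff.2 hθ, hc, hγ, hσ] with z h1 h2' h3 h4 h5
    simp only [h1, h2', h4]
    have e2 : ∑ i, (⟪ψ i z, u i z • deriv (deriv Ξ) (s z) • σ z + c z • ψ i z⟫ +
        ⟪opSqrt (A z) (b z), ψ i z⟫ * (u i z * c z)) =
        deriv (deriv Ξ) (s z) * (1 / 2 * ⟪σ z, σ z⟫) + c z * ∑ i, ‖ψ i z‖ ^ 2 +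
          c z * (1 / 2 * ⟪opSqrt (A z) (b z), σ z⟫) := by
      have e3 : ⟪σ z, σ z⟫ = ∑ i, (2 * u i z) * ⟪ψ i z, σ z⟫ := by
        conv_lhs => rw [h5]
        rw [sum_inner]
        refine Finset.sum_congr rfl fun i _ => ?_
        rw [real_inner_smul_left, ← h5]
      have e4 : ⟪opSqrt (A z) (b z), σ z⟫ = ∑ i, (2 * u i z) * ⟪opSqrt (A z) (b z), ψ i z⟫ := by
        rw [h5, inner_sum]
        simp only [real_inner_smul_right]
      rw [e3, e4]
      simp only [Finset.mul_sum, ← Finset.sum_add_distrib]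
      refine Finset.sum_congr rfl fun i _ => ?_
      rw [inner_add_right, real_inner_smul_right, real_inner_smul_right, real_inner_smul_right,
        real_inner_self_eq_norm_sq]
      ring
    have e5 : 0 ≤ deriv (deriv Ξ) (s z) * ⟪σ z, σ z⟫ := mul_nonneg (h2 _) real_inner_self_nonneg
    rw [e2, h3]
    linarith
  have e1 : ∀ i, ⟪Lu i, v i⟫ = ∫ z, Lu i z * (u i z * deriv Ξ (∑ k, (u k z) ^ 2)) ∂μ := by
    intro i
    rw [L2.inner_def]
    refine integral_congr_ae ?_
    filter_upwards [hv i, hc, hs] with z h1 h3 h4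
    rw [h1, h3, h4]
    simp [mul_comm]
  have e2 : ∫ z, c z * ∑ i, ‖ψ i z‖ ^ 2 ∂μ =
      ∫ z, deriv Ξ (∑ k, (u k z) ^ 2) * ∑ i, ‖ψ i z‖ ^ 2 ∂μ := by
    refine integral_congr_ae ?_
    filter_upwards [hc, hs] with z h3 h4
    rw [h3, h4]
  have e3 : ∫ z, Ξ (s z) ∂μ = ∫ z, Ξ (∑ k, (u k z) ^ 2) ∂μ := by
    refine integral_congr_ae ?_
    filter_upwards [hs] with z h4
    rw [h4]
  simp only [hform, e1, e2] at hsum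
  rw [e3] at hdrift
  rw [Finset.sum_neg_distrib] at hsum
  linarith

end LowerBound

/-! ### C₀-semigroups and Steklov averages -/

section Semigroup

variable {X : Type*} [NormedAddCommGroup X] [NormedSpace ℝ X] [CompleteSpace X]
  {P : ℝ → X →L[ℝ] X}

lemma IsC0Semigroup.tendsto_nhdsGE (hP : IsC0Semigroup P) (x : X) :
    Tendsto (fun t => P t x) (𝓝[≥] 0) (𝓝 x) := by
  have : (𝓝[≥] (0 : ℝ)) = pure 0 ⊔ 𝓝[>] 0 := by
    rw [← Ioi_insert, nhdsWithin_insert]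
  rw [this, tendsto_sup]
  refine ⟨?_, hP.tendsto x⟩
  have h0 : P 0 x = x := by rw [hP.zero]; rfl
  rw [tendsto_pure_left]
  intro s hs
  rw [h0]
  exact mem_of_mem_nhds hs

/-- Otherwise there are times t_n → 0 with ‖P_{t_n}‖ > n. The orbits along this sequence converge,
hence are bounded, which contradicts the uniform boundedness principle. -/
lemma IsC0Semigroup.exists_bound_near_zero (hP : IsC0Semigroup P) :
    ∃ δ > 0, ∃ M : ℝ, ∀ t ∈ Icc 0 δ, ‖P t‖ ≤ M := by
  by_contra! h
  choose t ht hlt using fun n : ℕ => h (1 / ((n : ℝ) + 1)) (by positivity) n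
  have htend : Tendsto t atTop (𝓝[≥] 0) := by
    refine tendsto_nhdsWithin_iff.2 ⟨?_, Eventually.of_forall fun n => (ht n).1⟩
    exact squeeze_zero (fun n => (ht n).1) (fun n => (ht n).2) tendsto_one_div_add_atTop_nhds_zero_nat
  obtain ⟨C, hC⟩ := banach_steinhaus (g := fun n => P (t n)) fun x => by
    obtain ⟨C, hC⟩ := ((hP.tendsto_nhdsGE x).comp htend).norm.bddAbove_range
    exact ⟨C, fun n => hC ⟨n, rfl⟩⟩
  obtain ⟨n, hn⟩ := exists_nat_gt C
  linarith [hC n, hlt n]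

lemma IsC0Semigroup.exists_bound (hP : IsC0Semigroup P) (T : ℝ) :
    ∃ M : ℝ, 1 ≤ M ∧ ∀ t ∈ Icc 0 T, ‖P t‖ ≤ M := by
  obtain ⟨δ, hδ, M, hM⟩ := hP.exists_bound_near_zero
  have key : ∀ n : ℕ, ∀ t ∈ Icc 0 (n * δ), ‖P t‖ ≤ (max M 1) ^ (n + 1) := by
    intro n
    induction n with
    | zero =>
      intro t ht
      have : t ∈ Icc 0 δ := ⟨ht.1, ht.2.trans (by simpa using hδ.le)⟩
      simpa using Or.inl (hM t this)
    | succ n ih =>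
      intro t ht
      rcases le_total t δ with h | h
      · refine (hM t ⟨ht.1, h⟩).trans ((le_max_left M 1).trans ?_)
        exact le_self_pow₀ (le_max_right _ _) (by omega)
      · have e : P t = P (t - δ) ∘L P δ := by
          rw [← hP.add _ _ (by linarith) hδ.le]; congr 1; ring
        rw [e, pow_succ]
        refine (ContinuousLinearMap.opNorm_comp_le _ _).trans ?_
        have h1 := ih (t - δ) ⟨by linarith, by have := ht.2; push_cast at this; linarith⟩
        have h2 := hM δ ⟨hδ.le, le_rfl⟩
        exact mul_le_mul h1 (h2.trans (le_max_left _ _)) (norm_nonneg _) (by positivity)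
  obtain ⟨n, hn⟩ := exists_nat_gt (T / δ)
  refine ⟨(max M 1) ^ (n + 1), one_le_pow₀ (le_max_right _ _), fun t ht => key n t ⟨ht.1, ?_⟩⟩
  rw [div_lt_iff₀ hδ] at hn
  linarith [ht.2]

/-- The difference of two orbit points is P at the smaller time applied to P_{|s-t|}x - x. Local
boundedness thus reduces continuity from both sides to continuity at 0. -/
lemma IsC0Semigroup.continuousOn_orbit (hP : IsC0Semigroup P) (x : X) :
    ContinuousOn (fun t => P t x) (Ici 0) := by
  intro t ht
  have ht0 : (0 : ℝ) ≤ t := ht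
  obtain ⟨M, hM1, hM⟩ := hP.exists_bound (t + 1)
  rw [ContinuousWithinAt, tendsto_iff_norm_sub_tendsto_zero]
  have hlim : Tendsto (fun s : ℝ => M * ‖P |s - t| x - x‖) (𝓝[Ici 0] t) (𝓝 0) := by
    have h1 : Tendsto (fun s : ℝ => |s - t|) (𝓝[Ici 0] t) (𝓝[≥] 0) := by
      refine tendsto_nhdsWithin_iff.2 ⟨?_, Eventually.of_forall fun n => mem_Ici.2 (abs_nonneg _)⟩
      have : Continuous fun s : ℝ => |s - t| := by fun_prop
      have h := this.tendsto t
      rw [sub_self, abs_zero] at h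
      exact h.mono_left nhdsWithin_le_nhds
    have h2 := (tendsto_iff_norm_sub_tendsto_zero.1 ((hP.tendsto_nhdsGE x).comp h1)).const_mul M
    simpa using h2
  refine squeeze_zero' (Eventually.of_forall fun s => norm_nonneg _) ?_ hlim
  have hev : ∀ᶠ s in 𝓝[Ici 0] t, s ∈ Ici (0 : ℝ) ∧ s < t + 1 :=
    (eventually_mem_nhdsWithin).and
      (nhdsWithin_le_nhds (eventually_lt_nhds (by linarith : t < t + 1)))
  filter_upwards [hev] with s ⟨hs0, hs1⟩
  have hs0' : (0 : ℝ) ≤ s := hs0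
  rcases le_total s t with h | h
  · have e : P t x = P s (P (t - s) x) := by
      have := hP.add s (t - s) hs0' (by linarith)
      rw [show s + (t - s) = t by ring] at this
      rw [this]; rfl
    rw [abs_of_nonpos (by linarith), e, ← map_sub, neg_sub, norm_sub_rev (P (t - s) x) x]
    refine (ContinuousLinearMap.le_opNorm _ _).trans ?_
    gcongr
    exact hM s ⟨hs0', hs1.le⟩
  · have e : P s x = P t (P (s - t) x) := by
      have := hP.add t (s - t) ht0 (by linarith)
      rw [show t + (s - t) = s by ring] at this
      rw [this]; rfl
    rw [abs_of_nonneg (by linarith), e, ← map_sub]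
    refine (ContinuousLinearMap.le_opNorm _ _).trans ?_
    gcongr
    exact hM t ⟨ht0, by linarith⟩

/-- The semigroup extended by the identity to negative times. -/
def extP (P : ℝ → X →L[ℝ] X) (t : ℝ) : X →L[ℝ] X := P (max t 0)

lemma extP_of_nonneg {t : ℝ} (ht : 0 ≤ t) : extP P t = P t := by rw [extP, max_eq_left ht]

lemma IsC0Semigroup.continuous_extP (hP : IsC0Semigroup P) :
    Continuous fun p : ℝ × X => extP P p.1 p.2 := by
  rw [continuous_iff_continuousAt]
  rintro ⟨t, x⟩
  obtain ⟨M, hM1, hM⟩ := hP.exists_bound (|t| + 1)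
  have horb : Continuous fun s => extP P s x :=
    (hP.continuousOn_orbit x).comp_continuous (by fun_prop) fun s => mem_Ici.2 (le_max_right _ _)
  rw [ContinuousAt, tendsto_iff_norm_sub_tendsto_zero]
  have hlim : Tendsto (fun p : ℝ × X => M * ‖p.2 - x‖ + ‖extP P p.1 x - extP P t x‖) (𝓝 (t, x))
      (𝓝 0) := by
    have : Continuous fun p : ℝ × X => M * ‖p.2 - x‖ + ‖extP P p.1 x - extP P t x‖ := by
      have := horb.comp (continuous_fst (X := ℝ) (Y := X))
      simp only [Function.comp_def] at this
      fun_prop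
    have h := this.tendsto (t, x)
    simpa using h
  refine squeeze_zero' (Eventually.of_forall fun s => norm_nonneg _) ?_ hlim
  have hev : ∀ᶠ p : ℝ × X in 𝓝 (t, x), p.1 < |t| + 1 :=
    (continuous_fst.tendsto (t, x)).eventually
      (eventually_lt_nhds (by linarith [le_abs_self t] : t < |t| + 1))
  filter_upwards [hev] with p hp
  have e : extP P p.1 p.2 - extP P t x =
      extP P p.1 (p.2 - x) + (extP P p.1 x - extP P t x) := by rw [map_sub]; abel
  rw [e]
  refine (norm_add_le _ _).trans (add_le_add_left ?_ _)
  refine (ContinuousLinearMap.le_opNorm _ _).trans ?_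
  gcongr
  exact hM _ ⟨le_max_right _ _, max_le hp.le (by positivity)⟩

lemma IsC0Semigroup.continuous_extP_orbit (hP : IsC0Semigroup P) (x : X) :
    Continuous fun t => extP P t x :=
  hP.continuous_extP.comp (by fun_prop : Continuous fun t : ℝ => (t, x))

lemma IsC0Semigroup.apply_add (hP : IsC0Semigroup P) {s t : ℝ} (hs : 0 ≤ s) (ht : 0 ≤ t) (x : X) :
    P (s + t) x = P s (P t x) := by rw [hP.add s t hs ht]; rfl

lemma IsC0Semigroup.apply_comm (hP : IsC0Semigroup P) {s t : ℝ} (hs : 0 ≤ s) (ht : 0 ≤ t) (x : X) :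
    P s (P t x) = P t (P s x) := by rw [← hP.apply_add hs ht, ← hP.apply_add ht hs, add_comm]

lemma norm_extP_le {T M : ℝ} (hM : ∀ t ∈ Icc 0 T, ‖P t‖ ≤ M) (hT : 0 ≤ T) {t : ℝ} (ht : t ≤ T) :
    ‖extP P t‖ ≤ M := hM _ ⟨le_max_right _ _, max_le ht hT⟩

/-- `h⁻¹ ∫₀ʰ P_r x dr`. -/
noncomputable def steklov (hP : IsC0Semigroup P) (h : ℝ) : X →L[ℝ] X :=
  LinearMap.mkContinuousOfExistsBound
    { toFun := fun x => h⁻¹ • ∫ r in (0 : ℝ)..h, extP P r x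
      map_add' := fun x y => by
        simp only [map_add]
        rw [intervalIntegral.integral_add, smul_add]
        · exact (hP.continuous_extP_orbit x).intervalIntegrable _ _
        · exact (hP.continuous_extP_orbit y).intervalIntegrable _ _
      map_smul' := fun c x => by
        simp only [map_smul, RingHom.id_apply]
        rw [intervalIntegral.integral_smul, smul_comm] }
    (by
      obtain ⟨M, hM1, hM⟩ := hP.exists_bound |h|
      refine ⟨|h⁻¹| * (M * |h|), fun x => ?_⟩
      have : ‖∫ r in (0 : ℝ)..h, extP P r x‖ ≤ M * ‖x‖ * |h - 0| := by
        refine intervalIntegral.norm_integral_le_of_norm_le_const fun r hr => ?_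
        refine (extP P r).le_of_opNorm_le (norm_extP_le hM (abs_nonneg _) ?_) x
        have := hr.2
        refine this.trans (max_le (abs_nonneg _) (le_abs_self _))
      simp only [LinearMap.coe_mk, AddHom.coe_mk]
      rw [norm_smul, Real.norm_eq_abs]
      calc |h⁻¹| * _ ≤ |h⁻¹| * (M * ‖x‖ * |h - 0|) := by gcongr
        _ = _ := by rw [sub_zero]; ring)

variable (hP : IsC0Semigroup P)

lemma steklov_apply (h : ℝ) (x : X) :
    steklov hP h x = h⁻¹ • ∫ r in (0 : ℝ)..h, extP P r x := rfl

lemma hasDerivAt_integral_extP (hP : IsC0Semigroup P) (x : X) (a t : ℝ) :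
    HasDerivAt (fun s => ∫ r in a..s, extP P r x) (extP P t x) t :=
  intervalIntegral.integral_hasDerivAt_right
    ((hP.continuous_extP_orbit x).intervalIntegrable _ _)
    (hP.continuous_extP_orbit x).aestronglyMeasurable.stronglyMeasurableAtFilter
    (hP.continuous_extP_orbit x).continuousAt

lemma steklov_tendsto (x : X) : Tendsto (fun h => steklov hP h x) (𝓝[>] 0) (𝓝 x) := by
  have h := (hasDerivAt_integral_extP hP x 0 0).tendsto_slope_zero_right
  simp only [zero_add, intervalIntegral.integral_same, sub_zero] at h
  rw [extP_of_nonneg le_rfl, hP.zero] at h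
  exact h

lemma norm_steklov_le {T M : ℝ} (hM : ∀ t ∈ Icc 0 T, ‖P t‖ ≤ M) {h : ℝ} (h0 : 0 < h) (hT : h ≤ T) :
    ‖steklov hP h‖ ≤ M := by
  have hM0 : 0 ≤ M := (norm_nonneg _).trans (hM 0 ⟨le_rfl, h0.le.trans hT⟩)
  refine ContinuousLinearMap.opNorm_le_bound _ hM0 fun x => ?_
  rw [steklov_apply, norm_smul, norm_inv, Real.norm_of_nonneg h0.le, inv_mul_le_iff₀ h0]
  have : ‖∫ r in (0 : ℝ)..h, extP P r x‖ ≤ M * ‖x‖ * |h - 0| := by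
    refine intervalIntegral.norm_integral_le_of_norm_le_const fun r hr => ?_
    rw [uIoc_of_le h0.le] at hr
    exact (extP P r).le_of_opNorm_le (norm_extP_le hM (h0.le.trans hT) (hr.2.trans hT)) x
  rw [sub_zero, abs_of_pos h0] at this
  linarith

lemma extP_steklov {t h : ℝ} (ht : 0 ≤ t) (h0 : 0 ≤ h) (x : X) :
    P t (steklov hP h x) = h⁻¹ • ∫ r in t..(t + h), extP P r x := by
  rw [steklov_apply, map_smul, ← (P t).intervalIntegral_comp_comm
    ((hP.continuous_extP_orbit x).intervalIntegrable _ _)]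
  have : ∫ r in t..(t + h), extP P r x = ∫ r in (0 : ℝ)..h, extP P (t + r) x := by
    rw [intervalIntegral.integral_comp_add_left (fun r => extP P r x), add_zero]
  rw [this]
  congr 1
  refine intervalIntegral.integral_congr fun r hr => ?_
  rw [uIcc_of_le h0] at hr
  rw [extP_of_nonneg hr.1, extP_of_nonneg (by linarith [hr.1]), hP.apply_add ht hr.1]

lemma steklov_comm {t h : ℝ} (ht : 0 ≤ t) (h0 : 0 ≤ h) (x : X) :
    P t (steklov hP h x) = steklov hP h (P t x) := by
  rw [steklov_apply, steklov_apply, map_smul, ← (P t).intervalIntegral_comp_comm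
    ((hP.continuous_extP_orbit x).intervalIntegrable _ _)]
  congr 1
  refine intervalIntegral.integral_congr fun r hr => ?_
  rw [uIcc_of_le h0] at hr
  rw [extP_of_nonneg hr.1, hP.apply_comm ht hr.1]

/-- Applying P_t shifts the interval of integration, so the difference quotient is a difference of
averages near its endpoints h and 0. The average therefore lies in the domain for every x, and its
generator value is a bounded function of x. -/
lemma steklov_isGenerator {h : ℝ} (h0 : 0 < h) (x : X) :
    IsGenerator P (steklov hP h x) (h⁻¹ • (P h x - x)) := by
  have h1 := (hasDerivAt_integral_extP hP x 0 h).tendsto_slope_zero_right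
  have h2 := (hasDerivAt_integral_extP hP x 0 0).tendsto_slope_zero_right
  have h3 := (h1.sub h2).const_smul h⁻¹
  rw [extP_of_nonneg h0.le, extP_of_nonneg le_rfl, hP.zero] at h3
  refine Tendsto.congr' ?_ h3
  filter_upwards [self_mem_nhdsWithin] with t ht
  have ht0 : (0 : ℝ) < t := ht
  have hi : ∀ a b, IntervalIntegrable (fun r => extP P r x) volume a b := fun a b =>
    (hP.continuous_extP_orbit x).intervalIntegrable _ _
  rw [extP_steklov hP ht0.le h0.le, steklov_apply, ← smul_sub, ← smul_sub, smul_comm,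
    intervalIntegral.integral_same, sub_zero, zero_add]
  congr 2
  have e1 := intervalIntegral.integral_add_adjacent_intervals (hi 0 t) (hi t (t + h))
  rw [add_comm h t, ← e1]
  abel

/-- The average commutes with the generator. Only right derivatives of the orbit are available from
the definition of the generator, and they suffice for the fundamental theorem of calculus. -/
lemma IsGenerator.steklov_eq {x v : X} (hx : IsGenerator P x v) {h : ℝ} (h0 : 0 < h) :
    h⁻¹ • (P h x - x) = steklov hP h v := by
  rw [steklov_apply]
  congr 1
  have e : ∀ r, ContinuousOn (fun r => P r x) (Icc 0 r) := fun r =>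
    (hP.continuousOn_orbit x).mono Icc_subset_Ici_self
  have key := intervalIntegral.integral_eq_sub_of_hasDeriv_right_of_le (f := fun r => P r x)
    (f' := fun r => extP P r v) h0.le (e h) (fun r hr => ?_)
    ((hP.continuous_extP_orbit v).intervalIntegrable _ _)
  · rw [key, hP.zero]; rfl
  · rw [extP_of_nonneg hr.1.le]
    rw [hasDerivWithinAt_iff_tendsto_slope, sdiff_singleton_eq_self (by simp)]
    have h1 : Tendsto (fun s : ℝ => s - r) (𝓝[>] r) (𝓝[>] 0) := by
      refine tendsto_nhdsWithin_iff.2 ⟨?_, ?_⟩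
      · have : Continuous fun s : ℝ => s - r := by fun_prop
        have h := this.tendsto r
        rw [sub_self] at h
        exact h.mono_left nhdsWithin_le_nhds
      · filter_upwards [self_mem_nhdsWithin] with s hs
        exact mem_Ioi.2 (sub_pos.2 (mem_Ioi.1 hs))
    have h2 := ((P r).continuous.tendsto _).comp (hx.comp h1)
    refine Tendsto.congr' ?_ h2
    filter_upwards [self_mem_nhdsWithin] with s hs
    have hs' : r < s := hs
    have : P s x = P r (P (s - r) x) := by
      rw [← hP.apply_add hr.1.le (by linarith)]; congr 2; ring
    simp only [Function.comp, slope_def_module, map_smul, map_sub, this]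

end Semigroup

/-! ### Mild and strong solutions of the linear backward equation -/

section Mild

variable {X : Type*} [NormedAddCommGroup X] [NormedSpace ℝ X] [CompleteSpace X]
  {P : ℝ → X →L[ℝ] X}

/-- The mild solution of `(∂_t + L) u + g = 0`, `u_T = φ`. -/
noncomputable def mild (P : ℝ → X →L[ℝ] X) (T : ℝ) (φ : X) (g : ℝ → X) (t : ℝ) : X :=
  P (T - t) φ + ∫ s in t..T, P (s - t) (g s)

variable (hP : IsC0Semigroup P) {T : ℝ} {g g' : ℝ → X} {φ φ' : X}
include hP

lemma aestronglyMeasurable_extP_comp {ν : Measure ℝ} (hg : AEStronglyMeasurable g ν) (t : ℝ) :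
    AEStronglyMeasurable (fun s => extP P (s - t) (g s)) ν :=
  hP.continuous_extP.comp_aestronglyMeasurable
    ((by fun_prop : Continuous fun s : ℝ => s - t).aestronglyMeasurable.prodMk hg)

lemma integrableOn_extP_comp (hT : 0 ≤ T) (hg : IntegrableOn g (Icc 0 T)) {t : ℝ} (ht : 0 ≤ t) :
    IntegrableOn (fun s => extP P (s - t) (g s)) (Icc 0 T) := by
  obtain ⟨M, hM1, hM⟩ := hP.exists_bound T
  refine Integrable.mono' (hg.norm.const_mul M) (aestronglyMeasurable_extP_comp hP hg.1 t) ?_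
  filter_upwards [ae_restrict_mem measurableSet_Icc] with s hs
  exact (extP P (s - t)).le_of_opNorm_le (norm_extP_le hM hT (by linarith [hs.2])) _

lemma intervalIntegrable_extP_comp (hg : IntegrableOn g (Icc 0 T)) {t a b : ℝ} (ht : 0 ≤ t)
    (ha : a ∈ Icc 0 T) (hb : b ∈ Icc 0 T) :
    IntervalIntegrable (fun s => extP P (s - t) (g s)) volume a b := by
  have h := integrableOn_extP_comp hP (ha.1.trans ha.2) hg ht
  refine (h.mono_set ?_).intervalIntegrable
  exact uIcc_subset_Icc ha hb

lemma mild_eq {t : ℝ} (ht : t ≤ T) :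
    mild P T φ g t = P (T - t) φ + ∫ s in t..T, extP P (s - t) (g s) := by
  rw [mild]
  congr 1
  refine intervalIntegral.integral_congr fun s hs => ?_
  rw [uIcc_of_le ht] at hs
  rw [extP_of_nonneg (by linarith [hs.1])]

lemma mild_terminal : mild P T φ g T = φ := by
  rw [mild, sub_self, hP.zero, intervalIntegral.integral_same, add_zero]; rfl

lemma mild_sub (hg : IntegrableOn g (Icc 0 T)) (hg' : IntegrableOn g' (Icc 0 T)) {t : ℝ}
    (ht : t ∈ Icc 0 T) :
    mild P T (φ - φ') (fun s => g s - g' s) t = mild P T φ g t - mild P T φ' g' t := by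
  have hTm : T ∈ Icc 0 T := ⟨ht.1.trans ht.2, le_rfl⟩
  rw [mild_eq hP ht.2, mild_eq hP ht.2, mild_eq hP ht.2]
  simp only [map_sub]
  rw [intervalIntegral.integral_sub (intervalIntegrable_extP_comp hP hg ht.1 ht hTm)
    (intervalIntegrable_extP_comp hP hg' ht.1 ht hTm)]
  abel

lemma norm_mild_le {M : ℝ} (hM : ∀ t ∈ Icc 0 T, ‖P t‖ ≤ M) (hg : IntegrableOn g (Icc 0 T)) {t : ℝ}
    (ht : t ∈ Icc 0 T) : ‖mild P T φ g t‖ ≤ M * (‖φ‖ + ∫ s in Icc 0 T, ‖g s‖) := by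
  have hT : 0 ≤ T := ht.1.trans ht.2
  have hM0 : 0 ≤ M := (norm_nonneg _).trans (hM 0 ⟨le_rfl, hT⟩)
  rw [mild_eq hP ht.2, mul_add]
  refine (norm_add_le _ _).trans (add_le_add ?_ ?_)
  · exact (P (T - t)).le_of_opNorm_le (hM _ ⟨by linarith [ht.2], by linarith [ht.1]⟩) _
  · refine (intervalIntegral.norm_integral_le_integral_norm ht.2).trans ?_
    rw [intervalIntegral.integral_of_le ht.2, ← integral_const_mul]
    have hsub : Ioc t T ⊆ Icc 0 T := fun s hs => ⟨ht.1.trans hs.1.le, hs.2⟩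
    have hMg : IntegrableOn (fun s => M * ‖g s‖) (Icc 0 T) := hg.norm.const_mul M
    calc ∫ s in Ioc t T, ‖extP P (s - t) (g s)‖ ≤ ∫ s in Ioc t T, M * ‖g s‖ := by
          refine setIntegral_mono_on ?_ (hMg.mono_set hsub) measurableSet_Ioc
            fun s hs => ?_
          · exact ((integrableOn_extP_comp hP hT hg ht.1).mono_set hsub).norm
          · exact (extP P (s - t)).le_of_opNorm_le
              (norm_extP_le hM hT (by linarith [hs.2, ht.1])) _
      _ ≤ ∫ s in Icc 0 T, M * ‖g s‖ := by
          refine setIntegral_mono_set hMg ?_ hsub.eventuallyLE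
          exact Eventually.of_forall fun s => by positivity

/-- A mild solution can be restarted from its value at an intermediate time; its difference
quotients are computed from this identity. -/
lemma mild_shift (hg : IntegrableOn g (Icc 0 T)) {t t' : ℝ} (ht : 0 ≤ t) (htt : t ≤ t')
    (ht' : t' ≤ T) : mild P T φ g t =
      P (t' - t) (mild P T φ g t') + ∫ s in t..t', extP P (s - t) (g s) := by
  have hTm : T ∈ Icc 0 T := ⟨ht.trans (htt.trans ht'), le_rfl⟩
  have htm : t ∈ Icc 0 T := ⟨ht, htt.trans ht'⟩
  have htm' : t' ∈ Icc 0 T := ⟨ht.trans htt, ht'⟩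
  rw [mild_eq hP htm.2, mild_eq hP ht', map_add, ← hP.apply_add (by linarith) (by linarith),
    ← (P (t' - t)).intervalIntegral_comp_comm
      (intervalIntegrable_extP_comp hP hg htm'.1 htm' hTm),
    ← intervalIntegral.integral_add_adjacent_intervals
      (intervalIntegrable_extP_comp hP hg ht htm htm')
      (intervalIntegrable_extP_comp hP hg ht htm' hTm)]
  have e1 : T - t = t' - t + (T - t') := by ring
  have e2 : ∫ s in t'..T, P (t' - t) (extP P (s - t') (g s)) =
      ∫ s in t'..T, extP P (s - t) (g s) := by
    refine intervalIntegral.integral_congr fun s hs => ?_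
    rw [uIcc_of_le ht'] at hs
    rw [extP_of_nonneg (by linarith [hs.1]), extP_of_nonneg (by linarith [hs.1]),
      ← hP.apply_add (by linarith) (by linarith [hs.1])]
    congr 2
    ring
  rw [e2, e1]
  abel

lemma mild_continuousOn (hg : IntegrableOn g (Icc 0 T)) :
    ContinuousOn (mild P T φ g) (Icc 0 T) := by
  -- Rewritten over a fixed interval with an indicator, the Duhamel integral is continuous by
  -- domination: at a fixed t₀ the integrand can be discontinuous in t only for s = t₀.
  have key : ContinuousOn (fun t => P (T - t) φ +
      ∫ s in Icc 0 T, (Ioc t T).indicator (fun s => extP P (s - t) (g s)) s) (Icc 0 T) := by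
    refine ContinuousOn.add ?_ ?_
    · exact (hP.continuousOn_orbit φ).comp (by fun_prop) fun t ht => mem_Ici.2 (by linarith [ht.2])
    intro t₀ ht₀
    obtain ⟨M, hM1, hM⟩ := hP.exists_bound T
    have hT : 0 ≤ T := ht₀.1.trans ht₀.2
    refine continuousWithinAt_of_dominated (bound := fun s => M * ‖g s‖)
      (Eventually.of_forall fun t => (aestronglyMeasurable_extP_comp hP hg.1 t).indicator
        measurableSet_Ioc) ?_ (hg.norm.const_mul M) ?_
    · filter_upwards [self_mem_nhdsWithin] with t ht
      filter_upwards [ae_restrict_mem measurableSet_Icc] with s hs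
      refine (norm_indicator_le_norm_self _ _).trans ?_
      exact (extP P (s - t)).le_of_opNorm_le (norm_extP_le hM hT (by linarith [hs.2, ht.1])) _
    · have hne : ∀ᵐ s ∂(volume.restrict (Icc 0 T)), s ≠ t₀ :=
        ae_restrict_of_ae (Measure.ae_ne volume t₀)
      filter_upwards [hne] with s hs
      refine ContinuousAt.continuousWithinAt ?_
      have hc : Continuous fun t => extP P (s - t) (g s) :=
        hP.continuous_extP.comp (by fun_prop : Continuous fun t : ℝ => (s - t, g s))
      rcases lt_or_gt_of_ne hs with h | h
      · have hev : (fun t => (Ioc t T).indicator (fun s => extP P (s - t) (g s)) s) =ᶠ[𝓝 t₀]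
            fun _ => 0 := by
          filter_upwards [eventually_gt_nhds h] with t ht
          rw [indicator_of_notMem]
          exact fun hm => absurd hm.1 (by linarith)
        exact continuousAt_const.congr hev.symm
      · by_cases hsT : s ≤ T
        · have hev : (fun t => (Ioc t T).indicator (fun s => extP P (s - t) (g s)) s) =ᶠ[𝓝 t₀]
              fun t => extP P (s - t) (g s) := by
            filter_upwards [eventually_lt_nhds h] with t ht
            rw [indicator_of_mem]
            exact ⟨ht, hsT⟩
          exact hc.continuousAt.congr hev.symm
        · have hev : (fun t => (Ioc t T).indicator (fun s => extP P (s - t) (g s)) s) =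
              fun _ => 0 := by
            funext t
            rw [indicator_of_notMem]
            exact fun hm => hsT hm.2
          rw [hev]
          exact continuousAt_const
  refine key.congr fun t ht => ?_
  beta_reduce
  rw [mild_eq hP ht.2, intervalIntegral.integral_of_le ht.2, setIntegral_indicator measurableSet_Ioc]
  congr 3
  ext s
  exact ⟨fun hs => ⟨⟨ht.1.trans hs.1.le, hs.2⟩, hs⟩, fun hs => hs.2⟩

lemma steklov_mild (hg : IntegrableOn g (Icc 0 T)) {h : ℝ} (h0 : 0 < h) {t : ℝ}
    (ht : t ∈ Icc 0 T) : steklov hP h (mild P T φ g t) =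
      mild P T (steklov hP h φ) (fun s => steklov hP h (g s)) t := by
  have hTm : T ∈ Icc 0 T := ⟨ht.1.trans ht.2, le_rfl⟩
  rw [mild_eq hP ht.2, mild_eq hP ht.2, map_add, steklov_comm hP (by linarith [ht.2]) h0.le,
    ← (steklov hP h).intervalIntegral_comp_comm (intervalIntegrable_extP_comp hP hg ht.1 ht hTm)]
  congr 1
  refine intervalIntegral.integral_congr fun s hs => ?_
  exact (steklov_comm hP (le_max_right _ _) h0.le _).symm

lemma tendsto_average_extP (hg : Continuous g) (a : ℝ) :
    Tendsto (fun δ : ℝ => δ⁻¹ • ∫ s in (a - δ)..a, extP P (s - (a - δ)) (g s)) (𝓝[>] 0)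
      (𝓝 (g a)) := by
  rw [Metric.tendsto_nhds]
  intro ε hε
  have hc : Continuous fun p : ℝ × ℝ => extP P p.1 (g (a + p.2)) :=
    hP.continuous_extP.comp (by fun_prop : Continuous fun p : ℝ × ℝ => (p.1, g (a + p.2)))
  have hnear := (Metric.continuousAt_iff.1 (hc.continuousAt (x := (0, 0)))) (ε / 2) (by linarith)
  obtain ⟨δ₀, hδ₀, hnear⟩ := hnear
  have hev : ∀ᶠ δ : ℝ in 𝓝[>] 0, δ < δ₀ := nhdsWithin_le_nhds (eventually_lt_nhds hδ₀)
  filter_upwards [hev, self_mem_nhdsWithin] with δ hδ1 hδ2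
  replace hδ2 : 0 < δ := hδ2
  have hcs : Continuous fun s => extP P (s - (a - δ)) (g s) :=
    hP.continuous_extP.comp (by fun_prop : Continuous fun s : ℝ => (s - (a - δ), g s))
  have e : (δ⁻¹ • ∫ s in (a - δ)..a, extP P (s - (a - δ)) (g s)) - g a =
      δ⁻¹ • ((∫ s in (a - δ)..a, extP P (s - (a - δ)) (g s)) - δ • g a) := by
    rw [smul_sub, smul_smul, inv_mul_cancel₀ hδ2.ne', one_smul]
  rw [dist_eq_norm]
  have e2 : (∫ s in (a - δ)..a, extP P (s - (a - δ)) (g s)) - δ • g a =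
      ∫ s in (a - δ)..a, (extP P (s - (a - δ)) (g s) - g a) := by
    rw [intervalIntegral.integral_sub (hcs.intervalIntegrable _ _) intervalIntegrable_const,
      intervalIntegral.integral_const]
    simp
  have h0 : extP P 0 (g (a + 0)) = g a := by
    rw [extP_of_nonneg le_rfl, hP.zero, add_zero]; rfl
  have hb : ‖∫ s in (a - δ)..a, (extP P (s - (a - δ)) (g s) - g a)‖ ≤
      ε / 2 * |a - (a - δ)| := by
    refine intervalIntegral.norm_integral_le_of_norm_le_const fun s hs => ?_
    rw [uIoc_of_le (by linarith)] at hs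
    have h1 := hnear (x := (s - (a - δ), s - a)) (by
      rw [Prod.dist_eq, max_lt_iff, Real.dist_eq, Real.dist_eq]
      simp only [sub_zero]
      refine ⟨abs_lt.2 ⟨by linarith [hs.1], by linarith [hs.2]⟩,
        abs_lt.2 ⟨by linarith [hs.1], by linarith [hs.2]⟩⟩)
    simp only [h0, dist_eq_norm, add_sub_cancel] at h1
    exact h1.le
  calc ‖(δ⁻¹ • ∫ s in (a - δ)..a, extP P (s - (a - δ)) (g s)) - g a‖
      = δ⁻¹ * ‖∫ s in (a - δ)..a, (extP P (s - (a - δ)) (g s) - g a)‖ := by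
        rw [e, e2, norm_smul, norm_inv, Real.norm_of_nonneg hδ2.le]
    _ ≤ δ⁻¹ * (ε / 2 * |a - (a - δ)|) := by gcongr
    _ = ε / 2 := by rw [sub_sub_cancel, abs_of_pos hδ2]; field_simp
    _ < ε := by linarith

/-- In reversed time τ = T - t the restart identity exhibits the right difference quotient as that
of the semigroup plus an average of the source. Its limit is Lu + g, and a continuous function with
a continuous right derivative is recovered by integration. -/
lemma mild_eq_integral_of_isGenerator (hg : Continuous g) {Lu : ℝ → X}
    (hL : ∀ t ∈ Icc 0 T, IsGenerator P (mild P T φ g t) (Lu t)) (hLc : ContinuousOn Lu (Icc 0 T))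
    {t : ℝ} (ht : t ∈ Icc 0 T) :
    mild P T φ g t = φ + ∫ s in t..T, (Lu s + g s) := by
  have hgi : IntegrableOn g (Icc 0 T) := hg.continuousOn.integrableOn_Icc
  have hq : ContinuousOn (fun s => Lu s + g s) (Icc 0 T) := hLc.add hg.continuousOn
  have hmaps : MapsTo (fun τ => T - τ) (Icc 0 (T - t)) (Icc 0 T) := fun τ hτ =>
    ⟨by linarith [hτ.2, ht.1], by linarith [hτ.1]⟩
  have key := intervalIntegral.integral_eq_sub_of_hasDeriv_right_of_le
    (f := fun τ => mild P T φ g (T - τ)) (f' := fun τ => Lu (T - τ) + g (T - τ))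
    (a := 0) (b := T - t) (by linarith [ht.2])
    ((mild_continuousOn hP hgi).comp (by fun_prop) hmaps) ?_ ?_
  · rw [intervalIntegral.integral_comp_sub_left (fun s => Lu s + g s) T] at key
    simp only [sub_sub_cancel, sub_zero] at key
    rw [key, mild_terminal hP]
    abel
  · intro τ hτ
    rw [hasDerivWithinAt_iff_tendsto_slope, sdiff_singleton_eq_self (by simp)]
    have h1 : Tendsto (fun s : ℝ => s - τ) (𝓝[>] τ) (𝓝[>] 0) := by
      refine tendsto_nhdsWithin_iff.2 ⟨?_, ?_⟩
      · have : Continuous fun s : ℝ => s - τ := by fun_prop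
        have h := this.tendsto τ
        rw [sub_self] at h
        exact h.mono_left nhdsWithin_le_nhds
      · filter_upwards [self_mem_nhdsWithin] with s hs
        exact mem_Ioi.2 (sub_pos.2 (mem_Ioi.1 hs))
    have h2 := ((hL (T - τ) (hmaps ⟨hτ.1.le, hτ.2.le⟩)).add
      (tendsto_average_extP hP hg (T - τ))).comp h1
    refine Tendsto.congr' ?_ h2
    have hev : ∀ᶠ s in 𝓝[>] τ, τ < s ∧ s < T - t :=
      (eventually_mem_nhdsWithin).and (nhdsWithin_le_nhds (eventually_lt_nhds hτ.2))
    filter_upwards [hev] with s ⟨hs1, hs2⟩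
    have := mild_shift hP (φ := φ) hgi (t := T - s) (t' := T - τ) (by linarith [ht.1])
      (by linarith) (by linarith [hτ.1])
    simp only [Function.comp, slope_def_module]
    rw [this, ← smul_add]
    congr 1
    have e1 : T - τ - (T - s) = s - τ := by ring
    have e2 : T - τ - (s - τ) = T - s := by ring
    rw [e1, e2]
    abel
  · refine (ContinuousOn.comp hq (by fun_prop) ?_).intervalIntegrable
    rw [uIcc_of_le (by linarith [ht.2])]
    exact hmaps

lemma mild_hasDerivWithinAt (hT : 0 < T) (hg : Continuous g) {Lu : ℝ → X}
    (hL : ∀ t ∈ Icc 0 T, IsGenerator P (mild P T φ g t) (Lu t)) (hLc : ContinuousOn Lu (Icc 0 T))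
    {t : ℝ} (ht : t ∈ Icc 0 T) :
    HasDerivWithinAt (mild P T φ g) (-(Lu t + g t)) (Icc 0 T) t := by
  have hq : ContinuousOn (fun s => Lu s + g s) (Icc 0 T) := hLc.add hg.continuousOn
  -- Continuous extension beyond [0,T] makes the primitive two-sidedly differentiable at the
  -- endpoints too.
  set q : ℝ → X := IccExtend hT.le ((Icc 0 T).domRestrict fun s => Lu s + g s)
  have hqc : Continuous q := (continuousOn_iff_continuous_domRestrict.1 hq).Icc_extend'
  have hqe : ∀ s ∈ Icc 0 T, q s = Lu s + g s := fun s hs => IccExtend_of_mem hT.le _ hs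
  have h1 : HasDerivAt (fun s => φ + ∫ r in s..T, q r) (-(q t)) t :=
    (intervalIntegral.integral_hasDerivAt_left (hqc.intervalIntegrable _ _)
      hqc.aestronglyMeasurable.stronglyMeasurableAtFilter hqc.continuousAt).const_add φ
  have h2 : ∀ s ∈ Icc 0 T, mild P T φ g s = φ + ∫ r in s..T, q r := by
    intro s hs
    rw [mild_eq_integral_of_isGenerator hP hg hL hLc hs]
    congr 1
    refine intervalIntegral.integral_congr fun r hr => ?_
    rw [uIcc_of_le hs.2] at hr
    exact (hqe r ⟨hs.1.trans hr.1, hr.2⟩).symm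
  rw [← hqe t ht]
  exact h1.hasDerivWithinAt.congr h2 (h2 t ht)

/-- Since u(s) lies in the domain only for almost every s, P_{s-t}u(s) cannot be differentiated at
every s. The Steklov average of u(s) lies in the domain for all s; the formula is proved for it and
the averaging parameter is sent to 0. -/
lemma eq_mild_of_strong (hT : 0 < T) {u du Lu : ℝ → X}
    (hu : ∀ t ∈ Icc 0 T, HasDerivWithinAt u (du t) (Icc 0 T) t)
    (hL : ∀ᵐ t ∂(volume.restrict (Icc 0 T)), IsGenerator P (u t) (Lu t))
    (hg : IntegrableOn g (Icc 0 T))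
    (heq : ∀ᵐ t ∂(volume.restrict (Icc 0 T)), du t + Lu t + g t = 0) {t : ℝ} (ht : t ∈ Icc 0 T) :
    u t = mild P T (u T) g t := by
  have hTm : T ∈ Icc 0 T := ⟨hT.le, le_rfl⟩
  have huc : ContinuousOn u (Icc 0 T) := fun s hs => (hu s hs).continuousWithinAt
  have key : ∀ h : ℝ, 0 < h → steklov hP h (u t) = steklov hP h (mild P T (u T) g t) := by
    intro h h0
    set R := steklov hP h
    -- The left side is the right derivative of P_{s-t}R u(s), which exists at every interior s. The
    -- equation identifies it with -P_{s-t}R g(s) only almost everywhere, which is enough under the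
    -- integral.
    have hae : ∀ᵐ s ∂(volume.restrict (Icc 0 T)),
        extP P (s - t) (h⁻¹ • (P h (u s) - u s) + R (du s)) = -extP P (s - t) (R (g s)) := by
      filter_upwards [hL, heq] with s h1 h2
      rw [h1.steklov_eq hP h0, ← map_add, ← map_neg, ← map_neg]
      congr 2
      rw [eq_neg_iff_add_eq_zero, ← h2]
      abel
    have hRg : IntegrableOn (fun s => R (g s)) (Icc 0 T) := R.integrable_comp hg
    have hsub : uIoc t T ⊆ Icc 0 T := by
      rw [uIoc_of_le ht.2]
      exact fun s hs => ⟨ht.1.trans hs.1.le, hs.2⟩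
    have hae' := ae_mono (Measure.restrict_mono hsub le_rfl) hae
    have hint := (intervalIntegrable_extP_comp hP hRg ht.1 ht hTm).neg
    have hRu : ContinuousOn (fun s => R (u s)) (Icc 0 T) := R.continuous.comp_continuousOn huc
    have hftc := intervalIntegral.integral_eq_sub_of_hasDeriv_right_of_le
      (f := fun s => extP P (s - t) (R (u s)))
      (f' := fun s => extP P (s - t) (h⁻¹ • (P h (u s) - u s) + R (du s))) ht.2
      (hP.continuous_extP.comp_continuousOn ((by fun_prop : Continuous fun s : ℝ => s - t).continuousOn.prodMk
        (hRu.mono (Icc_subset_Icc_left ht.1)))) ?_ ?_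
    · rw [intervalIntegral.integral_congr_ae_restrict hae', intervalIntegral.integral_neg] at hftc
      rw [steklov_mild hP hg h0 ht, mild_eq hP ht.2]
      rw [sub_self, extP_of_nonneg (t := T - t) (by linarith [ht.2]), extP_of_nonneg (t := 0) le_rfl,
        hP.zero, ContinuousLinearMap.id_apply] at hftc
      have : R (u t) = P (T - t) (R (u T)) + ∫ s in t..T, extP P (s - t) (R (g s)) := by
        rw [eq_sub_iff_add_eq] at hftc
        rw [← hftc]
        abel
      exact this
    · intro s hs
      have hs' : s ∈ Icc 0 T := ⟨ht.1.trans hs.1.le, hs.2.le⟩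
      rw [hasDerivWithinAt_iff_tendsto_slope, sdiff_singleton_eq_self (by simp)]
      have h1 : Tendsto (fun r : ℝ => r - s) (𝓝[>] s) (𝓝[>] 0) := by
        refine tendsto_nhdsWithin_iff.2 ⟨?_, ?_⟩
        · have : Continuous fun r : ℝ => r - s := by fun_prop
          have h := this.tendsto s
          rw [sub_self] at h
          exact h.mono_left nhdsWithin_le_nhds
        · filter_upwards [self_mem_nhdsWithin] with r hr
          exact mem_Ioi.2 (sub_pos.2 (mem_Ioi.1 hr))
      have h2 : Tendsto (fun r => (r - s)⁻¹ • (u r - u s)) (𝓝[>] s) (𝓝 (du s)) := by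
        have := (hu s hs').mono_of_mem_nhdsWithin (Icc_mem_nhdsGT_of_mem (b := s) ⟨hs'.1, hs.2⟩)
        rw [hasDerivWithinAt_iff_tendsto_slope, sdiff_singleton_eq_self (by simp)] at this
        exact this
      have h3 : Tendsto (fun r => extP P (r - t) (R ((r - s)⁻¹ • (u r - u s)))) (𝓝[>] s)
          (𝓝 (extP P (s - t) (R (du s)))) := by
        have h4 : Tendsto (fun r : ℝ => r - t) (𝓝[>] s) (𝓝 (s - t)) :=
          ((by fun_prop : Continuous fun r : ℝ => r - t).tendsto s).mono_left nhdsWithin_le_nhds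
        exact (hP.continuous_extP.tendsto _).comp
          (h4.prodMk_nhds ((R.continuous.tendsto _).comp h2))
      have h5 := ((extP P (s - t)).continuous.tendsto _).comp
        ((steklov_isGenerator hP h0 (u s)).comp h1)
      rw [map_add]
      refine Tendsto.congr' ?_ (h5.add h3)
      filter_upwards [self_mem_nhdsWithin] with r hr
      have hr' : s < r := hr
      have e1 : extP P (r - t) (R (u s)) = extP P (s - t) (P (r - s) (R (u s))) := by
        rw [extP_of_nonneg (by linarith [hs.1]), extP_of_nonneg (by linarith [hs.1]),
          ← hP.apply_add (by linarith [hs.1]) (by linarith)]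
        congr 2
        ring
      simp only [Function.comp, slope_def_module, map_smul, map_sub]
      rw [← smul_add, e1]
      congr 1
      abel
    · exact hint.congr_ae (EventuallyEq.symm hae')
  have l1 := steklov_tendsto hP (u t)
  have l2 := steklov_tendsto hP (mild P T (u T) g t)
  refine tendsto_nhds_unique (l1.congr' ?_) l2
  filter_upwards [self_mem_nhdsWithin] with h hh using key h hh

end Mild

/-! ### Sup bounds inside L² and truncation -/

section BoundedSets

variable {E : Type*} [MeasurableSpace E] {μ : Measure E}

/-- The functions in `L²` with values in `[-M, M]`. -/
def bddSet (μ : Measure E) (M : ℝ) : Set (Lp ℝ 2 μ) := {u | ∀ᵐ z ∂μ, |u z| ≤ M}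

lemma isClosed_bddSet (M : ℝ) : IsClosed (bddSet μ M) := by
  refine IsSeqClosed.isClosed fun f g hf hlim => ?_
  obtain ⟨ns, -, hae⟩ := Lp_exists_subseq_ae hlim
  have hf' : ∀ᵐ z ∂μ, ∀ n, |f n z| ≤ M := ae_all_iff.2 hf
  show ∀ᵐ z ∂μ, |g z| ≤ M
  filter_upwards [hae, hf'] with z h1 h2
  exact le_of_tendsto h1.abs (Eventually.of_forall fun n => h2 _)

lemma bddSet_mono {M M' : ℝ} (h : M ≤ M') : bddSet μ M ⊆ bddSet μ M' :=
  fun u hu => by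
    show ∀ᵐ z ∂μ, |u z| ≤ M'
    have hu' : ∀ᵐ z ∂μ, |u z| ≤ M := hu
    exact hu'.mono fun z hz => hz.trans h

lemma add_mem_bddSet {M M' : ℝ} {u v : Lp ℝ 2 μ} (hu : u ∈ bddSet μ M) (hv : v ∈ bddSet μ M') :
    u + v ∈ bddSet μ (M + M') := by
  show ∀ᵐ z ∂μ, |(u + v) z| ≤ M + M'
  filter_upwards [Lp.coeFn_add u v, hu, hv] with z h1 h2 h3
  rw [h1]
  exact (abs_add_le _ _).trans (add_le_add h2 h3)

lemma smul_mem_bddSet {M : ℝ} {u : Lp ℝ 2 μ} (hu : u ∈ bddSet μ M) (c : ℝ) :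
    c • u ∈ bddSet μ (|c| * M) := by
  show ∀ᵐ z ∂μ, |(c • u) z| ≤ |c| * M
  filter_upwards [Lp.coeFn_smul c u, hu] with z h1 h2
  rw [h1, Pi.smul_apply, smul_eq_mul, abs_mul]
  gcongr

lemma sub_mem_bddSet {M M' : ℝ} {u v : Lp ℝ 2 μ} (hu : u ∈ bddSet μ M) (hv : v ∈ bddSet μ M') :
    u - v ∈ bddSet μ (M + M') := by
  have := add_mem_bddSet hu (smul_mem_bddSet hv (-1))
  simpa [sub_eq_add_neg] using this

lemma convex_bddSet (M : ℝ) : Convex ℝ (bddSet μ M) := by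
  intro u hu v hv a c ha hc hac
  have := add_mem_bddSet (smul_mem_bddSet hu a) (smul_mem_bddSet hv c)
  rwa [abs_of_nonneg ha, abs_of_nonneg hc, ← add_mul, hac, one_mul] at this

lemma zero_mem_bddSet {M : ℝ} (hM : 0 ≤ M) : (0 : Lp ℝ 2 μ) ∈ bddSet μ M := by
  show ∀ᵐ z ∂μ, |(0 : Lp ℝ 2 μ) z| ≤ M
  filter_upwards [Lp.coeFn_zero ℝ 2 μ] with z h1
  rw [h1]
  simpa using hM

/-- Functions bounded by M form a closed convex set in L², which contains the averages of its
members. Sup bounds thus pass through Bochner integrals without pointwise representatives. -/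
lemma integral_mem_bddSet {f : ℝ → Lp ℝ 2 μ} {a c M : ℝ} (hac : a ≤ c)
    (hf : IntegrableOn f (Ioc a c)) (hM : ∀ᵐ s ∂(volume.restrict (Ioc a c)), f s ∈ bddSet μ M) :
    (∫ s in a..c, f s) ∈ bddSet μ (M * (c - a)) := by
  rcases hac.eq_or_lt with rfl | hlt
  · simpa using zero_mem_bddSet le_rfl
  have h1 : (⨍ s in Ioc a c, f s) ∈ bddSet μ M :=
    (convex_bddSet M).set_average_mem (isClosed_bddSet M) (by simpa using hlt) (by simp) hM hf
  have h2 := smul_mem_bddSet h1 (c - a)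
  rw [setAverage_eq, smul_smul] at h2
  have h3 : (volume : Measure ℝ).real (Ioc a c) = c - a := by simp [hac]
  rw [h3, mul_inv_cancel₀ (by linarith), one_smul, abs_of_nonneg (by linarith), mul_comm] at h2
  rwa [intervalIntegral.integral_of_le hac]

/-- Truncation at level `M`. -/
noncomputable def clampFun (M x : ℝ) : ℝ := max (-M) (min x M)

lemma lipschitzWith_clampFun (M : ℝ) : LipschitzWith 1 (clampFun M) := by
  have h : LipschitzWith 1 fun x : ℝ => min x M := LipschitzWith.id.min_const M
  exact h.const_max _

lemma clampFun_zero {M : ℝ} (hM : 0 ≤ M) : clampFun M 0 = 0 := by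
  simp [clampFun, hM]

lemma abs_clampFun_le {M : ℝ} (hM : 0 ≤ M) (x : ℝ) : |clampFun M x| ≤ M :=
  abs_le.2 ⟨le_max_left _ _, max_le (by linarith) (min_le_right _ _)⟩

lemma clampFun_of_abs_le {M x : ℝ} (h : |x| ≤ M) : clampFun M x = x := by
  rw [clampFun, min_eq_left (abs_le.1 h).2, max_eq_right (abs_le.1 h).1]

lemma abs_clampFun_le_abs {M : ℝ} (hM : 0 ≤ M) (x : ℝ) : |clampFun M x| ≤ |x| := by
  have := (lipschitzWith_clampFun M).dist_le_mul x 0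
  simpa [clampFun_zero hM, Real.dist_eq] using this

/-- Truncation at level `M` on `L²`. -/
noncomputable def clampLp {M : ℝ} (hM : 0 ≤ M) (u : Lp ℝ 2 μ) : Lp ℝ 2 μ :=
  (lipschitzWith_clampFun M).compLp (clampFun_zero hM) u

lemma coeFn_clampLp {M : ℝ} (hM : 0 ≤ M) (u : Lp ℝ 2 μ) :
    clampLp hM u =ᵐ[μ] fun z => clampFun M (u z) :=
  LipschitzWith.coeFn_compLp _ _ _

lemma clampLp_mem {M : ℝ} (hM : 0 ≤ M) (u : Lp ℝ 2 μ) : clampLp hM u ∈ bddSet μ M := by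
  show ∀ᵐ z ∂μ, |clampLp hM u z| ≤ M
  filter_upwards [coeFn_clampLp hM u] with z hz
  rw [hz]
  exact abs_clampFun_le hM _

lemma clampLp_of_mem {M : ℝ} (hM : 0 ≤ M) {u : Lp ℝ 2 μ} (hu : u ∈ bddSet μ M) :
    clampLp hM u = u := by
  refine Lp.ext ?_
  filter_upwards [coeFn_clampLp hM u, hu] with z h1 h2
  rw [h1, clampFun_of_abs_le h2]

lemma norm_clampLp_sub_le {M : ℝ} (hM : 0 ≤ M) (u v : Lp ℝ 2 μ) :
    ‖clampLp hM u - clampLp hM v‖ ≤ ‖u - v‖ := by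
  have := (lipschitzWith_clampFun M).norm_compLp_sub_le (clampFun_zero hM) u v
  rw [NNReal.coe_one, one_mul] at this
  exact this

lemma continuous_clampLp {M : ℝ} (hM : 0 ≤ M) :
    Continuous (clampLp hM : Lp ℝ 2 μ → Lp ℝ 2 μ) :=
  LipschitzWith.continuous_compLp (lipschitzWith_clampFun M) (clampFun_zero hM)

lemma tendsto_clampLp (u : Lp ℝ 2 μ) :
    Tendsto (fun n : ℕ => clampLp n.cast_nonneg u) atTop (𝓝 u) := by
  refine Lp_tendsto_of_dominated (Lp.memLp u).norm (fun n => ?_) ?_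
  · filter_upwards [coeFn_clampLp (μ := μ) (M := n) n.cast_nonneg u] with z hz
    rw [hz]
    exact abs_clampFun_le_abs n.cast_nonneg _
  · have : ∀ᵐ z ∂μ, ∀ n : ℕ, clampLp n.cast_nonneg u z = clampFun n (u z) :=
      ae_all_iff.2 fun n => coeFn_clampLp n.cast_nonneg u
    filter_upwards [this] with z hz
    obtain ⟨N, hN⟩ := exists_nat_ge |u z|
    refine tendsto_const_nhds.congr' ?_
    filter_upwards [eventually_ge_atTop N] with n hn
    rw [hz, clampFun_of_abs_le]
    exact hN.trans (by exact_mod_cast hn)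

end BoundedSets

/-! ### Regularized data -/

section NiceData

variable {E : Type*} [MeasurableSpace E] {μ : Measure E}
  {T : ℝ} {P : ℝ → Lp ℝ 2 μ →L[ℝ] Lp ℝ 2 μ}

/-- `P_t` maps functions bounded by `M` to functions bounded by `C M`, `t ∈ [0, T]`. -/
def MapsBdd (μ : Measure E) (T : ℝ) (P : ℝ → Lp ℝ 2 μ →L[ℝ] Lp ℝ 2 μ) (C : ℝ) : Prop :=
  ∀ t ∈ Icc 0 T, ∀ M, 0 ≤ M → ∀ u ∈ bddSet μ M, P t u ∈ bddSet μ (C * M)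

lemma mapsBdd_of_eLpNorm_le {C : ℝ≥0} (h : ∀ t ∈ Icc 0 T, ∀ u : Lp ℝ 2 μ,
    eLpNorm (P t u) ∞ μ ≤ C * eLpNorm u ∞ μ) : MapsBdd μ T P C := by
  intro t ht M hM u hu
  have h1 : eLpNorm u ∞ μ ≤ ENNReal.ofReal M := by
    rw [eLpNorm_exponent_top]
    refine eLpNormEssSup_le_of_ae_bound (C := M) ?_
    exact hu
  have h2 : eLpNorm (P t u) ∞ μ ≤ ENNReal.ofReal (C * M) := by
    refine (h t ht u).trans ?_
    rw [ENNReal.ofReal_mul C.coe_nonneg, ENNReal.ofReal_coe_nnreal]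
    gcongr
  show ∀ᵐ z ∂μ, |P t u z| ≤ C * M
  rw [eLpNorm_exponent_top] at h2
  filter_upwards [ae_le_eLpNormEssSup (f := P t u) (μ := μ)] with z hz
  have h3 := hz.trans h2
  rw [Real.enorm_eq_ofReal_abs] at h3
  exact (ENNReal.ofReal_le_ofReal_iff (by positivity)).1 h3

lemma mild_mem_bddSet (hP : IsC0Semigroup P) {C : ℝ} (hC : MapsBdd μ T P C) (hC0 : 0 ≤ C)
    {φ : Lp ℝ 2 μ} {g : ℝ → Lp ℝ 2 μ} (hg : IntegrableOn g (Icc 0 T)) {M : ℝ} (hM : 0 ≤ M)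
    (hφ : φ ∈ bddSet μ M) (hgM : ∀ᵐ s ∂(volume.restrict (Icc 0 T)), g s ∈ bddSet μ M) {t : ℝ}
    (ht : t ∈ Icc 0 T) : mild P T φ g t ∈ bddSet μ (C * M * (1 + T)) := by
  have hT : 0 ≤ T := ht.1.trans ht.2
  rw [mild_eq hP ht.2]
  have h1 : P (T - t) φ ∈ bddSet μ (C * M) :=
    hC _ ⟨by linarith [ht.2], by linarith [ht.1]⟩ M hM φ hφ
  have hsub : Ioc t T ⊆ Icc 0 T := fun s hs => ⟨ht.1.trans hs.1.le, hs.2⟩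
  have h2 := integral_mem_bddSet (M := C * M) ht.2
    ((integrableOn_extP_comp hP hT hg ht.1).mono_set hsub) (by
      filter_upwards [ae_mono (Measure.restrict_mono hsub le_rfl) hgM,
        ae_restrict_mem measurableSet_Ioc] with s hs hs'
      rw [extP_of_nonneg (by linarith [hs'.1])]
      exact hC _ ⟨by linarith [hs'.1], by linarith [hs'.2, ht.1]⟩ M hM _ hs)
  refine bddSet_mono ?_ (add_mem_bddSet h1 h2)
  rw [mul_add, mul_one]
  gcongr
  linarith [ht.1]

lemma steklov_mem_bddSet (hP : IsC0Semigroup P) {C : ℝ} (hC : MapsBdd μ T P C)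
    {M : ℝ} (hM : 0 ≤ M) {h : ℝ} (h0 : 0 < h) (hT : h ≤ T) {u : Lp ℝ 2 μ} (hu : u ∈ bddSet μ M) :
    steklov hP h u ∈ bddSet μ (C * M) := by
  rw [steklov_apply]
  have h2 := integral_mem_bddSet (f := fun r => extP P r u) (M := C * M) h0.le
    ((hP.continuous_extP_orbit u).intervalIntegrable (μ := volume) 0 h).1 (by
      filter_upwards [ae_restrict_mem measurableSet_Ioc] with s hs
      rw [extP_of_nonneg hs.1.le]
      exact hC _ ⟨hs.1.le, hs.2.trans hT⟩ M hM _ hu)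
  have h3 := smul_mem_bddSet h2 h⁻¹
  refine bddSet_mono (le_of_eq ?_) h3
  rw [abs_of_pos (by positivity), sub_zero]
  field_simp

/-- Data for which the mild solution is bounded and is a strong solution. -/
structure NiceData (P : ℝ → Lp ℝ 2 μ →L[ℝ] Lp ℝ 2 μ) (T : ℝ) (φ : Lp ℝ 2 μ) (g : ℝ → Lp ℝ 2 μ)
    (M : ℝ) : Prop where
  continuous : Continuous g
  bdd_terminal : φ ∈ bddSet μ M
  bdd : ∀ t ∈ Icc 0 T, g t ∈ bddSet μ M
  bdd_mild : ∀ t ∈ Icc 0 T, mild P T φ g t ∈ bddSet μ M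
  exists_generator : ∃ Lu : ℝ → Lp ℝ 2 μ, ContinuousOn Lu (Icc 0 T) ∧
    ∀ t ∈ Icc 0 T, IsGenerator P (mild P T φ g t) (Lu t)

lemma NiceData.integrableOn {φ : Lp ℝ 2 μ} {g : ℝ → Lp ℝ 2 μ} {M : ℝ} (h : NiceData P T φ g M) :
    IntegrableOn g (Icc 0 T) := h.continuous.continuousOn.integrableOn_Icc

lemma NiceData.sub (hP : IsC0Semigroup P) {φ φ' : Lp ℝ 2 μ} {g g' : ℝ → Lp ℝ 2 μ} {M M' : ℝ}
    (h : NiceData P T φ g M) (h' : NiceData P T φ' g' M') :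
    NiceData P T (φ - φ') (fun s => g s - g' s) (M + M') := by
  obtain ⟨Lu, hLc, hL⟩ := h.exists_generator
  obtain ⟨Lu', hLc', hL'⟩ := h'.exists_generator
  refine ⟨h.continuous.sub h'.continuous, sub_mem_bddSet h.bdd_terminal h'.bdd_terminal,
    fun t ht => sub_mem_bddSet (h.bdd t ht) (h'.bdd t ht), fun t ht => ?_,
    fun t => Lu t - Lu' t, hLc.sub hLc', fun t ht => ?_⟩
  · rw [mild_sub hP h.integrableOn h'.integrableOn ht]
    exact sub_mem_bddSet (h.bdd_mild t ht) (h'.bdd_mild t ht)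
  · rw [mild_sub hP h.integrableOn h'.integrableOn ht]
    refine ((hL t ht).sub (hL' t ht)).congr fun s => ?_
    rw [map_sub, ← smul_sub]
    congr 1
    abel

/-- Averaging moves the mild solution into the domain, with the continuous generator value h⁻¹(P_h -
1) applied to the original mild solution. One factor C in the bound comes from the averaging, the
other from Duhamel's formula. -/
lemma niceData_steklov (hP : IsC0Semigroup P) {C : ℝ} (hC : MapsBdd μ T P C) (hC1 : 1 ≤ C)
    (hT : 0 < T) {φ : Lp ℝ 2 μ} {g : ℝ → Lp ℝ 2 μ} (hg : Continuous g) {M : ℝ} (hM : 0 ≤ M)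
    (hφ : φ ∈ bddSet μ M) (hgM : ∀ s, g s ∈ bddSet μ M) {h : ℝ} (h0 : 0 < h) (hhT : h ≤ T) :
    NiceData P T (steklov hP h φ) (fun s => steklov hP h (g s)) (C * (C * M) * (1 + T)) := by
  have hC0 : 0 ≤ C := by linarith
  have hgi : IntegrableOn g (Icc 0 T) := hg.continuousOn.integrableOn_Icc
  have hle : C * M ≤ C * (C * M) * (1 + T) := by
    have : 0 ≤ C * M := by positivity
    nlinarith [mul_nonneg (mul_nonneg hC0 this) hT.le]
  have hRg : Continuous fun s => steklov hP h (g s) := (steklov hP h).continuous.comp hg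
  have hRb : ∀ s, steklov hP h (g s) ∈ bddSet μ (C * M) := fun s =>
    steklov_mem_bddSet hP hC hM h0 hhT (hgM s)
  have hRφ := steklov_mem_bddSet hP hC hM h0 hhT hφ
  refine ⟨hRg, bddSet_mono hle hRφ, fun t _ => bddSet_mono hle (hRb t), fun t ht => ?_,
    fun t => h⁻¹ • (P h (mild P T φ g t) - mild P T φ g t), ?_, fun t ht => ?_⟩
  · exact mild_mem_bddSet hP hC hC0 hRg.continuousOn.integrableOn_Icc (by positivity) hRφ
      (Eventually.of_forall hRb) ht
  · have := mild_continuousOn hP (φ := φ) hgi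
    exact ContinuousOn.const_smul (((P h).continuous.comp_continuousOn this).sub this) (h⁻¹ : ℝ)
  · rw [← steklov_mild hP hgi h0 ht]
    exact steklov_isGenerator hP h0 _

lemma tendsto_integral_norm_steklov_sub (hP : IsC0Semigroup P) (hT : 0 < T) {g : ℝ → Lp ℝ 2 μ}
    (hg : IntegrableOn g (Icc 0 T)) :
    Tendsto (fun h => ∫ s in Icc 0 T, ‖steklov hP h (g s) - g s‖) (𝓝[>] 0) (𝓝 0) := by
  obtain ⟨M, hM1, hM⟩ := hP.exists_bound T
  have key := tendsto_integral_filter_of_dominated_convergence (l := 𝓝[>] (0 : ℝ))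
    (μ := volume.restrict (Icc 0 T)) (F := fun h s => ‖steklov hP h (g s) - g s‖)
    (f := fun _ => (0 : ℝ)) (fun s => M * ‖g s‖ + ‖g s‖)
    (Eventually.of_forall fun h =>
      (((steklov hP h).continuous.comp_aestronglyMeasurable hg.1).sub hg.1).norm) ?_
    ((hg.norm.const_mul M).add hg.norm) ?_
  · simpa using key
  · have : ∀ᶠ h : ℝ in 𝓝[>] 0, h < T := nhdsWithin_le_nhds (eventually_lt_nhds hT)
    filter_upwards [this, self_mem_nhdsWithin] with h h1 h0
    refine Eventually.of_forall fun s => ?_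
    rw [norm_norm]
    refine (norm_sub_le _ _).trans (add_le_add_left ?_ _)
    exact (steklov hP h).le_of_opNorm_le (norm_steklov_le hP hM h0 h1.le) _
  · refine Eventually.of_forall fun s => ?_
    exact tendsto_iff_norm_sub_tendsto_zero.1 (steklov_tendsto hP (g s))

/-- The bound of the approximants does not depend on ε. The maximum principle uses this when it
passes to the limit. -/
lemma exists_niceData_of_bdd (hP : IsC0Semigroup P) {C : ℝ} (hC : MapsBdd μ T P C) (hC1 : 1 ≤ C)
    (hT : 0 < T) {φ : Lp ℝ 2 μ} {g : ℝ → Lp ℝ 2 μ} (hg : IntegrableOn g (Icc 0 T)) {M : ℝ}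
    (hM : 0 ≤ M) (hφ : φ ∈ bddSet μ M)
    (hgM : ∀ᵐ s ∂(volume.restrict (Icc 0 T)), g s ∈ bddSet μ M) {ε : ℝ} (hε : 0 < ε) :
    ∃ (φ' : Lp ℝ 2 μ) (g' : ℝ → Lp ℝ 2 μ), NiceData P T φ' g' (C * (C * M) * (1 + T)) ∧
      ‖φ' - φ‖ ≤ ε ∧ ∫ s in Icc 0 T, ‖g' s - g s‖ ≤ ε := by
  obtain ⟨c, -, hc, hcc, hci⟩ := Integrable.exists_hasCompactSupport_integral_sub_le hg
    (half_pos hε)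
  -- Truncating the continuous approximant restores the bound M and costs no distance: truncation is
  -- 1-Lipschitz and fixes g.
  set c' : ℝ → Lp ℝ 2 μ := fun s => clampLp hM (c s)
  have hc'c : Continuous c' := (continuous_clampLp hM).comp hcc
  have hc'i : IntegrableOn c' (Icc 0 T) := hc'c.continuousOn.integrableOn_Icc
  have hc' : ∫ s in Icc 0 T, ‖c' s - g s‖ ≤ ε / 2 := by
    refine le_trans ?_ hc
    refine integral_mono_ae (hc'i.sub hg).norm (hg.sub hci).norm ?_
    filter_upwards [hgM] with s hs
    conv_lhs => rw [← clampLp_of_mem hM hs]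
    rw [norm_sub_rev (g s)]
    exact norm_clampLp_sub_le hM _ _
  have e1 : ∀ᶠ h in 𝓝[>] 0, ‖steklov hP h φ - φ‖ < ε :=
    (tendsto_iff_norm_sub_tendsto_zero.1 (steklov_tendsto hP φ)).eventually (gt_mem_nhds hε)
  have e2 : ∀ᶠ h in 𝓝[>] 0, ∫ s in Icc 0 T, ‖steklov hP h (c' s) - c' s‖ < ε / 2 :=
    (tendsto_integral_norm_steklov_sub hP hT hc'i).eventually (gt_mem_nhds (half_pos hε))
  have e3 : ∀ᶠ h : ℝ in 𝓝[>] 0, h < T := nhdsWithin_le_nhds (eventually_lt_nhds hT)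
  have e4 : ∀ᶠ h : ℝ in 𝓝[>] 0, 0 < h := self_mem_nhdsWithin
  obtain ⟨h, h1, h2, h3, h0⟩ := (e1.and (e2.and (e3.and e4))).exists
  refine ⟨steklov hP h φ, fun s => steklov hP h (c' s),
    niceData_steklov hP hC hC1 hT hc'c hM hφ (fun s => clampLp_mem hM _) h0 h3.le, h1.le, ?_⟩
  have hRi : IntegrableOn (fun s => steklov hP h (c' s)) (Icc 0 T) :=
    (steklov hP h).integrable_comp hc'i
  calc ∫ s in Icc 0 T, ‖steklov hP h (c' s) - g s‖
      ≤ ∫ s in Icc 0 T, (‖steklov hP h (c' s) - c' s‖ + ‖c' s - g s‖) := by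
        refine integral_mono (hRi.sub hg).norm ((hRi.sub hc'i).norm.add (hc'i.sub hg).norm)
          fun s => ?_
        exact norm_sub_le_norm_sub_add_norm_sub _ _ _
    _ = (∫ s in Icc 0 T, ‖steklov hP h (c' s) - c' s‖) + ∫ s in Icc 0 T, ‖c' s - g s‖ :=
        integral_add (hRi.sub hc'i).norm (hc'i.sub hg).norm
    _ ≤ ε := by linarith

/-- Unbounded data are first truncated at a high level n, so the bound now depends on ε. The energy
inequality tolerates this. -/
lemma exists_niceData (hP : IsC0Semigroup P) {C : ℝ} (hC : MapsBdd μ T P C) (hC1 : 1 ≤ C)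
    (hT : 0 < T) {g : ℝ → Lp ℝ 2 μ} (φ : Lp ℝ 2 μ) (hg : IntegrableOn g (Icc 0 T)) {ε : ℝ}
    (hε : 0 < ε) : ∃ (φ' : Lp ℝ 2 μ) (g' : ℝ → Lp ℝ 2 μ) (M : ℝ), NiceData P T φ' g' M ∧
      ‖φ' - φ‖ ≤ ε ∧ ∫ s in Icc 0 T, ‖g' s - g s‖ ≤ ε := by
  have hcm : ∀ n : ℕ, AEStronglyMeasurable (fun s => clampLp (M := n) n.cast_nonneg (g s))
      (volume.restrict (Icc 0 T)) := fun n =>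
    (continuous_clampLp n.cast_nonneg).comp_aestronglyMeasurable hg.1
  have hcn : ∀ (n : ℕ) (v : Lp ℝ 2 μ), ‖clampLp (M := n) n.cast_nonneg v‖ ≤ ‖v‖ := by
    intro n v
    have := norm_clampLp_sub_le (μ := μ) (M := n) n.cast_nonneg v 0
    rwa [clampLp_of_mem n.cast_nonneg (zero_mem_bddSet n.cast_nonneg), sub_zero, sub_zero] at this
  have hci : ∀ n : ℕ, IntegrableOn (fun s => clampLp (M := n) n.cast_nonneg (g s)) (Icc 0 T) :=
    fun n => Integrable.mono hg (hcm n) (Eventually.of_forall fun s => hcn n _)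
  have hlim : Tendsto (fun n : ℕ => ∫ s in Icc 0 T, ‖clampLp (M := n) n.cast_nonneg (g s) - g s‖)
      atTop (𝓝 0) := by
    have key := tendsto_integral_of_dominated_convergence (μ := volume.restrict (Icc 0 T))
      (F := fun (n : ℕ) s => ‖clampLp (M := n) n.cast_nonneg (g s) - g s‖) (f := fun _ => (0 : ℝ))
      (fun s => ‖g s‖ + ‖g s‖)
      (fun n => ((hcm n).sub hg.1).norm) (hg.norm.add hg.norm) (fun n => ?_) ?_
    · simpa using key
    · refine Eventually.of_forall fun s => ?_
      rw [norm_norm]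
      exact (norm_sub_le _ _).trans (add_le_add_left (hcn n _) _)
    · refine Eventually.of_forall fun s => ?_
      exact tendsto_iff_norm_sub_tendsto_zero.1 (tendsto_clampLp (g s))
  have e1 := hlim.eventually (gt_mem_nhds (half_pos hε))
  have e2 := (tendsto_iff_norm_sub_tendsto_zero.1 (tendsto_clampLp φ)).eventually
    (gt_mem_nhds (half_pos hε))
  obtain ⟨n, h1, h2⟩ := (e1.and e2).exists
  obtain ⟨φ', g', hn, h3, h4⟩ := exists_niceData_of_bdd hP hC hC1 hT (hci n) n.cast_nonneg
    (clampLp_mem n.cast_nonneg φ) (Eventually.of_forall fun s => clampLp_mem n.cast_nonneg (g s))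
    (half_pos hε)
  refine ⟨φ', g', _, hn, ?_, ?_⟩
  · have := norm_sub_le_norm_sub_add_norm_sub φ' (clampLp (M := n) n.cast_nonneg φ) φ
    linarith
  · have h5 : ∫ s in Icc 0 T, ‖g' s - g s‖ ≤
        ∫ s in Icc 0 T, (‖g' s - clampLp (M := n) n.cast_nonneg (g s)‖ +
          ‖clampLp (M := n) n.cast_nonneg (g s) - g s‖) := by
      refine integral_mono (hn.integrableOn.sub hg).norm
        ((hn.integrableOn.sub (hci n)).norm.add ((hci n).sub hg).norm) fun s => ?_
      exact norm_sub_le_norm_sub_add_norm_sub _ _ _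
    refine h5.trans ((integral_add (hn.integrableOn.sub (hci n)).norm
      ((hci n).sub hg).norm).le.trans ?_)
    exact (add_le_add h4 h1.le).trans (add_halves ε).le

end NiceData

/-! ### Dominated subsequences and limits in L² -/

section Domination

variable {β X : Type*} [MeasurableSpace β] {ν : Measure β} [NormedAddCommGroup X]

lemma exists_subseq_dominated {f : ℕ → β → X} (hf : ∀ n, Integrable (f n) ν)
    (h : Tendsto (fun n => ∫ s, ‖f n s‖ ∂ν) atTop (𝓝 0)) :
    ∃ ns : ℕ → ℕ, StrictMono ns ∧ ∃ G : β → ℝ, Integrable G ν ∧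
      (∀ᵐ s ∂ν, ∀ n, ‖f (ns n) s‖ ≤ G s) ∧
      ∀ᵐ s ∂ν, Tendsto (fun n => f (ns n) s) atTop (𝓝 0) := by
  -- Along a subsequence the L¹-norms are below 2⁻ⁿ, so the sum of all terms is an integrable
  -- dominant and the terms tend to 0 wherever it is finite.
  obtain ⟨ns, hns, hlt⟩ := extraction_forall_of_eventually (P := fun n k =>
    ∫ s, ‖f k s‖ ∂ν < (1 / 2 : ℝ) ^ n) fun n => h.eventually (gt_mem_nhds (by positivity))
  have hsum : ∫⁻ s, ∑' n, ‖f (ns n) s‖ₑ ∂ν ≠ ∞ := by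
    rw [lintegral_tsum fun n => (hf _).1.enorm]
    have : ∀ n, ∫⁻ s, ‖f (ns n) s‖ₑ ∂ν ≤ ENNReal.ofReal ((1 / 2 : ℝ) ^ n) := fun n => by
      rw [← ofReal_integral_norm_eq_lintegral_enorm (hf _)]
      exact ENNReal.ofReal_le_ofReal (hlt n).le
    refine ne_top_of_le_ne_top ?_ (ENNReal.tsum_le_tsum this)
    rw [← ENNReal.ofReal_tsum_of_nonneg (fun n => by positivity) summable_geometric_two]
    exact ENNReal.ofReal_ne_top
  have hmeas : AEMeasurable (fun s => ∑' n, ‖f (ns n) s‖ₑ) ν :=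
    AEMeasurable.tsum fun n => (hf _).1.enorm
  have hfin := ae_lt_top' hmeas hsum
  refine ⟨ns, hns, fun s => (∑' n, ‖f (ns n) s‖ₑ).toReal,
    integrable_toReal_of_lintegral_ne_top hmeas hsum, ?_, ?_⟩
  · filter_upwards [hfin] with s hs n
    rw [← toReal_enorm]
    exact ENNReal.toReal_mono hs.ne (ENNReal.le_tsum n)
  · filter_upwards [hfin] with s hs
    rw [tendsto_zero_iff_norm_tendsto_zero]
    simpa using (ENNReal.summable_toReal hs.ne).tendsto_atTop_zero

lemma exists_L2_limit [InnerProductSpace ℝ X] [CompleteSpace X] {f : ℕ → β → X}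
    (hf : ∀ n, MemLp (f n) 2 ν) {c : ℕ → ℝ} (hc : Tendsto c atTop (𝓝 0))
    (h : ∀ n m, n ≤ m → ∫ s, ‖f n s - f m s‖ ^ 2 ∂ν ≤ c n) :
    ∃ f' : β → X, MemLp f' 2 ν ∧ Tendsto (fun n => ∫ s, ‖f n s - f' s‖ ^ 2 ∂ν) atTop (𝓝 0) := by
  have key : ∀ (u v : β → X) (hu : MemLp u 2 ν) (hv : MemLp v 2 ν),
      ∫ s, ‖u s - v s‖ ^ 2 ∂ν = ‖hu.toLp - hv.toLp‖ ^ 2 := by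
    intro u v hu hv
    rw [Lp_norm_sq]
    refine integral_congr_ae ?_
    filter_upwards [Lp.coeFn_sub hu.toLp hv.toLp, hu.coeFn_toLp, hv.coeFn_toLp] with s h1 h2 h3
    rw [h1, Pi.sub_apply, h2, h3]
  have hcau : CauchySeq fun n => (hf n).toLp := by
    refine cauchySeq_of_le_tendsto_0' (fun n => √(c n)) (fun n m hnm => ?_) ?_
    · rw [dist_eq_norm]
      refine Real.le_sqrt_of_sq_le ?_
      rw [← key]
      exact h n m hnm
    · simpa using hc.sqrt
  obtain ⟨g, hg⟩ := cauchySeq_tendsto_of_complete hcau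
  refine ⟨g, Lp.memLp g, ?_⟩
  have h1 : ∀ n, ∫ s, ‖f n s - g s‖ ^ 2 ∂ν = ‖(hf n).toLp - g‖ ^ 2 := fun n => by
    rw [key _ _ (hf n) (Lp.memLp g), Lp.toLp_coeFn]
  simp only [h1]
  simpa using (tendsto_iff_norm_sub_tendsto_zero.1 hg).pow 2

end Domination

/-! ### Exponential weights with integrable rates -/

section ExpWeight

variable {T : ℝ} {k : ℝ → ℝ}

/-- The exponential weight `exp (∫₀ᵗ k)`. -/
noncomputable def expWeight (k : ℝ → ℝ) (t : ℝ) : ℝ := Real.exp (∫ s in 0..t, k s)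

lemma expWeight_pos (k : ℝ → ℝ) (t : ℝ) : 0 < expWeight k t := Real.exp_pos _

lemma expWeight_hasDerivAt (hk : Continuous k) (t : ℝ) :
    HasDerivAt (expWeight k) (expWeight k t * k t) t :=
  (hk.integral_hasStrictDerivAt 0 t).hasDerivAt.exp

lemma continuousOn_expWeight (hT : 0 ≤ T) (hk : IntegrableOn k (Icc 0 T)) :
    ContinuousOn (expWeight k) (Icc 0 T) := by
  have := intervalIntegral.continuousOn_primitive_interval (a := 0) (b := T) (f := k)
    (μ := volume) (by rwa [uIcc_of_le hT])
  rw [uIcc_of_le hT] at this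
  exact this.rexp

lemma abs_primitive_le (hk : IntegrableOn k (Icc 0 T)) {t : ℝ} (ht : t ∈ Icc 0 T) :
    |∫ s in 0..t, k s| ≤ ∫ s in Icc 0 T, |k s| := by
  rw [intervalIntegral.integral_of_le ht.1]
  refine (norm_integral_le_integral_norm (μ := volume.restrict (Ioc 0 t)) k).trans ?_
  exact setIntegral_mono_set hk.norm (Eventually.of_forall fun s => norm_nonneg _)
    (LE.le.eventuallyLE fun s hs => ⟨hs.1.le, hs.2.trans ht.2⟩)

lemma expWeight_le (hk : IntegrableOn k (Icc 0 T)) {t : ℝ} (ht : t ∈ Icc 0 T) :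
    expWeight k t ≤ Real.exp (∫ s in Icc 0 T, |k s|) :=
  Real.exp_le_exp.2 ((le_abs_self _).trans (abs_primitive_le hk ht))

lemma one_le_expWeight (hk0 : ∀ s, 0 ≤ k s) {t : ℝ} (ht : 0 ≤ t) : 1 ≤ expWeight k t :=
  Real.one_le_exp (intervalIntegral.integral_nonneg ht fun s _ => hk0 s)

/-- An integrable function on `[0, T]` is a dominated a.e. limit of continuous functions, with
convergence of the exponential weights. -/
lemma exists_continuous_dominated (hk : IntegrableOn k (Icc 0 T)) :
    ∃ (κ : ℕ → ℝ → ℝ) (K : ℝ → ℝ) (B : ℝ), (∀ n, Continuous (κ n)) ∧ IntegrableOn K (Icc 0 T) ∧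
      (∀ᵐ s ∂(volume.restrict (Icc 0 T)), ∀ n, |κ n s| ≤ K s) ∧
      (∀ᵐ s ∂(volume.restrict (Icc 0 T)), Tendsto (fun n => κ n s) atTop (𝓝 (k s))) ∧
      (∀ n, ∀ t ∈ Icc 0 T, expWeight (κ n) t ≤ B) ∧
      ∀ t ∈ Icc 0 T, Tendsto (fun n => expWeight (κ n) t) atTop (𝓝 (expWeight k t)) := by
  have hex : ∀ n : ℕ, ∃ c : ℝ → ℝ, Continuous c ∧ IntegrableOn c (Icc 0 T) ∧
      ∫ s in Icc 0 T, ‖k s - c s‖ ≤ 1 / ((n : ℝ) + 1) := fun n => by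
    obtain ⟨c, -, h1, h2, h3⟩ := Integrable.exists_hasCompactSupport_integral_sub_le hk
      (ε := 1 / ((n : ℝ) + 1)) (by positivity)
    exact ⟨c, h2, h3, h1⟩
  choose c hcc hci hc using hex
  obtain ⟨ns, -, G, hG, h1, h2⟩ := exists_subseq_dominated (ν := volume.restrict (Icc 0 T))
    (f := fun n s => k s - c n s) (fun n => hk.sub (hci n))
    (squeeze_zero (fun n => integral_nonneg fun s => norm_nonneg _) hc
      tendsto_one_div_add_atTop_nhds_zero_nat)
  have h3 : ∀ᵐ s ∂(volume.restrict (Icc 0 T)), ∀ n, |c (ns n) s| ≤ |k s| + G s := by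
    filter_upwards [h1] with s hs n
    have := norm_sub_le (k s) (k s - c (ns n) s)
    rw [sub_sub_cancel] at this
    exact this.trans (add_le_add_right (hs n) _)
  have hlim : ∀ᵐ s ∂(volume.restrict (Icc 0 T)),
      Tendsto (fun n => c (ns n) s) atTop (𝓝 (k s)) := by
    filter_upwards [h2] with s hs
    simpa using tendsto_const_nhds (x := k s).sub hs
  refine ⟨fun n => c (ns n), fun s => |k s| + G s, Real.exp (∫ s in Icc 0 T, (|k s| + G s)),
    fun n => hcc _, hk.norm.add hG, h3, hlim, fun n t ht => ?_, fun t ht => ?_⟩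
  · refine (expWeight_le (hci _) ht).trans (Real.exp_le_exp.2 ?_)
    refine integral_mono_ae (hci _).norm (hk.norm.add hG) ?_
    filter_upwards [h3] with s hs using hs n
  · refine (Real.continuous_exp.tendsto _).comp ?_
    have hsub : Ioc 0 t ⊆ Icc 0 T := fun s hs => ⟨hs.1.le, hs.2.trans ht.2⟩
    simp only [intervalIntegral.integral_of_le ht.1]
    refine tendsto_integral_of_dominated_convergence (fun s => |k s| + G s)
      (fun n => (hcc _).aestronglyMeasurable) (IntegrableOn.mono_set (hk.norm.add hG) hsub) (fun n => ?_) ?_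
    · filter_upwards [ae_mono (Measure.restrict_mono hsub le_rfl) h3] with s hs using hs n
    · exact ae_mono (Measure.restrict_mono hsub le_rfl) hlim

end ExpWeight

/-! ### Energy inequality for regularized data -/

section Energy

variable {E H : Type*} [NormedAddCommGroup E] [NormedSpace ℝ E]
  [NormedAddCommGroup H] [InnerProductSpace ℝ H] [CompleteSpace H]
  [MeasurableSpace E] [BorelSpace E] {j : H →L[ℝ] E} {A : E → H →L[ℝ] H} {b : E → H}
  {μ : Measure E} [IsFiniteMeasure μ] {T : ℝ} {P : ℝ → Lp ℝ 2 μ →L[ℝ] Lp ℝ 2 μ} {α : ℝ}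

/-- The standing assumptions on the form and the semigroup. -/
structure FormSetting (j : H →L[ℝ] E) (A : E → H →L[ℝ] H) (b : E → H) (μ : Measure E) (T : ℝ)
    (P : ℝ → Lp ℝ 2 μ →L[ℝ] Lp ℝ 2 μ) (α : ℝ) : Prop where
  pos : ∀ z, (A z).IsPositive
  condA1 : CondA1 j A μ
  condA2 : CondA2 j A b μ
  condA3 : CondA3 j A b μ T P
  time_pos : 0 < T
  nonneg : 0 ≤ α
  drift : DriftLowerBound j A b μ α

lemma FormSetting.semigroup (S : FormSetting j A b μ T P α) : IsC0Semigroup P := S.condA3.semigroup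

lemma FormSetting.exists_mapsBdd (S : FormSetting j A b μ T P α) : ∃ C, 1 ≤ C ∧ MapsBdd μ T P C := by
  obtain ⟨C, -, hC⟩ := S.condA3.bound
  -- Enlarging the constant makes it at least 1, as the bounds for regularized data require.
  refine ⟨C + 1, by simp, fun t ht M hM u hu => ?_⟩
  exact bddSet_mono (by nlinarith) (mapsBdd_of_eLpNorm_le hC t ht M hM u hu)

variable {φ : Lp ℝ 2 μ} {g : ℝ → Lp ℝ 2 μ} {M : ℝ}

lemma NiceData.hasGradA (S : FormSetting j A b μ T P α) (h : NiceData P T φ g M) {t : ℝ} (ht : t ∈ Icc 0 T) :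
    HasGradA j A μ (mild P T φ g t) (gradA j A μ (mild P T φ g t)) := by
  obtain ⟨Lu, -, hL⟩ := h.exists_generator
  exact hasGradA_gradA (S.condA3.dom_sub _ _ (hL t ht) ⟨M, h.bdd_mild t ht⟩)

/-- The gradient inequality is applied to u(s) - u(t), whose generator value Lu(s) - Lu(t) tends to
0. -/
lemma NiceData.continuousOn_gradA (S : FormSetting j A b μ T P α) (h : NiceData P T φ g M) :
    ContinuousOn (fun t => gradA j A μ (mild P T φ g t)) (Icc 0 T) := by
  obtain ⟨Lu, hLc, hL⟩ := h.exists_generator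
  have hc := mild_continuousOn S.semigroup (φ := φ) h.integrableOn
  intro t ht
  have hbound : ∀ s ∈ Icc 0 T,
      ‖gradA j A μ (mild P T φ g s) - gradA j A μ (mild P T φ g t)‖ ^ 2 ≤
      -⟪Lu s - Lu t, mild P T φ g s - mild P T φ g t⟫ +
        α / 2 * ‖mild P T φ g s - mild P T φ g t‖ ^ 2 := by
    intro s hs
    refine norm_sq_gradient_le S.pos S.condA1 S.condA2 S.condA3 S.drift ?_
      ⟨M + M, sub_mem_bddSet (h.bdd_mild s hs) (h.bdd_mild t ht)⟩
      ((h.hasGradA S hs).sub (h.hasGradA S ht))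
    refine ((hL s hs).sub (hL t ht)).congr fun r => ?_
    rw [map_sub, ← smul_sub]
    congr 1
    abel
  have hlim : Tendsto (fun s => -⟪Lu s - Lu t, mild P T φ g s - mild P T φ g t⟫ +
      α / 2 * ‖mild P T φ g s - mild P T φ g t‖ ^ 2) (𝓝[Icc 0 T] t) (𝓝 0) := by
    have h1 := (hLc t ht).sub (tendsto_const_nhds (x := Lu t))
    have h2 := (hc t ht).sub (tendsto_const_nhds (x := mild P T φ g t))
    have h3 := Tendsto.add (Tendsto.neg (Tendsto.inner (𝕜 := ℝ) h1 h2))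
      (Tendsto.const_mul (α / 2) (Tendsto.pow (Tendsto.norm h2) 2))
    simpa using h3
  have hsq : Tendsto (fun s =>
      ‖gradA j A μ (mild P T φ g s) - gradA j A μ (mild P T φ g t)‖ ^ 2) (𝓝[Icc 0 T] t) (𝓝 0) :=
    tendsto_of_tendsto_of_tendsto_of_le_of_le' tendsto_const_nhds hlim
      (Eventually.of_forall fun s => sq_nonneg _)
      (by filter_upwards [self_mem_nhdsWithin] with s hs using hbound s hs)
  refine tendsto_iff_norm_sub_tendsto_zero.2 ?_
  have := hsq.sqrt
  simpa [Real.sqrt_sq (norm_nonneg _)] using this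

/-- The derivative of w‖u‖² is w(k‖u‖² - 2⟨u, Lu + g⟩), and the gradient inequality bounds -2⟨u, Lu⟩
from below by 2‖Du‖² - α‖u‖². Continuity of k is needed to differentiate the weight; integrable
rates follow by approximation. -/
lemma NiceData.energy_le (S : FormSetting j A b μ T P α) (h : NiceData P T φ g M) {k : ℝ → ℝ} (hk : Continuous k) {t : ℝ}
    (ht : t ∈ Icc 0 T) :
    expWeight k t * ‖mild P T φ g t‖ ^ 2 + ∫ s in t..T, expWeight k s *
      (2 * ‖gradA j A μ (mild P T φ g s)‖ ^ 2 + (k s - α) * ‖mild P T φ g s‖ ^ 2 -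
        2 * ⟪g s, mild P T φ g s⟫) ≤ expWeight k T * ‖φ‖ ^ 2 := by
  obtain ⟨Lu, hLc, hL⟩ := h.exists_generator
  have hc := mild_continuousOn S.semigroup (φ := φ) h.integrableOn
  have hD := h.continuousOn_gradA S
  have hw : Continuous (expWeight k) :=
    continuous_iff_continuousAt.2 fun t => (expWeight_hasDerivAt hk t).continuousAt
  have hsub : Icc t T ⊆ Icc 0 T := Icc_subset_Icc_left ht.1
  have hg := h.continuous
  have key := intervalIntegral.integral_le_sub_of_hasDeriv_right_of_le ht.2
    (g := fun s => expWeight k s * ‖mild P T φ g s‖ ^ 2)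
    (g' := fun s => expWeight k s * k s * ‖mild P T φ g s‖ ^ 2 +
      expWeight k s * (2 * ⟪mild P T φ g s, -(Lu s + g s)⟫))
    (φ := fun s => expWeight k s *
      (2 * ‖gradA j A μ (mild P T φ g s)‖ ^ 2 + (k s - α) * ‖mild P T φ g s‖ ^ 2 -
        2 * ⟪g s, mild P T φ g s⟫))
    (hw.continuousOn.mul ((hc.mono hsub).norm.pow 2)) (fun s hs => ?_) ?_ (fun s hs => ?_)
  · rw [mild_terminal S.semigroup] at key
    linarith
  · have hs' : s ∈ Icc 0 T := ⟨ht.1.trans hs.1.le, hs.2.le⟩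
    have h1 := mild_hasDerivWithinAt S.semigroup S.time_pos hg hL hLc hs'
    have h2 : HasDerivAt (mild P T φ g) (-(Lu s + g s)) s :=
      h1.hasDerivAt (Icc_mem_nhds (ht.1.trans_lt hs.1) hs.2)
    exact ((expWeight_hasDerivAt hk s).mul h2.norm_sq).hasDerivWithinAt
  · refine ContinuousOn.integrableOn_Icc ?_
    have hc' := hc.mono hsub
    exact hw.continuousOn.mul (((hD.mono hsub).norm.pow 2 |>.const_mul 2).add
      ((hk.continuousOn.sub continuousOn_const).mul (hc'.norm.pow 2)) |>.sub
      ((hg.continuousOn.inner hc').const_mul 2))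
  · have hs' : s ∈ Icc 0 T := ⟨ht.1.trans hs.1.le, hs.2.le⟩
    have h1 := norm_sq_gradient_le S.pos S.condA1 S.condA2 S.condA3 S.drift (hL s hs')
      ⟨M, h.bdd_mild s hs'⟩ (h.hasGradA S hs')
    have h2 := expWeight_pos k s
    rw [inner_neg_right, inner_add_right, real_inner_comm (Lu s), real_inner_comm (g s)]
    have h3 : expWeight k s * (2 * ‖gradA j A μ (mild P T φ g s)‖ ^ 2) ≤ expWeight k s *
        (2 * (-⟪Lu s, mild P T φ g s⟫ + α / 2 * ‖mild P T φ g s‖ ^ 2)) := by gcongr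
    linarith

end Energy

/-! ### Approximation of mild solutions and the energy inequality -/

section Approximation

variable {E H : Type*} [NormedAddCommGroup E] [NormedSpace ℝ E]
  [NormedAddCommGroup H] [InnerProductSpace ℝ H] [CompleteSpace H]
  [MeasurableSpace E] [BorelSpace E] {j : H →L[ℝ] E} {A : E → H →L[ℝ] H} {b : E → H}
  {μ : Measure E} [IsFiniteMeasure μ] {T : ℝ} {P : ℝ → Lp ℝ 2 μ →L[ℝ] Lp ℝ 2 μ} {α : ℝ}
  {φ φ' : Lp ℝ 2 μ} {g g' : ℝ → Lp ℝ 2 μ} {M M' : ℝ}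

lemma NiceData.memLp_gradA (S : FormSetting j A b μ T P α) (h : NiceData P T φ g M) :
    MemLp (fun t => gradA j A μ (mild P T φ g t)) 2 (volume.restrict (Icc 0 T)) := by
  obtain ⟨B, hB⟩ := isCompact_Icc.exists_bound_of_continuousOn (h.continuousOn_gradA S)
  refine MemLp.of_bound ((h.continuousOn_gradA S).aestronglyMeasurable measurableSet_Icc) B ?_
  filter_upwards [ae_restrict_mem measurableSet_Icc] with s hs using hB s hs

/-- The distance of the gradients of two mild solutions with nice data. -/
lemma NiceData.integral_norm_sq_gradA_sub_le (S : FormSetting j A b μ T P α)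
    (h : NiceData P T φ g M) (h' : NiceData P T φ' g' M') {B : ℝ}
    (hB : ∀ t ∈ Icc 0 T, ‖mild P T φ g t - mild P T φ' g' t‖ ≤ B) :
    ∫ s in Icc 0 T, ‖gradA j A μ (mild P T φ g s) - gradA j A μ (mild P T φ' g' s)‖ ^ 2 ≤
      Real.exp (α * T) * (‖φ - φ'‖ ^ 2 + 2 * B * ∫ s in Icc 0 T, ‖g s - g' s‖) := by
  have hT := S.time_pos
  have hd := h.sub S.semigroup h'
  -- The rate k = α cancels the term (k - α)‖u‖².
  have key := hd.energy_le S (k := fun _ => α) continuous_const (t := 0) ⟨le_rfl, hT.le⟩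
  set G : ℝ → Lp ℝ 2 μ := fun s => g s - g' s with hG
  set U : ℝ → Lp ℝ 2 μ := mild P T (φ - φ') G with hU
  have hUe : ∀ s ∈ Icc 0 T, U s = mild P T φ g s - mild P T φ' g' s := fun s hs =>
    mild_sub S.semigroup h.integrableOn h'.integrableOn hs
  have hDe : ∀ s ∈ Icc 0 T, gradA j A μ (U s) =
      gradA j A μ (mild P T φ g s) - gradA j A μ (mild P T φ' g' s) := fun s hs => by
    rw [hUe s hs]
    exact ((h.hasGradA S hs).sub (h'.hasGradA S hs)).gradA_eq S.pos S.condA1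
  have hw : ∀ s, expWeight (fun _ => α) s = Real.exp (α * s) := fun s => by
    simp [expWeight, mul_comm]
  simp only [sub_self, zero_mul, add_zero, hw] at key
  have h1 : ∫ s in Icc 0 T,
      ‖gradA j A μ (mild P T φ g s) - gradA j A μ (mild P T φ' g' s)‖ ^ 2 =
      ∫ s in Ioc 0 T, ‖gradA j A μ (U s)‖ ^ 2 := by
    rw [integral_Icc_eq_integral_Ioc]
    refine setIntegral_congr_fun measurableSet_Ioc fun s hs => ?_
    simp only [hDe s (Ioc_subset_Icc_self hs)]
  have hDc : ContinuousOn (fun s => gradA j A μ (U s)) (Icc 0 T) := hd.continuousOn_gradA S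
  have hUc : ContinuousOn U (Icc 0 T) := mild_continuousOn S.semigroup hd.integrableOn
  have hGc : Continuous G := hd.continuous
  have hec : Continuous fun s : ℝ => Real.exp (α * s) := by fun_prop
  have i1 : IntegrableOn (fun s => ‖gradA j A μ (U s)‖ ^ 2) (Ioc 0 T) :=
    ((hDc.norm.pow 2).integrableOn_Icc).mono_set Ioc_subset_Icc_self
  have i2 : IntegrableOn (fun s => Real.exp (α * s) * (2 * ‖gradA j A μ (U s)‖ ^ 2 -
      2 * ⟪G s, U s⟫)) (Ioc 0 T) := by
    refine (ContinuousOn.integrableOn_Icc ?_).mono_set Ioc_subset_Icc_self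
    exact hec.continuousOn.mul (((hDc.norm.pow 2).const_mul 2).sub
      ((hGc.continuousOn.inner hUc).const_mul 2))
  have i3 : IntegrableOn (fun s => ‖G s‖) (Ioc 0 T) :=
    (hGc.norm.continuousOn.integrableOn_Icc).mono_set Ioc_subset_Icc_self
  -- The weight lies between 1 and exp(αT), so twice the weighted energy dominates the plain energy,
  -- and the source term costs at most exp(αT)·2B‖G‖.
  have hpt : ∀ s ∈ Ioc 0 T, ‖gradA j A μ (U s)‖ ^ 2 ≤
      Real.exp (α * s) * (2 * ‖gradA j A μ (U s)‖ ^ 2 - 2 * ⟪G s, U s⟫) +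
        Real.exp (α * T) * (2 * B) * ‖G s‖ := by
    intro s hs
    have hs' := Ioc_subset_Icc_self hs
    have hα := mul_nonneg S.nonneg hs.1.le
    have e1 : 1 ≤ Real.exp (α * s) := Real.one_le_exp hα
    have e2 : Real.exp (α * s) ≤ Real.exp (α * T) :=
      Real.exp_le_exp.2 (mul_le_mul_of_nonneg_left hs.2 S.nonneg)
    have e3 : ⟪G s, U s⟫ ≤ B * ‖G s‖ := by
      refine (real_inner_le_norm _ _).trans ?_
      rw [mul_comm]
      gcongr
      rw [hUe s hs']
      exact hB s hs'
    have hB0 : 0 ≤ B := (norm_nonneg _).trans (hB s hs')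
    have e4 : Real.exp (α * s) * ⟪G s, U s⟫ ≤ Real.exp (α * T) * (B * ‖G s‖) :=
      (mul_le_mul_of_nonneg_left e3 (Real.exp_pos _).le).trans
        (mul_le_mul_of_nonneg_right e2 (by positivity))
    nlinarith [sq_nonneg ‖gradA j A μ (U s)‖]
  have h2 := setIntegral_mono_on i1 (i2.add (i3.const_mul (Real.exp (α * T) * (2 * B))))
    measurableSet_Ioc hpt
  simp only [Pi.add_apply] at h2
  rw [integral_add i2 (i3.const_mul _), integral_const_mul] at h2
  rw [intervalIntegral.integral_of_le hT.le] at key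
  have h3 : ∫ s in Icc 0 T, ‖g s - g' s‖ = ∫ s in Ioc 0 T, ‖G s‖ := integral_Icc_eq_integral_Ioc
  rw [h1, h3]
  have h4 : 0 ≤ Real.exp (α * 0) * ‖U 0‖ ^ 2 := by positivity
  linarith

/-- Approximation of a mild solution by mild solutions with nice data. -/
structure NiceApprox (j : H →L[ℝ] E) (A : E → H →L[ℝ] H) (P : ℝ → Lp ℝ 2 μ →L[ℝ] Lp ℝ 2 μ)
    (T : ℝ) (φ : Lp ℝ 2 μ) (g : ℝ → Lp ℝ 2 μ) (φn : ℕ → Lp ℝ 2 μ) (gn : ℕ → ℝ → Lp ℝ 2 μ)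
    (Mn : ℕ → ℝ) : Prop where
  nice : ∀ n, NiceData P T (φn n) (gn n) (Mn n)
  tendsto_terminal : Tendsto φn atTop (𝓝 φ)
  tendsto_integral : Tendsto (fun n => ∫ s in Icc 0 T, ‖gn n s - g s‖) atTop (𝓝 0)
  tendsto : ∀ᵐ s ∂(volume.restrict (Icc 0 T)), Tendsto (fun n => gn n s) atTop (𝓝 (g s))
  dominated : ∃ G : ℝ → ℝ, IntegrableOn G (Icc 0 T) ∧
    ∀ᵐ s ∂(volume.restrict (Icc 0 T)), ∀ n, ‖gn n s‖ ≤ G s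
  bdd_mild : ∃ B : ℝ, ∀ n, ∀ t ∈ Icc 0 T, ‖mild P T (φn n) (gn n) t‖ ≤ B
  tendsto_mild : TendstoUniformlyOn (fun n => mild P T (φn n) (gn n)) (mild P T φ g) atTop
    (Icc 0 T)
  hasGradA : ∀ᵐ s ∂(volume.restrict (Icc 0 T)),
    HasGradA j A μ (mild P T φ g s) (gradA j A μ (mild P T φ g s))
  memLp_gradA : MemLp (fun s => gradA j A μ (mild P T φ g s)) 2 (volume.restrict (Icc 0 T))
  tendsto_gradA : ∀ᵐ s ∂(volume.restrict (Icc 0 T)),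
    Tendsto (fun n => gradA j A μ (mild P T (φn n) (gn n) s)) atTop
      (𝓝 (gradA j A μ (mild P T φ g s)))
  tendsto_integral_gradA : Tendsto (fun n => ∫ s in Icc 0 T,
    ‖gradA j A μ (mild P T (φn n) (gn n) s) - gradA j A μ (mild P T φ g s)‖ ^ 2) atTop (𝓝 0)
  dominated_gradA : ∃ G : ℝ → ℝ, IntegrableOn G (Icc 0 T) ∧
    ∀ᵐ s ∂(volume.restrict (Icc 0 T)), ∀ n, ‖gradA j A μ (mild P T (φn n) (gn n) s)‖ ^ 2 ≤ G s

/-- Convergence of the data gives uniform convergence of the mild solutions, and the energy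
inequality for differences makes the gradients Cauchy in L²(0,T;L²). Closedness of the gradient
identifies their limit Θ as the gradient of the mild solution. -/
lemma exists_niceApprox_of (S : FormSetting j A b μ T P α) (hg : IntegrableOn g (Icc 0 T))
    {φn : ℕ → Lp ℝ 2 μ} {gn : ℕ → ℝ → Lp ℝ 2 μ} {Mn : ℕ → ℝ}
    (hn : ∀ n, NiceData P T (φn n) (gn n) (Mn n))
    (hφ : ∀ n : ℕ, ‖φn n - φ‖ ≤ 1 / ((n : ℝ) + 1))
    (hgn : ∀ n : ℕ, ∫ s in Icc 0 T, ‖gn n s - g s‖ ≤ 1 / ((n : ℝ) + 1)) :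
    ∃ ns : ℕ → ℕ, NiceApprox j A P T φ g (fun n => φn (ns n)) (fun n => gn (ns n))
      (fun n => Mn (ns n)) := by
  have hP := S.semigroup
  have hT := S.time_pos
  obtain ⟨K, hK1, hK⟩ := hP.exists_bound T
  have hgi : ∀ n, IntegrableOn (gn n) (Icc 0 T) := fun n => (hn n).integrableOn
  set ε : ℕ → ℝ := fun n => 1 / ((n : ℝ) + 1)
  have hε : Tendsto ε atTop (𝓝 0) := tendsto_one_div_add_atTop_nhds_zero_nat
  have hε0 : ∀ n, 0 ≤ ε n := fun n => by positivity
  have hε1 : ∀ n, ε n ≤ 1 := fun n => by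
    rw [div_le_one (by positivity)]
    linarith [n.cast_nonneg (α := ℝ)]
  have hεm : ∀ n m, n ≤ m → ε m ≤ ε n := fun n m h => Nat.one_div_le_one_div h
  have hdist : ∀ n, ∀ t ∈ Icc 0 T, ‖mild P T (φn n) (gn n) t - mild P T φ g t‖ ≤ K * (2 * ε n) := by
    intro n t ht
    rw [← mild_sub hP (hgi n) hg ht]
    refine (norm_mild_le hP hK ((hgi n).sub hg) ht).trans ?_
    have h1 : ‖φn n - φ‖ ≤ ε n := hφ n
    have h2 : ∫ s in Icc 0 T, ‖(gn n - g) s‖ ≤ ε n := hgn n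
    gcongr
    exact (add_le_add h1 h2).trans (two_mul _).ge
  have huc : ContinuousOn (mild P T φ g) (Icc 0 T) := mild_continuousOn hP hg
  have hDcau : ∀ n m, n ≤ m → ∫ s in Icc 0 T, ‖gradA j A μ (mild P T (φn n) (gn n) s) -
      gradA j A μ (mild P T (φn m) (gn m) s)‖ ^ 2 ≤
      Real.exp (α * T) * ((2 * ε n) ^ 2 + 2 * (K * (4 * ε n)) * (2 * ε n)) := by
    intro n m hnm
    have hm := hεm n m hnm
    refine ((hn n).integral_norm_sq_gradA_sub_le S (hn m) (B := K * (4 * ε n))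
      fun t ht => ?_).trans ?_
    · have h1 := hdist n t ht
      have h2 := hdist m t ht
      rw [norm_sub_rev] at h2
      have h3 := norm_sub_le_norm_sub_add_norm_sub (mild P T (φn n) (gn n) t) (mild P T φ g t)
        (mild P T (φn m) (gn m) t)
      nlinarith
    · have h1 : ‖φn n - φn m‖ ≤ 2 * ε n := by
        have h2 := hφ n
        have h3 := hφ m
        rw [norm_sub_rev] at h3
        have := norm_sub_le_norm_sub_add_norm_sub (φn n) φ (φn m)
        change _ ≤ ε n at h2
        change _ ≤ ε m at h3
        linarith
      have h2 : ∫ s in Icc 0 T, ‖gn n s - gn m s‖ ≤ 2 * ε n := by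
        have h3 : ∫ s in Icc 0 T, ‖gn n s - gn m s‖ ≤
            ∫ s in Icc 0 T, (‖gn n s - g s‖ + ‖gn m s - g s‖) := by
          refine integral_mono ((hgi n).sub (hgi m)).norm
            (((hgi n).sub hg).norm.add ((hgi m).sub hg).norm) fun s => ?_
          have := norm_sub_le_norm_sub_add_norm_sub (gn n s) (g s) (gn m s)
          rwa [norm_sub_rev (g s)] at this
        have h4 := integral_add ((hgi n).sub hg).norm ((hgi m).sub hg).norm
        have h5 := hgn n
        have h6 := hgn m
        change _ ≤ ε n at h5
        change _ ≤ ε m at h6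
        simp only [Pi.sub_apply] at h4
        linarith
      have := hε0 n
      gcongr
  have hlim0 : Tendsto (fun n => Real.exp (α * T) * ((2 * ε n) ^ 2 +
      2 * (K * (4 * ε n)) * (2 * ε n))) atTop (𝓝 0) := by
    have : Tendsto (fun n => Real.exp (α * T) * ((2 * ε n) ^ 2 +
      2 * (K * (4 * ε n)) * (2 * ε n))) atTop (𝓝 (Real.exp (α * T) * ((2 * 0) ^ 2 +
      2 * (K * (4 * 0)) * (2 * 0)))) := by
      refine Tendsto.const_mul _ (((hε.const_mul 2).pow 2).add ?_)
      exact (((hε.const_mul 4).const_mul K).const_mul 2).mul (hε.const_mul 2)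
    simpa using this
  obtain ⟨Θ, hΘ, hΘlim⟩ := exists_L2_limit (fun n => (hn n).memLp_gradA S) hlim0 hDcau
  -- Source error and squared gradient error are summed, so one extraction provides a.e. convergence
  -- and domination for both.
  set F : ℕ → ℝ → ℝ := fun n s => ‖gn n s - g s‖ +
    ‖gradA j A μ (mild P T (φn n) (gn n) s) - Θ s‖ ^ 2 with hF
  have hF0 : ∀ n s, 0 ≤ F n s := fun n s => by positivity
  have hgint : ∀ n, IntegrableOn (fun s => ‖gn n s - g s‖) (Icc 0 T) := fun n =>
    ((hgi n).sub hg).norm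
  have hDint : ∀ n, IntegrableOn (fun s => ‖gradA j A μ (mild P T (φn n) (gn n) s) - Θ s‖ ^ 2)
      (Icc 0 T) := fun n => (((hn n).memLp_gradA S).sub hΘ).integrable_norm_pow (by norm_num)
  have hgl : Tendsto (fun n => ∫ s in Icc 0 T, ‖gn n s - g s‖) atTop (𝓝 0) :=
    squeeze_zero (fun n => integral_nonneg fun s => norm_nonneg _) hgn hε
  obtain ⟨ns, hns, G, hG, hdom, hlim⟩ := exists_subseq_dominated
    (ν := volume.restrict (Icc 0 T)) (f := F) (fun n => (hgint n).add (hDint n)) (by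
      have := hgl.add hΘlim
      rw [add_zero] at this
      refine this.congr fun n => ?_
      rw [← integral_add (hgint n) (hDint n)]
      refine integral_congr_ae (Eventually.of_forall fun s => ?_)
      exact (Real.norm_of_nonneg (hF0 n s)).symm)
  have hlg : ∀ᵐ s ∂(volume.restrict (Icc 0 T)), Tendsto (fun n => gn (ns n) s) atTop (𝓝 (g s)) := by
    filter_upwards [hlim] with s hs
    refine tendsto_iff_norm_sub_tendsto_zero.2 ?_
    exact squeeze_zero (fun n => norm_nonneg _)
      (fun n => le_add_of_nonneg_right (sq_nonneg _)) hs
  have hlD : ∀ᵐ s ∂(volume.restrict (Icc 0 T)),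
      Tendsto (fun n => gradA j A μ (mild P T (φn (ns n)) (gn (ns n)) s)) atTop (𝓝 (Θ s)) := by
    filter_upwards [hlim] with s hs
    refine tendsto_iff_norm_sub_tendsto_zero.2 ?_
    have : Tendsto (fun n => ‖gradA j A μ (mild P T (φn (ns n)) (gn (ns n)) s) - Θ s‖ ^ 2) atTop
        (𝓝 0) := squeeze_zero (fun n => sq_nonneg _)
      (fun n => le_add_of_nonneg_left (norm_nonneg _)) hs
    simpa [Real.sqrt_sq (norm_nonneg _)] using this.sqrt
  have hunif : TendstoUniformlyOn (fun n => mild P T (φn (ns n)) (gn (ns n))) (mild P T φ g) atTop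
      (Icc 0 T) := by
    rw [Metric.tendstoUniformlyOn_iff]
    intro δ hδ
    have : Tendsto (fun n => K * (2 * ε (ns n))) atTop (𝓝 0) := by
      simpa using ((hε.comp hns.tendsto_atTop).const_mul 2).const_mul K
    filter_upwards [this.eventually (gt_mem_nhds hδ)] with n hnδ t ht
    rw [dist_comm, dist_eq_norm]
    exact (hdist _ t ht).trans_lt hnδ
  have hgrad : ∀ᵐ s ∂(volume.restrict (Icc 0 T)), HasGradA j A μ (mild P T φ g s) (Θ s) := by
    filter_upwards [hlD, ae_restrict_mem measurableSet_Icc] with s hs hs'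
    exact HasGradA.of_tendsto (fun n => (hn (ns n)).hasGradA S hs') (hunif.tendsto_at hs') hs
  have hgeq : ∀ᵐ s ∂(volume.restrict (Icc 0 T)), gradA j A μ (mild P T φ g s) = Θ s := by
    filter_upwards [hgrad] with s hs using hs.gradA_eq S.pos S.condA1
  have hΘi : IntegrableOn (fun s => ‖Θ s‖ ^ 2) (Icc 0 T) := hΘ.integrable_norm_pow (by norm_num)
  have hGi : Integrable (fun s => 2 * ‖Θ s‖ ^ 2 + 2 * G s) (volume.restrict (Icc 0 T)) :=
    Integrable.add (Integrable.const_mul hΘi 2) (Integrable.const_mul hG 2)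
  obtain ⟨Bu, hBu⟩ := isCompact_Icc.exists_bound_of_continuousOn huc
  refine ⟨ns, fun n => hn _, ?_, hgl.comp hns.tendsto_atTop, hlg, ⟨fun s => ‖g s‖ + G s,
    hg.norm.add hG, ?_⟩, ⟨Bu + K * 2, fun n t ht => ?_⟩, hunif, ?_, ?_, ?_, ?_,
    ⟨fun s => 2 * ‖Θ s‖ ^ 2 + 2 * G s,
      hGi, ?_⟩⟩
  · exact (tendsto_iff_norm_sub_tendsto_zero.2
      (squeeze_zero (fun n => norm_nonneg _) hφ hε)).comp hns.tendsto_atTop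
  · filter_upwards [hdom] with s hs n
    have h1 : ‖gn (ns n) s - g s‖ ≤ G s := by
      refine le_trans ?_ (hs n)
      rw [Real.norm_of_nonneg (hF0 _ _)]
      exact le_add_of_nonneg_right (sq_nonneg _)
    have h2 := norm_add_le (g s) (gn (ns n) s - g s)
    rw [add_sub_cancel] at h2
    linarith
  · have h1 := hdist (ns n) t ht
    have h2 := norm_add_le (mild P T φ g t) (mild P T (φn (ns n)) (gn (ns n)) t - mild P T φ g t)
    rw [add_sub_cancel] at h2
    have h3 := hBu t ht
    have h4 : K * (2 * ε (ns n)) ≤ K * 2 := by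
      have := hε1 (ns n)
      nlinarith
    linarith
  · filter_upwards [hgrad, hgeq] with s h1 h2
    rwa [h2]
  · exact hΘ.ae_eq (EventuallyEq.symm hgeq)
  · filter_upwards [hlD, hgeq] with s h1 h2
    rwa [h2]
  · refine (hΘlim.comp hns.tendsto_atTop).congr fun n => ?_
    refine integral_congr_ae ?_
    filter_upwards [hgeq] with s h2
    rw [h2]
  · filter_upwards [hdom] with s hs n
    have h1 : ‖gradA j A μ (mild P T (φn (ns n)) (gn (ns n)) s) - Θ s‖ ^ 2 ≤ G s := by
      refine le_trans ?_ (hs n)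
      rw [Real.norm_of_nonneg (hF0 _ _)]
      exact le_add_of_nonneg_left (norm_nonneg _)
    have h2 := norm_add_le (Θ s) (gradA j A μ (mild P T (φn (ns n)) (gn (ns n)) s) - Θ s)
    rw [add_sub_cancel] at h2
    nlinarith [sq_nonneg (‖Θ s‖ - ‖gradA j A μ (mild P T (φn (ns n)) (gn (ns n)) s) - Θ s‖),
      norm_nonneg (gradA j A μ (mild P T (φn (ns n)) (gn (ns n)) s))]

lemma exists_niceApprox (S : FormSetting j A b μ T P α) (φ : Lp ℝ 2 μ)
    (hg : IntegrableOn g (Icc 0 T)) :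
    ∃ φn gn Mn, NiceApprox j A P T φ g φn gn Mn := by
  obtain ⟨C, hC1, hC⟩ := S.exists_mapsBdd
  have h : ∀ n : ℕ, _ := fun n => exists_niceData S.semigroup hC hC1 S.time_pos φ hg
    (ε := 1 / ((n : ℝ) + 1)) (by positivity)
  choose φn gn Mn h1 h2 h3 using h
  obtain ⟨ns, hns⟩ := exists_niceApprox_of S hg h1 h2 h3
  exact ⟨_, _, _, hns⟩

/-- For bounded data one sup bound serves all approximants. -/
lemma exists_niceApprox_of_bdd (S : FormSetting j A b μ T P α)
    (hg : IntegrableOn g (Icc 0 T)) (hM : 0 ≤ M) (hφ : φ ∈ bddSet μ M)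
    (hgM : ∀ᵐ s ∂(volume.restrict (Icc 0 T)), g s ∈ bddSet μ M) :
    ∃ φn gn M', NiceApprox j A P T φ g φn gn fun _ => M' := by
  obtain ⟨C, hC1, hC⟩ := S.exists_mapsBdd
  have h : ∀ n : ℕ, _ := fun n => exists_niceData_of_bdd S.semigroup hC hC1 S.time_pos hg hM hφ hgM
    (ε := 1 / ((n : ℝ) + 1)) (by positivity)
  choose φn gn h1 h2 h3 using h
  obtain ⟨ns, hns⟩ := exists_niceApprox_of S hg h1 h2 h3
  exact ⟨_, _, _, hns⟩

lemma inFhat_mild (S : FormSetting j A b μ T P α) (φ : Lp ℝ 2 μ)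
    (hg : IntegrableOn g (Icc 0 T)) : InFhat j A μ T (mild P T φ g) := by
  obtain ⟨φn, gn, Mn, h⟩ := exists_niceApprox S φ hg
  exact ⟨mild_continuousOn S.semigroup hg, h.hasGradA.mono fun s hs => hs.mem, h.memLp_gradA⟩

/-- The energy inequality for mild solutions. -/
lemma energy_mild_le (S : FormSetting j A b μ T P α) (φ : Lp ℝ 2 μ)
    (hg : IntegrableOn g (Icc 0 T)) {k : ℝ → ℝ} (hk : IntegrableOn k (Icc 0 T)) {t : ℝ}
    (ht : t ∈ Icc 0 T) :
    expWeight k t * ‖mild P T φ g t‖ ^ 2 + ∫ s in Icc t T, expWeight k s *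
      (2 * ‖gradA j A μ (mild P T φ g s)‖ ^ 2 + (k s - α) * ‖mild P T φ g s‖ ^ 2 -
        2 * ⟪g s, mild P T φ g s⟫) ≤ expWeight k T * ‖φ‖ ^ 2 := by
  obtain ⟨φn, gn, Mn, h⟩ := exists_niceApprox S φ hg
  obtain ⟨κ, K, W, hκc, hK, hκK, hκ, hW, hwlim⟩ := exists_continuous_dominated hk
  obtain ⟨G, hG, hGb⟩ := h.dominated
  obtain ⟨G', hG', hGb'⟩ := h.dominated_gradA
  obtain ⟨B, hB⟩ := h.bdd_mild
  have hT := S.time_pos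
  have hTm : T ∈ Icc 0 T := ⟨hT.le, le_rfl⟩
  have hsub : Icc t T ⊆ Icc 0 T := Icc_subset_Icc_left ht.1
  have hle : volume.restrict (Icc t T) ≤ volume.restrict (Icc 0 T) :=
    Measure.restrict_mono hsub le_rfl
  have hu : ∀ s ∈ Icc 0 T, Tendsto (fun n => mild P T (φn n) (gn n) s) atTop
    (𝓝 (mild P T φ g s)) := fun s hs => h.tendsto_mild.tendsto_at hs
  have hn : ∀ n, _ := fun n => (h.nice n).energy_le S (hκc n) ht
  simp only [intervalIntegral.integral_of_le ht.2, ← integral_Icc_eq_integral_Ioc] at hn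
  refine le_of_tendsto_of_tendsto' (((hwlim t ht).mul ((hu t ht).norm.pow 2)).add ?_)
    ((hwlim T hTm).mul (h.tendsto_terminal.norm.pow 2)) hn
  have hB0 : 0 ≤ B := (norm_nonneg _).trans (hB 0 T hTm)
  refine tendsto_integral_of_dominated_convergence
    (fun s => W * (2 * G' s + (K s + |α|) * B ^ 2 + 2 * (G s * B))) (fun n => ?_) ?_
    (fun n => ?_) ?_
  · have hc := (mild_continuousOn S.semigroup (φ := φn n) (h.nice n).integrableOn).mono hsub
    have hD := ((h.nice n).continuousOn_gradA S).mono hsub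
    have hw : Continuous (expWeight (κ n)) :=
      continuous_iff_continuousAt.2 fun t => (expWeight_hasDerivAt (hκc n) t).continuousAt
    refine ContinuousOn.aestronglyMeasurable ?_ measurableSet_Icc
    exact hw.continuousOn.mul (((hD.norm.pow 2).const_mul 2).add
      (((hκc n).continuousOn.sub continuousOn_const).mul (hc.norm.pow 2)) |>.sub
      (((h.nice n).continuous.continuousOn.inner hc).const_mul 2))
  · refine Integrable.const_mul ?_ W
    refine Integrable.add (Integrable.add ((hG'.mono_set hsub).const_mul 2) ?_)
      (((hG.mono_set hsub).mul_const B).const_mul 2)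
    exact ((hK.mono_set hsub).add (integrable_const _)).mul_const _
  · filter_upwards [ae_mono hle hκK, ae_mono hle hGb, ae_mono hle hGb',
      ae_restrict_mem measurableSet_Icc] with s h1 h2 h3 h4
    have h5 := hB n s (hsub h4)
    rw [norm_mul, Real.norm_of_nonneg (expWeight_pos _ _).le]
    have hW0 : 0 ≤ W := (expWeight_pos _ _).le.trans (hW n s (hsub h4))
    refine mul_le_mul (hW n s (hsub h4)) ?_ (norm_nonneg _) hW0
    refine (norm_sub_le _ _).trans (add_le_add ((norm_add_le _ _).trans (add_le_add ?_ ?_)) ?_)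
    · rw [Real.norm_of_nonneg (by positivity)]
      linarith [h3 n]
    · rw [norm_mul, Real.norm_of_nonneg (sq_nonneg ‖mild P T (φn n) (gn n) s‖)]
      refine mul_le_mul ((norm_sub_le _ _).trans (add_le_add_left (h1 n) _))
        (pow_le_pow_left₀ (norm_nonneg _) h5 2) (sq_nonneg _) ?_
      linarith [(abs_nonneg _).trans (h1 n), abs_nonneg α]
    · rw [norm_mul, Real.norm_ofNat]
      gcongr
      exact (norm_inner_le_norm _ _).trans (mul_le_mul (h2 n) h5 (norm_nonneg _)
        ((norm_nonneg _).trans (h2 n)))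
  · filter_upwards [ae_mono hle hκ, ae_mono hle h.tendsto, ae_mono hle h.tendsto_gradA,
      ae_restrict_mem measurableSet_Icc] with s h1 h2 h3 h4
    have h5 := hu s (hsub h4)
    exact (hwlim s (hsub h4)).mul ((((h3.norm.pow 2).const_mul 2).add
      ((h1.sub_const α).mul (h5.norm.pow 2))).sub ((h2.inner h5).const_mul 2))

end Approximation

/-! ### Curves in L² and jointly measurable functions -/

section MeasurableRepresentatives

variable {E F β : Type*} [MeasurableSpace E] [MeasurableSpace.CountablyGenerated E]
  {μ : Measure E} [IsFiniteMeasure μ] [MeasurableSpace β] {ν : Measure β}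
  [NormedAddCommGroup F] [InnerProductSpace ℝ F] [CompleteSpace F]
  [TopologicalSpace.SeparableSpace F] [MeasurableSpace F] [BorelSpace F]

lemma Lp_enorm_sq (f : Lp F 2 μ) : ‖f‖ₑ ^ 2 = ∫⁻ x, ‖f x‖ₑ ^ 2 ∂μ := by
  have h := ofReal_integral_norm_eq_lintegral_enorm (Lp_integrable_norm_sq f)
  have h1 : ∫ x, ‖‖f x‖ ^ 2‖ ∂μ = ‖f‖ ^ 2 := by
    rw [Lp_norm_sq]
    exact integral_congr_ae (Eventually.of_forall fun x => by simp)
  rw [h1, ENNReal.ofReal_pow (norm_nonneg _), ofReal_norm] at h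
  rw [h]
  refine lintegral_congr fun x => ?_
  simp [enorm_pow]

lemma Lp_enorm_sub_sq (f g : Lp F 2 μ) : ‖f - g‖ₑ ^ 2 = ∫⁻ x, ‖f x - g x‖ₑ ^ 2 ∂μ := by
  rw [Lp_enorm_sq]
  refine lintegral_congr_ae ?_
  filter_upwards [Lp.coeFn_sub f g] with x hx
  rw [hx, Pi.sub_apply]

lemma ae_tendsto_of_norm_sub_le {f : ℕ → Lp F 2 μ} {g : Lp F 2 μ}
    (h : ∀ n, ‖f n - g‖ ≤ (1 / 2) ^ n) : ∀ᵐ x ∂μ, Tendsto (fun n => f n x) atTop (𝓝 (g x)) := by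
  have hm : ∀ n, AEMeasurable (fun x => ‖f n x - g x‖ₑ ^ 2) μ := fun n =>
    ((Lp.aestronglyMeasurable (f n)).sub (Lp.aestronglyMeasurable g)).enorm.pow_const 2
  have hsum : ∫⁻ x, ∑' n, ‖f n x - g x‖ₑ ^ 2 ∂μ ≠ ∞ := by
    rw [lintegral_tsum hm]
    have : ∀ n, ∫⁻ x, ‖f n x - g x‖ₑ ^ 2 ∂μ ≤ ENNReal.ofReal ((1 / 2 : ℝ) ^ n) := fun n => by
      rw [← Lp_enorm_sub_sq, ← ofReal_norm, ← ENNReal.ofReal_pow (norm_nonneg _)]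
      refine ENNReal.ofReal_le_ofReal ?_
      have h1 : ((1 : ℝ) / 2) ^ n ≤ 1 := pow_le_one₀ (by norm_num) (by norm_num)
      nlinarith [h n, norm_nonneg (f n - g)]
    refine ne_top_of_le_ne_top ?_ (ENNReal.tsum_le_tsum this)
    rw [← ENNReal.ofReal_tsum_of_nonneg (fun n => by positivity) summable_geometric_two]
    exact ENNReal.ofReal_ne_top
  filter_upwards [ae_lt_top' (AEMeasurable.tsum hm) hsum] with x hx
  rw [tendsto_iff_norm_sub_tendsto_zero]
  have h1 := (ENNReal.summable_toReal hx.ne).tendsto_atTop_zero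
  simp only [ENNReal.toReal_pow, toReal_enorm] at h1
  simpa [Real.sqrt_sq (norm_nonneg _)] using h1.sqrt

/-- A strongly measurable curve in `L²` has a jointly measurable representative. -/
lemma exists_measurable_representative {u : β → Lp F 2 μ} (hu : AEStronglyMeasurable u ν) :
    ∃ w : β × E → F, Measurable w ∧ ∀ᵐ t ∂ν, u t =ᵐ[μ] fun x => w (t, x) := by
  classical
  have : Fact ((2 : ℝ≥0∞) ≠ ∞) := ⟨by norm_num⟩
  set d := TopologicalSpace.denseSeq (Lp F 2 μ)
  set u' := hu.mk u
  have hu' : StronglyMeasurable u' := hu.stronglyMeasurable_mk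
  -- The curve is replaced by the first member of a dense sequence within 2⁻ⁿ. The index depends
  -- measurably on t, so the approximation is jointly measurable, and the geometric rate gives
  -- convergence for almost every x at each such t.
  have hex : ∀ (n : ℕ) (t : β), ∃ k, ‖d k - u' t‖ < (1 / 2 : ℝ) ^ n := fun n t => by
    obtain ⟨k, hk⟩ := (TopologicalSpace.denseRange_denseSeq (Lp F 2 μ)).exists_dist_lt (u' t)
      (ε := (1 / 2 : ℝ) ^ n) (by positivity)
    rw [dist_comm, dist_eq_norm] at hk
    exact ⟨k, hk⟩
  have hN : ∀ n, Measurable fun t => Nat.find (hex n t) := fun n =>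
    measurable_find (hex n) fun k =>
      measurableSet_lt (stronglyMeasurable_const.sub hu').norm.measurable measurable_const
  set w : ℕ → β × E → F := fun n p => d (Nat.find (hex n p.1)) p.2
  have hw : ∀ n, StronglyMeasurable (w n) := fun n => by
    have h1 : Measurable fun p : ℕ × E => d p.1 p.2 :=
      measurable_from_prod_countable_right fun k => (Lp.stronglyMeasurable (d k)).measurable
    exact (h1.comp (((hN n).comp measurable_fst).prodMk measurable_snd)).stronglyMeasurable
  refine ⟨fun p => limUnder atTop (w · p), (StronglyMeasurable.limUnder hw).measurable, ?_⟩
  filter_upwards [hu.ae_eq_mk] with t ht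
  rw [ht]
  filter_upwards [ae_tendsto_of_norm_sub_le (f := fun n => d (Nat.find (hex n t))) (g := u' t)
    fun n => (Nat.find_spec (hex n t)).le] with x hx
  exact hx.limUnder_eq.symm

/-- A jointly measurable function with sections in `L²` is a strongly measurable curve in `L²`. -/
lemma aestronglyMeasurable_of_representative {u : β → Lp F 2 μ} {w : β × E → F}
    (hw : Measurable w) (hu : ∀ᵐ t ∂ν, u t =ᵐ[μ] fun x => w (t, x)) :
    AEStronglyMeasurable u ν := by
  classical
  have : Fact ((2 : ℝ≥0∞) ≠ ∞) := ⟨by norm_num⟩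
  set d := TopologicalSpace.denseSeq (Lp F 2 μ)
  set h : ℕ → β → ℝ≥0∞ := fun k t => ∫⁻ x, ‖d k x - w (t, x)‖ₑ ^ 2 ∂μ
  have hm : ∀ k, Measurable (h k) := fun k => by
    refine Measurable.lintegral_prod_right' (f := fun p : β × E => ‖d k p.2 - w p‖ₑ ^ 2) ?_
    exact (((Lp.stronglyMeasurable (d k)).measurable.comp measurable_snd).sub hw).enorm.pow_const 2
  have heq : ∀ᵐ t ∂ν, ∀ k, h k t = ‖d k - u t‖ₑ ^ 2 := by
    filter_upwards [hu] with t ht k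
    rw [Lp_enorm_sub_sq]
    refine lintegral_congr_ae ?_
    filter_upwards [ht] with x hx
    rw [hx]
  -- The distances are expressed through w, because measurability of u is the goal. The second
  -- alternative keeps the search defined for exceptional t; at good t density excludes it.
  have hex : ∀ (n : ℕ) (t : β), ∃ k, h k t < (1 / 2 : ℝ≥0∞) ^ n ∨ ∀ k', ¬ h k' t < (1 / 2) ^ n :=
    fun n t => by
      by_cases hk : ∃ k, h k t < (1 / 2 : ℝ≥0∞) ^ n
      · exact hk.imp fun k => Or.inl
      · exact ⟨0, Or.inr (not_exists.1 hk)⟩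
  have hbad : ∀ n : ℕ, MeasurableSet {t | ∀ k', ¬ h k' t < (1 / 2 : ℝ≥0∞) ^ n} := fun n => by
    have : {t | ∀ k', ¬ h k' t < (1 / 2 : ℝ≥0∞) ^ n} = ⋂ k', {t | h k' t < (1 / 2) ^ n}ᶜ := by
      ext t; simp
    rw [this]
    exact MeasurableSet.iInter fun k' => (measurableSet_lt (hm k') measurable_const).compl
  have hN : ∀ n, Measurable fun t => Nat.find (hex n t) := fun n =>
    measurable_find (hex n) fun k => (measurableSet_lt (hm k) measurable_const).union (hbad n)
  refine aestronglyMeasurable_of_tendsto_ae atTop (f := fun n t => d (Nat.find (hex n t)))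
    (fun n => ?_) ?_
  · have h1 : StronglyMeasurable d := StronglyMeasurable.of_discrete
    exact (h1.comp_measurable (hN n)).aestronglyMeasurable
  · filter_upwards [heq] with t ht
    have hlt : ∀ n, ‖d (Nat.find (hex n t)) - u t‖ₑ ^ 2 < (1 / 2) ^ n := fun n => by
      rcases Nat.find_spec (hex n t) with h1 | h1
      · rwa [ht] at h1
      · exfalso
        obtain ⟨k, hk⟩ := (TopologicalSpace.denseRange_denseSeq (Lp F 2 μ)).exists_dist_lt (u t)
          (ε := √((1 / 2 : ℝ) ^ n)) (by positivity)
        rw [dist_comm, dist_eq_norm, Real.lt_sqrt (norm_nonneg _)] at hk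
        refine h1 k ?_
        rw [ht, ← ofReal_norm, ← ENNReal.ofReal_pow (norm_nonneg _)]
        have : (1 / 2 : ℝ≥0∞) ^ n = ENNReal.ofReal ((1 / 2) ^ n) := by
          rw [ENNReal.ofReal_pow (by norm_num), ENNReal.ofReal_div_of_pos (by norm_num)]
          simp
        rw [this]
        exact (ENNReal.ofReal_lt_ofReal_iff (by positivity)).2 hk
    rw [tendsto_iff_norm_sub_tendsto_zero]
    have h0 : Tendsto (fun n => (1 / 2 : ℝ≥0∞) ^ n) atTop (𝓝 0) :=
      ENNReal.tendsto_pow_atTop_nhds_zero_of_lt_one (by simp)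
    have h2 : Tendsto (fun n => ‖d (Nat.find (hex n t)) - u t‖ₑ ^ 2) atTop (𝓝 0) :=
      tendsto_of_tendsto_of_tendsto_of_le_of_le tendsto_const_nhds h0 (fun n => bot_le)
        fun n => (hlt n).le
    have h3 := (ENNReal.tendsto_toReal ENNReal.zero_ne_top).comp h2
    have h4 := h3.sqrt
    simpa [Function.comp_def, Real.sqrt_sq (norm_nonneg _)] using h4

end MeasurableRepresentatives

/-! ### Superposition operators -/

section Nemytskii

variable {E H : Type*} [MeasurableSpace E] [MeasurableSpace.CountablyGenerated E]
  [NormedAddCommGroup E]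
  {μ : Measure E} [IsFiniteMeasure μ]
  [NormedAddCommGroup H] [InnerProductSpace ℝ H] [CompleteSpace H]
  [TopologicalSpace.SeparableSpace H] [MeasurableSpace H] [BorelSpace H] {T : ℝ} {l : ℕ}

/-- `g = f(·,·,v,V)` as an element of `L¹([0,T]; L²)^l`. -/
def IsNemytskii (μ : Measure E) (T : ℝ) {l : ℕ}
    (f : ℝ → E → EuclideanSpace ℝ (Fin l) → (Fin l → H) → EuclideanSpace ℝ (Fin l))
    (v : Fin l → ℝ → Lp ℝ 2 μ) (V : Fin l → ℝ → Lp H 2 μ) (g : Fin l → ℝ → Lp ℝ 2 μ) : Prop :=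
  ∀ i, IntegrableOn (g i) (Icc 0 T) ∧
    ∀ᵐ t ∂(volume.restrict (Icc 0 T)), (g i t : E → ℝ) =ᵐ[μ]
      fun x => f t x (vec (fun k => v k t) x) (fun k => V k t x) i

variable {f : ℝ → E → EuclideanSpace ℝ (Fin l) → (Fin l → H) → EuclideanSpace ℝ (Fin l)}
  {v : Fin l → ℝ → Lp ℝ 2 μ} {V : Fin l → ℝ → Lp H 2 μ}

/-- Substitution is done with jointly measurable representatives, since f(t,x,·,·) cannot be
composed measurably with mere curves in L². Time passes through `projIcc` because f is measurable
only over [0,T]. -/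
lemma exists_isNemytskii (hT : 0 ≤ T) (hf : MeasurableNonlinearity T f)
    (hv : ∀ i, AEStronglyMeasurable (v i) (volume.restrict (Icc 0 T)))
    (hV : ∀ i, AEStronglyMeasurable (V i) (volume.restrict (Icc 0 T)))
    {G : ℝ → ℝ≥0∞} (hG : ∫⁻ t in Icc 0 T, G t < ∞)
    (hb : ∀ᵐ t ∂(volume.restrict (Icc 0 T)),
      eLpNorm (fun x => f t x (vec (fun k => v k t) x) (fun k => V k t x)) 2 μ ≤ G t) :
    ∃ g, IsNemytskii μ T f v V g := by
  choose v' hv'm hv' using fun i => exists_measurable_representative (hv i)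
  choose V' hV'm hV' using fun i => exists_measurable_representative (hV i)
  set w : ℝ × E → EuclideanSpace ℝ (Fin l) := fun p =>
    f (projIcc 0 T hT p.1) p.2 (WithLp.toLp 2 fun k => v' k p) (fun k => V' k p) with hw
  have hwm : Measurable w := by
    have h1 : Measurable fun p : ℝ × E => (projIcc 0 T hT p.1, p.2,
        (WithLp.toLp 2 fun k => v' k p : EuclideanSpace ℝ (Fin l)), fun k => V' k p) := by
      refine (continuous_projIcc.measurable.comp measurable_fst).prodMk
        (measurable_snd.prodMk (Measurable.prodMk ?_ (measurable_pi_lambda _ hV'm)))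
      exact (PiLp.continuous_toLp 2 _).measurable.comp (measurable_pi_lambda _ hv'm)
    exact hf.comp h1
  have heq : ∀ᵐ t ∂(volume.restrict (Icc 0 T)), ∀ᵐ x ∂μ,
      f t x (vec (fun k => v k t) x) (fun k => V k t x) = w (t, x) := by
    filter_upwards [ae_all_iff.2 hv', ae_all_iff.2 hV', ae_restrict_mem measurableSet_Icc]
      with t h1 h2 h3
    filter_upwards [ae_all_iff.2 h1, ae_all_iff.2 h2] with x h4 h5
    simp only [hw, vec, projIcc_of_mem hT h3, h4, h5]
  set N : ℝ → ℝ≥0∞ := fun t => eLpNorm (fun x => w (t, x)) 2 μ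
  have hNG : ∀ᵐ t ∂(volume.restrict (Icc 0 T)), N t ≤ G t := by
    filter_upwards [heq, hb] with t h1 h2
    exact (eLpNorm_congr_ae h1).symm.trans_le h2
  have hNm : Measurable N := by
    have : N = fun t => (∫⁻ x, ‖w (t, x)‖ₑ ^ (2 : ℝ) ∂μ) ^ (1 / (2 : ℝ)) := by
      funext t
      simp only [N]
      rw [eLpNorm_eq_lintegral_rpow_enorm_toReal (by norm_num) (by norm_num)]
      simp
    rw [this]
    exact (Measurable.lintegral_prod_right' (f := fun p : ℝ × E => ‖w p‖ₑ ^ (2 : ℝ))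
      (hwm.enorm.pow_const _)).pow_const _
  have hNi : ∫⁻ t in Icc 0 T, N t < ∞ := (lintegral_mono_ae hNG).trans_lt hG
  have hNf : ∀ᵐ t ∂(volume.restrict (Icc 0 T)), N t < ∞ := ae_lt_top hNm hNi.ne
  have hwi : ∀ i, Measurable fun p => w p i := fun i =>
    (PiLp.continuous_apply 2 _ i).measurable.comp hwm
  have hle : ∀ i t, eLpNorm (fun x => w (t, x) i) 2 μ ≤ N t := fun i t =>
    eLpNorm_mono fun x => PiLp.norm_apply_le _ i
  classical
  set g : Fin l → ℝ → Lp ℝ 2 μ := fun i t =>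
    if h : MemLp (fun x => w (t, x) i) 2 μ then h.toLp else 0
  have hmem : ∀ i t, N t < ∞ → MemLp (fun x => w (t, x) i) 2 μ := fun i t ht =>
    ⟨((hwi i).comp measurable_prodMk_left).aestronglyMeasurable, (hle i t).trans_lt ht⟩
  have hg : ∀ i, ∀ᵐ t ∂(volume.restrict (Icc 0 T)), g i t =ᵐ[μ] fun x => w (t, x) i := by
    intro i
    filter_upwards [hNf] with t ht
    simp only [g, dif_pos (hmem i t ht)]
    exact (hmem i t ht).coeFn_toLp
  refine ⟨g, fun i => ⟨⟨aestronglyMeasurable_of_representative (hwi i) (hg i), ?_⟩, ?_⟩⟩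
  · refine lt_of_le_of_lt (lintegral_mono_ae ?_) hNi
    filter_upwards [hg i] with t ht
    rw [Lp.enorm_def, eLpNorm_congr_ae ht]
    exact hle i t
  · filter_upwards [hg i, heq] with t h1 h2
    filter_upwards [h1, h2] with x h3 h4
    rw [h3, h4]

lemma exists_isNemytskii_of_bdd (hT : 0 ≤ T) (hf : MeasurableNonlinearity T f)
    (hv : ∀ i, AEStronglyMeasurable (v i) (volume.restrict (Icc 0 T)))
    (hV : ∀ i, AEStronglyMeasurable (V i) (volume.restrict (Icc 0 T)))
    {B : ℝ} (hb : ∀ᵐ t ∂(volume.restrict (Icc 0 T)), ∀ᵐ x ∂μ,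
      ‖f t x (vec (fun k => v k t) x) (fun k => V k t x)‖ ≤ B) :
    ∃ g, IsNemytskii μ T f v V g := by
  refine exists_isNemytskii hT hf hv hV
    (G := fun _ => μ univ ^ (2 : ℝ≥0∞).toReal⁻¹ * ENNReal.ofReal B) ?_ ?_
  · rw [setLIntegral_const]
    refine ENNReal.mul_lt_top (ENNReal.mul_lt_top ?_ ENNReal.ofReal_lt_top) (by simp)
    exact ENNReal.rpow_lt_top_of_nonneg (by positivity) (measure_ne_top _ _)
  · filter_upwards [hb] with t ht using eLpNorm_le_of_ae_bound ht

end Nemytskii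

/-! ### A smooth convex function vanishing on the negative half-line -/

section ConvexCutoff

/-- A smooth convex function that vanishes exactly on `(-∞, 0]`. -/
noncomputable def expNegInvPrimitive (x : ℝ) : ℝ := ∫ s in 0..x, expNegInvGlue s

lemma continuous_expNegInvGlue : Continuous expNegInvGlue :=
  (expNegInvGlue.contDiff (n := 0)).continuous

lemma hasDerivAt_expNegInvPrimitive (x : ℝ) :
    HasDerivAt expNegInvPrimitive (expNegInvGlue x) x :=
  (continuous_expNegInvGlue.integral_hasStrictDerivAt 0 x).hasDerivAt

lemma deriv_expNegInvPrimitive : deriv expNegInvPrimitive = expNegInvGlue :=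
  funext fun x => (hasDerivAt_expNegInvPrimitive x).deriv

lemma contDiff_expNegInvPrimitive : ContDiff ℝ (⊤ : ℕ∞) expNegInvPrimitive := by
  rw [contDiff_infty_iff_deriv, deriv_expNegInvPrimitive]
  exact ⟨fun x => (hasDerivAt_expNegInvPrimitive x).differentiableAt, expNegInvGlue.contDiff⟩

lemma deriv_expNegInvGlue_nonneg (x : ℝ) : 0 ≤ deriv expNegInvGlue x :=
  expNegInvGlue.monotone.deriv_nonneg

lemma expNegInvPrimitive_of_nonpos {x : ℝ} (hx : x ≤ 0) : expNegInvPrimitive x = 0 := by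
  rw [expNegInvPrimitive, intervalIntegral.integral_symm, neg_eq_zero]
  refine (intervalIntegral.integral_congr (g := fun _ => (0 : ℝ)) fun _ hs => ?_).trans (by simp)
  rw [uIcc_of_le hx] at hs
  exact expNegInvGlue.zero_of_nonpos hs.2

lemma expNegInvPrimitive_pos {x : ℝ} (hx : 0 < x) : 0 < expNegInvPrimitive x :=
  intervalIntegral.intervalIntegral_pos_of_pos_on
    (continuous_expNegInvGlue.intervalIntegrable _ _)
    (fun _ hs => expNegInvGlue.pos_of_pos hs.1) hx

lemma expNegInvPrimitive_nonneg (x : ℝ) : 0 ≤ expNegInvPrimitive x := by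
  rcases le_or_gt x 0 with h | h
  · exact (expNegInvPrimitive_of_nonpos h).ge
  · exact (expNegInvPrimitive_pos h).le

/-- Convexity in tangent form. In the maximum principle it replaces differentiation of the nonlinear
functional under the integral. -/
lemma expNegInvPrimitive_tangent (x y : ℝ) :
    expNegInvPrimitive x + expNegInvGlue x * (y - x) ≤ expNegInvPrimitive y := by
  have hi : ∀ a b, IntervalIntegrable expNegInvGlue volume a b :=
    continuous_expNegInvGlue.intervalIntegrable
  have h1 : expNegInvPrimitive y - expNegInvPrimitive x = ∫ s in x..y, expNegInvGlue s :=
    intervalIntegral.integral_interval_sub_left (hi _ _) (hi _ _)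
  have h2 : expNegInvGlue x * (y - x) = ∫ s in x..y, expNegInvGlue x := by
    rw [intervalIntegral.integral_const, smul_eq_mul, mul_comm]
  have h3 : ∫ s in x..y, expNegInvGlue x ≤ ∫ s in x..y, expNegInvGlue s := by
    rcases le_total x y with h | h
    · refine intervalIntegral.integral_mono_on h (by simp) (hi _ _) fun _ hs => ?_
      exact expNegInvGlue.monotone hs.1
    · rw [intervalIntegral.integral_symm, intervalIntegral.integral_symm y x, neg_le_neg_iff]
      refine intervalIntegral.integral_mono_on h (hi _ _) (by simp) fun _ hs => ?_
      exact expNegInvGlue.monotone hs.2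
  linarith

end ConvexCutoff

/-! ### Pointwise products in L¹ -/

section L1Tools

variable {E X : Type*} [MeasurableSpace E] {μ : Measure E}
  [NormedAddCommGroup X] [InnerProductSpace ℝ X] {l : ℕ}

/-- The pointwise inner product `L² × L² → L¹`. -/
noncomputable def innerL1 (μ : Measure E) (X : Type*) [NormedAddCommGroup X]
    [InnerProductSpace ℝ X] : Lp X 2 μ →L[ℝ] Lp X 2 μ →L[ℝ] Lp ℝ 1 μ :=
  (innerSL ℝ : X →L[ℝ] X →L[ℝ] ℝ).holderL μ 2 2 1

lemma coeFn_innerL1 (u v : Lp X 2 μ) : innerL1 μ X u v =ᵐ[μ] fun x => ⟪u x, v x⟫ :=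
  (innerSL ℝ : X →L[ℝ] X →L[ℝ] ℝ).coeFn_holder u v

lemma norm_innerL1_le (u v : Lp X 2 μ) : ‖innerL1 μ X u v‖ ≤ ‖u‖ * ‖v‖ := by
  refine ((innerSL ℝ : X →L[ℝ] X →L[ℝ] ℝ).norm_holder_apply_apply_le u v).trans ?_
  have : ‖(innerSL ℝ : X →L[ℝ] X →L[ℝ] ℝ)‖ ≤ 1 := norm_innerSL_le ℝ
  rw [mul_assoc]
  exact mul_le_of_le_one_left (by positivity) this

/-- The pointwise inner product of two systems in `L²`. -/
noncomputable def dotL1 (u v : Fin l → Lp X 2 μ) : Lp ℝ 1 μ := ∑ i, innerL1 μ X (u i) (v i)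

lemma coeFn_dotL1 (u v : Fin l → Lp X 2 μ) : dotL1 u v =ᵐ[μ] fun x => ∑ i, ⟪u i x, v i x⟫ := by
  refine (Lp.coeFn_fun_finsetSum _ _).trans ?_
  filter_upwards [ae_all_iff.2 fun i => coeFn_innerL1 (u i) (v i)] with z hz
  simp only [hz]

lemma norm_dotL1_le (u v : Fin l → Lp X 2 μ) : ‖dotL1 u v‖ ≤ ∑ i, ‖u i‖ * ‖v i‖ :=
  (norm_sum_le _ _).trans (Finset.sum_le_sum fun _ _ => norm_innerL1_le _ _)

lemma tendsto_clm_apply {V W β : Type*} [NormedAddCommGroup V] [NormedSpace ℝ V]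
    [NormedAddCommGroup W] [NormedSpace ℝ W] {L : Filter β} {f : β → V →L[ℝ] W} {f' : V →L[ℝ] W}
    {v : β → V} {v' : V} (hf : Tendsto f L (𝓝 f')) (hv : Tendsto v L (𝓝 v')) :
    Tendsto (fun s => f s (v s)) L (𝓝 (f' v')) :=
  (isBoundedBilinearMap_apply.continuous.tendsto (f', v')).comp (hf.prodMk_nhds hv)

lemma tendsto_dotL1 {β : Type*} {L : Filter β} {u v : β → Fin l → Lp X 2 μ}
    {u' v' : Fin l → Lp X 2 μ} (hu : ∀ i, Tendsto (fun s => u s i) L (𝓝 (u' i)))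
    (hv : ∀ i, Tendsto (fun s => v s i) L (𝓝 (v' i))) :
    Tendsto (fun s => dotL1 (u s) (v s)) L (𝓝 (dotL1 u' v')) := by
  have h : ∀ i, Tendsto (fun s => innerL1 μ X (u s i) (v s i)) L (𝓝 (innerL1 μ X (u' i) (v' i))) :=
    fun i => tendsto_clm_apply (((innerL1 μ X).continuous.tendsto (u' i)).comp (hu i)) (hv i)
  exact tendsto_finsetSum Finset.univ fun i _ => h i

lemma L1_norm_eq (f : Lp ℝ 1 μ) : ‖f‖ = ∫ x, ‖f x‖ ∂μ := L1.norm_eq_integral_norm f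

lemma L1_integrable (f : Lp ℝ 1 μ) : Integrable f μ := L1.integrable_coeFn f

/-- The arguments of χ stay in a fixed compact interval, so χ is bounded there. It then suffices to
pass to subsequences along which S converges almost everywhere and J is dominated. -/
lemma tendsto_integral_comp_mul {χ : ℝ → ℝ} (hχ : Continuous χ) {S J : ℕ → Lp ℝ 1 μ}
    {S' J' : Lp ℝ 1 μ} {R : ℝ} (hS : Tendsto S atTop (𝓝 S')) (hR : ∀ n, ∀ᵐ x ∂μ, |S n x| ≤ R)
    {w c : ℕ → ℝ} {w' c' : ℝ} (hw : Tendsto w atTop (𝓝 w')) (hc : Tendsto c atTop (𝓝 c'))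
    (hJ : Tendsto J atTop (𝓝 J')) :
    Tendsto (fun n => ∫ x, χ (w n * S n x - c n) * J n x ∂μ) atTop
      (𝓝 (∫ x, χ (w' * S' x - c') * J' x ∂μ)) := by
  obtain ⟨Wb, hWb⟩ := hw.norm.bddAbove_range
  obtain ⟨Cb, hCb⟩ := hc.norm.bddAbove_range
  have hWb' : ∀ n, |w n| ≤ Wb := fun n => hWb ⟨n, rfl⟩
  have hCb' : ∀ n, |c n| ≤ Cb := fun n => hCb ⟨n, rfl⟩
  obtain ⟨K, hK⟩ := exists_bound_on_Icc hχ (Wb * R + Cb)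
  have hχK : ∀ n, ∀ᵐ x ∂μ, |χ (w n * S n x - c n)| ≤ K := fun n => by
    filter_upwards [hR n] with x hx
    refine hK _ ((abs_sub _ _).trans (add_le_add ?_ (hCb' n)))
    rw [abs_mul]
    exact mul_le_mul (hWb' n) hx (abs_nonneg _) ((abs_nonneg _).trans (hWb' n))
  refine tendsto_of_subseq_tendsto fun ns hns => ?_
  obtain ⟨ms, hms, hSae⟩ :=
    (tendstoInMeasure_of_tendsto_Lp (hS.comp hns)).exists_seq_tendsto_ae
  have hJ2 : Tendsto (fun n => ∫ x, ‖(J (ns (ms n)) - J') x‖ ∂μ) atTop (𝓝 0) := by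
    simp only [← L1_norm_eq]
    exact tendsto_iff_norm_sub_tendsto_zero.1 (hJ.comp (hns.comp hms.tendsto_atTop))
  obtain ⟨ks, hks, G, hG, hdom, hlim⟩ := exists_subseq_dominated
    (fun n => L1_integrable (J (ns (ms n)) - J')) hJ2
  have hsub : ∀ᵐ x ∂μ, ∀ n, (J (ns (ms (ks n))) - J') x = J (ns (ms (ks n))) x - J' x :=
    ae_all_iff.2 fun n => Lp.coeFn_sub _ _
  refine ⟨fun n => ms (ks n), ?_⟩
  refine tendsto_integral_of_dominated_convergence (fun x => K * (|J' x| + G x)) (fun n => ?_)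
    (((L1_integrable J').abs.add hG).const_mul K) (fun n => ?_) ?_
  · have h1 := Lp.aestronglyMeasurable (S (ns (ms (ks n))))
    exact (hχ.comp_aestronglyMeasurable ((h1.const_mul _).sub aestronglyMeasurable_const)).mul
      (Lp.aestronglyMeasurable _)
  · filter_upwards [hχK (ns (ms (ks n))), hdom, hsub] with x h1 h2 h3
    rw [norm_mul]
    refine mul_le_mul h1 ?_ (norm_nonneg _) ((abs_nonneg _).trans h1)
    have h4 := norm_add_le (J' x) (J (ns (ms (ks n))) x - J' x)
    rw [add_sub_cancel] at h4
    refine h4.trans (add_le_add_right ?_ _)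
    rw [← h3]
    exact h2 n
  · filter_upwards [hSae, hlim, hsub] with x h1 h2 h3
    have h4 : Tendsto (fun n => J (ns (ms (ks n))) x) atTop (𝓝 (J' x)) := by
      have h5 : Tendsto (fun n => J (ns (ms (ks n))) x - J' x) atTop (𝓝 0) :=
        h2.congr fun n => h3 n
      simpa using h5.add_const (J' x)
    refine Tendsto.mul ((hχ.tendsto _).comp (Tendsto.sub (Tendsto.mul ?_ ?_) ?_)) h4
    · exact hw.comp (hns.comp (hms.tendsto_atTop.comp hks.tendsto_atTop))
    · exact h1.comp hks.tendsto_atTop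
    · exact hc.comp (hns.comp (hms.tendsto_atTop.comp hks.tendsto_atTop))

end L1Tools

/-! ### The bracket of the maximum principle -/

section Bracket

variable {E X : Type*} [MeasurableSpace E] {μ : Measure E} [IsFiniteMeasure μ]
  [NormedAddCommGroup X] [InnerProductSpace ℝ X] {l : ℕ}

/-- A bounded weight acts on L¹ as a continuous linear functional, so its composition with a
differentiable curve in L¹ is differentiated by the chain rule. -/
lemma exists_pairing {θ : E → ℝ} {K : ℝ} (hθ : AEStronglyMeasurable θ μ)
    (hK : ∀ᵐ x ∂μ, |θ x| ≤ K) :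
    ∃ Λ : Lp ℝ 1 μ →L[ℝ] ℝ, ∀ J, Λ J = ∫ x, θ x * J x ∂μ := by
  have hm : MemLp θ ∞ μ := memLp_top_of_bound hθ K hK
  refine ⟨(ContinuousLinearMap.mul ℝ ℝ).lpPairing μ ∞ 1 hm.toLp, fun J => ?_⟩
  rw [ContinuousLinearMap.lpPairing_eq_integral]
  refine integral_congr_ae ?_
  filter_upwards [hm.coeFn_toLp] with x hx
  rw [hx]
  rfl

lemma innerL1_comm (u v : Lp X 2 μ) : innerL1 μ X u v = innerL1 μ X v u := by
  refine Lp.ext ?_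
  filter_upwards [coeFn_innerL1 u v, coeFn_innerL1 v u] with x h1 h2
  rw [h1, h2, real_inner_comm]

/-- `κ |u|² + 2 |ψ|² + N - 2 u · g`. -/
noncomputable def bracketL1 (κ N : ℝ) (u g : Fin l → Lp ℝ 2 μ) (ψ : Fin l → Lp X 2 μ) :
    Lp ℝ 1 μ :=
  κ • dotL1 u u + (2 : ℝ) • dotL1 ψ ψ + Lp.const 1 μ N - (2 : ℝ) • dotL1 u g

lemma coeFn_bracketL1 (κ N : ℝ) (u g : Fin l → Lp ℝ 2 μ) (ψ : Fin l → Lp X 2 μ) :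
    bracketL1 κ N u g ψ =ᵐ[μ] fun x => κ * (∑ i, ⟪u i x, u i x⟫) +
      2 * (∑ i, ⟪ψ i x, ψ i x⟫) + N - 2 * ∑ i, ⟪u i x, g i x⟫ := by
  filter_upwards [Lp.coeFn_sub (κ • dotL1 u u + (2 : ℝ) • dotL1 ψ ψ + Lp.const 1 μ N)
    ((2 : ℝ) • dotL1 u g), Lp.coeFn_add (κ • dotL1 u u + (2 : ℝ) • dotL1 ψ ψ) (Lp.const 1 μ N),
    Lp.coeFn_add (κ • dotL1 u u) ((2 : ℝ) • dotL1 ψ ψ), Lp.coeFn_smul κ (dotL1 u u),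
    Lp.coeFn_smul (2 : ℝ) (dotL1 ψ ψ), Lp.coeFn_smul (2 : ℝ) (dotL1 u g),
    Lp.coeFn_const (p := 1) (μ := μ) N, coeFn_dotL1 u u, coeFn_dotL1 ψ ψ, coeFn_dotL1 u g]
    with x h1 h2 h3 h4 h5 h6 h7 h8 h9 h10
  rw [bracketL1, h1, Pi.sub_apply, h2, Pi.add_apply, h3, Pi.add_apply, h4, h5, h6, h7,
    Pi.smul_apply, Pi.smul_apply, Pi.smul_apply, h8, h9, h10]
  rfl

lemma tendsto_bracketL1 {β : Type*} {L : Filter β} {κ : β → ℝ} {κ' N : ℝ}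
    {u g : β → Fin l → Lp ℝ 2 μ} {ψ : β → Fin l → Lp X 2 μ} {u' g' : Fin l → Lp ℝ 2 μ}
    {ψ' : Fin l → Lp X 2 μ} (hκ : Tendsto κ L (𝓝 κ'))
    (hu : ∀ i, Tendsto (fun s => u s i) L (𝓝 (u' i)))
    (hg : ∀ i, Tendsto (fun s => g s i) L (𝓝 (g' i)))
    (hψ : ∀ i, Tendsto (fun s => ψ s i) L (𝓝 (ψ' i))) :
    Tendsto (fun s => bracketL1 (κ s) N (u s) (g s) (ψ s)) L (𝓝 (bracketL1 κ' N u' g' ψ')) :=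
  (((hκ.smul (tendsto_dotL1 hu hu)).add ((tendsto_dotL1 hψ hψ).const_smul 2)).add_const _).sub
    ((tendsto_dotL1 hu hg).const_smul 2)

lemma norm_bracketL1_le (κ N : ℝ) (u g : Fin l → Lp ℝ 2 μ) (ψ : Fin l → Lp X 2 μ) :
    ‖bracketL1 κ N u g ψ‖ ≤ |κ| * (∑ i, ‖u i‖ * ‖u i‖) + 2 * (∑ i, ‖ψ i‖ * ‖ψ i‖) +
      ‖Lp.const 1 μ N‖ + 2 * ∑ i, ‖u i‖ * ‖g i‖ := by
  refine (norm_sub_le _ _).trans (add_le_add ((norm_add_le _ _).trans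
    (add_le_add ((norm_add_le _ _).trans (add_le_add ?_ ?_)) le_rfl)) ?_)
  · rw [norm_smul, Real.norm_eq_abs]
    gcongr
    exact norm_dotL1_le _ _
  · rw [norm_smul, Real.norm_ofNat]
    gcongr
    exact norm_dotL1_le _ _
  · rw [norm_smul, Real.norm_ofNat]
    gcongr
    exact norm_dotL1_le _ _

lemma abs_dotL1_self_le {u : Fin l → Lp ℝ 2 μ} {M : ℝ} (hu : ∀ i, u i ∈ bddSet μ M) :
    ∀ᵐ x ∂μ, |dotL1 u u x| ≤ l * M ^ 2 := by
  filter_upwards [coeFn_dotL1 u u, ae_all_iff.2 hu] with x h1 h2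
  rw [h1]
  refine (Finset.abs_sum_le_sum_abs _ _).trans ?_
  refine (Finset.sum_le_card_nsmul _ _ (M ^ 2) fun i _ => ?_).trans (by simp)
  rw [real_inner_self_eq_norm_sq, abs_of_nonneg (sq_nonneg _)]
  exact pow_le_pow_left₀ (norm_nonneg _) (h2 i) 2

end Bracket

/-! ### Maximum principle and energy inequality for systems -/

section MaximumPrinciple

variable {E H : Type*} [NormedAddCommGroup E] [NormedSpace ℝ E]
  [NormedAddCommGroup H] [InnerProductSpace ℝ H] [CompleteSpace H]
  [MeasurableSpace E] [BorelSpace E] {j : H →L[ℝ] E} {A : E → H →L[ℝ] H} {b : E → H}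
  {μ : Measure E} [IsFiniteMeasure μ] {T : ℝ} {P : ℝ → Lp ℝ 2 μ →L[ℝ] Lp ℝ 2 μ} {α : ℝ} {l : ℕ}

lemma continuousOn_of_seq {K : Set ℝ} {f : ℝ → ℝ} (h : ∀ s : ℕ → ℝ, (∀ n, s n ∈ K) → ∀ x ∈ K,
    Tendsto s atTop (𝓝 x) → Tendsto (fun n => f (s n)) atTop (𝓝 (f x))) : ContinuousOn f K := by
  rw [continuousOn_iff_continuous_domRestrict]
  refine SeqContinuous.continuous fun s x hs => ?_
  exact h (fun n => s n) (fun n => (s n).2) x x.2 ((continuous_subtype_val.tendsto x).comp hs)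

/-- Static inequality behind the maximum principle. -/
lemma pairing_generator_le (S : FormSetting j A b μ T P α) {u Lu : Fin l → Lp ℝ 2 μ}
    {ψ : Fin l → Lp H 2 μ} (hL : ∀ i, IsGenerator P (u i) (Lu i)) {M : ℝ}
    (hM : ∀ i, u i ∈ bddSet μ M) (hψ : ∀ i, HasGradA j A μ (u i) (ψ i)) {w c : ℝ}
    {Λ : Lp ℝ 1 μ →L[ℝ] ℝ}
    (hΛ : ∀ J, Λ J = ∫ x, expNegInvGlue (w * dotL1 u u x - c) * J x ∂μ) :
    2 * w * Λ (dotL1 u Lu) + 2 * w * Λ (dotL1 ψ ψ) ≤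
      α * ∫ x, expNegInvPrimitive (w * dotL1 u u x - c) ∂μ := by
  have hd : ∀ r, HasDerivAt (fun r => expNegInvPrimitive (w * r - c))
      (w * expNegInvGlue (w * r - c)) r := fun r => by
    have h1 : HasDerivAt (fun r => w * r - c) w r := by
      simpa using ((hasDerivAt_id r).const_mul w).sub_const c
    have h2 := (hasDerivAt_expNegInvPrimitive (w * r - c)).comp r h1
    rwa [mul_comm] at h2
  have hd' : deriv (fun r => expNegInvPrimitive (w * r - c)) =
      fun r => w * expNegInvGlue (w * r - c) := funext fun r => (hd r).deriv
  have hd2 : ∀ r, deriv (fun r => w * expNegInvGlue (w * r - c)) r =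
      w * (deriv expNegInvGlue (w * r - c) * w) := fun r => by
    have h1 : HasDerivAt (fun r => w * r - c) w r := by
      simpa using ((hasDerivAt_id r).const_mul w).sub_const c
    have h3 : DifferentiableAt ℝ expNegInvGlue (w * r - c) :=
      (expNegInvGlue.contDiff (n := 1)).differentiable (by norm_num) _
    exact ((h3.hasDerivAt.comp r h1).const_mul w).deriv
  -- The test is made with Ξ(r) = Ψ(wr - c), Ψ = `expNegInvPrimitive`: its derivative carries the
  -- factor w, and its second derivative w²Ψ'' is nonnegative.
  have key := sum_integral_generator_le S.pos S.condA1 S.condA2 S.condA3 S.drift hL hM hψ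
    (Ξ := fun r => expNegInvPrimitive (w * r - c))
    (contDiff_expNegInvPrimitive.comp (by fun_prop)) (fun x => expNegInvPrimitive_nonneg _)
    (fun x => by
      rw [hd', hd2]
      have := deriv_expNegInvGlue_nonneg (w * x - c)
      nlinarith [mul_nonneg this (mul_self_nonneg w)])
  have hs : dotL1 u u =ᵐ[μ] fun x => ∑ k, (u k x) ^ 2 := by
    filter_upwards [coeFn_dotL1 u u] with x hx
    rw [hx]
    exact Finset.sum_congr rfl fun i _ => by rw [real_inner_self_eq_norm_sq, Real.norm_eq_abs, sq_abs]
  have e1 : ∀ i, ∫ z, Lu i z * (u i z * (w * expNegInvGlue (w * (∑ k, (u k z) ^ 2) - c))) ∂μ =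
      w * Λ (innerL1 μ ℝ (u i) (Lu i)) := fun i => by
    rw [hΛ, ← integral_const_mul]
    refine integral_congr_ae ?_
    filter_upwards [hs, coeFn_innerL1 (u i) (Lu i)] with z h1 h2
    rw [h1, h2]
    simp
    ring
  have e2 : ∫ z, (w * expNegInvGlue (w * (∑ k, (u k z) ^ 2) - c)) * ∑ i, ‖ψ i z‖ ^ 2 ∂μ =
      w * Λ (dotL1 ψ ψ) := by
    rw [hΛ, ← integral_const_mul]
    refine integral_congr_ae ?_
    filter_upwards [hs, coeFn_dotL1 ψ ψ] with z h1 h2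
    rw [h1, h2]
    simp only [real_inner_self_eq_norm_sq]
    ring
  have e3 : ∫ z, expNegInvPrimitive (w * (∑ k, (u k z) ^ 2) - c) ∂μ =
      ∫ x, expNegInvPrimitive (w * dotL1 u u x - c) ∂μ := by
    refine integral_congr_ae ?_
    filter_upwards [hs] with z h1
    rw [h1]
  rw [hd'] at key
  simp only [e1, e2, e3] at key
  rw [← Finset.mul_sum] at key
  have e4 : Λ (dotL1 u Lu) = ∑ i, Λ (innerL1 μ ℝ (u i) (Lu i)) := by
    rw [dotL1, map_sum]
  rw [e4]
  linarith

/-- The moving level in the maximum principle. -/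
noncomputable def barrier (κ : ℝ → ℝ) (T N₀ N s : ℝ) : ℝ :=
  N₀ * expWeight κ T + N * ∫ r in s..T, expWeight κ r

/-- Let y(s) = e^{αs}∫Ψ(w_s|u_s|² - c_s)dμ, with Ψ = `expNegInvPrimitive`, w the weight and c the
barrier, so that c' = -Nw. The inequality is the integral form of y' ≥ `low`, where `low` pairs Ψ'
with the bracket. Differentiability of y is not needed: by convexity, freezing Ψ' at time x gives a
differentiable minorant touching y at x, which bounds the right slopes of y from below. -/
lemma NiceData.stampacchia_le (S : FormSetting j A b μ T P α) {φ : Fin l → Lp ℝ 2 μ}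
    {g : Fin l → ℝ → Lp ℝ 2 μ} {M : ℝ} (h : ∀ i, NiceData P T (φ i) (g i) M) {κ : ℝ → ℝ}
    (hκ : Continuous κ) (N₀ N : ℝ) {U : Fin l → ℝ → Lp ℝ 2 μ}
    (hU : ∀ i, U i = mild P T (φ i) (g i)) {t : ℝ} (ht : t ∈ Icc 0 T) :
    ContinuousOn (fun s => Real.exp (α * s) * (expWeight κ s * ∫ x, expNegInvGlue (expWeight κ s *
        dotL1 (fun i => U i s) (fun i => U i s) x - barrier κ T N₀ N s) *
        bracketL1 (κ s) N (fun i => U i s) (fun i => g i s) (fun i => gradA j A μ (U i s)) x ∂μ))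
      (Icc 0 T) ∧
    (Real.exp (α * t) * ∫ x, expNegInvPrimitive (expWeight κ t *
        dotL1 (fun i => U i t) (fun i => U i t) x - barrier κ T N₀ N t) ∂μ) +
      ∫ s in t..T, Real.exp (α * s) * (expWeight κ s * ∫ x, expNegInvGlue (expWeight κ s *
        dotL1 (fun i => U i s) (fun i => U i s) x - barrier κ T N₀ N s) *
        bracketL1 (κ s) N (fun i => U i s) (fun i => g i s) (fun i => gradA j A μ (U i s)) x ∂μ) ≤
    Real.exp (α * T) * ∫ x, expNegInvPrimitive (expWeight κ T *
        dotL1 (fun i => U i T) (fun i => U i T) x - barrier κ T N₀ N T) ∂μ := by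
  have hP := S.semigroup
  choose Lu hLuc hLu using fun i => (h i).exists_generator
  have hLu' : ∀ i, ∀ t ∈ Icc 0 T, IsGenerator P (U i t) (Lu i t) := fun i t ht => by
    rw [hU]; exact hLu i t ht
  have hUb : ∀ i, ∀ t ∈ Icc 0 T, U i t ∈ bddSet μ M := fun i t ht => by
    rw [hU]; exact (h i).bdd_mild t ht
  have hUc : ∀ i, ContinuousOn (U i) (Icc 0 T) := fun i => by
    rw [hU]; exact mild_continuousOn hP (h i).integrableOn
  have hUd : ∀ i, ∀ t ∈ Icc 0 T, HasDerivWithinAt (U i) (-(Lu i t + g i t)) (Icc 0 T) t :=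
    fun i t ht => by
      rw [hU]; exact mild_hasDerivWithinAt hP S.time_pos (h i).continuous (hLu i) (hLuc i) ht
  have hUg : ∀ i, ∀ t ∈ Icc 0 T, HasGradA j A μ (U i t) (gradA j A μ (U i t)) := fun i t ht => by
    rw [hU]; exact (h i).hasGradA S ht
  have hUgc : ∀ i, ContinuousOn (fun t => gradA j A μ (U i t)) (Icc 0 T) := fun i => by
    rw [hU]; exact (h i).continuousOn_gradA S
  set Q : ℝ → Lp ℝ 1 μ := fun s => dotL1 (fun i => U i s) (fun i => U i s) with hQ
  set J : ℝ → Lp ℝ 1 μ := fun s => bracketL1 (κ s) N (fun i => U i s) (fun i => g i s)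
    (fun i => gradA j A μ (U i s)) with hJ
  set w := expWeight κ with hw
  set c := barrier κ T N₀ N with hc
  have hwd : ∀ s, HasDerivAt w (w s * κ s) s := fun s => expWeight_hasDerivAt hκ s
  have hwc : Continuous w := continuous_iff_continuousAt.2 fun t => (hwd t).continuousAt
  have hcd : ∀ s, HasDerivAt c (N * -w s) s := fun s =>
    ((intervalIntegral.integral_hasDerivAt_left (hwc.intervalIntegrable _ _)
      hwc.aestronglyMeasurable.stronglyMeasurableAtFilter hwc.continuousAt).const_mul N).const_add _
  have hcc : Continuous c := continuous_iff_continuousAt.2 fun t => (hcd t).continuousAt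
  have hQb : ∀ s ∈ Icc 0 T, ∀ᵐ x ∂μ, |Q s x| ≤ l * M ^ 2 := fun s hs =>
    abs_dotL1_self_le fun i => hUb i s hs
  set Y : ℝ → ℝ := fun s => ∫ x, expNegInvPrimitive (w s * Q s x - c s) ∂μ with hY
  set I : ℝ → ℝ := fun s => ∫ x, expNegInvGlue (w s * Q s x - c s) * J s x ∂μ with hI
  have hQlim : ∀ s : ℕ → ℝ, (∀ n, s n ∈ Icc 0 T) → ∀ x ∈ Icc 0 T, Tendsto s atTop (𝓝 x) →
      Tendsto (fun n => Q (s n)) atTop (𝓝 (Q x)) := by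
    intro s hs x hx hsx
    have hsx' : Tendsto s atTop (𝓝[Icc 0 T] x) :=
      tendsto_nhdsWithin_iff.2 ⟨hsx, Eventually.of_forall hs⟩
    exact tendsto_dotL1 (fun i => (hUc i x hx).tendsto.comp hsx')
      (fun i => (hUc i x hx).tendsto.comp hsx')
  have hYc : ContinuousOn Y (Icc 0 T) := by
    refine continuousOn_of_seq fun s hs x hx hsx => ?_
    have h1 := tendsto_integral_comp_mul (contDiff_expNegInvPrimitive.continuous)
      (hQlim s hs x hx hsx) (fun n => hQb _ (hs n)) ((hwc.tendsto x).comp hsx)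
      ((hcc.tendsto x).comp hsx) (tendsto_const_nhds (x := Lp.const 1 μ (1 : ℝ)))
    have h2 : ∀ f : E → ℝ, ∫ x, f x * Lp.const 1 μ (1 : ℝ) x ∂μ = ∫ x, f x ∂μ := fun f => by
      refine integral_congr_ae ?_
      filter_upwards [Lp.coeFn_const (p := 1) (μ := μ) (1 : ℝ)] with x hx
      rw [hx]
      simp
    simp only [h2] at h1
    exact h1
  have hIc : ContinuousOn I (Icc 0 T) := by
    refine continuousOn_of_seq fun s hs x hx hsx => ?_
    have hsx' : Tendsto s atTop (𝓝[Icc 0 T] x) :=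
      tendsto_nhdsWithin_iff.2 ⟨hsx, Eventually.of_forall hs⟩
    refine tendsto_integral_comp_mul continuous_expNegInvGlue
      (hQlim s hs x hx hsx) (fun n => hQb _ (hs n)) ((hwc.tendsto x).comp hsx)
      ((hcc.tendsto x).comp hsx) ?_
    exact tendsto_bracketL1 ((hκ.tendsto x).comp hsx)
      (fun i => (hUc i x hx).tendsto.comp hsx')
      (fun i => (((h i).continuous).tendsto x).comp hsx)
      (fun i => (hUgc i x hx).tendsto.comp hsx')
  set low : ℝ → ℝ := fun s => Real.exp (α * s) * (w s * I s) with hlow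
  have hlowc : ContinuousOn low (Icc 0 T) :=
    (by fun_prop : Continuous fun s : ℝ => Real.exp (α * s)).continuousOn.mul
      (hwc.continuousOn.mul hIc)
  set y : ℝ → ℝ := fun s => Real.exp (α * s) * Y s with hy
  have hyc : ContinuousOn y (Icc 0 T) :=
    (by fun_prop : Continuous fun s : ℝ => Real.exp (α * s)).continuousOn.mul hYc
  -- a differentiable minorant touching `y` at `x`
  have hminor : ∀ x ∈ Icc 0 T, ∃ (m : ℝ → ℝ) (m' : ℝ), HasDerivWithinAt m m' (Icc 0 T) x ∧
      m x = y x ∧ (∀ z ∈ Icc 0 T, m z ≤ y z) ∧ low x ≤ m' := by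
    intro x hx
    have hθm : AEStronglyMeasurable (fun z => expNegInvGlue (w x * Q x z - c x)) μ :=
      continuous_expNegInvGlue.comp_aestronglyMeasurable
        (((Lp.aestronglyMeasurable (Q x)).const_mul _).sub aestronglyMeasurable_const)
    have hbd : ∀ s ∈ Icc 0 T, ∀ᵐ z ∂μ, |w s * Q s z - c s| ≤ |w s| * (l * M ^ 2) + |c s| := by
      intro s hs
      filter_upwards [hQb s hs] with z hz
      refine (abs_sub _ _).trans (add_le_add ?_ le_rfl)
      rw [abs_mul]
      gcongr
    obtain ⟨K, hK⟩ := exists_bound_on_Icc continuous_expNegInvGlue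
      (|w x| * (l * M ^ 2) + |c x|)
    have hθK : ∀ᵐ z ∂μ, |expNegInvGlue (w x * Q x z - c x)| ≤ K :=
      (hbd x hx).mono fun z hz => hK _ hz
    obtain ⟨Λ, hΛ⟩ := exists_pairing hθm hθK
    have hΨi : ∀ s ∈ Icc 0 T, Integrable (fun z => expNegInvPrimitive (w s * Q s z - c s)) μ := by
      intro s hs
      obtain ⟨K', hK'⟩ := exists_bound_on_Icc contDiff_expNegInvPrimitive.continuous
        (|w s| * (l * M ^ 2) + |c s|)
      refine Integrable.of_bound (contDiff_expNegInvPrimitive.continuous.comp_aestronglyMeasurable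
        (((Lp.aestronglyMeasurable (Q s)).const_mul _).sub aestronglyMeasurable_const)) K' ?_
      exact (hbd s hs).mono fun z hz => hK' _ hz
    have hθQ : ∀ s, Integrable (fun z => expNegInvGlue (w x * Q x z - c x) * Q s z) μ := fun s =>
      (L1_integrable (Q s)).bdd_mul hθm hθK
    have hθi : Integrable (fun z => expNegInvGlue (w x * Q x z - c x)) μ :=
      Integrable.of_bound hθm K hθK
    have hΛN : ∀ a : ℝ, Λ (Lp.const 1 μ a) = a * ∫ z, expNegInvGlue (w x * Q x z - c x) ∂μ := by
      intro a
      rw [hΛ, ← integral_const_mul]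
      refine integral_congr_ae ?_
      filter_upwards [Lp.coeFn_const (p := 1) (μ := μ) a] with z hz
      rw [hz]
      exact mul_comm _ _
    set Λ₁ := ∫ z, expNegInvGlue (w x * Q x z - c x) ∂μ
    -- The constant that makes the minorant equal to y at x.
    set k₁ := Y x - (w x * Λ (Q x) - c x * Λ₁)
    have hQd : HasDerivWithinAt Q (-((2 : ℝ) • (dotL1 (fun i => U i x) (fun i => Lu i x) +
        dotL1 (fun i => U i x) (fun i => g i x)))) (Icc 0 T) x := by
      have h1 : HasDerivWithinAt Q (∑ i, (innerL1 μ ℝ (U i x) (-(Lu i x + g i x)) +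
          innerL1 μ ℝ (-(Lu i x + g i x)) (U i x))) (Icc 0 T) x :=
        HasDerivWithinAt.fun_sum fun i _ =>
          (innerL1 μ ℝ).hasDerivWithinAt_of_bilinear (hUd i x hx) (hUd i x hx)
      convert h1 using 1
      rw [dotL1, dotL1, ← Finset.sum_add_distrib, Finset.smul_sum, ← Finset.sum_neg_distrib]
      refine Finset.sum_congr rfl fun i _ => ?_
      rw [innerL1_comm (-(Lu i x + g i x)), map_neg, map_add, two_smul]
      abel
    refine ⟨fun z => Real.exp (α * z) * (w z * Λ (Q z) - c z * Λ₁ + k₁), _,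
      ((((hasDerivAt_id x).const_mul α).exp).hasDerivWithinAt.mul
        ((((hwd x).hasDerivWithinAt.mul (Λ.hasFDerivAt.comp_hasDerivWithinAt x hQd)).sub
          ((hcd x).hasDerivWithinAt.mul_const Λ₁)).add_const k₁)), ?_, fun z hz => ?_, ?_⟩
    · simp only [hy, k₁]
      ring
    · refine mul_le_mul_of_nonneg_left ?_ (Real.exp_pos _).le
      have h1 : w z * Λ (Q z) - c z * Λ₁ + k₁ = ∫ v, (expNegInvPrimitive (w x * Q x v - c x) +
          expNegInvGlue (w x * Q x v - c x) * ((w z * Q z v - c z) - (w x * Q x v - c x))) ∂μ := by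
        have h2 : ∀ v, expNegInvPrimitive (w x * Q x v - c x) +
            expNegInvGlue (w x * Q x v - c x) * ((w z * Q z v - c z) - (w x * Q x v - c x)) =
            expNegInvPrimitive (w x * Q x v - c x) +
            (w z * (expNegInvGlue (w x * Q x v - c x) * Q z v) -
            w x * (expNegInvGlue (w x * Q x v - c x) * Q x v) +
            (c x - c z) * expNegInvGlue (w x * Q x v - c x)) := fun v => by ring
        simp only [h2]
        have i1 := (hθQ z).const_mul (w z)
        have i2 := (hθQ x).const_mul (w x)
        have i3 := hθi.const_mul (c x - c z)
        have i12 : Integrable (fun v => w z * (expNegInvGlue (w x * Q x v - c x) * Q z v) -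
          w x * (expNegInvGlue (w x * Q x v - c x) * Q x v)) μ := i1.sub i2
        have i123 : Integrable (fun v => w z * (expNegInvGlue (w x * Q x v - c x) * Q z v) -
          w x * (expNegInvGlue (w x * Q x v - c x) * Q x v) +
          (c x - c z) * expNegInvGlue (w x * Q x v - c x)) μ := i12.add i3
        rw [integral_add (hΨi x hx) i123, integral_add i12 i3, integral_sub i1 i2, integral_const_mul, integral_const_mul, integral_const_mul,
          ← hΛ, ← hΛ]
        simp only [k₁, hY, Λ₁]
        ring
      rw [h1]
      refine integral_mono ((hΨi x hx).add ?_) (hΨi z hz) fun v => expNegInvPrimitive_tangent _ _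
      have i4 := (((hθQ z).const_mul (w z)).sub ((hθQ x).const_mul (w x))).add
        (hθi.const_mul (c x - c z))
      refine i4.congr (Eventually.of_forall fun v => ?_)
      simp only [Pi.add_apply, Pi.sub_apply]
      ring
    · have h1 := pairing_generator_le S (fun i => hLu' i x hx) (fun i => hUb i x hx)
        (fun i => hUg i x hx) hΛ
      have h2 : I x = κ x * Λ (Q x) + 2 * Λ (dotL1 (fun i => gradA j A μ (U i x))
          (fun i => gradA j A μ (U i x))) + N * Λ₁ -
          2 * Λ (dotL1 (fun i => U i x) (fun i => g i x)) := by
        have h3 : I x = Λ (J x) := (hΛ _).symm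
        rw [h3, hJ]
        simp only [bracketL1, map_sub, map_add, map_smul, smul_eq_mul, hΛN]
        rfl
      have h4 := Real.exp_pos (α * x)
      have h5 : w x * Λ (Q x) - c x * Λ₁ + k₁ = Y x := by simp only [k₁]; ring
      have h1' : 2 * w x * Λ (dotL1 (fun i => U i x) (fun i => Lu i x)) + 2 * w x *
          Λ (dotL1 (fun i => gradA j A μ (U i x)) (fun i => gradA j A μ (U i x))) ≤ α * Y x := h1
      simp only [hlow, h2, map_neg, map_smul, map_add, smul_eq_mul, mul_one, Function.comp_apply,
        id, h5]
      nlinarith [mul_le_mul_of_nonneg_left h1' h4.le]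
  have hsub : Icc t T ⊆ Icc 0 T := Icc_subset_Icc_left ht.1
  have hlow' := hlowc.mono hsub
  have hder : ∀ x ∈ Ico t T, HasDerivWithinAt (fun s => -y t - ∫ r in t..s, low r) (-low x)
      (Ici x) x := by
    intro x hx
    have h1 : HasDerivWithinAt (fun s => ∫ r in t..s, low r) (low x) (Ici x) x := by
      have hxI : x ∈ Icc t T := Ico_subset_Icc_self hx
      refine intervalIntegral.integral_hasDerivWithinAt_right ?_ ?_
        (t := Ioi x) ?_
      · refine ContinuousOn.intervalIntegrable ?_
        rw [uIcc_of_le hx.1]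
        exact hlow'.mono (Icc_subset_Icc_right hx.2.le)
      · refine ⟨Icc t T, ?_, hlow'.aestronglyMeasurable measurableSet_Icc⟩
        exact mem_of_superset (Ioo_mem_nhdsGT hx.2)
          fun z hz => ⟨hx.1.trans hz.1.le, hz.2.le⟩
      · exact (hlow' x hxI).mono_of_mem_nhdsWithin (mem_of_superset (Ioo_mem_nhdsGT hx.2)
          fun z hz => ⟨hx.1.trans hz.1.le, hz.2.le⟩)
    have h2 := h1.const_sub (-y t)
    exact h2
  -- The comparison is made for -y, where only an upper bound on right slopes is required.
  have hfin := image_le_of_liminf_slope_right_le_deriv_boundary (f := fun s => -y s) (a := t)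
    (b := T) (hyc.mono hsub).neg (B := fun s => -y t - ∫ r in t..s, low r)
    (B' := fun s => -low s) (by simp) (by
      have h1 := intervalIntegral.continuousOn_primitive_interval (a := t) (b := T) (f := low)
        (μ := volume) (by rw [uIcc_of_le ht.2]; exact hlow'.integrableOn_Icc)
      rw [uIcc_of_le ht.2] at h1
      exact continuousOn_const.sub h1) hder (fun x hx r hr => by
      have hxI : x ∈ Icc 0 T := hsub (Ico_subset_Icc_self hx)
      obtain ⟨m, m', hm, hmx, hmz, hlm⟩ := hminor x hxI
      have hmem : Icc 0 T ∈ 𝓝[>] x := mem_of_superset (Ioo_mem_nhdsGT hx.2)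
        fun z hz => ⟨hxI.1.trans hz.1.le, hz.2.le⟩
      have h1 : HasDerivWithinAt m m' (Ioi x) x := hm.mono_of_mem_nhdsWithin hmem
      have h2 := (hasDerivWithinAt_iff_tendsto_slope' (by simp)).1 h1
      have h3 : ∀ᶠ z in 𝓝[>] x, -r < slope m x z :=
        h2.eventually (lt_mem_nhds (by linarith))
      refine Eventually.frequently ?_
      filter_upwards [h3, hmem, self_mem_nhdsWithin] with z h4 h5 h6
      have h7 : 0 < z - x := sub_pos.2 h6
      have h8 : slope m x z ≤ (y z - y x) / (z - x) := by
        rw [slope_def_field]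
        gcongr
        · exact hmz z h5
        · exact hmx.ge
      rw [slope_def_field]
      have h9 : (-y z - -y x) / (z - x) = -((y z - y x) / (z - x)) := by ring
      rw [h9]
      linarith) (right_mem_Icc.2 ht.2)
  have hfin' : -y T ≤ -y t - ∫ r in t..T, low r := hfin
  have hgoal : y t + ∫ r in t..T, low r ≤ y T := by linarith
  exact ⟨hlowc, hgoal⟩

lemma expNegInvGlue_le_one (x : ℝ) : expNegInvGlue x ≤ 1 := by
  unfold expNegInvGlue
  split_ifs with h
  · exact zero_le_one
  · rw [Real.exp_le_one_iff, Left.neg_nonpos_iff, inv_nonneg]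
    exact (not_le.1 h).le

lemma NiceData.mono {φ : Lp ℝ 2 μ} {g : ℝ → Lp ℝ 2 μ} {M M' : ℝ} (h : NiceData P T φ g M)
    (hM : M ≤ M') : NiceData P T φ g M' :=
  ⟨h.continuous, bddSet_mono hM h.bdd_terminal, fun t ht => bddSet_mono hM (h.bdd t ht),
    fun t ht => bddSet_mono hM (h.bdd_mild t ht), h.exists_generator⟩

/-- Maximum principle for systems of mild solutions. -/
lemma mild_ae_le_barrier (S : FormSetting j A b μ T P α) {φ : Fin l → Lp ℝ 2 μ}
    {g : Fin l → ℝ → Lp ℝ 2 μ} (hg : ∀ i, IntegrableOn (g i) (Icc 0 T)) {M : ℝ} (hM : 0 ≤ M)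
    (hφM : ∀ i, φ i ∈ bddSet μ M)
    (hgM : ∀ i, ∀ᵐ s ∂(volume.restrict (Icc 0 T)), g i s ∈ bddSet μ M)
    {k : ℝ → ℝ} (hk : IntegrableOn k (Icc 0 T)) {N₀ N : ℝ}
    {U : Fin l → ℝ → Lp ℝ 2 μ} (hU : ∀ i, U i = mild P T (φ i) (g i))
    (hφ : ∀ᵐ x ∂μ, ∑ i, (φ i x) ^ 2 ≤ N₀)
    (hbr : ∀ᵐ s ∂(volume.restrict (Icc 0 T)), ∀ᵐ x ∂μ, 2 * ∑ i, U i s x * g i s x ≤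
      k s * ∑ i, (U i s x) ^ 2 + 2 * ∑ i, ‖gradA j A μ (U i s) x‖ ^ 2 + N)
    {t : ℝ} (ht : t ∈ Icc 0 T) :
    ∀ᵐ x ∂μ, expWeight k t * ∑ i, (U i t x) ^ 2 ≤ barrier k T N₀ N t := by
  have hT := S.time_pos
  have hTm : T ∈ Icc 0 T := ⟨hT.le, le_rfl⟩
  -- The bounds M' do not depend on n; all limits below are taken inside one sup-norm ball of radius
  -- R.
  choose φn gn M' happ using fun i => exists_niceApprox_of_bdd S (hg i) hM (hφM i) (hgM i)
  obtain ⟨κ, Kd, W, hκc, hKd, hκK, hκ, hW, hwlim⟩ := exists_continuous_dominated hk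
  choose G hG hGb using fun i => (happ i).dominated
  choose G' hG' hGb' using fun i => (happ i).dominated_gradA
  choose B hB using fun i => (happ i).bdd_mild
  set R := ∑ i, |M' i|
  have hnice : ∀ n i, NiceData P T (φn i n) (gn i n) R := fun n i =>
    ((happ i).nice n).mono ((le_abs_self _).trans
      (Finset.single_le_sum (f := fun i => |M' i|) (fun i _ => abs_nonneg _) (Finset.mem_univ i)))
  set Un : ℕ → Fin l → ℝ → Lp ℝ 2 μ := fun n i => mild P T (φn i n) (gn i n) with hUn
  have hn : ∀ n, _ := fun n => NiceData.stampacchia_le S (hnice n) (hκc n) N₀ N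
    (U := Un n) (fun i => rfl) ht
  have hUlim : ∀ i, ∀ s ∈ Icc 0 T, Tendsto (fun n => Un n i s) atTop (𝓝 (U i s)) := fun i s hs => by
    rw [hU]
    exact (happ i).tendsto_mild.tendsto_at hs
  have hUb : ∀ n i, ∀ s ∈ Icc 0 T, Un n i s ∈ bddSet μ R := fun n i s hs => (hnice n i).bdd_mild s hs
  have hblim : ∀ s ∈ Icc 0 T, Tendsto (fun n => barrier (κ n) T N₀ N s) atTop
      (𝓝 (barrier k T N₀ N s)) := by
    intro s hs
    refine ((hwlim T hTm).const_mul N₀).add (Tendsto.const_mul N ?_)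
    simp only [intervalIntegral.integral_of_le hs.2]
    have hsub : Ioc s T ⊆ Icc 0 T := fun r hr => ⟨hs.1.trans hr.1.le, hr.2⟩
    refine tendsto_integral_of_dominated_convergence (fun _ => W) (fun n => ?_)
      (integrable_const _) (fun n => ?_) ?_
    · exact (continuous_iff_continuousAt.2
        fun t => (expWeight_hasDerivAt (hκc n) t).continuousAt).aestronglyMeasurable
    · filter_upwards [ae_restrict_mem measurableSet_Ioc] with r hr
      rw [Real.norm_of_nonneg (expWeight_pos _ _).le]
      exact hW n r (hsub hr)
    · filter_upwards [ae_restrict_mem measurableSet_Ioc] with r hr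
      exact hwlim r (hsub hr)
  have hQlim : ∀ s ∈ Icc 0 T, Tendsto (fun n => dotL1 (fun i => Un n i s) (fun i => Un n i s)) atTop
      (𝓝 (dotL1 (fun i => U i s) (fun i => U i s))) := fun s hs =>
    tendsto_dotL1 (fun i => hUlim i s hs) (fun i => hUlim i s hs)
  have hQb : ∀ s ∈ Icc 0 T, ∀ n, ∀ᵐ x ∂μ,
      |dotL1 (fun i => Un n i s) (fun i => Un n i s) x| ≤ l * R ^ 2 := fun s hs n =>
    abs_dotL1_self_le fun i => hUb n i s hs
  have hone : ∀ f : E → ℝ, ∫ x, f x * Lp.const 1 μ (1 : ℝ) x ∂μ = ∫ x, f x ∂μ := fun f => by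
    refine integral_congr_ae ?_
    filter_upwards [Lp.coeFn_const (p := 1) (μ := μ) (1 : ℝ)] with x hx
    rw [hx]
    simp
  have hYlim : ∀ s ∈ Icc 0 T, Tendsto (fun n => ∫ x, expNegInvPrimitive (expWeight (κ n) s *
      dotL1 (fun i => Un n i s) (fun i => Un n i s) x - barrier (κ n) T N₀ N s) ∂μ) atTop
      (𝓝 (∫ x, expNegInvPrimitive (expWeight k s *
      dotL1 (fun i => U i s) (fun i => U i s) x - barrier k T N₀ N s) ∂μ)) := by
    intro s hs
    have h1 := tendsto_integral_comp_mul contDiff_expNegInvPrimitive.continuous (hQlim s hs)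
      (hQb s hs) (hwlim s hs) (hblim s hs) (tendsto_const_nhds (x := Lp.const 1 μ (1 : ℝ)))
    simpa only [hone] using h1
  have hsub : Icc t T ⊆ Icc 0 T := Icc_subset_Icc_left ht.1
  have hle : volume.restrict (Icc t T) ≤ volume.restrict (Icc 0 T) :=
    Measure.restrict_mono hsub le_rfl
  set J : ℝ → Lp ℝ 1 μ := fun s => bracketL1 (k s) N (fun i => U i s) (fun i => g i s)
    (fun i => gradA j A μ (U i s)) with hJ
  -- The sign of the bracket is known only for the given data and not for the approximations, so the
  -- inequality is carried to the limit before the sign is used.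
  have hlim := le_of_tendsto_of_tendsto' (((hYlim t ht).const_mul (Real.exp (α * t))).add
    (f := fun n => Real.exp (α * t) * _)
    (g := fun n => ∫ s in t..T, Real.exp (α * s) * (expWeight (κ n) s * ∫ x,
      expNegInvGlue (expWeight (κ n) s *
        dotL1 (fun i => Un n i s) (fun i => Un n i s) x - barrier (κ n) T N₀ N s) *
        bracketL1 (κ n s) N (fun i => Un n i s) (fun i => gn i n s)
          (fun i => gradA j A μ (Un n i s)) x ∂μ))
    (b := ∫ s in t..T, Real.exp (α * s) * (expWeight k s * ∫ x,
      expNegInvGlue (expWeight k s *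
        dotL1 (fun i => U i s) (fun i => U i s) x - barrier k T N₀ N s) * J s x ∂μ)) ?_)
    ((hYlim T hTm).const_mul (Real.exp (α * T))) (fun n => (hn n).2)
  · -- conclusion
    have hQe : ∀ s, dotL1 (fun i => U i s) (fun i => U i s) =ᵐ[μ] fun x => ∑ i, (U i s x) ^ 2 :=
      fun s => by
        filter_upwards [coeFn_dotL1 (fun i => U i s) (fun i => U i s)] with x hx
        rw [hx]
        exact Finset.sum_congr rfl fun i _ => by
          rw [real_inner_self_eq_norm_sq, Real.norm_eq_abs, sq_abs]
    -- At time T the barrier is N₀ times the weight, so |φ|² ≤ N₀ makes the argument nonpositive.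
    have h0 : ∫ x, expNegInvPrimitive (expWeight k T *
        dotL1 (fun i => U i T) (fun i => U i T) x - barrier k T N₀ N T) ∂μ = 0 := by
      refine (integral_congr_ae (g := fun _ => (0 : ℝ)) ?_).trans (by simp)
      filter_upwards [hQe T, hφ] with x h1 h2
      refine expNegInvPrimitive_of_nonpos ?_
      rw [h1]
      simp only [hU, mild_terminal S.semigroup, barrier, intervalIntegral.integral_same]
      nlinarith [mul_le_mul_of_nonneg_left h2 (expWeight_pos k T).le]
    have h1 : 0 ≤ ∫ s in t..T, Real.exp (α * s) * (expWeight k s * ∫ x,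
        expNegInvGlue (expWeight k s *
        dotL1 (fun i => U i s) (fun i => U i s) x - barrier k T N₀ N s) * J s x ∂μ) := by
      rw [intervalIntegral.integral_of_le ht.2, ← integral_Icc_eq_integral_Ioc]
      refine integral_nonneg_of_ae ?_
      filter_upwards [ae_mono hle hbr] with s hs
      refine mul_nonneg (Real.exp_pos _).le (mul_nonneg (expWeight_pos _ _).le
        (integral_nonneg_of_ae ?_))
      filter_upwards [hs, coeFn_bracketL1 (k s) N (fun i => U i s) (fun i => g i s)
        (fun i => gradA j A μ (U i s))] with x h2 h3
      refine mul_nonneg (expNegInvGlue.nonneg _) ?_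
      rw [hJ, h3]
      have e1 : ∑ i, ⟪U i s x, U i s x⟫ = ∑ i, (U i s x) ^ 2 :=
        Finset.sum_congr rfl fun i _ => by rw [real_inner_self_eq_norm_sq, Real.norm_eq_abs, sq_abs]
      have e2 : ∑ i, ⟪gradA j A μ (U i s) x, gradA j A μ (U i s) x⟫ =
          ∑ i, ‖gradA j A μ (U i s) x‖ ^ 2 :=
        Finset.sum_congr rfl fun i _ => real_inner_self_eq_norm_sq _
      have e3 : ∑ i, ⟪U i s x, g i s x⟫ = ∑ i, U i s x * g i s x :=
        Finset.sum_congr rfl fun i _ => mul_comm _ _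
      rw [e1, e2, e3]
      linarith
    rw [h0, mul_zero] at hlim
    -- The integral at time t is squeezed to 0. As the integrand is positive exactly above the
    -- barrier, the barrier is not exceeded.
    have h2 : ∫ x, expNegInvPrimitive (expWeight k t *
        dotL1 (fun i => U i t) (fun i => U i t) x - barrier k T N₀ N t) ∂μ = 0 := by
      refine le_antisymm ?_ (integral_nonneg fun x => expNegInvPrimitive_nonneg _)
      have h3 := Real.exp_pos (α * t)
      by_contra hcon
      nlinarith [mul_pos h3 (not_le.1 hcon)]
    have hUtb : ∀ i, U i t ∈ bddSet μ R := fun i =>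
      (isClosed_bddSet R).mem_of_tendsto (hUlim i t ht)
        (Eventually.of_forall fun n => hUb n i t ht)
    have hint : Integrable (fun x => expNegInvPrimitive (expWeight k t *
        dotL1 (fun i => U i t) (fun i => U i t) x - barrier k T N₀ N t)) μ := by
      obtain ⟨K', hK'⟩ := exists_bound_on_Icc contDiff_expNegInvPrimitive.continuous
        (|expWeight k t| * (l * R ^ 2) + |barrier k T N₀ N t|)
      refine Integrable.of_bound (contDiff_expNegInvPrimitive.continuous.comp_aestronglyMeasurable
        (((Lp.aestronglyMeasurable _).const_mul _).sub aestronglyMeasurable_const)) K' ?_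
      filter_upwards [abs_dotL1_self_le hUtb] with x hx
      refine hK' _ ((abs_sub _ _).trans (add_le_add ?_ le_rfl))
      rw [abs_mul]
      gcongr
    have h4 := (integral_eq_zero_iff_of_nonneg (fun x => expNegInvPrimitive_nonneg _) hint).1 h2
    filter_upwards [h4, hQe t] with x h5 h6
    rw [← h6]
    by_contra hcon
    have h7 := expNegInvPrimitive_pos (sub_pos.2 (not_le.1 hcon))
    rw [Pi.zero_apply] at h5
    exact h7.ne' h5
  · -- convergence of the integrals
    simp only [intervalIntegral.integral_of_le ht.2, ← integral_Icc_eq_integral_Ioc]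
    refine tendsto_integral_of_dominated_convergence (fun s => Real.exp (α * T) * (W *
      (Kd s * (∑ i, B i * B i) + 2 * (∑ i, G' i s) + ‖Lp.const 1 μ N‖ + 2 * ∑ i, B i * G i s)))
      (fun n => ?_) ?_ (fun n => ?_) ?_
    · exact ((hn n).1.mono hsub).aestronglyMeasurable measurableSet_Icc
    · refine Integrable.const_mul (Integrable.const_mul ?_ _) _
      refine Integrable.add (Integrable.add (Integrable.add ?_ ?_) (integrable_const _)) ?_
      · exact (hKd.mono_set hsub).mul_const _
      · exact (integrable_finsetSum _ fun i _ => (hG' i).mono_set hsub).const_mul 2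
      · exact (integrable_finsetSum _ fun i _ =>
          ((hG i).mono_set hsub).const_mul (B i)).const_mul 2
    · filter_upwards [ae_mono hle hκK, ae_mono hle (ae_all_iff.2 hGb),
        ae_mono hle (ae_all_iff.2 hGb'), ae_restrict_mem measurableSet_Icc] with s h1 h2 h3 h4
      have hs := hsub h4
      rw [norm_mul, norm_mul, Real.norm_of_nonneg (Real.exp_pos _).le,
        Real.norm_of_nonneg (expWeight_pos _ _).le]
      have e1 : Real.exp (α * s) ≤ Real.exp (α * T) :=
        Real.exp_le_exp.2 (mul_le_mul_of_nonneg_left h4.2 S.nonneg)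
      have e2 := hW n s hs
      have e3 : ‖∫ x, expNegInvGlue (expWeight (κ n) s *
          dotL1 (fun i => Un n i s) (fun i => Un n i s) x - barrier (κ n) T N₀ N s) *
          bracketL1 (κ n s) N (fun i => Un n i s) (fun i => gn i n s)
          (fun i => gradA j A μ (Un n i s)) x ∂μ‖ ≤
          Kd s * (∑ i, B i * B i) + 2 * (∑ i, G' i s) + ‖Lp.const 1 μ N‖ +
            2 * ∑ i, B i * G i s := by
        refine (norm_integral_le_integral_norm _).trans ?_
        have e4 : ∫ x, ‖expNegInvGlue (expWeight (κ n) s *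
            dotL1 (fun i => Un n i s) (fun i => Un n i s) x - barrier (κ n) T N₀ N s) *
            bracketL1 (κ n s) N (fun i => Un n i s) (fun i => gn i n s)
            (fun i => gradA j A μ (Un n i s)) x‖ ∂μ ≤
            ‖bracketL1 (κ n s) N (fun i => Un n i s) (fun i => gn i n s)
            (fun i => gradA j A μ (Un n i s))‖ := by
          rw [L1_norm_eq]
          refine integral_mono_of_nonneg (Eventually.of_forall fun x => norm_nonneg _)
            (L1_integrable _).norm (Eventually.of_forall fun x => ?_)
          dsimp only
          rw [norm_mul, Real.norm_of_nonneg (expNegInvGlue.nonneg _)]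
          exact mul_le_of_le_one_left (norm_nonneg _) (expNegInvGlue_le_one _)
        refine e4.trans ((norm_bracketL1_le _ _ _ _ _).trans ?_)
        have hBn : ∀ i, ‖Un n i s‖ ≤ B i := fun i => hB i n s hs
        refine add_le_add (add_le_add (add_le_add ?_ ?_) le_rfl) ?_
        · refine mul_le_mul (h1 n) (Finset.sum_le_sum fun i _ => ?_)
            (Finset.sum_nonneg fun i _ => by positivity) ((abs_nonneg _).trans (h1 n))
          exact mul_le_mul (hBn i) (hBn i) (norm_nonneg _) ((norm_nonneg _).trans (hBn i))
        · refine mul_le_mul_of_nonneg_left (Finset.sum_le_sum fun i _ => ?_) (by norm_num)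
          rw [← sq]
          exact h3 i n
        · refine mul_le_mul_of_nonneg_left (Finset.sum_le_sum fun i _ => ?_) (by norm_num)
          exact mul_le_mul (hBn i) (h2 i n) (norm_nonneg _) ((norm_nonneg _).trans (hBn i))
      have hW0 : 0 ≤ W := (expWeight_pos _ _).le.trans e2
      exact mul_le_mul e1 (mul_le_mul e2 e3 (norm_nonneg _) hW0)
        (mul_nonneg (expWeight_pos _ _).le (norm_nonneg _)) (Real.exp_pos _).le
    · filter_upwards [ae_mono hle hκ, ae_mono hle (ae_all_iff.2 fun i => (happ i).tendsto),
        ae_mono hle (ae_all_iff.2 fun i => (happ i).tendsto_gradA),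
        ae_restrict_mem measurableSet_Icc] with s h1 h2 h3 h4
      have hs := hsub h4
      refine ((hwlim s hs).mul ?_).const_mul _
      refine tendsto_integral_comp_mul continuous_expNegInvGlue (hQlim s hs) (hQb s hs)
        (hwlim s hs) (hblim s hs) ?_
      refine tendsto_bracketL1 h1 (fun i => hUlim i s hs) h2 fun i => ?_
      have := h3 i
      rwa [← hU] at this

/-- Energy inequality for systems of mild solutions with a one-sided bound on the source. -/
lemma energy_system_le (S : FormSetting j A b μ T P α) {φ : Fin l → Lp ℝ 2 μ}
    {g : Fin l → ℝ → Lp ℝ 2 μ} (hg : ∀ i, IntegrableOn (g i) (Icc 0 T))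
    {U : Fin l → ℝ → Lp ℝ 2 μ} (hU : ∀ i, ∀ t ∈ Icc 0 T, U i t = mild P T (φ i) (g i) t)
    {k h : ℝ → ℝ} (hk : IntegrableOn k (Icc 0 T)) (hh : IntegrableOn h (Icc 0 T))
    (hbr : ∀ᵐ s ∂(volume.restrict (Icc 0 T)), 2 * ∑ i, ⟪g i s, U i s⟫ ≤
      k s * ∑ i, ‖U i s‖ ^ 2 + h s) {t : ℝ} (ht : t ∈ Icc 0 T) :
    expWeight (fun s => k s + α) t * (∑ i, ‖U i t‖ ^ 2) +
      2 * ∫ s in Icc t T, expWeight (fun s => k s + α) s * ∑ i, ‖gradA j A μ (U i s)‖ ^ 2 ≤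
    expWeight (fun s => k s + α) T * (∑ i, ‖φ i‖ ^ 2) +
      ∫ s in Icc t T, expWeight (fun s => k s + α) s * h s := by
  have hT := S.time_pos
  have hsub : Icc t T ⊆ Icc 0 T := Icc_subset_Icc_left ht.1
  have hle : volume.restrict (Icc t T) ≤ volume.restrict (Icc 0 T) :=
    Measure.restrict_mono hsub le_rfl
  have hkα : IntegrableOn (fun s => k s + α) (Icc 0 T) := Integrable.add hk (integrable_const _)
  set w := expWeight (fun s => k s + α) with hw
  have hwm : AEStronglyMeasurable w (volume.restrict (Icc t T)) :=
    ((continuousOn_expWeight hT.le hkα).mono hsub).aestronglyMeasurable measurableSet_Icc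
  set W := Real.exp (∫ s in Icc 0 T, |k s + α|)
  have hwW : ∀ᵐ s ∂(volume.restrict (Icc t T)), ‖w s‖ ≤ W := by
    filter_upwards [ae_restrict_mem measurableSet_Icc] with s hs
    rw [Real.norm_of_nonneg (expWeight_pos _ _).le]
    exact expWeight_le hkα (hsub hs)
  have hwi : ∀ {f : ℝ → ℝ}, IntegrableOn f (Icc t T) → IntegrableOn (fun s => w s * f s) (Icc t T) :=
    fun hf => Integrable.bdd_mul hf hwm hwW
  have hD : ∀ i, IntegrableOn (fun s => ‖gradA j A μ (U i s)‖ ^ 2) (Icc t T) := fun i => by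
    have h1 : IntegrableOn (fun s => ‖gradA j A μ (mild P T (φ i) (g i) s)‖ ^ 2) (Icc 0 T) :=
      (inFhat_mild S (φ i) (hg i)).memLp.integrable_norm_pow (by norm_num)
    refine (h1.mono_set hsub).congr ?_
    filter_upwards [ae_restrict_mem measurableSet_Icc] with s hs
    rw [hU i s (hsub hs)]
  have hUc : ∀ i, ContinuousOn (U i) (Icc t T) := fun i =>
    ((mild_continuousOn S.semigroup (hg i)).mono hsub).congr fun s hs => hU i s (hsub hs)
  have hkU : ∀ i, IntegrableOn (fun s => k s * ‖U i s‖ ^ 2) (Icc t T) := fun i =>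
    (hk.mono_set hsub).mul_continuousOn ((hUc i).norm.pow 2) isCompact_Icc
  have hgU : ∀ i, IntegrableOn (fun s => ⟪g i s, U i s⟫) (Icc t T) := fun i => by
    obtain ⟨B, hB⟩ := isCompact_Icc.exists_bound_of_continuousOn (hUc i)
    refine Integrable.mono' (((hg i).mono_set hsub).norm.mul_const B)
      (((hg i).mono_set hsub).1.inner ((hUc i).aestronglyMeasurable measurableSet_Icc)) ?_
    filter_upwards [ae_restrict_mem measurableSet_Icc] with s hs
    exact (norm_inner_le_norm _ _).trans (mul_le_mul_of_nonneg_left (hB s hs) (norm_nonneg _))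
  have hi : ∀ i, w t * ‖U i t‖ ^ 2 + ∫ s in Icc t T, w s *
      (2 * ‖gradA j A μ (U i s)‖ ^ 2 + k s * ‖U i s‖ ^ 2 - 2 * ⟪g i s, U i s⟫) ≤
      w T * ‖φ i‖ ^ 2 := fun i => by
    have h1 := energy_mild_le S (φ i) (hg i) hkα ht
    rw [← hU i t ht] at h1
    refine le_trans (add_le_add le_rfl (le_of_eq ?_)) h1
    refine setIntegral_congr_fun measurableSet_Icc fun s hs => ?_
    simp only [hU i s (hsub hs), add_sub_cancel_right]
    rfl
  have hint : ∀ i, IntegrableOn (fun s => w s *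
      (2 * ‖gradA j A μ (U i s)‖ ^ 2 + k s * ‖U i s‖ ^ 2 - 2 * ⟪g i s, U i s⟫)) (Icc t T) :=
    fun i => hwi ((((hD i).const_mul 2).add (hkU i)).sub ((hgU i).const_mul 2))
  have hsumi := Finset.sum_le_sum fun i (_ : i ∈ Finset.univ) => hi i
  rw [Finset.sum_add_distrib, ← Finset.mul_sum, ← Finset.mul_sum,
    ← integral_finsetSum _ fun i _ => hint i] at hsumi
  have i1 : IntegrableOn (fun s => 2 * (w s * ∑ i, ‖gradA j A μ (U i s)‖ ^ 2) - w s * h s)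
      (Icc t T) :=
    ((hwi (integrable_finsetSum _ fun i _ => hD i)).const_mul 2).sub (hwi (hh.mono_set hsub))
  have hmono : ∫ s in Icc t T, (2 * (w s * ∑ i, ‖gradA j A μ (U i s)‖ ^ 2) - w s * h s) ≤
      ∫ s in Icc t T, ∑ i, w s *
        (2 * ‖gradA j A μ (U i s)‖ ^ 2 + k s * ‖U i s‖ ^ 2 - 2 * ⟪g i s, U i s⟫) := by
    refine integral_mono_ae i1 (integrable_finsetSum _ fun i _ => hint i) ?_
    filter_upwards [ae_mono hle hbr] with s hs
    rw [← Finset.mul_sum, Finset.sum_sub_distrib, Finset.sum_add_distrib, ← Finset.mul_sum,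
      ← Finset.mul_sum, ← Finset.mul_sum]
    nlinarith [expWeight_pos (fun s => k s + α) s]
  rw [integral_sub ((hwi (integrable_finsetSum _ fun i _ => hD i)).const_mul 2)
    (hwi (hh.mono_set hsub)), integral_const_mul] at hmono
  linarith

end MaximumPrinciple

/-! ### Banach's fixed point theorem in weighted L² -/

section FixedPoint

variable {X β : Type*} [NormedAddCommGroup X] [InnerProductSpace ℝ X] [CompleteSpace X]
  [MeasurableSpace β] {ν : Measure β} {l : ℕ}

/-- Banach's fixed point theorem in `L²(ν; X)^l`, stated for functions. -/
lemma exists_fixedPoint (Φ : (Fin l → β → X) → Fin l → β → X)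
    (hΦ : ∀ V, (∀ i, MemLp (V i) 2 ν) → ∀ i, MemLp (Φ V i) 2 ν)
    (hc : ∀ V V', (∀ i, MemLp (V i) 2 ν) → (∀ i, MemLp (V' i) 2 ν) →
      ∑ i, ∫ s, ‖Φ V i s - Φ V' i s‖ ^ 2 ∂ν ≤ 1 / 2 * ∑ i, ∫ s, ‖V i s - V' i s‖ ^ 2 ∂ν) :
    ∃ V, (∀ i, MemLp (V i) 2 ν) ∧ ∀ i, Φ V i =ᵐ[ν] V i := by
  have hm : ∀ z : PiLp 2 (fun _ : Fin l => Lp X 2 ν), ∀ i, MemLp (fun s => z i s) 2 ν :=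
    fun z i => Lp.memLp (z i)
  set Ψ : PiLp 2 (fun _ : Fin l => Lp X 2 ν) → PiLp 2 (fun _ : Fin l => Lp X 2 ν) := fun z =>
    WithLp.toLp 2 fun i => (hΦ (fun i s => z i s) (hm z) i).toLp with hΨ
  have hΨe : ∀ z i, Ψ z i =ᵐ[ν] Φ (fun i s => z i s) i := fun z i =>
    (hΦ (fun i s => z i s) (hm z) i).coeFn_toLp
  have key : ∀ z z', ‖Ψ z - Ψ z'‖ ^ 2 ≤ 1 / 2 * ‖z - z'‖ ^ 2 := by
    intro z z'
    rw [PiLp.norm_sq_eq_of_L2, PiLp.norm_sq_eq_of_L2]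
    simp only [PiLp.sub_apply, Lp_norm_sq]
    refine le_trans (le_of_eq ?_) ((hc _ _ (hm z) (hm z')).trans (le_of_eq ?_))
    · refine Finset.sum_congr rfl fun i _ => integral_congr_ae ?_
      filter_upwards [Lp.coeFn_sub (Ψ z i) (Ψ z' i), hΨe z i, hΨe z' i] with s h1 h2 h3
      rw [h1, Pi.sub_apply, h2, h3]
    · congr 1
      refine Finset.sum_congr rfl fun i _ => integral_congr_ae ?_
      filter_upwards [Lp.coeFn_sub (z i) (z' i)] with s h1
      rw [h1, Pi.sub_apply]
  have hK : ContractingWith (NNReal.sqrt (1 / 2)) Ψ := by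
    constructor
    · rw [← NNReal.sqrt_one, NNReal.sqrt_lt_sqrt]
      norm_num
    · refine LipschitzWith.of_dist_le_mul fun z z' => ?_
      rw [dist_eq_norm, dist_eq_norm, Real.coe_sqrt]
      refine abs_le_of_sq_le_sq' ?_ (by positivity) |>.2
      rw [mul_pow, Real.sq_sqrt (by positivity)]
      simpa using key z z'
  refine ⟨fun i s => hK.fixedPoint Ψ i s, hm _, fun i => (hΨe _ i).symm.trans ?_⟩
  rw [hK.fixedPoint_isFixedPt]

/-- Banach's fixed point theorem in a weighted `L²(ν; X)^l`, stated for functions. -/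
lemma exists_fixedPoint_weighted {w : β → ℝ} (hw : AEMeasurable w ν) {W : ℝ}
    (hw1 : ∀ᵐ s ∂ν, 1 ≤ w s) (hwW : ∀ᵐ s ∂ν, w s ≤ W)
    (Φ : (Fin l → β → X) → Fin l → β → X)
    (hΦ : ∀ V, (∀ i, MemLp (V i) 2 ν) → ∀ i, MemLp (Φ V i) 2 ν)
    (hc : ∀ V V', (∀ i, MemLp (V i) 2 ν) → (∀ i, MemLp (V' i) 2 ν) →
      ∫ s, w s * ∑ i, ‖Φ V i s - Φ V' i s‖ ^ 2 ∂ν ≤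
        1 / 2 * ∫ s, w s * ∑ i, ‖V i s - V' i s‖ ^ 2 ∂ν) :
    ∃ V, (∀ i, MemLp (V i) 2 ν) ∧ ∀ i, Φ V i =ᵐ[ν] V i := by
  set ρ : β → ℝ≥0 := fun s => (w s).toNNReal
  have hρ : AEMeasurable ρ ν := hw.real_toNNReal
  -- Since 1 ≤ w ≤ W, square integrability is the same for ν and ν', and null sets of ν' are null
  -- for ν.
  set ν' := ν.withDensity fun s => (ρ s : ℝ≥0∞) with hν'
  have hle : ν ≤ ν' := by
    refine Measure.le_iff.2 fun B hB => ?_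
    rw [hν', withDensity_apply _ hB, ← setLIntegral_one]
    refine lintegral_mono_ae ((ae_restrict_of_ae hw1).mono fun s hs => ?_)
    exact ENNReal.one_le_coe_iff.2 (Real.one_le_toNNReal.2 hs)
  have hle' : ν' ≤ ENNReal.ofReal W • ν := by
    refine Measure.le_iff.2 fun B hB => ?_
    rw [hν', withDensity_apply _ hB, Measure.smul_apply, smul_eq_mul, ← setLIntegral_const]
    refine lintegral_mono_ae ((ae_restrict_of_ae hwW).mono fun s hs => ?_)
    exact ENNReal.coe_le_coe.2 (Real.toNNReal_le_toNNReal hs)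
  have hm : ∀ {f : β → X}, MemLp f 2 ν' ↔ MemLp f 2 ν := fun {f} =>
    ⟨fun h => h.mono_measure hle, fun h => h.of_measure_le_smul ENNReal.ofReal_ne_top hle'⟩
  have hint : ∀ {V V' : Fin l → β → X}, (∀ i, MemLp (V i) 2 ν) → (∀ i, MemLp (V' i) 2 ν) →
      ∑ i, ∫ s, ‖V i s - V' i s‖ ^ 2 ∂ν' = ∫ s, w s * ∑ i, ‖V i s - V' i s‖ ^ 2 ∂ν := by
    intro V V' hV hV'
    have hi : ∀ i, Integrable (fun s => ‖V i s - V' i s‖ ^ 2) ν' := fun i =>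
      ((hm.2 (hV i)).sub (hm.2 (hV' i))).integrable_norm_pow (by norm_num)
    rw [← integral_finsetSum _ fun i _ => hi i, hν',
      integral_withDensity_eq_integral_smul₀ hρ]
    refine integral_congr_ae (hw1.mono fun s hs => ?_)
    simp only [ρ, NNReal.smul_def, Real.coe_toNNReal _ (zero_le_one.trans hs), smul_eq_mul]
  obtain ⟨V, hV, hfix⟩ := exists_fixedPoint (ν := ν') Φ
    (fun V hV i => hm.2 (hΦ V (fun i => hm.1 (hV i)) i)) fun V V' hV hV' => by
      have hV1 := fun i => hm.1 (hV i)
      have hV1' := fun i => hm.1 (hV' i)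
      rw [hint hV1 hV1', hint (hΦ V hV1) (hΦ V' hV1')]
      exact hc V V' hV1 hV1'
  exact ⟨V, fun i => hm.1 (hV i), fun i => ae_mono hle (hfix i)⟩

end FixedPoint

/-! ### Pointwise inequalities and convergence of superpositions -/

section Algebra

variable {E F : Type*} [MeasurableSpace E] {μ : Measure E}
  [NormedAddCommGroup F] [InnerProductSpace ℝ F] {l : ℕ}

/-- Young's inequality in each summand, arranged so that the squares s_i² appear with coefficient 1.
The energy inequality offers coefficient 2 and can absorb them. -/
lemma two_mul_mul_sum_le (a C : ℝ) (s : Fin l → ℝ) :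
    2 * a * (C * ∑ i, s i) ≤ C ^ 2 * l * a ^ 2 + ∑ i, s i ^ 2 := by
  have h : ∑ i, 2 * a * (C * s i) ≤ ∑ i, (C ^ 2 * a ^ 2 + s i ^ 2) :=
    Finset.sum_le_sum fun i _ => by nlinarith [sq_nonneg (C * a - s i)]
  rw [Finset.sum_add_distrib, Finset.sum_const, Finset.card_univ, Fintype.card_fin,
    nsmul_eq_mul, ← Finset.mul_sum, ← Finset.mul_sum] at h
  linarith

/-- A pointwise quadratic inequality integrates to one for `L²`-functions. -/
lemma two_sum_inner_le {a c : Fin l → Lp ℝ 2 μ} {e : Fin l → Lp F 2 μ} {k : ℝ} {d : E → ℝ}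
    (hd : Integrable d μ)
    (h : ∀ᵐ x ∂μ, 2 * ∑ i, a i x * c i x ≤ k * ∑ i, (c i x) ^ 2 + ∑ i, ‖e i x‖ ^ 2 + d x) :
    2 * ∑ i, ⟪a i, c i⟫ ≤ k * ∑ i, ‖c i‖ ^ 2 + ∑ i, ‖e i‖ ^ 2 + ∫ x, d x ∂μ := by
  have h1 : ∀ i, Integrable (fun x => a i x * c i x) μ := fun i => by
    simpa [mul_comm] using L2.integrable_inner (𝕜 := ℝ) (a i) (c i)
  have h2 : ∀ i, Integrable (fun x => (c i x) ^ 2) μ := fun i => by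
    simpa using Lp_integrable_norm_sq (c i)
  have h3 : ∀ i, ⟪a i, c i⟫ = ∫ x, a i x * c i x ∂μ := fun i => by
    rw [L2.inner_def]
    exact integral_congr_ae (Eventually.of_forall fun x => mul_comm _ _)
  have h4 : ∀ i, ‖c i‖ ^ 2 = ∫ x, (c i x) ^ 2 ∂μ := fun i => by
    rw [Lp_norm_sq]
    simp
  have h5 : Integrable (fun x => k * ∑ i, (c i x) ^ 2) μ :=
    (integrable_finsetSum _ fun i _ => h2 i).const_mul k
  have h6 : Integrable (fun x => ∑ i, ‖e i x‖ ^ 2) μ :=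
    integrable_finsetSum _ fun i _ => Lp_integrable_norm_sq (e i)
  have h7 : Integrable (fun x => k * ∑ i, (c i x) ^ 2 + ∑ i, ‖e i x‖ ^ 2) μ := h5.add h6
  simp only [h3, h4, Lp_norm_sq (e _)]
  rw [← integral_finsetSum _ fun i _ => h1 i, ← integral_finsetSum _ fun i _ => h2 i,
    ← integral_finsetSum _ fun i _ => Lp_integrable_norm_sq (e i), ← integral_const_mul,
    ← integral_const_mul, ← integral_add h5 h6, ← integral_add h7 hd]
  exact integral_mono_ae ((integrable_finsetSum _ fun i _ => h1 i).const_mul 2) (h7.add hd) h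

lemma norm_vec_sq (v : Fin l → Lp ℝ 2 μ) (x : E) : ‖vec v x‖ ^ 2 = ∑ i, (v i x) ^ 2 := by
  rw [PiLp.norm_sq_eq_of_L2]
  simp [vec]

lemma norm_vec_sub_sq (v w : Fin l → Lp ℝ 2 μ) (x : E) :
    ‖vec v x - vec w x‖ ^ 2 = ∑ i, (v i x - w i x) ^ 2 := by
  rw [PiLp.norm_sq_eq_of_L2]
  simp [vec]

lemma inner_vec_sub (v w : Fin l → Lp ℝ 2 μ) (x : E) (a a' : EuclideanSpace ℝ (Fin l)) :
    ⟪vec v x - vec w x, a - a'⟫ = ∑ i, (a i - a' i) * (v i x - w i x) := by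
  rw [PiLp.inner_apply]
  simp [vec]

lemma ae_coeFn_sub (v w : Fin l → Lp F 2 μ) :
    ∀ᵐ x ∂μ, ∀ i, (v i - w i : Lp F 2 μ) x = v i x - w i x := by
  rw [ae_all_iff]
  exact fun i => Lp.coeFn_sub _ _

/-- Summing the squared distances over the components allows a single extraction for the whole
vector. -/
lemma exists_subseq_tendsto_vec {u : ℕ → Fin l → Lp ℝ 2 μ} {u' : Fin l → Lp ℝ 2 μ}
    (hu : ∀ i, Tendsto (fun n => u n i) atTop (𝓝 (u' i))) :
    ∃ ns : ℕ → ℕ, StrictMono ns ∧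
      ∀ᵐ x ∂μ, Tendsto (fun n => vec (u (ns n)) x) atTop (𝓝 (vec u' x)) := by
  have h1 : Tendsto (fun n => ∫ x, ‖‖vec (u n) x - vec u' x‖ ^ 2‖ ∂μ) atTop (𝓝 0) := by
    have h2 : ∀ n, ∫ x, ‖‖vec (u n) x - vec u' x‖ ^ 2‖ ∂μ = ∑ i, ‖u n i - u' i‖ ^ 2 := by
      intro n
      simp only [Lp_norm_sq]
      rw [← integral_finsetSum _ fun i _ => Lp_integrable_norm_sq _]
      refine integral_congr_ae ?_
      filter_upwards [ae_coeFn_sub (u n) u'] with x hx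
      rw [norm_pow, norm_norm, norm_vec_sub_sq]
      simp only [hx, Real.norm_eq_abs, sq_abs]
    simp only [h2]
    have h3 : Tendsto (fun n => ∑ i, ‖u n i - u' i‖ ^ 2) atTop
        (𝓝 (∑ i : Fin l, ‖u' i - u' i‖ ^ 2)) :=
      tendsto_finsetSum _ fun i _ => ((hu i).sub_const (u' i)).norm.pow 2
    simpa using h3
  have h2 : ∀ n, Integrable (fun x => ‖vec (u n) x - vec u' x‖ ^ 2) μ := fun n => by
    have := integrable_finsetSum Finset.univ fun i (_ : i ∈ Finset.univ) =>
      Lp_integrable_norm_sq (u n i - u' i)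
    refine this.congr ?_
    filter_upwards [ae_coeFn_sub (u n) u'] with x hx
    simp only [norm_vec_sub_sq, hx, Real.norm_eq_abs, sq_abs]
  obtain ⟨ms, hms, -, -, -, hlim⟩ := exists_subseq_dominated h2 h1
  refine ⟨ms, hms, hlim.mono fun x e1 => ?_⟩
  rw [tendsto_iff_norm_sub_tendsto_zero]
  simpa [Real.sqrt_sq (norm_nonneg _)] using e1.sqrt

/-- Continuous convergence of the nonlinearities and domination imply convergence of the
superposition operators. -/
lemma tendsto_superposition {g : ℕ → Lp ℝ 2 μ} {g' : Lp ℝ 2 μ} {u : ℕ → Fin l → Lp ℝ 2 μ}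
    {u' : Fin l → Lp ℝ 2 μ} (hu : ∀ i, Tendsto (fun n => u n i) atTop (𝓝 (u' i)))
    {f : ℕ → E → EuclideanSpace ℝ (Fin l) → ℝ} {f' : E → EuclideanSpace ℝ (Fin l) → ℝ}
    (hg : ∀ n, ∀ᵐ x ∂μ, g n x = f n x (vec (u n) x)) (hg' : ∀ᵐ x ∂μ, g' x = f' x (vec u' x))
    (hf : ∀ᵐ x ∂μ, ∀ y, Tendsto (fun p : ℕ × EuclideanSpace ℝ (Fin l) => f p.1 x p.2)
      (atTop ×ˢ 𝓝 y) (𝓝 (f' x y)))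
    {D : E → ℝ} (hD : MemLp D 2 μ) (hb : ∀ n, ∀ᵐ x ∂μ, |g n x| ≤ D x) :
    Tendsto g atTop (𝓝 g') := by
  refine tendsto_of_subseq_tendsto fun ns hns => ?_
  obtain ⟨ms, hms, hlim⟩ := exists_subseq_tendsto_vec fun i => (hu i).comp hns
  refine ⟨ms, Lp_tendsto_of_dominated hD (fun n => hb _) ?_⟩
  filter_upwards [hlim, hf, hg', ae_all_iff.2 hg] with x e1 e2 e3 e4
  simp only [e4, e3]
  exact (e2 (vec u' x)).comp ((hns.comp hms.tendsto_atTop).prodMk e1)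

end Algebra

/-! ### Stability under one-sided bounds -/

section Stability

variable {E H : Type*} [NormedAddCommGroup E] [NormedSpace ℝ E]
  [NormedAddCommGroup H] [InnerProductSpace ℝ H] [CompleteSpace H]
  [MeasurableSpace E] [BorelSpace E] {j : H →L[ℝ] E} {A : E → H →L[ℝ] H} {b : E → H}
  {μ : Measure E} [IsFiniteMeasure μ] {T : ℝ} {P : ℝ → Lp ℝ 2 μ →L[ℝ] Lp ℝ 2 μ} {α : ℝ} {l : ℕ}

lemma InFhat.congr {u u' : ℝ → Lp ℝ 2 μ} (h : InFhat j A μ T u) (he : EqOn u' u (Icc 0 T)) :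
    InFhat j A μ T u' := by
  refine ⟨h.continuousOn.congr he, ?_, h.memLp.ae_eq ?_⟩
  · filter_upwards [h.mem, ae_restrict_mem measurableSet_Icc] with t ht ht'
    rwa [he ht']
  · filter_upwards [ae_restrict_mem measurableSet_Icc] with t ht
    rw [he ht]

lemma InFhat.gradA_sub (S : FormSetting j A b μ T P α) {u u' : ℝ → Lp ℝ 2 μ}
    (h : InFhat j A μ T u) (h' : InFhat j A μ T u') :
    ∀ᵐ t ∂(volume.restrict (Icc 0 T)),
      gradA j A μ (u t - u' t) = gradA j A μ (u t) - gradA j A μ (u' t) := by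
  filter_upwards [h.mem, h'.mem] with t h1 h2
  exact ((hasGradA_gradA h1).sub (hasGradA_gradA h2)).gradA_eq S.pos S.condA1

/-- Energy inequality for the difference of two systems of mild solutions. -/
lemma energy_sub_le (S : FormSetting j A b μ T P α) {φ φ' : Fin l → Lp ℝ 2 μ}
    {g g' : Fin l → ℝ → Lp ℝ 2 μ} (hg : ∀ i, IntegrableOn (g i) (Icc 0 T))
    (hg' : ∀ i, IntegrableOn (g' i) (Icc 0 T)) {u u' : Fin l → ℝ → Lp ℝ 2 μ}
    (hu : ∀ i, ∀ t ∈ Icc 0 T, u i t = mild P T (φ i) (g i) t)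
    (hu' : ∀ i, ∀ t ∈ Icc 0 T, u' i t = mild P T (φ' i) (g' i) t)
    {k h : ℝ → ℝ} (hk : IntegrableOn k (Icc 0 T)) (hh : IntegrableOn h (Icc 0 T))
    (hbr : ∀ᵐ s ∂(volume.restrict (Icc 0 T)), 2 * ∑ i, ⟪g i s - g' i s, u i s - u' i s⟫ ≤
      k s * ∑ i, ‖u i s - u' i s‖ ^ 2 + h s) {t : ℝ} (ht : t ∈ Icc 0 T) :
    expWeight (fun s => k s + α) t * (∑ i, ‖u i t - u' i t‖ ^ 2) +
      2 * ∫ s in Icc t T, expWeight (fun s => k s + α) s *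
        ∑ i, ‖gradA j A μ (u i s) - gradA j A μ (u' i s)‖ ^ 2 ≤
    expWeight (fun s => k s + α) T * (∑ i, ‖φ i - φ' i‖ ^ 2) +
      ∫ s in Icc t T, expWeight (fun s => k s + α) s * h s := by
  have h1 := energy_system_le S (φ := fun i => φ i - φ' i) (g := fun i s => g i s - g' i s)
    (fun i => (hg i).sub (hg' i)) (U := fun i s => u i s - u' i s) (fun i s hs => by
      rw [mild_sub S.semigroup (hg i) (hg' i) hs, hu i s hs, hu' i s hs]) hk hh hbr ht
  have h2 : ∀ᵐ s ∂(volume.restrict (Icc t T)), ∀ i, gradA j A μ (u i s - u' i s) =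
      gradA j A μ (u i s) - gradA j A μ (u' i s) := by
    refine ae_mono (Measure.restrict_mono (Icc_subset_Icc_left ht.1) le_rfl) (ae_all_iff.2 fun i => ?_)
    exact ((inFhat_mild S (φ i) (hg i)).congr (hu i)).gradA_sub S
      ((inFhat_mild S (φ' i) (hg' i)).congr (hu' i))
  refine le_trans (le_of_eq ?_) h1
  congr 2
  refine integral_congr_ae ?_
  filter_upwards [h2] with s hs
  simp only [hs]

/-- Stability of mild solutions under a one-sided bound on the difference of the sources. -/
lemma stability_le (S : FormSetting j A b μ T P α) {φ φ' : Fin l → Lp ℝ 2 μ}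
    {g g' : Fin l → ℝ → Lp ℝ 2 μ} (hg : ∀ i, IntegrableOn (g i) (Icc 0 T))
    (hg' : ∀ i, IntegrableOn (g' i) (Icc 0 T)) {u u' : Fin l → ℝ → Lp ℝ 2 μ}
    (hu : ∀ i, ∀ t ∈ Icc 0 T, u i t = mild P T (φ i) (g i) t)
    (hu' : ∀ i, ∀ t ∈ Icc 0 T, u' i t = mild P T (φ' i) (g' i) t)
    {k h : ℝ → ℝ} (hk : IntegrableOn k (Icc 0 T)) (hk0 : ∀ s, 0 ≤ k s)
    (hh : IntegrableOn h (Icc 0 T)) (hh0 : ∀ᵐ s ∂(volume.restrict (Icc 0 T)), 0 ≤ h s)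
    (hbr : ∀ᵐ s ∂(volume.restrict (Icc 0 T)), 2 * ∑ i, ⟪g i s - g' i s, u i s - u' i s⟫ ≤
      k s * ∑ i, ‖u i s - u' i s‖ ^ 2 +
        ∑ i, ‖gradA j A μ (u i s) - gradA j A μ (u' i s)‖ ^ 2 + h s)
    {t : ℝ} (ht : t ∈ Icc 0 T) :
    (∑ i, ‖u i t - u' i t‖ ^ 2) +
      ∫ s in Icc t T, ∑ i, ‖gradA j A μ (u i s) - gradA j A μ (u' i s)‖ ^ 2 ≤
    Real.exp (∫ s in Icc 0 T, |k s + α|) *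
      ((∑ i, ‖φ i - φ' i‖ ^ 2) + ∫ s in Icc 0 T, h s) := by
  have hT := S.time_pos
  set D : ℝ → ℝ := fun s => ∑ i, ‖gradA j A μ (u i s) - gradA j A μ (u' i s)‖ ^ 2 with hD
  set w := expWeight (fun s => k s + α) with hw
  set W := Real.exp (∫ s in Icc 0 T, |k s + α|)
  have hkα : IntegrableOn (fun s => k s + α) (Icc 0 T) := Integrable.add hk (integrable_const _)
  have hsub : Icc t T ⊆ Icc 0 T := Icc_subset_Icc_left ht.1
  have hle : volume.restrict (Icc t T) ≤ volume.restrict (Icc 0 T) :=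
    Measure.restrict_mono hsub le_rfl
  have hDi : IntegrableOn D (Icc 0 T) := integrable_finsetSum _ fun i _ =>
    (((inFhat_mild S (φ i) (hg i)).congr (hu i)).memLp.sub
      ((inFhat_mild S (φ' i) (hg' i)).congr (hu' i)).memLp).integrable_norm_pow (by norm_num)
  have hD0 : ∀ s, 0 ≤ D s := fun s => Finset.sum_nonneg fun i _ => by positivity
  have hwm : AEStronglyMeasurable w (volume.restrict (Icc 0 T)) :=
    (continuousOn_expWeight hT.le hkα).aestronglyMeasurable measurableSet_Icc
  have hw1 : ∀ s ∈ Icc 0 T, 1 ≤ w s := fun s hs =>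
    one_le_expWeight (fun s => add_nonneg (hk0 s) S.nonneg) hs.1
  have hwW : ∀ s ∈ Icc 0 T, w s ≤ W := fun s hs => expWeight_le hkα hs
  have hwi : ∀ {f : ℝ → ℝ}, IntegrableOn f (Icc 0 T) → IntegrableOn (fun s => w s * f s) (Icc 0 T) :=
    fun {f} hf => Integrable.bdd_mul hf hwm (c := W) (by
      filter_upwards [ae_restrict_mem measurableSet_Icc] with s hs
      rw [Real.norm_of_nonneg (zero_le_one.trans (hw1 s hs))]
      exact hwW s hs)
  -- The squared gradient difference D enters as part of the error, and the factor 2 on the left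
  -- leaves one copy of it over.
  have key := energy_sub_le S hg hg' hu hu' (h := fun s => D s + h s) hk (hDi.add hh)
    (hbr.mono fun s hs => hs.trans_eq (add_assoc _ _ _)) ht
  simp only [mul_add] at key
  rw [integral_add ((hwi hDi).mono_set hsub) ((hwi hh).mono_set hsub)] at key
  have e1 : ∫ s in Icc t T, D s ≤ ∫ s in Icc t T, w s * D s := by
    refine setIntegral_mono_on (hDi.mono_set hsub) ((hwi hDi).mono_set hsub) measurableSet_Icc
      fun s hs => le_mul_of_one_le_left (hD0 s) (hw1 s (hsub hs))
  have e2 : ∫ s in Icc t T, w s * h s ≤ W * ∫ s in Icc 0 T, h s := by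
    rw [← integral_const_mul]
    refine le_trans (integral_mono_ae ((hwi hh).mono_set hsub) ((hh.mono_set hsub).const_mul W) ?_)
      (setIntegral_mono_set (hh.const_mul W) ?_ hsub.eventuallyLE)
    · filter_upwards [ae_mono hle hh0, ae_restrict_mem measurableSet_Icc] with s h1 h2
      exact mul_le_mul_of_nonneg_right (hwW s (hsub h2)) h1
    · filter_upwards [hh0] with s h1 using mul_nonneg (Real.exp_pos _).le h1
  have e3 : ∑ i, ‖u i t - u' i t‖ ^ 2 ≤ w t * ∑ i, ‖u i t - u' i t‖ ^ 2 :=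
    le_mul_of_one_le_left (Finset.sum_nonneg fun i _ => by positivity) (hw1 t ht)
  have e4 : w T * ∑ i, ‖φ i - φ' i‖ ^ 2 ≤ W * ∑ i, ‖φ i - φ' i‖ ^ 2 :=
    mul_le_mul_of_nonneg_right (hwW T ⟨hT.le, le_rfl⟩)
      (Finset.sum_nonneg fun i _ => by positivity)
  rw [mul_add]
  linarith

/-- Mild solutions of approximating problems whose sources satisfy a one-sided Cauchy condition
converge. -/
lemma exists_limit_of_stability (S : FormSetting j A b μ T P α) {φ : Fin l → Lp ℝ 2 μ}
    {g : ℕ → Fin l → ℝ → Lp ℝ 2 μ} (hg : ∀ n i, IntegrableOn (g n i) (Icc 0 T))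
    {u : ℕ → Fin l → ℝ → Lp ℝ 2 μ} (hu : ∀ n i, ∀ t ∈ Icc 0 T, u n i t = mild P T (φ i) (g n i) t)
    {k : ℝ → ℝ} (hk : IntegrableOn k (Icc 0 T)) (hk0 : ∀ s, 0 ≤ k s) {h : ℕ → ℕ → ℝ → ℝ}
    (hh : ∀ n m, n ≤ m → IntegrableOn (h n m) (Icc 0 T))
    (hh0 : ∀ n m, n ≤ m → ∀ᵐ s ∂(volume.restrict (Icc 0 T)), 0 ≤ h n m s)
    {c : ℕ → ℝ} (hc : Tendsto c atTop (𝓝 0))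
    (hhc : ∀ n m, n ≤ m → ∫ s in Icc 0 T, h n m s ≤ c n)
    (hbr : ∀ n m, n ≤ m → ∀ᵐ s ∂(volume.restrict (Icc 0 T)),
      2 * ∑ i, ⟪g n i s - g m i s, u n i s - u m i s⟫ ≤
      k s * ∑ i, ‖u n i s - u m i s‖ ^ 2 +
        ∑ i, ‖gradA j A μ (u n i s) - gradA j A μ (u m i s)‖ ^ 2 + h n m s) :
    ∃ (U : Fin l → ℝ → Lp ℝ 2 μ) (V : Fin l → ℝ → Lp H 2 μ),
      (∀ i, ∀ t ∈ Icc 0 T, Tendsto (fun n => u n i t) atTop (𝓝 (U i t))) ∧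
      (∀ i, MemLp (V i) 2 (volume.restrict (Icc 0 T))) ∧
      (∀ i, Tendsto (fun n => ∫ s in Icc 0 T, ‖gradA j A μ (u n i s) - V i s‖ ^ 2) atTop (𝓝 0)) ∧
      ∀ i, ∀ᵐ s ∂(volume.restrict (Icc 0 T)), HasGradA j A μ (U i s) (V i s) := by
  have hT := S.time_pos
  set W := Real.exp (∫ s in Icc 0 T, |k s + α|)
  -- A bound depending on the smaller index only, valid at every time: it makes the solutions Cauchy
  -- in L² at each t and, at t = 0, the gradients Cauchy in L²(0,T;L²).
  have key : ∀ n m, n ≤ m → ∀ t ∈ Icc 0 T, (∑ i, ‖u n i t - u m i t‖ ^ 2) +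
      ∫ s in Icc t T, ∑ i, ‖gradA j A μ (u n i s) - gradA j A μ (u m i s)‖ ^ 2 ≤ W * c n := by
    intro n m hnm t ht
    refine (stability_le S (hg n) (hg m) (hu n) (hu m) hk hk0 (hh n m hnm) (hh0 n m hnm)
      (hbr n m hnm) ht).trans ?_
    simp only [sub_self, norm_zero]
    have := mul_le_mul_of_nonneg_left (hhc n m hnm) (Real.exp_pos (∫ s in Icc 0 T, |k s + α|)).le
    simpa using this
  have hWc : Tendsto (fun n => W * c n) atTop (𝓝 0) := by simpa using hc.const_mul W
  have hF : ∀ n i, InFhat j A μ T (u n i) := fun n i => (inFhat_mild S (φ i) (hg n i)).congr (hu n i)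
  have hcau : ∀ i, ∀ t ∈ Icc 0 T, ∃ x, Tendsto (fun n => u n i t) atTop (𝓝 x) := by
    intro i t ht
    refine cauchySeq_tendsto_of_complete (cauchySeq_of_le_tendsto_0' (fun n => √(W * c n))
      (fun n m hnm => ?_) (by simpa using hWc.sqrt))
    rw [dist_eq_norm]
    refine Real.le_sqrt_of_sq_le (le_trans ?_ (key n m hnm t ht))
    have h1 := Finset.single_le_sum (f := fun i => ‖u n i t - u m i t‖ ^ 2)
      (fun i _ => by positivity) (Finset.mem_univ i)
    have h2 : 0 ≤ ∫ s in Icc t T, ∑ i, ‖gradA j A μ (u n i s) - gradA j A μ (u m i s)‖ ^ 2 :=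
      integral_nonneg fun s => Finset.sum_nonneg fun i _ => by positivity
    linarith
  have hgrad : ∀ i, ∃ V : ℝ → Lp H 2 μ, MemLp V 2 (volume.restrict (Icc 0 T)) ∧
      Tendsto (fun n => ∫ s in Icc 0 T, ‖gradA j A μ (u n i s) - V s‖ ^ 2) atTop (𝓝 0) := by
    intro i
    refine exists_L2_limit (fun n => (hF n i).memLp) hWc fun n m hnm => ?_
    refine le_trans ?_ (key n m hnm 0 ⟨le_rfl, hT.le⟩)
    have hi : ∀ i, IntegrableOn (fun s => ‖gradA j A μ (u n i s) - gradA j A μ (u m i s)‖ ^ 2)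
        (Icc 0 T) := fun i => ((hF n i).memLp.sub (hF m i).memLp).integrable_norm_pow (by norm_num)
    have h1 : ∫ s in Icc 0 T, ‖gradA j A μ (u n i s) - gradA j A μ (u m i s)‖ ^ 2 ≤
        ∫ s in Icc 0 T, ∑ i, ‖gradA j A μ (u n i s) - gradA j A μ (u m i s)‖ ^ 2 :=
      integral_mono (hi i) (integrable_finsetSum _ fun i _ => hi i) fun s =>
        Finset.single_le_sum (f := fun i => ‖gradA j A μ (u n i s) - gradA j A μ (u m i s)‖ ^ 2)
          (fun i _ => by positivity) (Finset.mem_univ i)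
    have h2 : 0 ≤ ∑ i, ‖u n i 0 - u m i 0‖ ^ 2 := Finset.sum_nonneg fun i _ => by positivity
    linarith
  choose V hV hVlim using hgrad
  classical
  choose! U hU using hcau
  refine ⟨U, V, hU, hV, hVlim, fun i => ?_⟩
  have hi : ∀ n, Integrable (fun s => ‖gradA j A μ (u n i s) - V i s‖ ^ 2)
      (volume.restrict (Icc 0 T)) := fun n =>
    ((hF n i).memLp.sub (hV i)).integrable_norm_pow (by norm_num)
  -- Along a subsequence the gradients converge for almost every time, and closedness identifies V
  -- as the gradient of U.
  obtain ⟨ns, hns, -, -, -, hlim⟩ := exists_subseq_dominated hi (by simpa using hVlim i)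
  filter_upwards [hlim, ae_all_iff.2 fun n => (hF n i).mem, ae_restrict_mem measurableSet_Icc]
    with s h1 h2 h3
  refine HasGradA.of_tendsto (fun n => hasGradA_gradA (h2 (ns n)))
    ((hU i s h3).comp hns.tendsto_atTop) ?_
  rw [tendsto_iff_norm_sub_tendsto_zero]
  simpa [Real.sqrt_sq (norm_nonneg _)] using h1.sqrt

lemma tendsto_mild_of_tendsto_integral (S : FormSetting j A b μ T P α) {φ : Lp ℝ 2 μ}
    {g : ℕ → ℝ → Lp ℝ 2 μ} {g' : ℝ → Lp ℝ 2 μ} (hg : ∀ n, IntegrableOn (g n) (Icc 0 T))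
    (hg' : IntegrableOn g' (Icc 0 T))
    (h : Tendsto (fun n => ∫ s in Icc 0 T, ‖g n s - g' s‖) atTop (𝓝 0)) {t : ℝ} (ht : t ∈ Icc 0 T) :
    Tendsto (fun n => mild P T φ (g n) t) atTop (𝓝 (mild P T φ g' t)) := by
  obtain ⟨M, -, hM⟩ := S.semigroup.exists_bound T
  rw [tendsto_iff_norm_sub_tendsto_zero]
  refine squeeze_zero (fun n => norm_nonneg _) (fun n => ?_) (by simpa using h.const_mul M)
  rw [← mild_sub S.semigroup (hg n) hg' ht]
  refine (norm_mild_le S.semigroup hM ((hg n).sub hg') ht).trans_eq ?_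
  simp

/-- Identification of the limit of approximating mild solutions. -/
lemma eqOn_mild_of_tendsto (S : FormSetting j A b μ T P α) {φ : Lp ℝ 2 μ}
    {g : ℕ → ℝ → Lp ℝ 2 μ} {g' : ℝ → Lp ℝ 2 μ} (hg : ∀ n, IntegrableOn (g n) (Icc 0 T))
    (hg' : IntegrableOn g' (Icc 0 T))
    (h : Tendsto (fun n => ∫ s in Icc 0 T, ‖g n s - g' s‖) atTop (𝓝 0))
    {u : ℕ → ℝ → Lp ℝ 2 μ} {U : ℝ → Lp ℝ 2 μ} (hu : ∀ n, ∀ t ∈ Icc 0 T, u n t = mild P T φ (g n) t)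
    (hU : ∀ t ∈ Icc 0 T, Tendsto (fun n => u n t) atTop (𝓝 (U t))) :
    EqOn U (mild P T φ g') (Icc 0 T) := fun t ht =>
  tendsto_nhds_unique (hU t ht) ((tendsto_mild_of_tendsto_integral S hg hg' h ht).congr fun n =>
    (hu n t ht).symm)

end Stability

/-! ### From pointwise to integrated source estimates -/

section NemytskiiEstimates

variable {E H F : Type*} [MeasurableSpace E] [NormedAddCommGroup E]
  {μ : Measure E} [NormedAddCommGroup H] [InnerProductSpace ℝ H] [CompleteSpace H]
  [NormedAddCommGroup F] [InnerProductSpace ℝ F] {T : ℝ} {l : ℕ}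
  {f : ℝ → E → EuclideanSpace ℝ (Fin l) → (Fin l → H) → EuclideanSpace ℝ (Fin l)}
  {v v' g : Fin l → ℝ → Lp ℝ 2 μ} {V V' : Fin l → ℝ → Lp H 2 μ}

lemma IsNemytskii.ae (h : IsNemytskii μ T f v V g) :
    ∀ᵐ t ∂(volume.restrict (Icc 0 T)), ∀ᵐ x ∂μ, ∀ i,
      g i t x = f t x (vec (fun k => v k t) x) (fun k => V k t x) i := by
  filter_upwards [ae_all_iff.2 fun i => (h i).2] with t ht using ae_all_iff.2 ht

lemma IsNemytskii.congr (h : IsNemytskii μ T f v V g)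
    (hv : ∀ i, v i =ᵐ[volume.restrict (Icc 0 T)] v' i)
    (hV : ∀ i, V i =ᵐ[volume.restrict (Icc 0 T)] V' i) : IsNemytskii μ T f v' V' g := by
  intro i
  refine ⟨(h i).1, ?_⟩
  filter_upwards [(h i).2, ae_all_iff.2 hv, ae_all_iff.2 hV] with t h1 h2 h3
  simpa only [h2, h3] using h1

/-- Integrated form of a pointwise one-sided estimate of sources. -/
lemma two_sum_inner_sub_le {g g' u u' : Fin l → Lp ℝ 2 μ} {a a' : E → EuclideanSpace ℝ (Fin l)}
    (hg : ∀ᵐ x ∂μ, ∀ i, g i x = a x i) (hg' : ∀ᵐ x ∂μ, ∀ i, g' i x = a' x i)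
    {e : Fin l → Lp F 2 μ} {k : ℝ} {d : E → ℝ} (hd : Integrable d μ)
    (h : ∀ᵐ x ∂μ, 2 * ⟪vec u x - vec u' x, a x - a' x⟫ ≤
      k * ‖vec u x - vec u' x‖ ^ 2 + ∑ i, ‖e i x‖ ^ 2 + d x) :
    2 * ∑ i, ⟪g i - g' i, u i - u' i⟫ ≤
      k * ∑ i, ‖u i - u' i‖ ^ 2 + ∑ i, ‖e i‖ ^ 2 + ∫ x, d x ∂μ := by
  refine two_sum_inner_le hd ?_
  filter_upwards [h, hg, hg', ae_coeFn_sub g g', ae_coeFn_sub u u'] with x h1 h2 h3 h4 h5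
  simp only [h4, h5, h2, h3]
  rwa [inner_vec_sub, norm_vec_sub_sq] at h1

lemma memLp_of_continuousOn_Icc {X : Type*} [NormedAddCommGroup X] {u : ℝ → X}
    (h : ContinuousOn u (Icc 0 T)) :
    MemLp u 2 (volume.restrict (Icc 0 T)) := by
  obtain ⟨B, hB⟩ := isCompact_Icc.exists_bound_of_continuousOn h
  refine MemLp.of_bound (h.aestronglyMeasurable measurableSet_Icc) B ?_
  filter_upwards [ae_restrict_mem measurableSet_Icc] with s hs using hB s hs

end NemytskiiEstimates

/-! ### Existence: Lipschitz nonlinearity with frozen gradient -/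

section LipschitzCase

variable {E H : Type*} [NormedAddCommGroup E] [NormedSpace ℝ E]
  [NormedAddCommGroup H] [InnerProductSpace ℝ H] [CompleteSpace H]
  [TopologicalSpace.SeparableSpace H] [MeasurableSpace H] [BorelSpace H]
  [MeasurableSpace E] [BorelSpace E] [MeasurableSpace.CountablyGenerated E]
  {j : H →L[ℝ] E} {A : E → H →L[ℝ] H} {b : E → H}
  {μ : Measure E} [IsFiniteMeasure μ] {T : ℝ} {P : ℝ → Lp ℝ 2 μ →L[ℝ] Lp ℝ 2 μ} {α : ℝ} {l : ℕ}
  {f : ℝ → E → EuclideanSpace ℝ (Fin l) → (Fin l → H) → EuclideanSpace ℝ (Fin l)}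
  {V : Fin l → ℝ → Lp H 2 μ}

/-- Existence of mild solutions for bounded nonlinearities that are Lipschitz in the solution, the
gradient argument being frozen. -/
lemma exists_mild_of_lipschitz (S : FormSetting j A b μ T P α) (hf : MeasurableNonlinearity T f)
    (hV : ∀ i, AEStronglyMeasurable (V i) (volume.restrict (Icc 0 T))) (φ : Fin l → Lp ℝ 2 μ)
    {B K : ℝ} (hB : ∀ t ∈ Icc 0 T, ∀ x y z, ‖f t x y z‖ ≤ B)
    (hK : ∀ t ∈ Icc 0 T, ∀ x y y' z, ‖f t x y z - f t x y' z‖ ≤ K * ‖y - y'‖) :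
    ∃ g, IsNemytskii μ T f (fun i => mild P T (φ i) (g i)) V g := by
  have hT := S.time_pos
  -- The source map is made total, with the junk value 0 outside L², so that it can enter the fixed
  -- point theorem.
  have hex : ∀ v : Fin l → ℝ → Lp ℝ 2 μ, ∃ g, (∀ i, MemLp (v i) 2 (volume.restrict (Icc 0 T))) →
      IsNemytskii μ T f v V g := by
    intro v
    by_cases hv : ∀ i, MemLp (v i) 2 (volume.restrict (Icc 0 T))
    · obtain ⟨g, hg⟩ := exists_isNemytskii_of_bdd hT.le hf (fun i => (hv i).1) hV (B := B) (by
        filter_upwards [ae_restrict_mem measurableSet_Icc] with t ht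
        exact Eventually.of_forall fun x => hB t ht _ _ _)
      exact ⟨g, fun _ => hg⟩
    · exact ⟨0, fun h => absurd h hv⟩
  choose N hN using hex
  -- With this rate, 2Kpq ≤ kp² + q²/(2T) by completing the square. The coefficient 1/(2T),
  -- integrated over [0,T], gives the contraction factor 1/2.
  set k : ℝ := 2 * T * K ^ 2 with hk
  have hk0 : 0 ≤ k := by positivity
  set w := expWeight (fun _ => k + α) with hw
  have hwc : ContinuousOn w (Icc 0 T) := continuousOn_expWeight hT.le (integrable_const _)
  have hw1 : ∀ s ∈ Icc 0 T, 1 ≤ w s := fun s hs =>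
    one_le_expWeight (fun s => add_nonneg hk0 S.nonneg) hs.1
  obtain ⟨v, hv, hfix⟩ := exists_fixedPoint_weighted (ν := volume.restrict (Icc 0 T)) (w := w)
    (hwc.aemeasurable measurableSet_Icc) (W := Real.exp (∫ s in Icc 0 T, |k + α|))
    (by filter_upwards [ae_restrict_mem measurableSet_Icc] with s hs using hw1 s hs)
    (by
      filter_upwards [ae_restrict_mem measurableSet_Icc] with s hs
      exact expWeight_le (integrable_const _) hs)
    (fun v i => mild P T (φ i) (N v i))
    (fun v hv i => memLp_of_continuousOn_Icc (mild_continuousOn S.semigroup (hN v hv i).1)) (by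
      intro v v' hv hv'
      -- The scaling puts the term |v - v'|²/(2T) in the slot that `two_sum_inner_sub_le` reserves
      -- for Σ‖e_i‖².
      set ρ : ℝ := √(1 / (2 * T)) with hρ
      have hρ2 : ρ ^ 2 = 1 / (2 * T) := Real.sq_sqrt (by positivity)
      have hg := hN v hv
      have hg' := hN v' hv'
      have hwi : ∀ {F : ℝ → ℝ}, IntegrableOn F (Icc 0 T) →
          IntegrableOn (fun s => w s * F s) (Icc 0 T) :=
        fun {F} hF => IntegrableOn.continuousOn_mul hwc hF isCompact_Icc
      have hvi : IntegrableOn (fun s => ∑ i, ‖v i s - v' i s‖ ^ 2) (Icc 0 T) :=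
        integrable_finsetSum _ fun i _ => ((hv i).sub (hv' i)).integrable_norm_pow (by norm_num)
      set u := fun i => mild P T (φ i) (N v i) with hu
      set u' := fun i => mild P T (φ i) (N v' i) with hu'
      have huc : ∀ i, ContinuousOn (fun s => u i s - u' i s) (Icc 0 T) := fun i =>
        (mild_continuousOn S.semigroup (hg i).1).sub (mild_continuousOn S.semigroup (hg' i).1)
      have hbr : ∀ᵐ s ∂(volume.restrict (Icc 0 T)),
          2 * ∑ i, ⟪N v i s - N v' i s, u i s - u' i s⟫ ≤
          k * ∑ i, ‖u i s - u' i s‖ ^ 2 + 1 / (2 * T) * ∑ i, ‖v i s - v' i s‖ ^ 2 := by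
        filter_upwards [hg.ae, hg'.ae, ae_restrict_mem measurableSet_Icc] with s h1 h2 h3
        have h4 := two_sum_inner_sub_le (u := fun i => u i s) (u' := fun i => u' i s) h1 h2
          (e := fun i => ρ • (v i s - v' i s)) (k := k) (d := fun _ => 0) (integrable_zero _ _ _) (by
            filter_upwards [ae_coeFn_sub (fun i => v i s) (fun i => v' i s),
              ae_all_iff.2 fun i => Lp.coeFn_smul ρ (v i s - v' i s)] with x h5 h6
            have e1 : ∑ i, ‖(ρ • (v i s - v' i s) : Lp ℝ 2 μ) x‖ ^ 2 =
                ρ ^ 2 * ‖vec (fun i => v i s) x - vec (fun i => v' i s) x‖ ^ 2 := by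
              rw [norm_vec_sub_sq, Finset.mul_sum]
              refine Finset.sum_congr rfl fun i _ => ?_
              rw [h6, Pi.smul_apply, h5, norm_smul, mul_pow, Real.norm_eq_abs, Real.norm_eq_abs,
                sq_abs, sq_abs]
            rw [e1, hρ2, add_zero]
            have e2 := hK s h3 x (vec (fun i => v i s) x) (vec (fun i => v' i s) x)
              (fun i => V i s x)
            have e3 := (real_inner_le_norm (vec (fun i => u i s) x - vec (fun i => u' i s) x) _).trans
              (mul_le_mul_of_nonneg_left e2 (norm_nonneg _))
            refine (mul_le_mul_of_nonneg_left e3 zero_le_two).trans ?_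
            rw [← sub_nonneg]
            have e4 : ∀ p q : ℝ, k * p ^ 2 + 1 / (2 * T) * q ^ 2 - 2 * (p * (K * q)) =
                1 / (2 * T) * (2 * T * K * p - q) ^ 2 := fun p q => by
              rw [hk]
              field_simp
              ring
            rw [e4]
            positivity)
        simp only [norm_smul, mul_pow, Real.norm_eq_abs, sq_abs, integral_zero, add_zero,
          ← Finset.mul_sum] at h4
        rwa [hρ2] at h4
      have hpt : ∀ t ∈ Icc 0 T, w t * ∑ i, ‖u i t - u' i t‖ ^ 2 ≤
          1 / (2 * T) * ∫ s in Icc 0 T, w s * ∑ i, ‖v i s - v' i s‖ ^ 2 := by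
        intro t ht
        have h1 := energy_sub_le S (fun i => (hg i).1) (fun i => (hg' i).1) (u := u) (u' := u')
          (φ := φ) (φ' := φ) (fun i t _ => rfl) (fun i t _ => rfl) (k := fun _ => k)
          (integrable_const _) (hvi.const_mul (1 / (2 * T))) hbr ht
        have h2 : 0 ≤ ∫ s in Icc t T, w s *
            ∑ i, ‖gradA j A μ (u i s) - gradA j A μ (u' i s)‖ ^ 2 :=
          integral_nonneg fun s => mul_nonneg (expWeight_pos _ _).le
            (Finset.sum_nonneg fun i _ => by positivity)
        have h3 : ∫ s in Icc t T, w s * (1 / (2 * T) * ∑ i, ‖v i s - v' i s‖ ^ 2) ≤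
            1 / (2 * T) * ∫ s in Icc 0 T, w s * ∑ i, ‖v i s - v' i s‖ ^ 2 := by
          simp only [mul_left_comm (w _)]
          rw [integral_const_mul]
          refine mul_le_mul_of_nonneg_left (setIntegral_mono_set (hwi hvi) ?_
            (Icc_subset_Icc_left ht.1).eventuallyLE) (by positivity)
          exact Eventually.of_forall fun s => mul_nonneg (expWeight_pos _ _).le
            (Finset.sum_nonneg fun i _ => by positivity)
        have h4 : ∑ i : Fin l, ‖φ i - φ i‖ ^ 2 = 0 := by simp
        rw [h4, mul_zero, zero_add] at h1
        linarith
      refine (setIntegral_mono_on (hwi (integrable_finsetSum _ fun i _ =>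
        (memLp_of_continuousOn_Icc (huc i)).integrable_norm_pow (by norm_num)))
        (integrable_const _) measurableSet_Icc hpt).trans (le_of_eq ?_)
      rw [setIntegral_const, smul_eq_mul, Measure.real, Real.volume_Icc, sub_zero,
        ENNReal.toReal_ofReal hT.le]
      field_simp)
  exact ⟨N v, (hN v hv).congr (fun i => (hfix i).symm) fun i => EventuallyEq.rfl⟩

end LipschitzCase

/-! ### Mollification in the solution variable -/

section Mollification

variable {Y Z : Type*} [NormedAddCommGroup Y] [InnerProductSpace ℝ Y] [FiniteDimensional ℝ Y]
  [MeasurableSpace Y] [BorelSpace Y]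
  [NormedAddCommGroup Z] [NormedSpace ℝ Z] [CompleteSpace Z]

/-- A sequence of smooth bumps concentrating at the origin. -/
noncomputable def shrinkingBump (Y : Type*) [NormedAddCommGroup Y] [InnerProductSpace ℝ Y] (n : ℕ) :
    ContDiffBump (0 : Y) :=
  ⟨1 / (2 * (n + 1)), 1 / (n + 1), by positivity, by
    have : (0 : ℝ) < n + 1 := by positivity
    gcongr
    linarith⟩

/-- The density of the `n`-th mollifier. -/
noncomputable def mollifier (Y : Type*) [NormedAddCommGroup Y] [InnerProductSpace ℝ Y]
    [FiniteDimensional ℝ Y] [MeasurableSpace Y] [BorelSpace Y] (n : ℕ) : Y → ℝ :=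
  (shrinkingBump Y n).normed volume

/-- The `n`-th mollification of `g`. -/
noncomputable def mollify (n : ℕ) (g : Y → Z) (y : Y) : Z := ∫ w, mollifier Y n w • g (y - w)

lemma mollifier_nonneg (n : ℕ) (w : Y) : 0 ≤ mollifier Y n w := ContDiffBump.nonneg_normed _ _

lemma integrable_mollifier (n : ℕ) : Integrable (mollifier Y n) :=
  ContDiffBump.integrable_normed (shrinkingBump Y n)

lemma integral_mollifier (n : ℕ) : ∫ w, mollifier Y n w = 1 :=
  ContDiffBump.integral_normed (shrinkingBump Y n)

lemma mollifier_eq_zero {n : ℕ} {w : Y} (h : 1 / ((n : ℝ) + 1) ≤ ‖w‖) : mollifier Y n w = 0 := by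
  by_contra hcon
  have h1 : w ∈ Function.support ((shrinkingBump Y n).normed volume) := hcon
  rw [ContDiffBump.support_normed_eq, mem_ball_zero_iff] at h1
  exact absurd h (not_le.2 h1)

lemma continuous_mollifier (n : ℕ) : Continuous (mollifier Y n) :=
  ContDiffBump.continuous_normed (shrinkingBump Y n)

lemma exists_lipschitz_mollifier (n : ℕ) : ∃ L : ℝ, 0 ≤ L ∧
    ∀ w w' : Y, |mollifier Y n w - mollifier Y n w'| ≤ L * ‖w - w'‖ := by
  obtain ⟨L, hL⟩ := ContDiff.lipschitzWith_of_hasCompactSupport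
    (ContDiffBump.hasCompactSupport_normed (shrinkingBump Y n) (μ := volume))
    (ContDiffBump.contDiff_normed (shrinkingBump Y n) (n := 1)) (by simp)
  refine ⟨L, L.2, fun w w' => ?_⟩
  have := hL.dist_le_mul w w'
  rwa [Real.dist_eq, dist_eq_norm] at this

variable {g : Y → Z} {B : ℝ}

lemma integrable_mollifier_smul (hg : Continuous g) (hB : ∀ y, ‖g y‖ ≤ B) (n : ℕ) (y : Y) :
    Integrable fun w => mollifier Y n w • g (y - w) :=
  (integrable_mollifier n).smul_bdd B
    (hg.comp (continuous_const.sub continuous_id)).aestronglyMeasurable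
    (Eventually.of_forall fun _ => hB _)

lemma norm_mollify_le (hg : Continuous g) (hB : ∀ y, ‖g y‖ ≤ B) (n : ℕ) (y : Y) :
    ‖mollify n g y‖ ≤ B := by
  refine (norm_integral_le_integral_norm _).trans ?_
  have h1 : ∫ w, mollifier Y n w * B = B := by
    rw [integral_mul_const, integral_mollifier, one_mul]
  rw [← h1]
  refine integral_mono (integrable_mollifier_smul hg hB n y).norm
    ((integrable_mollifier n).mul_const B) fun w => ?_
  dsimp only
  rw [norm_smul, Real.norm_of_nonneg (mollifier_nonneg n w)]
  exact mul_le_mul_of_nonneg_left (hB _) (mollifier_nonneg n w)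

/-- The difference is moved onto the kernel, so the constant depends on g only through B. This
uniformity lets one K serve f(t,x,·,z) for all (t,x,z). -/
lemma exists_lipschitz_mollify (Y : Type*) [NormedAddCommGroup Y] [InnerProductSpace ℝ Y]
    [FiniteDimensional ℝ Y] [MeasurableSpace Y] [BorelSpace Y] (n : ℕ) (B : ℝ) (hB0 : 0 ≤ B) :
    ∃ K : ℝ, 0 ≤ K ∧ ∀ g : Y → Y, Continuous g → (∀ y, ‖g y‖ ≤ B) →
      ∀ y y', ‖mollify n g y - mollify n g y'‖ ≤ K * ‖y - y'‖ := by
  obtain ⟨L, hL0, hL⟩ := exists_lipschitz_mollifier (Y := Y) n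
  -- The supports of all mollifiers lie in the unit ball, whose volume replaces that of the support.
  set m : Y → ℝ := (Metric.closedBall (0 : Y) 1).indicator fun _ => 1
  have hm : Integrable m :=
    (integrable_indicator_iff Metric.isClosed_closedBall.measurableSet).2
      (integrableOn_const (isCompact_closedBall _ _).measure_lt_top.ne)
  have hm0 : ∀ w, 0 ≤ m w := fun w => indicator_nonneg (fun _ _ => zero_le_one) w
  have hzero : ∀ w, m w = 0 → mollifier Y n w = 0 := fun w hw => by
    refine mollifier_eq_zero ?_
    by_contra hcon
    have h1 : w ∈ Metric.closedBall (0 : Y) 1 := by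
      rw [mem_closedBall_zero_iff]
      refine (not_le.1 hcon).le.trans ?_
      rw [div_le_one (by positivity)]
      linarith [n.cast_nonneg (α := ℝ)]
    simp [m, indicator_of_mem h1] at hw
  have hone : ∀ w, m w = 0 ∨ m w = 1 := fun w => by
    by_cases h : w ∈ Metric.closedBall (0 : Y) 1
    · exact Or.inr (indicator_of_mem h _)
    · exact Or.inl (indicator_of_notMem h _)
  refine ⟨L * B * (2 * ∫ w, m w), mul_nonneg (mul_nonneg hL0 hB0)
    (mul_nonneg zero_le_two (integral_nonneg hm0)), fun g hg hgB y y' => ?_⟩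
  have hsh : ∀ y, mollify n g y = ∫ w, mollifier Y n (y - w) • g w := fun y => by
    rw [mollify, ← integral_sub_left_eq_self (fun w => mollifier Y n (y - w) • g w) volume y]
    simp only [sub_sub_cancel]
  have hi : ∀ y, Integrable fun w => mollifier Y n (y - w) • g w := fun y => by
    have := (integrable_mollifier_smul hg hgB n y).comp_sub_left y
    simpa only [sub_sub_cancel] using this
  rw [hsh, hsh, ← integral_sub (hi y) (hi y')]
  refine (norm_integral_le_integral_norm _).trans ?_
  have hmi : Integrable fun w => L * ‖y - y'‖ * B * (m (y - w) + m (y' - w)) :=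
    ((hm.comp_sub_left y).add (hm.comp_sub_left y')).const_mul _
  refine (integral_mono ((hi y).sub (hi y')).norm hmi fun w => ?_).trans (le_of_eq ?_)
  · dsimp only
    rw [Pi.sub_apply, ← sub_smul, norm_smul, Real.norm_eq_abs]
    rcases hone (y - w) with h1 | h1
    · rcases hone (y' - w) with h2 | h2
      · rw [hzero _ h1, hzero _ h2, h1, h2]
        simp
      · have h3 := hL (y - w) (y' - w)
        rw [sub_sub_sub_cancel_right] at h3
        rw [h1, h2]
        have := mul_le_mul h3 (hgB w) (norm_nonneg _) (by positivity)
        linarith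
    · have h3 := hL (y - w) (y' - w)
      rw [sub_sub_sub_cancel_right] at h3
      have h4 := mul_le_mul h3 (hgB w) (norm_nonneg _) (by positivity)
      have h5 : 0 ≤ L * ‖y - y'‖ * B * m (y' - w) := mul_nonneg (by positivity) (hm0 _)
      rw [h1]
      linarith
  · rw [integral_const_mul, integral_add (hm.comp_sub_left y) (hm.comp_sub_left y'),
      integral_sub_left_eq_self m, integral_sub_left_eq_self m]
    ring

lemma tendstoUniformlyOn_mollify (hg : Continuous g) (hB : ∀ y, ‖g y‖ ≤ B) (R : ℝ) :
    TendstoUniformlyOn (fun n => mollify n g) g atTop (Metric.closedBall 0 R) := by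
  rw [Metric.tendstoUniformlyOn_iff]
  intro ε hε
  obtain ⟨δ, hδ, hu⟩ := Metric.uniformContinuousOn_iff.1
    ((isCompact_closedBall (0 : Y) (R + 1)).uniformContinuousOn_of_continuous hg.continuousOn)
    (ε / 2) (half_pos hε)
  have h0 : Tendsto (fun n : ℕ => 1 / ((n : ℝ) + 1)) atTop (𝓝 0) := tendsto_one_div_add_atTop_nhds_zero_nat
  filter_upwards [h0.eventually (gt_mem_nhds (lt_min hδ one_pos))] with n hn y hy
  rw [dist_comm, dist_eq_norm]
  have h1 : g y = ∫ w, mollifier Y n w • g y := by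
    rw [integral_smul_const, integral_mollifier, one_smul]
  have i1 := integrable_mollifier_smul hg hB n y
  have i2 : Integrable fun w => mollifier Y n w • g y := (integrable_mollifier n).smul_const _
  refine lt_of_le_of_lt ?_ (half_lt_self hε)
  rw [h1, mollify, ← integral_sub i1 i2]
  refine (norm_integral_le_integral_norm _).trans ?_
  have h2 : ∫ w, mollifier Y n w * (ε / 2) = ε / 2 := by
    rw [integral_mul_const, integral_mollifier, one_mul]
  rw [← h2]
  refine integral_mono (i1.sub i2).norm ((integrable_mollifier n).mul_const _) fun w => ?_
  dsimp only
  rw [← smul_sub, norm_smul, Real.norm_of_nonneg (mollifier_nonneg n w)]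
  by_cases hw : 1 / ((n : ℝ) + 1) ≤ ‖w‖
  · simp [mollifier_eq_zero hw]
  refine mul_le_mul_of_nonneg_left ?_ (mollifier_nonneg n w)
  have hwn := (not_le.1 hw).trans hn
  rw [mem_closedBall_zero_iff] at hy
  rw [← dist_eq_norm]
  refine (hu _ ?_ _ ?_ ?_).le
  · rw [mem_closedBall_zero_iff]
    exact (norm_sub_le _ _).trans (add_le_add hy (hwn.le.trans (min_le_right _ _)))
  · rw [mem_closedBall_zero_iff]
    linarith
  · rw [dist_eq_norm]
    simpa using hwn.trans_le (min_le_left _ _)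

/-- Continuous convergence, jointly in the index and the argument, follows from uniform convergence
on balls. -/
lemma tendsto_mollify_prod (hg : Continuous g) (hB : ∀ y, ‖g y‖ ≤ B) (y : Y) :
    Tendsto (fun p : ℕ × Y => mollify p.1 g p.2) (atTop ×ˢ 𝓝 y) (𝓝 (g y)) := by
  have h1 := tendstoUniformlyOn_iff_tendsto.1 (tendstoUniformlyOn_mollify hg hB (‖y‖ + 1))
  have h2 : Tendsto (fun p : ℕ × Y => g p.2) (atTop ×ˢ 𝓝 y) (𝓝 (g y)) :=
    (hg.tendsto y).comp tendsto_snd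
  refine h2.congr_uniformity (h1.mono_left (prod_mono le_rfl ?_))
  rw [le_principal_iff]
  refine mem_of_superset (Metric.ball_mem_nhds y one_pos) fun z hz => ?_
  rw [mem_ball_iff_norm] at hz
  rw [mem_closedBall_zero_iff]
  linarith [norm_sub_norm_le z y]

end Mollification

/-- The tail suprema. They turn a null sequence into error bounds controlled by the smaller of two
indices, as `exists_limit_of_stability` requires. -/
lemma exists_tail_bound {a : ℕ → ℝ} (ha : Tendsto a atTop (𝓝 0)) :
    ∃ c : ℕ → ℝ, Tendsto c atTop (𝓝 0) ∧ ∀ n m, n ≤ m → a m ≤ c n := by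
  have hb : ∀ n, BddAbove (range fun m => a (n + m)) := fun n =>
    ha.bddAbove_range.mono (range_subset_iff.2 fun m => mem_range_self _)
  refine ⟨fun n => ⨆ m, a (n + m), ?_, fun n m hnm => ?_⟩
  · rw [Metric.tendsto_atTop]
    intro ε hε
    obtain ⟨N, hN⟩ := Metric.tendsto_atTop.1 ha (ε / 2) (half_pos hε)
    refine ⟨N, fun n hn => ?_⟩
    have h1 : ∀ m, |a (n + m)| < ε / 2 := fun m => by
      simpa [Real.dist_eq] using hN (n + m) (hn.trans (Nat.le_add_right _ _))
    have h2 : ⨆ m, a (n + m) ≤ ε / 2 := ciSup_le fun m => (le_abs_self _).trans (h1 m).le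
    have h3 := le_ciSup (hb n) 0
    rw [Real.dist_eq, sub_zero, abs_lt]
    constructor
    · linarith [neg_abs_le (a (n + 0)), h1 0]
    · linarith
  · have := le_ciSup (hb n) (m - n)
    simpa [Nat.add_sub_cancel' hnm] using this

/-! ### Norms of bounded systems -/

section BoundedSystems

variable {E : Type*} [MeasurableSpace E] {μ : Measure E} {l : ℕ}

lemma norm_le_sum_abs (y : EuclideanSpace ℝ (Fin l)) : ‖y‖ ≤ ∑ i, |y i| := by
  have h : ‖y‖ ^ 2 ≤ (∑ i, |y i|) ^ 2 := by
    rw [PiLp.norm_sq_eq_of_L2]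
    simp only [Real.norm_eq_abs]
    exact Finset.sum_sq_le_sq_sum_of_nonneg fun i _ => abs_nonneg _
  exact (abs_le_of_sq_le_sq' h (Finset.sum_nonneg fun i _ => abs_nonneg _)).2

lemma abs_apply_le_norm (y : EuclideanSpace ℝ (Fin l)) (i : Fin l) : |y i| ≤ ‖y‖ :=
  PiLp.norm_apply_le y i

lemma norm_vec_le [NormedAddCommGroup E] {v : Fin l → Lp ℝ 2 μ} {R : ℝ} (h : ∀ i, v i ∈ bddSet μ R) :
    ∀ᵐ x ∂μ, ‖vec v x‖ ≤ l * R := by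
  filter_upwards [ae_all_iff.2 h] with x hx
  refine (norm_le_sum_abs _).trans ((Finset.sum_le_sum fun i _ => hx i).trans_eq ?_)
  simp

lemma exists_norm_le_of_mem_bddSet (μ : Measure E) [IsFiniteMeasure μ] :
    ∃ c : ℝ, 0 ≤ c ∧ ∀ R : ℝ, 0 ≤ R → ∀ u ∈ bddSet μ R, ‖u‖ ≤ c * R :=
  ⟨_, by positivity, fun _ hR _ hu => Lp.norm_le_of_ae_bound hR hu⟩

end BoundedSystems

/-! ### Existence: one-sided Lipschitz nonlinearity with frozen gradient -/

section MonotoneCase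

variable {E H : Type*} [NormedAddCommGroup E] [NormedSpace ℝ E]
  [NormedAddCommGroup H] [InnerProductSpace ℝ H] [CompleteSpace H]
  [TopologicalSpace.SeparableSpace H] [MeasurableSpace H] [BorelSpace H]
  [MeasurableSpace E] [BorelSpace E] [MeasurableSpace.CountablyGenerated E]
  {j : H →L[ℝ] E} {A : E → H →L[ℝ] H} {b : E → H}
  {μ : Measure E} [IsFiniteMeasure μ] {T : ℝ} {P : ℝ → Lp ℝ 2 μ →L[ℝ] Lp ℝ 2 μ} {α : ℝ} {l : ℕ}
  {f : ℝ → E → EuclideanSpace ℝ (Fin l) → (Fin l → H) → EuclideanSpace ℝ (Fin l)}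
  {V : Fin l → ℝ → Lp H 2 μ}

lemma MeasurableNonlinearity.mollify (hf : MeasurableNonlinearity T f) (n : ℕ) :
    MeasurableNonlinearity T fun t x y z => mollify n (fun y' => f t x y' z) y := by
  have h1 : Measurable fun p : (Icc (0 : ℝ) T × E × EuclideanSpace ℝ (Fin l) × (Fin l → H)) ×
      EuclideanSpace ℝ (Fin l) => mollifier (EuclideanSpace ℝ (Fin l)) n p.2 •
        f p.1.1 p.1.2.1 (p.1.2.2.1 - p.2) p.1.2.2.2 := by
    refine ((continuous_mollifier n).measurable.comp measurable_snd).smul ?_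
    have h2 : Measurable fun p : (Icc (0 : ℝ) T × E × EuclideanSpace ℝ (Fin l) × (Fin l → H)) ×
        EuclideanSpace ℝ (Fin l) => (p.1.1, p.1.2.1, p.1.2.2.1 - p.2, p.1.2.2.2) := by fun_prop
    exact hf.comp h2
  exact h1.stronglyMeasurable.integral_prod_right.measurable

/-- Existence of mild solutions for bounded nonlinearities that are continuous and one-sided
Lipschitz in the solution, the gradient argument being frozen. -/
lemma exists_mild_of_monotone (S : FormSetting j A b μ T P α) (hf : MeasurableNonlinearity T f)
    (hV : ∀ i, AEStronglyMeasurable (V i) (volume.restrict (Icc 0 T))) {φ : Fin l → Lp ℝ 2 μ}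
    {M : ℝ} (hφ : ∀ i, φ i ∈ bddSet μ M) {B : ℝ} (hB : ∀ t ∈ Icc 0 T, ∀ x y z, ‖f t x y z‖ ≤ B)
    (hc : ∀ t ∈ Icc 0 T, ∀ x z, Continuous fun y => f t x y z)
    {κ : ℝ → ℝ} (hκ : IntegrableOn κ (Icc 0 T)) (hκ0 : ∀ s, 0 ≤ κ s)
    (hm : ∀ t ∈ Icc 0 T, ∀ x y y' z, ⟪y - y', f t x y z - f t x y' z⟫ ≤ κ t * ‖y - y'‖ ^ 2) :
    ∃ g, IsNemytskii μ T f (fun i => mild P T (φ i) (g i)) V g := by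
  have hT := S.time_pos
  have hB0 : 0 ≤ B := (norm_nonneg _).trans (hB 0 ⟨le_rfl, hT.le⟩ 0 0 0)
  choose K hK0 hK using fun n => exists_lipschitz_mollify (EuclideanSpace ℝ (Fin l)) n B hB0
  set F := fun (n : ℕ) t x y z => mollify n (fun y' => f t x y' z) y with hF
  have hFB : ∀ n, ∀ t ∈ Icc 0 T, ∀ x y z, ‖F n t x y z‖ ≤ B := fun n t ht x y z =>
    norm_mollify_le (hc t ht x z) (fun y => hB t ht x y z) n y
  choose g hg using fun n => exists_mild_of_lipschitz S (hf.mollify n) hV φ (hFB n)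
    fun t ht x y y' z => hK n _ (hc t ht x z) (fun y => hB t ht x y z) y y'
  set u : ℕ → Fin l → ℝ → Lp ℝ 2 μ := fun n i => mild P T (φ i) (g n i) with hu
  have hum : ∀ n i, AEStronglyMeasurable (u n i) (volume.restrict (Icc 0 T)) := fun n i =>
    (mild_continuousOn S.semigroup (hg n i).1).aestronglyMeasurable measurableSet_Icc
  obtain ⟨C, hC1, hC⟩ := S.exists_mapsBdd
  obtain ⟨c₀, hc₀, hnorm⟩ := exists_norm_le_of_mem_bddSet μ
  set M' := max |M| B
  have hM'0 : 0 ≤ M' := hB0.trans (le_max_right _ _)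
  set R := C * M' * (1 + T)
  have hR0 : 0 ≤ R := by positivity
  have hgB : ∀ n i, ∀ᵐ s ∂(volume.restrict (Icc 0 T)), g n i s ∈ bddSet μ B := fun n i => by
    filter_upwards [(hg n).ae, ae_restrict_mem measurableSet_Icc] with s h1 h2
    filter_upwards [h1] with x h3
    rw [h3]
    exact (abs_apply_le_norm _ _).trans (hFB n s h2 _ _ _)
  have huR : ∀ n i, ∀ t ∈ Icc 0 T, u n i t ∈ bddSet μ R := fun n i t ht =>
    mild_mem_bddSet S.semigroup hC (zero_le_one.trans hC1) (hg n i).1 hM'0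
      (bddSet_mono ((le_abs_self M).trans (le_max_left _ _)) (hφ i))
      ((hgB n i).mono fun s hs => bddSet_mono (le_max_right _ _) hs) ht
  choose G hG using fun n => exists_isNemytskii_of_bdd hT.le hf (hum n) hV (B := B) (by
    filter_upwards [ae_restrict_mem measurableSet_Icc] with t ht
    exact Eventually.of_forall fun x => hB t ht _ _ _)
  -- The defect between the mollified and the original nonlinearity along u n. It tends to 0 in
  -- L¹(0,T;L²), and the one-sided bound is then used for f itself.
  set r : ℕ → Fin l → ℝ → Lp ℝ 2 μ := fun n i s => g n i s - G n i s with hr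
  have hri : ∀ n i, IntegrableOn (r n i) (Icc 0 T) := fun n i => (hg n i).1.sub (hG n i).1
  have hrb : ∀ n i, ∀ᵐ s ∂(volume.restrict (Icc 0 T)), r n i s ∈ bddSet μ (B + B) := fun n i => by
    filter_upwards [hgB n i, (hG n).ae, ae_restrict_mem measurableSet_Icc] with s h1 h2 h3
    refine sub_mem_bddSet h1 ?_
    filter_upwards [h2] with x h4
    rw [h4]
    exact (abs_apply_le_norm _ _).trans (hB s h3 _ _ _)
  have hrlim : ∀ i, Tendsto (fun n => ∫ s in Icc 0 T, ‖r n i s‖) atTop (𝓝 0) := by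
    intro i
    refine Tendsto.mono_right ?_ (congrArg 𝓝 (integral_zero ℝ ℝ (μ := volume.restrict (Icc 0 T)))).le
    refine tendsto_integral_of_dominated_convergence (fun _ => c₀ * (B + B))
      (fun n => (hri n i).norm.1) (integrable_const _) (fun n => ?_) ?_
    · filter_upwards [hrb n i] with s hs
      rw [norm_norm]
      exact hnorm _ (by positivity) _ hs
    · filter_upwards [ae_all_iff.2 fun n => (hg n).ae, ae_all_iff.2 fun n => (hG n).ae,
        ae_all_iff.2 fun n => hrb n i, ae_restrict_mem measurableSet_Icc] with s h1 h2 h3 h4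
      have h5 : Tendsto (fun n => r n i s) atTop (𝓝 0) := by
        refine Lp_tendsto_of_dominated (memLp_const (B + B)) h3 ?_
        filter_upwards [ae_all_iff.2 h1, ae_all_iff.2 h2,
          ae_all_iff.2 fun n => norm_vec_le fun i => huR n i s h4,
          ae_all_iff.2 fun n => Lp.coeFn_sub (g n i s) (G n i s), Lp.coeFn_zero ℝ 2 μ]
          with x e1 e2 e3 e4 e5
        rw [e5]
        simp only [hr, e4, Pi.sub_apply, e1, e2]
        -- Convergence of u n is not yet known. All its values lie in one ball, on which the
        -- mollifications converge uniformly.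
        have h6 := tendstoUniformlyOn_mollify (hc s h4 x fun k => V k s x)
          (fun y => hB s h4 x y _) (l * R)
        rw [Metric.tendsto_atTop]
        intro ε hε
        obtain ⟨N, hN⟩ := eventually_atTop.1 (Metric.tendstoUniformlyOn_iff.1 h6 ε hε)
        refine ⟨N, fun n hn => ?_⟩
        have h7 := hN n hn _ (mem_closedBall_zero_iff.2 (e3 n))
        rw [dist_comm, dist_eq_norm] at h7
        rw [Pi.zero_apply, Real.dist_eq, sub_zero]
        exact (abs_apply_le_norm (F n s x _ _ - f s x _ _) i).trans_lt h7
      simpa using h5.norm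
  set a : ℕ → ℝ := fun n => ∑ i, ∫ s in Icc 0 T, ‖r n i s‖ with ha
  have ha0 : Tendsto a atTop (𝓝 0) := by
    simpa using tendsto_finsetSum Finset.univ fun i (_ : i ∈ Finset.univ) => hrlim i
  obtain ⟨c, hc0, hcn⟩ := exists_tail_bound ha0
  set D := c₀ * (R + R) with hD
  have hD0 : 0 ≤ D := by positivity
  have hrsum : ∀ n, IntegrableOn (fun s => ∑ i, ‖r n i s‖) (Icc 0 T) := fun n =>
    integrable_finsetSum _ fun i _ => (hri n i).norm
  obtain ⟨U, -, hU, -, -, -⟩ := exists_limit_of_stability S (fun n i => (hg n i).1) (u := u)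
    (fun n i t _ => rfl) (k := fun s => 2 * κ s) (hκ.const_mul 2)
    (fun s => mul_nonneg zero_le_two (hκ0 s))
    (h := fun n m s => 2 * D * (∑ i, ‖r n i s‖ + ∑ i, ‖r m i s‖))
    (fun n m _ => ((hrsum n).add (hrsum m)).const_mul _)
    (fun n m _ => Eventually.of_forall fun s => mul_nonneg (by positivity)
      (add_nonneg (Finset.sum_nonneg fun i _ => norm_nonneg _)
        (Finset.sum_nonneg fun i _ => norm_nonneg _)))
    (c := fun n => 2 * D * (c n + c n)) (by simpa using (hc0.add hc0).const_mul (2 * D))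
    (fun n m hnm => by
      rw [integral_const_mul, integral_add (hrsum n) (hrsum m),
        integral_finsetSum _ fun i _ => (hri n i).norm,
        integral_finsetSum _ fun i _ => (hri m i).norm]
      exact mul_le_mul_of_nonneg_left (add_le_add (hcn n n le_rfl) (hcn n m hnm)) (by positivity))
    (fun n m hnm => by
      filter_upwards [(hG n).ae, (hG m).ae, ae_restrict_mem measurableSet_Icc] with s h1 h2 h3
      have h4 := two_sum_inner_sub_le (u := fun i => u n i s) (u' := fun i => u m i s) h1 h2
        (e := fun _ => (0 : Lp ℝ 2 μ)) (k := 2 * κ s) (d := fun _ => 0) (integrable_zero _ _ _) (by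
          refine Eventually.of_forall fun x => ?_
          have e1 := hm s h3 x (vec (fun k => u n k s) x) (vec (fun k => u m k s) x)
            fun k => V k s x
          have e2 : 0 ≤ ∑ i : Fin l, ‖(0 : Lp ℝ 2 μ) x‖ ^ 2 :=
            Finset.sum_nonneg fun i _ => by positivity
          linarith)
      -- Replacing g by G costs the two defects times D, which bounds ‖u n i s - u m i s‖ in L².
      have h5 : ∀ i, ⟪g n i s - g m i s, u n i s - u m i s⟫ ≤
          ⟪G n i s - G m i s, u n i s - u m i s⟫ + (‖r n i s‖ + ‖r m i s‖) * D := fun i => by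
        have e1 : g n i s - g m i s = (G n i s - G m i s) + (r n i s - r m i s) := by
          simp only [hr]
          abel
        rw [e1, inner_add_left]
        refine add_le_add le_rfl ((real_inner_le_norm _ _).trans ?_)
        refine mul_le_mul (norm_sub_le _ _) ?_ (norm_nonneg _) (by positivity)
        exact hnorm _ (by positivity) _ (sub_mem_bddSet (huR n i s h3) (huR m i s h3))
      have h6 := Finset.sum_le_sum fun i (_ : i ∈ Finset.univ) => h5 i
      rw [Finset.sum_add_distrib, ← Finset.sum_mul, Finset.sum_add_distrib] at h6
      have h7 : 0 ≤ ∑ i, ‖gradA j A μ (u n i s) - gradA j A μ (u m i s)‖ ^ 2 :=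
        Finset.sum_nonneg fun i _ => by positivity
      simp only [norm_zero, integral_zero, add_zero, ne_eq, OfNat.ofNat_ne_zero, not_false_eq_true,
        zero_pow, Finset.sum_const_zero] at h4
      linarith)
  have hUm : ∀ i, AEStronglyMeasurable (U i) (volume.restrict (Icc 0 T)) := fun i =>
    aestronglyMeasurable_of_tendsto_ae atTop (fun n => hum n i) (by
      filter_upwards [ae_restrict_mem measurableSet_Icc] with s hs using hU i s hs)
  obtain ⟨g', hg'⟩ := exists_isNemytskii_of_bdd hT.le hf hUm hV (B := B) (by
    filter_upwards [ae_restrict_mem measurableSet_Icc] with t ht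
    exact Eventually.of_forall fun x => hB t ht _ _ _)
  have hlim : ∀ i, Tendsto (fun n => ∫ s in Icc 0 T, ‖g n i s - g' i s‖) atTop (𝓝 0) := by
    intro i
    refine Tendsto.mono_right ?_ (congrArg 𝓝 (integral_zero ℝ ℝ (μ := volume.restrict (Icc 0 T)))).le
    refine tendsto_integral_of_dominated_convergence (fun s => c₀ * B + ‖g' i s‖)
      (fun n => ((hg n i).1.sub (hg' i).1).norm.1) ((integrable_const _).add (hg' i).1.norm)
      (fun n => ?_) ?_
    · filter_upwards [hgB n i] with s hs
      rw [norm_norm]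
      exact (norm_sub_le _ _).trans (add_le_add (hnorm _ hB0 _ hs) le_rfl)
    · filter_upwards [ae_all_iff.2 fun n => (hg n).ae, hg'.ae, ae_all_iff.2 fun n => hgB n i,
        ae_restrict_mem measurableSet_Icc] with s h1 h2 h3 h4
      have h5 : Tendsto (fun n => g n i s) atTop (𝓝 (g' i s)) := by
        refine tendsto_superposition (fun i => hU i s h4)
          (f := fun n x y => F n s x y (fun k => V k s x) i)
          (f' := fun x y => f s x y (fun k => V k s x) i)
          (fun n => (h1 n).mono fun x hx => hx i) (h2.mono fun x hx => hx i)
          (Eventually.of_forall fun x y => ?_) (memLp_const B) h3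
        exact ((PiLp.continuous_apply 2 _ i).tendsto _).comp
          (tendsto_mollify_prod (hc s h4 x fun k => V k s x) (fun y => hB s h4 x y _) y)
      simpa using (h5.sub_const (g' i s)).norm
  refine ⟨g', hg'.congr (fun i => ?_) fun i => EventuallyEq.rfl⟩
  filter_upwards [ae_restrict_mem measurableSet_Icc] with t ht
  exact eqOn_mild_of_tendsto S (fun n => (hg n i).1) (hg' i).1 (hlim i) (fun n t _ => rfl) (hU i) ht

end MonotoneCase

/-- Change y at fixed z by the one-sided bound, then z at fixed y' by the Lipschitz bound and
Young's inequality. The gradients enter with coefficient 1, half of what the energy inequality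
controls. -/
lemma two_inner_sub_le {H : Type*} [NormedAddCommGroup H] {l : ℕ}
    {f : EuclideanSpace ℝ (Fin l) → (Fin l → H) → EuclideanSpace ℝ (Fin l)} {κ C : ℝ}
    (hm : ∀ y y' z, ⟪y - y', f y z - f y' z⟫ ≤ κ * ‖y - y'‖ ^ 2)
    (hL : ∀ y z z', ‖f y z - f y z'‖ ≤ C * ∑ i, ‖z i - z' i‖)
    (y y' : EuclideanSpace ℝ (Fin l)) (z z' : Fin l → H) :
    2 * ⟪y - y', f y z - f y' z'⟫ ≤
      (2 * κ + C ^ 2 * l) * ‖y - y'‖ ^ 2 + ∑ i, ‖z i - z' i‖ ^ 2 := by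
  have h1 : f y z - f y' z' = (f y z - f y' z) + (f y' z - f y' z') := by abel
  have h2 := hm y y' z
  have h3 := (real_inner_le_norm (y - y') (f y' z - f y' z')).trans
    (mul_le_mul_of_nonneg_left (hL y' z z') (norm_nonneg _))
  have h4 := two_mul_mul_sum_le ‖y - y'‖ C fun i => ‖z i - z' i‖
  rw [h1, inner_add_right]
  linarith

/-! ### Existence: bounded nonlinearity depending on the gradient -/

section GradientCase

variable {E H : Type*} [NormedAddCommGroup E] [NormedSpace ℝ E]
  [NormedAddCommGroup H] [InnerProductSpace ℝ H] [CompleteSpace H]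
  [TopologicalSpace.SeparableSpace H] [MeasurableSpace H] [BorelSpace H]
  [MeasurableSpace E] [BorelSpace E] [MeasurableSpace.CountablyGenerated E]
  {j : H →L[ℝ] E} {A : E → H →L[ℝ] H} {b : E → H}
  {μ : Measure E} [IsFiniteMeasure μ] {T : ℝ} {P : ℝ → Lp ℝ 2 μ →L[ℝ] Lp ℝ 2 μ} {α : ℝ} {l : ℕ}
  {f : ℝ → E → EuclideanSpace ℝ (Fin l) → (Fin l → H) → EuclideanSpace ℝ (Fin l)}

/-- Existence of mild solutions for bounded nonlinearities that are continuous and one-sided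
Lipschitz in the solution and Lipschitz in the gradient. -/
lemma exists_mild_of_bounded (S : FormSetting j A b μ T P α) (hf : MeasurableNonlinearity T f)
    {φ : Fin l → Lp ℝ 2 μ} {M : ℝ} (hφ : ∀ i, φ i ∈ bddSet μ M) {B C : ℝ}
    (hB : ∀ t ∈ Icc 0 T, ∀ x y z, ‖f t x y z‖ ≤ B)
    (hL : ∀ t ∈ Icc 0 T, ∀ x y z z', ‖f t x y z - f t x y z'‖ ≤ C * ∑ i, ‖z i - z' i‖)
    (hc : ∀ t ∈ Icc 0 T, ∀ x z, Continuous fun y => f t x y z)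
    {κ : ℝ → ℝ} (hκ : IntegrableOn κ (Icc 0 T)) (hκ0 : ∀ s, 0 ≤ κ s)
    (hm : ∀ t ∈ Icc 0 T, ∀ x y y' z, ⟪y - y', f t x y z - f t x y' z⟫ ≤ κ t * ‖y - y'‖ ^ 2) :
    ∃ g, IsNemytskii μ T f (fun i => mild P T (φ i) (g i))
      (fun i t => gradA j A μ (mild P T (φ i) (g i) t)) g := by
  have hT := S.time_pos
  have hex : ∀ V : Fin l → ℝ → Lp H 2 μ, ∃ g, (∀ i, MemLp (V i) 2 (volume.restrict (Icc 0 T))) →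
      IsNemytskii μ T f (fun i => mild P T (φ i) (g i)) V g := by
    intro V
    by_cases hV : ∀ i, MemLp (V i) 2 (volume.restrict (Icc 0 T))
    · obtain ⟨g, hg⟩ := exists_mild_of_monotone S hf (fun i => (hV i).1) hφ hB hc hκ hκ0 hm
      exact ⟨g, fun _ => hg⟩
    · exact ⟨0, fun h => absurd h hV⟩
  choose N hN using hex
  set k : ℝ → ℝ := fun s => 2 * κ s + C ^ 2 * l with hk
  have hki : IntegrableOn k (Icc 0 T) := (hκ.const_mul 2).add (integrable_const _)
  have hk0 : ∀ s, 0 ≤ k s := fun s => add_nonneg (mul_nonneg zero_le_two (hκ0 s)) (by positivity)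
  have hkα : IntegrableOn (fun s => k s + α) (Icc 0 T) := Integrable.add hki (integrable_const _)
  set w := expWeight (fun s => k s + α) with hw
  have hwc : ContinuousOn w (Icc 0 T) := continuousOn_expWeight hT.le hkα
  -- The fixed point is sought among gradients only: V is frozen, the equation is solved, and D of
  -- the solution is returned. The energy inequality bounds twice the weighted distance of the
  -- outputs by that of the inputs, whence the factor 1/2.
  obtain ⟨V, hV, hfix⟩ := exists_fixedPoint_weighted (ν := volume.restrict (Icc 0 T)) (w := w)
    (hwc.aemeasurable measurableSet_Icc) (W := Real.exp (∫ s in Icc 0 T, |k s + α|))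
    (by
      filter_upwards [ae_restrict_mem measurableSet_Icc] with s hs
      exact one_le_expWeight (fun s => add_nonneg (hk0 s) S.nonneg) hs.1)
    (by
      filter_upwards [ae_restrict_mem measurableSet_Icc] with s hs
      exact expWeight_le hkα hs)
    (fun V i s => gradA j A μ (mild P T (φ i) (N V i) s))
    (fun V hV i => (inFhat_mild S (φ i) (hN V hV i).1).memLp) (by
      intro V V' hV hV'
      have hg := hN V hV
      have hg' := hN V' hV'
      set u := fun i => mild P T (φ i) (N V i) with hu
      set u' := fun i => mild P T (φ i) (N V' i) with hu'
      have hVi : IntegrableOn (fun s => ∑ i, ‖V i s - V' i s‖ ^ 2) (Icc 0 T) :=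
        integrable_finsetSum _ fun i _ => ((hV i).sub (hV' i)).integrable_norm_pow (by norm_num)
      have h1 := energy_sub_le S (fun i => (hg i).1) (fun i => (hg' i).1) (u := u) (u' := u')
        (φ := φ) (φ' := φ) (fun i t _ => rfl) (fun i t _ => rfl) hki hVi (by
          filter_upwards [hg.ae, hg'.ae, ae_restrict_mem measurableSet_Icc] with s h1 h2 h3
          have h4 := two_sum_inner_sub_le (u := fun i => u i s) (u' := fun i => u' i s) h1 h2
            (e := fun i => V i s - V' i s) (k := k s) (d := fun _ => 0) (integrable_zero _ _ _) (by
              filter_upwards [ae_coeFn_sub (fun i => V i s) (fun i => V' i s)] with x h5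
              simp only [h5, add_zero]
              exact two_inner_sub_le (hm s h3 x) (hL s h3 x) _ _ _ _)
          simpa only [integral_zero, add_zero] using h4) (t := 0) ⟨le_rfl, hT.le⟩
      have h2 : ∑ i : Fin l, ‖φ i - φ i‖ ^ 2 = 0 := by simp
      have h3 : 0 ≤ expWeight (fun s => k s + α) 0 * ∑ i, ‖u i 0 - u' i 0‖ ^ 2 :=
        mul_nonneg (expWeight_pos _ _).le (Finset.sum_nonneg fun i _ => by positivity)
      rw [h2, mul_zero, zero_add] at h1
      simp only [hu, hu', hw] at h1 h3 ⊢
      linarith)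
  exact ⟨N V, (hN V hV).congr (fun i => EventuallyEq.rfl) fun i => (hfix i).symm⟩

end GradientCase

/-! ### Radial truncation and cutoff -/

section Truncation

variable {H Y : Type*} [NormedAddCommGroup H] [InnerProductSpace ℝ H]
  [NormedAddCommGroup Y] [InnerProductSpace ℝ Y]

/-- Radial truncation at radius `ρ`. -/
noncomputable def radialTrunc (ρ : ℝ) (z : H) : H := min 1 (ρ / ‖z‖) • z

variable {ρ ρ' : ℝ} {z z' : H}

lemma radialTrunc_zero : radialTrunc ρ (0 : H) = 0 := smul_zero _

lemma min_one_div_mul (hρ : 0 ≤ ρ) (z : H) : min 1 (ρ / ‖z‖) * ‖z‖ = min ‖z‖ ρ := by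
  rcases eq_or_ne ‖z‖ 0 with h | h
  · rw [h, mul_zero, min_eq_left hρ]
  · rw [min_mul_of_nonneg _ _ (norm_nonneg _), one_mul, div_mul_cancel₀ _ h]

lemma min_one_div_nonneg (hρ : 0 ≤ ρ) (z : H) : 0 ≤ min 1 (ρ / ‖z‖) :=
  le_min zero_le_one (div_nonneg hρ (norm_nonneg _))

lemma norm_radialTrunc (hρ : 0 ≤ ρ) (z : H) : ‖radialTrunc ρ z‖ = min ‖z‖ ρ := by
  rw [radialTrunc, norm_smul, Real.norm_of_nonneg (min_one_div_nonneg hρ z), min_one_div_mul hρ]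

lemma radialTrunc_of_le (h : ‖z‖ ≤ ρ) : radialTrunc ρ z = z := by
  rcases eq_or_ne z 0 with rfl | h0
  · exact radialTrunc_zero
  · rw [radialTrunc, min_eq_left, one_smul]
    rwa [one_le_div (norm_pos_iff.2 h0)]

/-- After squaring, the radial parts are compared through the 1-Lipschitz map r ↦ min(r, ρ), and the
angular parts through Cauchy–Schwarz, as the product of the two scaling factors is at most 1. -/
lemma norm_radialTrunc_sub_le (hρ : 0 ≤ ρ) (z z' : H) :
    ‖radialTrunc ρ z - radialTrunc ρ z'‖ ≤ ‖z - z'‖ := by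
  refine (sq_le_sq₀ (norm_nonneg _) (norm_nonneg _)).1 ?_
  rw [norm_sub_sq_real, norm_sub_sq_real, norm_radialTrunc hρ, norm_radialTrunc hρ, radialTrunc,
    radialTrunc, real_inner_smul_left, real_inner_smul_right]
  have h1 := min_one_div_mul hρ z
  have h2 := min_one_div_mul hρ z'
  have h3 : |min ‖z‖ ρ - min ‖z'‖ ρ| ≤ |‖z‖ - ‖z'‖| := by
    have := abs_min_sub_min_le_max ‖z‖ ρ ‖z'‖ ρ
    simpa using this
  have h4 := sq_le_sq.2 h3
  have h5 : min 1 (ρ / ‖z‖) * min 1 (ρ / ‖z'‖) ≤ 1 :=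
    mul_le_one₀ (min_le_left _ _) (min_one_div_nonneg hρ z') (min_le_left _ _)
  have h6 := mul_le_mul_of_nonneg_left (real_inner_le_norm z z') (sub_nonneg.2 h5)
  have h7 : min 1 (ρ / ‖z‖) * min 1 (ρ / ‖z'‖) * (‖z‖ * ‖z'‖) = min ‖z‖ ρ * min ‖z'‖ ρ := by
    rw [← h1, ← h2]
    ring
  nlinarith

lemma norm_radialTrunc_sub_radialTrunc_le (hρ : 0 ≤ ρ) (h : ρ ≤ ρ') (z : H) :
    ‖radialTrunc ρ z - radialTrunc ρ' z‖ ≤ if ρ < ‖z‖ then ‖z‖ else 0 := by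
  split_ifs with hz
  · have h1 := min_one_div_nonneg hρ z
    have h2 := min_one_div_nonneg (hρ.trans h) z
    have h3 := min_le_left 1 (ρ / ‖z‖)
    have h4 := min_le_left 1 (ρ' / ‖z‖)
    rw [radialTrunc, radialTrunc, ← sub_smul, norm_smul, Real.norm_eq_abs]
    refine mul_le_of_le_one_left (norm_nonneg _) (abs_le.2 ⟨by linarith, by linarith⟩)
  · rw [radialTrunc_of_le (not_lt.1 hz), radialTrunc_of_le ((not_lt.1 hz).trans h), sub_self,
      norm_zero]

/-- Lipschitz cutoff, equal to `1` on the ball of radius `r` and to `0` off the ball of radius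
`r + 1`. -/
noncomputable def cutoff (r : ℝ) (y : Y) : ℝ := max 0 (min 1 (r + 1 - ‖y‖))

variable {r : ℝ}

lemma cutoff_nonneg (y : Y) : 0 ≤ cutoff r y := le_max_left _ _

lemma cutoff_le_one (y : Y) : cutoff r y ≤ 1 := max_le zero_le_one (min_le_left _ _)

lemma cutoff_of_le {y : Y} (h : ‖y‖ ≤ r) : cutoff r y = 1 := by
  rw [cutoff, min_eq_left (by linarith), max_eq_right zero_le_one]

lemma cutoff_of_lt {y : Y} (h : r + 1 < ‖y‖) : cutoff r y = 0 :=
  max_eq_left ((min_le_right _ _).trans (by linarith))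

lemma continuous_cutoff : Continuous (cutoff r : Y → ℝ) := by
  unfold cutoff
  fun_prop

lemma abs_cutoff_sub_le (y y' : Y) : |cutoff r y - cutoff r y'| ≤ ‖y - y'‖ := by
  have h1 := abs_max_sub_max_le_max 0 (min 1 (r + 1 - ‖y‖)) 0 (min 1 (r + 1 - ‖y'‖))
  have h2 := abs_min_sub_min_le_max 1 (r + 1 - ‖y‖) 1 (r + 1 - ‖y'‖)
  have h3 := abs_norm_sub_norm_le y' y
  replace h1 := h1.trans (max_le (by simp) le_rfl)
  replace h2 := h2.trans (max_le (by simp) le_rfl)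
  rw [sub_sub_sub_cancel_left] at h2
  rw [norm_sub_rev]
  exact h1.trans (h2.trans h3)

/-- The increment is split so that the difference of the cutoffs, which is 1-Lipschitz, multiplies G
at a point inside the ball of radius r + 1, where G is bounded. The other part multiplies the
one-sided bound by a number in [0,1], whence |κ| instead of κ. -/
lemma inner_cutoff_smul_sub_le {G : Y → Y} {κ M : ℝ} (hM : 0 ≤ M)
    (hG : ∀ y, ‖y‖ ≤ r + 1 → ‖G y‖ ≤ M)
    (hm : ∀ y y', ⟪y - y', G y - G y'⟫ ≤ κ * ‖y - y'‖ ^ 2) (y y' : Y) :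
    ⟪y - y', cutoff r y • G y - cutoff r y' • G y'⟫ ≤ (|κ| + M) * ‖y - y'‖ ^ 2 := by
  have hθ : ∀ θ : ℝ, 0 ≤ θ → θ ≤ 1 → θ * ⟪y - y', G y - G y'⟫ ≤ |κ| * ‖y - y'‖ ^ 2 := by
    intro θ h0 h1
    have e1 : ⟪y - y', G y - G y'⟫ ≤ |κ| * ‖y - y'‖ ^ 2 :=
      (hm y y').trans (mul_le_mul_of_nonneg_right (le_abs_self κ) (by positivity))
    have e2 := mul_le_mul_of_nonneg_left e1 h0
    have e3 : 0 ≤ |κ| * ‖y - y'‖ ^ 2 := by positivity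
    nlinarith
  have hc : ∀ x, ‖x‖ ≤ r + 1 →
      (cutoff r y - cutoff r y') * ⟪y - y', G x⟫ ≤ M * ‖y - y'‖ ^ 2 := by
    intro x hx
    refine (le_abs_self _).trans ?_
    rw [abs_mul]
    have e1 := (abs_real_inner_le_norm (y - y') (G x)).trans
      (mul_le_mul_of_nonneg_left (hG x hx) (norm_nonneg _))
    have e2 := mul_le_mul (abs_cutoff_sub_le (r := r) y y') e1 (abs_nonneg _) (norm_nonneg _)
    linarith
  by_cases h' : ‖y'‖ ≤ r + 1
  · have e1 : cutoff r y • G y - cutoff r y' • G y' =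
        cutoff r y • (G y - G y') + (cutoff r y - cutoff r y') • G y' := by module
    rw [e1, inner_add_right, real_inner_smul_right, real_inner_smul_right]
    have := hθ _ (cutoff_nonneg (r := r) y) (cutoff_le_one y)
    have := hc y' h'
    linarith
  · by_cases h : ‖y‖ ≤ r + 1
    · have e1 : cutoff r y • G y - cutoff r y' • G y' =
          cutoff r y' • (G y - G y') + (cutoff r y - cutoff r y') • G y := by module
      rw [e1, inner_add_right, real_inner_smul_right, real_inner_smul_right]
      have := hθ _ (cutoff_nonneg (r := r) y') (cutoff_le_one y')
      have := hc y h
      linarith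
    · rw [cutoff_of_lt (not_le.1 h), cutoff_of_lt (not_le.1 h')]
      simp only [zero_smul, sub_self, inner_zero_right]
      positivity

end Truncation

lemma mul_le_of_le_one_of_le_of_nonneg {a b c : ℝ} (ha : a ≤ 1) (hb : b ≤ c) (hb0 : 0 ≤ b) :
    a * b ≤ c :=
  (mul_le_of_le_one_left hb0 ha).trans hb

/-- Reduces the supremum in (H4) to a countable one, which makes it measurable. -/
lemma iSup_eq_biSup_of_dense {X : Type*} [TopologicalSpace X] {F : X → ℝ≥0∞} (hF : Continuous F)
    {D : Set X} (hD : Dense D) : ⨆ x, F x = ⨆ x ∈ D, F x := by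
  refine le_antisymm (iSup_le fun x => ?_) (iSup₂_le fun x _ => le_iSup F x)
  have hcl : IsClosed {x | F x ≤ ⨆ x ∈ D, F x} := isClosed_le hF continuous_const
  exact hcl.closure_subset_iff.2 (fun y hy => le_iSup₂_of_le (f := fun y _ => F y) y hy le_rfl) (hD x)

/-! ### The truncated nonlinearity -/

section TruncatedNonlinearity

variable {E H : Type*} [MeasurableSpace E] [NormedAddCommGroup E]
  [NormedAddCommGroup H] [InnerProductSpace ℝ H] [CompleteSpace H]
  [TopologicalSpace.SeparableSpace H] [MeasurableSpace H] [BorelSpace H]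
  {μ : Measure E} {T : ℝ} {l : ℕ}
  {f : ℝ → E → EuclideanSpace ℝ (Fin l) → (Fin l → H) → EuclideanSpace ℝ (Fin l)}
  {φ : Fin l → Lp ℝ 2 μ} {C : ℝ} {m : ℝ → ℝ} {R : ℝ} {t : ℝ}

/-- `sup_{|y| ≤ R} |f(t,x,y,0) - f(t,x,0,0)|`. -/
noncomputable def oscSup
    (f : ℝ → E → EuclideanSpace ℝ (Fin l) → (Fin l → H) → EuclideanSpace ℝ (Fin l))
    (R t : ℝ) (x : E) : ℝ :=
  (⨆ y ∈ Metric.closedBall (0 : EuclideanSpace ℝ (Fin l)) R, ‖f t x y 0 - f t x 0 0‖ₑ).toReal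

lemma oscSup_nonneg (x : E) : 0 ≤ oscSup f R t x := ENNReal.toReal_nonneg

lemma CondH.iSup_ne_top (h : CondH μ T C m f φ) (ht : t ∈ Icc 0 T) (x : E) :
    (⨆ y ∈ Metric.closedBall (0 : EuclideanSpace ℝ (Fin l)) R, ‖f t x y 0 - f t x 0 0‖ₑ) ≠ ∞ := by
  obtain ⟨B, hB⟩ := (isCompact_closedBall (0 : EuclideanSpace ℝ (Fin l)) R).exists_bound_of_continuousOn
    ((h.continuous t ht x 0).sub continuous_const).continuousOn (f := fun y => f t x y 0 - f t x 0 0)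
  refine ne_top_of_le_ne_top (ENNReal.ofReal_ne_top (r := B)) (iSup₂_le fun y hy => ?_)
  rw [← ofReal_norm]
  exact ENNReal.ofReal_le_ofReal (hB y hy)

lemma CondH.le_oscSup (h : CondH μ T C m f φ) (ht : t ∈ Icc 0 T) (x : E)
    {y : EuclideanSpace ℝ (Fin l)} (hy : ‖y‖ ≤ R) :
    ‖f t x y 0 - f t x 0 0‖ ≤ oscSup f R t x := by
  rw [← toReal_enorm]
  refine ENNReal.toReal_mono (h.iSup_ne_top ht x) ?_
  exact le_iSup₂_of_le (f := fun y _ => ‖f t x y 0 - f t x 0 0‖ₑ) y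
    (mem_closedBall_zero_iff.2 hy) le_rfl

lemma MeasurableNonlinearity.comp (hf : MeasurableNonlinearity T f) {Ω : Type*} [MeasurableSpace Ω]
    {τ : Ω → Icc (0 : ℝ) T} {x : Ω → E} {y : Ω → EuclideanSpace ℝ (Fin l)} {z : Ω → Fin l → H}
    (hτ : Measurable τ) (hx : Measurable x) (hy : Measurable y) (hz : Measurable z) :
    Measurable fun ω => f (τ ω) (x ω) (y ω) (z ω) := by
  have h1 : Measurable fun ω => (τ ω, x ω, y ω, z ω) := hτ.prodMk (hx.prodMk (hy.prodMk hz))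
  exact Measurable.comp hf h1

lemma CondH.measurable_oscSup (h : CondH μ T C m f φ) (R : ℝ) :
    Measurable fun p : Icc (0 : ℝ) T × E => oscSup f R p.1 p.2 := by
  refine Measurable.ennreal_toReal ?_
  obtain ⟨D, hDc, hDd⟩ := TopologicalSpace.exists_countable_dense
    (Metric.closedBall (0 : EuclideanSpace ℝ (Fin l)) R)
  have heq : (fun p : Icc (0 : ℝ) T × E =>
      ⨆ y ∈ Metric.closedBall (0 : EuclideanSpace ℝ (Fin l)) R,
        ‖f p.1 p.2 y 0 - f p.1 p.2 0 0‖ₑ) =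
      fun p => ⨆ y ∈ D, ‖f p.1 p.2 y.1 0 - f p.1 p.2 0 0‖ₑ := by
    funext p
    rw [← iSup_eq_biSup_of_dense (X := Metric.closedBall (0 : EuclideanSpace ℝ (Fin l)) R)
      (F := fun y => ‖f p.1 p.2 y.1 0 - f p.1 p.2 0 0‖ₑ) (continuous_enorm.comp
        (((h.continuous p.1 p.1.2 p.2 0).comp continuous_subtype_val).sub continuous_const)) hDd,
      iSup_subtype']
  rw [heq]
  refine Measurable.biSup D hDc fun y _ => ?_
  have h1 : ∀ y : EuclideanSpace ℝ (Fin l), Measurable fun p : Icc (0 : ℝ) T × E =>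
      f p.1 p.2 y 0 := fun y =>
    h.measurable.comp measurable_fst measurable_snd measurable_const measurable_const
  exact ((h1 y.1).sub (h1 0)).enorm

lemma CondH.norm_sub_zero_le (h : CondH μ T C m f φ) (ht : t ∈ Icc 0 T) (x : E)
    {y : EuclideanSpace ℝ (Fin l)} (hy : ‖y‖ ≤ R) (z : Fin l → H) :
    ‖f t x y z - f t x 0 0‖ ≤ oscSup f R t x + C * ∑ i, ‖z i‖ := by
  have h1 := h.lipschitz t ht x y z 0
  have h2 := h.le_oscSup ht x hy
  have h3 : f t x y z - f t x 0 0 = (f t x y z - f t x y 0) + (f t x y 0 - f t x 0 0) := by abel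
  simp only [Pi.zero_apply, sub_zero] at h1
  rw [h3]
  exact (norm_add_le _ _).trans (by linarith)

/-- Truncation of the nonlinearity in all its arguments. -/
noncomputable def truncNonlinearity
    (f : ℝ → E → EuclideanSpace ℝ (Fin l) → (Fin l → H) → EuclideanSpace ℝ (Fin l))
    (r N ρ t : ℝ) (x : E) (y : EuclideanSpace ℝ (Fin l)) (z : Fin l → H) :
    EuclideanSpace ℝ (Fin l) :=
  (if oscSup f (r + 1) t x ≤ ρ then (1 : ℝ) else 0) •
      (cutoff r y • (f t x y (fun i => radialTrunc ρ (z i)) - f t x 0 0)) +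
    if ‖f t x 0 0‖ ≤ N then f t x 0 0 else 0

variable {r N ρ ρ' : ℝ}

lemma ite_one_zero_nonneg (p : Prop) [Decidable p] : (0 : ℝ) ≤ if p then 1 else 0 := by
  split_ifs <;> norm_num

lemma ite_one_zero_le_one (p : Prop) [Decidable p] : (if p then (1 : ℝ) else 0) ≤ 1 := by
  split_ifs <;> norm_num

lemma norm_ite_le (hN : 0 ≤ N) (v : EuclideanSpace ℝ (Fin l)) :
    ‖if ‖v‖ ≤ N then v else 0‖ ≤ N := by
  split_ifs with h
  · exact h
  · rwa [norm_zero]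

lemma measurable_radialTrunc (ρ : ℝ) : Measurable (radialTrunc ρ : H → H) := by
  unfold radialTrunc
  exact (measurable_const.min (measurable_const.div measurable_norm)).smul measurable_id

lemma CondH.measurable_trunc (h : CondH μ T C m f φ) (r N ρ : ℝ) :
    MeasurableNonlinearity T (truncNonlinearity f r N ρ) := by
  let Ω := Icc (0 : ℝ) T × E × EuclideanSpace ℝ (Fin l) × (Fin l → H)
  have ht : Measurable fun p : Ω => p.1 := measurable_fst
  have hx : Measurable fun p : Ω => p.2.1 := measurable_snd.fst
  have hy : Measurable fun p : Ω => p.2.2.1 := measurable_snd.snd.fst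
  have hz : Measurable fun p : Ω => p.2.2.2 := measurable_snd.snd.snd
  have hz' : Measurable fun p : Ω => fun i => radialTrunc ρ (p.2.2.2 i) :=
    measurable_pi_lambda _ fun i => (measurable_radialTrunc ρ).comp ((measurable_pi_apply i).comp hz)
  have h0 : Measurable fun p : Ω => f p.1 p.2.1 0 0 :=
    h.measurable.comp (τ := fun p : Ω => p.1) (x := fun p => p.2.1) (y := fun _ => 0)
      (z := fun _ => 0) ht hx measurable_const measurable_const
  have h1 : Measurable fun p : Ω => f p.1 p.2.1 p.2.2.1 fun i => radialTrunc ρ (p.2.2.2 i) :=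
    h.measurable.comp (τ := fun p : Ω => p.1) (x := fun p => p.2.1) (y := fun p => p.2.2.1)
      (z := fun p i => radialTrunc ρ (p.2.2.2 i)) ht hx hy hz'
  have h2 : Measurable fun p : Ω => oscSup f (r + 1) p.1 p.2.1 :=
    (h.measurable_oscSup (r + 1)).comp (f := fun p : Ω => (p.1, p.2.1)) (ht.prodMk hx)
  have h3 : Measurable fun p : Ω => if oscSup f (r + 1) p.1 p.2.1 ≤ ρ then (1 : ℝ) else 0 :=
    Measurable.ite (measurableSet_le h2 measurable_const) measurable_const measurable_const
  have h4 : Measurable fun p : Ω => cutoff r p.2.2.1 := continuous_cutoff.measurable.comp hy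
  have h5 : Measurable fun p : Ω => if ‖f p.1 p.2.1 0 0‖ ≤ N then f p.1 p.2.1 0 0 else 0 :=
    Measurable.ite (measurableSet_le h0.norm measurable_const) h0 measurable_const
  exact (h3.smul (h4.smul (h1.sub h0))).add h5

/-- This bound does not involve ρ and serves as the common dominant when ρ → ∞; the constant bound
that follows makes each truncated problem accessible but grows with ρ. -/
lemma CondH.norm_trunc_le (h : CondH μ T C m f φ) (hC : 0 ≤ C) (hN : 0 ≤ N) (hρ : 0 ≤ ρ)
    (ht : t ∈ Icc 0 T) (x : E) (y : EuclideanSpace ℝ (Fin l)) (z : Fin l → H) :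
    ‖truncNonlinearity f r N ρ t x y z‖ ≤ oscSup f (r + 1) t x + C * ∑ i, ‖z i‖ + N := by
  refine (norm_add_le _ _).trans (add_le_add ?_ (norm_ite_le hN _))
  have h0 : 0 ≤ oscSup f (r + 1) t x + C * ∑ i, ‖z i‖ :=
    add_nonneg (oscSup_nonneg x) (mul_nonneg hC (Finset.sum_nonneg fun i _ => norm_nonneg _))
  rw [norm_smul, norm_smul, Real.norm_of_nonneg (ite_one_zero_nonneg _),
    Real.norm_of_nonneg (cutoff_nonneg y)]
  refine mul_le_of_le_one_of_le_of_nonneg (ite_one_zero_le_one _) ?_ (mul_nonneg (cutoff_nonneg y) (norm_nonneg _))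
  by_cases hy : ‖y‖ ≤ r + 1
  · refine mul_le_of_le_one_of_le_of_nonneg (cutoff_le_one y) ?_ (norm_nonneg _)
    refine (h.norm_sub_zero_le ht x hy _).trans ?_
    gcongr with i
    rw [norm_radialTrunc hρ]
    exact min_le_left _ _
  · rw [cutoff_of_lt (not_le.1 hy), zero_mul]
    exact h0

lemma CondH.norm_trunc_le_const (h : CondH μ T C m f φ) (hC : 0 ≤ C) (hN : 0 ≤ N) (hρ : 0 ≤ ρ)
    (ht : t ∈ Icc 0 T) (x : E) (y : EuclideanSpace ℝ (Fin l)) (z : Fin l → H) :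
    ‖truncNonlinearity f r N ρ t x y z‖ ≤ ρ + C * (l * ρ) + N := by
  refine (norm_add_le _ _).trans (add_le_add ?_ (norm_ite_le hN _))
  have h0 : 0 ≤ ρ + C * (l * ρ) := by positivity
  by_cases hosc : oscSup f (r + 1) t x ≤ ρ
  · rw [if_pos hosc, one_smul, norm_smul, Real.norm_of_nonneg (cutoff_nonneg y)]
    by_cases hy : ‖y‖ ≤ r + 1
    · refine mul_le_of_le_one_of_le_of_nonneg (cutoff_le_one y) ?_ (norm_nonneg _)
      refine (h.norm_sub_zero_le ht x hy _).trans (add_le_add hosc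
        (mul_le_mul_of_nonneg_left ?_ hC))
      refine (Finset.sum_le_sum fun i _ => (norm_radialTrunc hρ (z i)).trans_le
        (min_le_right _ _)).trans_eq ?_
      simp
    · rw [cutoff_of_lt (not_le.1 hy), zero_mul]
      exact h0
  · rw [if_neg hosc, zero_smul, norm_zero]
    exact h0

lemma CondH.lipschitz_trunc (h : CondH μ T C m f φ) (hC : 0 ≤ C) (hρ : 0 ≤ ρ)
    (ht : t ∈ Icc 0 T) (x : E) (y : EuclideanSpace ℝ (Fin l)) (z z' : Fin l → H) :
    ‖truncNonlinearity f r N ρ t x y z - truncNonlinearity f r N ρ t x y z'‖ ≤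
      C * ∑ i, ‖z i - z' i‖ := by
  have h0 : 0 ≤ C * ∑ i, ‖z i - z' i‖ :=
    mul_nonneg hC (Finset.sum_nonneg fun i _ => norm_nonneg _)
  rw [truncNonlinearity, truncNonlinearity, add_sub_add_right_eq_sub, ← smul_sub, ← smul_sub,
    sub_sub_sub_cancel_right, norm_smul, norm_smul, Real.norm_of_nonneg (ite_one_zero_nonneg _),
    Real.norm_of_nonneg (cutoff_nonneg y)]
  have h1 : 0 ≤ cutoff r y := cutoff_nonneg y
  refine mul_le_of_le_one_of_le_of_nonneg (ite_one_zero_le_one _) ?_ (mul_nonneg h1 (norm_nonneg _))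
  refine mul_le_of_le_one_of_le_of_nonneg (cutoff_le_one y) ?_ (norm_nonneg _)
  refine (h.lipschitz t ht x y _ _).trans ?_
  gcongr with i
  exact norm_radialTrunc_sub_le hρ _ _

lemma CondH.continuous_trunc (h : CondH μ T C m f φ) (ht : t ∈ Icc 0 T) (x : E) (z : Fin l → H) :
    Continuous fun y => truncNonlinearity f r N ρ t x y z := by
  have h1 : Continuous fun y => cutoff r y • (f t x y (fun i => radialTrunc ρ (z i)) - f t x 0 0) :=
    continuous_cutoff.smul ((h.continuous t ht x _).sub continuous_const)
  exact (h1.const_smul (if oscSup f (r + 1) t x ≤ ρ then (1 : ℝ) else 0)).add continuous_const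

/-- The cutoff spoils the one-sided constant by the size of the truncated function. The resulting
rate depends on ρ, so it is used only to solve the problem for fixed ρ. -/
lemma CondH.monotone_trunc (h : CondH μ T C m f φ) (hC : 0 ≤ C) (hρ : 0 ≤ ρ)
    (ht : t ∈ Icc 0 T) (x : E) (y y' : EuclideanSpace ℝ (Fin l)) (z : Fin l → H) :
    ⟪y - y', truncNonlinearity f r N ρ t x y z - truncNonlinearity f r N ρ t x y' z⟫ ≤
      (|m t| + (ρ + C * (l * ρ))) * ‖y - y'‖ ^ 2 := by
  rw [truncNonlinearity, truncNonlinearity, add_sub_add_right_eq_sub]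
  by_cases hosc : oscSup f (r + 1) t x ≤ ρ
  · simp only [if_pos hosc, one_smul]
    refine inner_cutoff_smul_sub_le
      (G := fun y => f t x y (fun i => radialTrunc ρ (z i)) - f t x 0 0) (by positivity)
      (fun y hy => ?_) (fun y y' => ?_) y y'
    · refine (h.norm_sub_zero_le ht x hy _).trans (add_le_add hosc
        (mul_le_mul_of_nonneg_left ?_ hC))
      refine (Finset.sum_le_sum fun i _ => (norm_radialTrunc hρ (z i)).trans_le
        (min_le_right _ _)).trans_eq ?_
      simp
    · rw [sub_sub_sub_cancel_right]
      exact h.monotone t ht x y y' _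
  · simp only [if_neg hosc, zero_smul, sub_self, inner_zero_right]
    positivity

/-- At y' = 0 the cutoff and the indicator merely multiply an expression with a nonnegative upper
bound by a number in [0,1]. The constants therefore do not involve r or ρ, and the a priori bounds
are uniform. -/
lemma CondH.inner_trunc_le (h : CondH μ T C m f φ) (hN : 0 ≤ N) (hρ : 0 ≤ ρ)
    (ht : t ∈ Icc 0 T) (x : E) (y : EuclideanSpace ℝ (Fin l)) (z : Fin l → H) :
    2 * ⟪y, truncNonlinearity f r N ρ t x y z⟫ ≤
      (2 * |m t| + C ^ 2 * l + 1) * ‖y‖ ^ 2 + ∑ i, ‖z i‖ ^ 2 + N ^ 2 := by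
  have h1 := two_inner_sub_le (h.monotone t ht x) (h.lipschitz t ht x) y 0
    (fun i => radialTrunc ρ (z i)) 0
  simp only [sub_zero, Pi.zero_apply] at h1
  have h2 : ∑ i, ‖radialTrunc ρ (z i)‖ ^ 2 ≤ ∑ i, ‖z i‖ ^ 2 := Finset.sum_le_sum fun i _ => by
    rw [norm_radialTrunc hρ]
    exact pow_le_pow_left₀ (le_min (norm_nonneg _) hρ) (min_le_left _ _) 2
  have h3 : m t * ‖y‖ ^ 2 ≤ |m t| * ‖y‖ ^ 2 :=
    mul_le_mul_of_nonneg_right (le_abs_self _) (by positivity)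
  have h4 : ∀ θ : ℝ, 0 ≤ θ → θ ≤ 1 →
      θ * (2 * ⟪y, f t x y (fun i => radialTrunc ρ (z i)) - f t x 0 0⟫) ≤
      (2 * |m t| + C ^ 2 * l) * ‖y‖ ^ 2 + ∑ i, ‖z i‖ ^ 2 := fun θ h0 h1' => by
    have e0 : 0 ≤ ∑ i, ‖z i‖ ^ 2 := Finset.sum_nonneg fun i _ => by positivity
    have e1 : 0 ≤ (2 * |m t| + C ^ 2 * l) * ‖y‖ ^ 2 + ∑ i, ‖z i‖ ^ 2 := by positivity
    have e2 : 2 * ⟪y, f t x y (fun i => radialTrunc ρ (z i)) - f t x 0 0⟫ ≤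
      (2 * |m t| + C ^ 2 * l) * ‖y‖ ^ 2 + ∑ i, ‖z i‖ ^ 2 := by linarith
    nlinarith [mul_le_mul_of_nonneg_left e2 h0]
  have h5 := (real_inner_le_norm y (if ‖f t x 0 0‖ ≤ N then f t x 0 0 else 0)).trans
    (mul_le_mul_of_nonneg_left (norm_ite_le hN _) (norm_nonneg _))
  have h6 := h4 ((if oscSup f (r + 1) t x ≤ ρ then (1 : ℝ) else 0) * cutoff r y)
    (mul_nonneg (ite_one_zero_nonneg _) (cutoff_nonneg y))
    (mul_le_one₀ (ite_one_zero_le_one _) (cutoff_nonneg y) (cutoff_le_one y))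
  rw [truncNonlinearity, inner_add_right, real_inner_smul_right, real_inner_smul_right]
  nlinarith [sq_nonneg (‖y‖ - N)]

/-- The error density in comparing two truncations. -/
noncomputable def truncError
    (f : ℝ → E → EuclideanSpace ℝ (Fin l) → (Fin l → H) → EuclideanSpace ℝ (Fin l))
    (C r ρ t : ℝ) (x : E) (z : Fin l → H) : ℝ :=
  (if ρ < oscSup f (r + 1) t x then oscSup f (r + 1) t x else 0) +
    C / √ρ * ∑ i, (2 * ‖z i‖ ^ 2 + oscSup f (r + 1) t x)

/-- Where the oscillation is at most ρ, the truncations differ only through gradients with |z_i| >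
ρ, and there |z_i|√ρ ≤ |z_i|² since ρ ≥ 1. Where the oscillation p exceeds ρ, one nonlinear part
vanishes and |z_i|√ρ ≤ 2|z_i|² + p. The error thus needs only an L² bound on gradients and an L¹
bound on the oscillation. -/
lemma CondH.norm_trunc_sub_le (h : CondH μ T C m f φ) (hC : 0 ≤ C) (hρ : 1 ≤ ρ) (hρ' : ρ ≤ ρ')
    (ht : t ∈ Icc 0 T) (x : E) {y : EuclideanSpace ℝ (Fin l)} (hy : ‖y‖ ≤ r) (z : Fin l → H) :
    ‖truncNonlinearity f r N ρ t x y z - truncNonlinearity f r N ρ' t x y z‖ ≤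
      truncError f C r ρ t x z := by
  set p := oscSup f (r + 1) t x with hp
  have hp0 : 0 ≤ p := oscSup_nonneg x
  have hρ0 : 0 ≤ ρ := zero_le_one.trans hρ
  have hs : 0 < √ρ := Real.sqrt_pos.2 (zero_lt_one.trans_le hρ)
  have hss : √ρ * √ρ = ρ := Real.mul_self_sqrt hρ0
  have hs1 : 1 ≤ √ρ := Real.one_le_sqrt.2 hρ
  rw [truncNonlinearity, truncNonlinearity, add_sub_add_right_eq_sub, cutoff_of_le hy, one_smul,
    one_smul, truncError]
  simp only [← hp]
  have key : ∀ i, ∀ a : ℝ, a ≤ 2 * ‖z i‖ ^ 2 + p → a / √ρ ≤ (2 * ‖z i‖ ^ 2 + p) / √ρ :=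
    fun i a ha => div_le_div_of_nonneg_right ha hs.le
  have hgoal : ∀ a : Fin l → ℝ, (∀ i, a i * √ρ ≤ 2 * ‖z i‖ ^ 2 + p) →
      C * ∑ i, a i ≤ C / √ρ * ∑ i, (2 * ‖z i‖ ^ 2 + p) := fun a ha => by
    rw [div_mul_eq_mul_div, le_div_iff₀ hs, mul_assoc, Finset.sum_mul]
    exact mul_le_mul_of_nonneg_left (Finset.sum_le_sum fun i _ => ha i) hC
  by_cases h1 : p ≤ ρ
  · rw [if_pos h1, if_pos (h1.trans hρ'), if_neg (not_lt.2 h1), one_smul, one_smul,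
      sub_sub_sub_cancel_right, zero_add]
    refine (h.lipschitz t ht x y _ _).trans (hgoal _ fun i => ?_)
    have h2 := norm_radialTrunc_sub_radialTrunc_le hρ0 hρ' (z i)
    refine (mul_le_mul_of_nonneg_right h2 hs.le).trans ?_
    split_ifs with h3
    · nlinarith [norm_nonneg (z i)]
    · rw [zero_mul]
      positivity
  · rw [if_neg h1, zero_smul, zero_sub, norm_neg, norm_smul,
      Real.norm_of_nonneg (ite_one_zero_nonneg _), if_pos (not_le.1 h1)]
    have h2 := h.norm_sub_zero_le (R := r + 1) ht x (by linarith) fun i => radialTrunc ρ' (z i)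
    refine mul_le_of_le_one_of_le_of_nonneg (ite_one_zero_le_one _) (h2.trans (add_le_add le_rfl ?_))
      (norm_nonneg _)
    refine hgoal _ fun i => ?_
    rw [norm_radialTrunc (hρ0.trans hρ')]
    have h3 := min_le_left ‖z i‖ ρ'
    have h4 := mul_le_mul_of_nonneg_right h3 hs.le
    nlinarith [sq_nonneg (‖z i‖ - √ρ), sq_nonneg ‖z i‖, sq_nonneg (2 * ‖z i‖ - √ρ), not_le.1 h1]

/-- On |y|, |y'| ≤ r the cutoff equals 1, so the truncation at ρ' inherits (H1) and (H2) with
constants independent of ρ'. The change from ρ to ρ' is paid by `truncError` times 2|y - y'| ≤ 4r.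
-/
lemma CondH.inner_trunc_sub_le (h : CondH μ T C m f φ) (hC : 0 ≤ C) (hρ : 1 ≤ ρ) (hρ' : ρ ≤ ρ')
    (ht : t ∈ Icc 0 T) (x : E) {y y' : EuclideanSpace ℝ (Fin l)} (hy : ‖y‖ ≤ r) (hy' : ‖y'‖ ≤ r)
    (z z' : Fin l → H) :
    2 * ⟪y - y', truncNonlinearity f r N ρ t x y z - truncNonlinearity f r N ρ' t x y' z'⟫ ≤
      (2 * |m t| + C ^ 2 * l) * ‖y - y'‖ ^ 2 + ∑ i, ‖z i - z' i‖ ^ 2 +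
        4 * r * truncError f C r ρ t x z := by
  have hρ0 : 0 ≤ ρ' := zero_le_one.trans (hρ.trans hρ')
  have h1 : truncNonlinearity f r N ρ t x y z - truncNonlinearity f r N ρ' t x y' z' =
      (truncNonlinearity f r N ρ' t x y z - truncNonlinearity f r N ρ' t x y' z') +
      (truncNonlinearity f r N ρ t x y z - truncNonlinearity f r N ρ' t x y z) := by abel
  have h2 : 2 * ⟪y - y', truncNonlinearity f r N ρ' t x y z - truncNonlinearity f r N ρ' t x y' z'⟫ ≤
      (2 * |m t| + C ^ 2 * l) * ‖y - y'‖ ^ 2 + ∑ i, ‖z i - z' i‖ ^ 2 := by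
    have e0 : 0 ≤ ∑ i, ‖z i - z' i‖ ^ 2 := Finset.sum_nonneg fun i _ => by positivity
    rw [truncNonlinearity, truncNonlinearity, add_sub_add_right_eq_sub, cutoff_of_le hy,
      cutoff_of_le hy', one_smul, one_smul, ← smul_sub, sub_sub_sub_cancel_right,
      real_inner_smul_right]
    split_ifs
    · have e1 := two_inner_sub_le (h.monotone t ht x) (h.lipschitz t ht x) y y'
        (fun i => radialTrunc ρ' (z i)) (fun i => radialTrunc ρ' (z' i))
      have e2 : ∑ i, ‖radialTrunc ρ' (z i) - radialTrunc ρ' (z' i)‖ ^ 2 ≤ ∑ i, ‖z i - z' i‖ ^ 2 :=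
        Finset.sum_le_sum fun i _ =>
          pow_le_pow_left₀ (norm_nonneg _) (norm_radialTrunc_sub_le hρ0 _ _) 2
      have e3 : m t * ‖y - y'‖ ^ 2 ≤ |m t| * ‖y - y'‖ ^ 2 :=
        mul_le_mul_of_nonneg_right (le_abs_self _) (by positivity)
      linarith
    · rw [zero_mul, mul_zero]
      positivity
  have h3 := (real_inner_le_norm (y - y') _).trans (mul_le_mul
    ((norm_sub_le y y').trans (add_le_add hy hy'))
    (h.norm_trunc_sub_le (N := N) hC hρ hρ' ht x hy z) (norm_nonneg _)
    (by linarith [norm_nonneg y]))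
  rw [h1, inner_add_right]
  linarith

lemma truncNonlinearity_eq {x : E} {z : Fin l → H} (h1 : oscSup f (r + 1) t x ≤ ρ)
    (h2 : ∀ i, ‖z i‖ ≤ ρ) (y : EuclideanSpace ℝ (Fin l)) :
    truncNonlinearity f r N ρ t x y z = cutoff r y • (f t x y z - f t x 0 0) +
      if ‖f t x 0 0‖ ≤ N then f t x 0 0 else 0 := by
  simp only [truncNonlinearity, if_pos h1, one_smul, radialTrunc_of_le (h2 _)]

end TruncatedNonlinearity

/-! ### A priori estimates -/

section Apriori

variable {E H : Type*} [NormedAddCommGroup E] [NormedSpace ℝ E]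
  [NormedAddCommGroup H] [InnerProductSpace ℝ H] [CompleteSpace H]
  [MeasurableSpace E] [BorelSpace E] {j : H →L[ℝ] E} {A : E → H →L[ℝ] H} {b : E → H}
  {μ : Measure E} [IsFiniteMeasure μ] {T : ℝ} {P : ℝ → Lp ℝ 2 μ →L[ℝ] Lp ℝ 2 μ} {α : ℝ} {l : ℕ}

lemma gradA_zero (S : FormSetting j A b μ T P α) : gradA j A μ 0 = 0 := by
  refine HasGradA.gradA_eq S.pos S.condA1 ?_
  rw [hasGradA_iff]
  exact Submodule.zero_mem _

lemma mild_zero (t : ℝ) : mild P T 0 (fun _ => 0) t = 0 := by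
  simp [mild]

/-- A priori estimate for mild solutions under a one-sided bound on the source. -/
lemma apriori_le (S : FormSetting j A b μ T P α) {φ : Fin l → Lp ℝ 2 μ}
    {g : Fin l → ℝ → Lp ℝ 2 μ} (hg : ∀ i, IntegrableOn (g i) (Icc 0 T)) {u : Fin l → ℝ → Lp ℝ 2 μ}
    (hu : ∀ i, ∀ t ∈ Icc 0 T, u i t = mild P T (φ i) (g i) t)
    {k h : ℝ → ℝ} (hk : IntegrableOn k (Icc 0 T)) (hk0 : ∀ s, 0 ≤ k s)
    (hh : IntegrableOn h (Icc 0 T)) (hh0 : ∀ᵐ s ∂(volume.restrict (Icc 0 T)), 0 ≤ h s)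
    (hbr : ∀ᵐ s ∂(volume.restrict (Icc 0 T)), 2 * ∑ i, ⟪g i s, u i s⟫ ≤
      k s * ∑ i, ‖u i s‖ ^ 2 + ∑ i, ‖gradA j A μ (u i s)‖ ^ 2 + h s)
    {t : ℝ} (ht : t ∈ Icc 0 T) :
    (∑ i, ‖u i t‖ ^ 2) + ∫ s in Icc t T, ∑ i, ‖gradA j A μ (u i s)‖ ^ 2 ≤
    Real.exp (∫ s in Icc 0 T, |k s + α|) * ((∑ i, ‖φ i‖ ^ 2) + ∫ s in Icc 0 T, h s) := by
  have := stability_le S (φ' := fun _ => 0) (g' := fun _ _ => 0) (u' := fun _ _ => 0) hg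
    (fun i => integrableOn_zero) hu (fun i t _ => (mild_zero t).symm) hk hk0 hh hh0 (by
      simpa only [sub_zero, gradA_zero S] using hbr) ht
  simpa only [sub_zero, gradA_zero S] using this

lemma two_sum_inner_le_of_bracket {F : Type*} [NormedAddCommGroup F] [InnerProductSpace ℝ F]
    {g u : Fin l → Lp ℝ 2 μ} {a : E → EuclideanSpace ℝ (Fin l)}
    (hg : ∀ᵐ x ∂μ, ∀ i, g i x = a x i) {e : Fin l → Lp F 2 μ} {k : ℝ} {d : E → ℝ}
    (hd : Integrable d μ)
    (h : ∀ᵐ x ∂μ, 2 * ⟪vec u x, a x⟫ ≤ k * ‖vec u x‖ ^ 2 + ∑ i, ‖e i x‖ ^ 2 + d x) :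
    2 * ∑ i, ⟪g i, u i⟫ ≤ k * ∑ i, ‖u i‖ ^ 2 + ∑ i, ‖e i‖ ^ 2 + ∫ x, d x ∂μ := by
  refine two_sum_inner_le hd ?_
  filter_upwards [h, hg] with x h1 h2
  have h3 : ⟪vec u x, a x⟫ = ∑ i, g i x * u i x := by
    rw [PiLp.inner_apply]
    exact Finset.sum_congr rfl fun i _ => by simp [vec, h2]
  rwa [h3, norm_vec_sq] at h1

lemma ae_norm_vec_le_of_tendsto {u : ℕ → Fin l → Lp ℝ 2 μ} {u' : Fin l → Lp ℝ 2 μ}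
    (hu : ∀ i, Tendsto (fun n => u n i) atTop (𝓝 (u' i))) {r : ℝ}
    (h : ∀ n, ∀ᵐ x ∂μ, ‖vec (u n) x‖ ≤ r) : ∀ᵐ x ∂μ, ‖vec u' x‖ ≤ r := by
  obtain ⟨ns, -, hns⟩ := exists_subseq_tendsto_vec hu
  filter_upwards [hns, ae_all_iff.2 h] with x h1 h2
  exact le_of_tendsto h1.norm (Eventually.of_forall fun n => h2 _)

/-- Cauchy–Schwarz on the bounded interval. -/
lemma tendsto_integral_norm_of_sq {X : Type*} [NormedAddCommGroup X] {v : ℕ → ℝ → X}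
    (hv : ∀ n, MemLp (v n) 2 (volume.restrict (Icc 0 T)))
    (h : Tendsto (fun n => ∫ s in Icc 0 T, ‖v n s‖ ^ 2) atTop (𝓝 0)) :
    Tendsto (fun n => ∫ s in Icc 0 T, ‖v n s‖) atTop (𝓝 0) := by
  have h1 : ∀ n, ∫ s in Icc 0 T, ‖v n s‖ ≤
      √(∫ s in Icc 0 T, ‖v n s‖ ^ 2) * √(volume.real (Icc 0 T)) := fun n => by
    have h2 := integral_mul_le_Lp_mul_Lq_of_nonneg Real.HolderConjugate.two_two
      (μ := volume.restrict (Icc 0 T)) (f := fun s => ‖v n s‖) (g := fun _ => (1 : ℝ))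
      (Eventually.of_forall fun s => norm_nonneg _) (Eventually.of_forall fun s => zero_le_one)
      (by simpa using (hv n).norm) (memLp_const _)
    simpa [Real.sqrt_eq_rpow] using h2
  refine squeeze_zero (fun n => integral_nonneg fun s => norm_nonneg _) h1 ?_
  simpa using h.sqrt.mul_const (√(volume.real (Icc 0 T)))

end Apriori

/-! ### Integrability of the oscillation -/

section OscillationIntegrability

variable {E H : Type*} [MeasurableSpace E] [NormedAddCommGroup E]
  [NormedAddCommGroup H] [InnerProductSpace ℝ H] [CompleteSpace H]
  [TopologicalSpace.SeparableSpace H] [MeasurableSpace H] [BorelSpace H]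
  {μ : Measure E} [IsFiniteMeasure μ] {T : ℝ} {l : ℕ}
  {f : ℝ → E → EuclideanSpace ℝ (Fin l) → (Fin l → H) → EuclideanSpace ℝ (Fin l)}
  {φ : Fin l → Lp ℝ 2 μ} {C : ℝ} {m : ℝ → ℝ} {R : ℝ}

/-- Transfers (H4) to a measurable real function on ℝ × E; since μ is finite, the L¹(L²) bound also
gives integrability for dt ⊗ μ. -/
lemma CondH.exists_oscSup (h : CondH μ T C m f φ) (hT : 0 ≤ T) (hR : 0 < R) :
    ∃ p : ℝ × E → ℝ, Measurable p ∧ (∀ t ∈ Icc 0 T, ∀ x, p (t, x) = oscSup f R t x) ∧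
      Measurable (fun t => eLpNorm (fun x => p (t, x)) 2 μ) ∧
      ∫⁻ t in Icc 0 T, eLpNorm (fun x => p (t, x)) 2 μ < ∞ ∧
      Integrable p ((volume.restrict (Icc 0 T)).prod μ) := by
  set p : ℝ × E → ℝ := fun q => oscSup f R (projIcc 0 T hT q.1) q.2 with hp
  have hpm : Measurable p := (h.measurable_oscSup R).comp
    (f := fun q : ℝ × E => (projIcc 0 T hT q.1, q.2))
    ((continuous_projIcc.measurable.comp measurable_fst).prodMk measurable_snd)
  have hpe : ∀ t ∈ Icc 0 T, ∀ x, p (t, x) = oscSup f R t x := fun t ht x => by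
    simp only [hp, projIcc_of_mem hT ht]
  have hN : (fun t => eLpNorm (fun x => p (t, x)) 2 μ) =
      fun t => (∫⁻ x, ‖p (t, x)‖ₑ ^ (2 : ℝ) ∂μ) ^ (1 / (2 : ℝ)) := by
    funext t
    rw [eLpNorm_eq_lintegral_rpow_enorm_toReal (by norm_num) (by norm_num)]
    simp
  have hNm : Measurable (fun t => eLpNorm (fun x => p (t, x)) 2 μ) := by
    rw [hN]
    exact (Measurable.lintegral_prod_right' (f := fun q : ℝ × E => ‖p q‖ₑ ^ (2 : ℝ))
      (hpm.enorm.pow_const _)).pow_const _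
  have hfin : ∫⁻ t in Icc 0 T, eLpNorm (fun x => p (t, x)) 2 μ < ∞ := by
    refine lt_of_eq_of_lt (setLIntegral_congr_fun measurableSet_Icc fun t ht => ?_) (h.growth R hR)
    rw [congrFun hN t]
    congr 1
    refine lintegral_congr fun x => ?_
    rw [hpe t ht, oscSup, Real.enorm_eq_ofReal ENNReal.toReal_nonneg,
      ENNReal.ofReal_toReal (h.iSup_ne_top ht x)]
    norm_cast
  refine ⟨p, hpm, hpe, hNm, hfin, hpm.aestronglyMeasurable, ?_⟩
  rw [HasFiniteIntegral, lintegral_prod _ hpm.enorm.aemeasurable]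
  refine lt_of_le_of_lt (lintegral_mono (g := fun t => μ univ ^ (1 / (1 : ℝ) - 1 / (2 : ℝ)) *
    eLpNorm (fun x => p (t, x)) 2 μ) fun t => ?_) ?_
  · have h1 := eLpNorm_le_eLpNorm_mul_rpow_measure_univ (p := 1) (q := 2) (by norm_num)
      ((hpm.comp measurable_prodMk_left).aestronglyMeasurable (μ := μ) (f := fun x => p (t, x)))
    rw [eLpNorm_one_eq_lintegral_enorm, mul_comm] at h1
    simpa using h1
  · rw [lintegral_const_mul _ hNm]
    exact ENNReal.mul_lt_top (ENNReal.rpow_lt_top_of_nonneg (by norm_num) (measure_ne_top _ _)) hfin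

end OscillationIntegrability

lemma barrier_le {k : ℝ → ℝ} {T : ℝ} (hk : IntegrableOn k (Icc 0 T)) {N₀ N : ℝ} (hN₀ : 0 ≤ N₀)
    (hN : 0 ≤ N) {t : ℝ} (ht : t ∈ Icc 0 T) :
    barrier k T N₀ N t ≤ Real.exp (∫ s in Icc 0 T, |k s|) * (N₀ + T * N) := by
  have hT : 0 ≤ T := ht.1.trans ht.2
  set W := Real.exp (∫ s in Icc 0 T, |k s|)
  have h1 : N₀ * expWeight k T ≤ N₀ * W :=
    mul_le_mul_of_nonneg_left (expWeight_le hk ⟨hT, le_rfl⟩) hN₀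
  have h2 : ∫ s in t..T, expWeight k s ≤ W * T := by
    refine (Real.le_norm_self _).trans ((intervalIntegral.norm_integral_le_of_norm_le_const
      (C := W) fun s hs => ?_).trans ?_)
    · rw [uIoc_of_le ht.2] at hs
      rw [Real.norm_of_nonneg (expWeight_pos _ _).le]
      exact expWeight_le hk ⟨ht.1.trans hs.1.le, hs.2⟩
    · rw [abs_of_nonneg (sub_nonneg.2 ht.2)]
      exact mul_le_mul_of_nonneg_left (by linarith [ht.1]) (Real.exp_pos _).le
  rw [barrier]
  nlinarith [mul_le_mul_of_nonneg_left h2 hN]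

/-! ### Existence for general nonlinearities -/

section Existence

variable {E H : Type*} [NormedAddCommGroup E] [NormedSpace ℝ E]
  [NormedAddCommGroup H] [InnerProductSpace ℝ H] [CompleteSpace H]
  [TopologicalSpace.SeparableSpace H] [MeasurableSpace H] [BorelSpace H]
  [MeasurableSpace E] [BorelSpace E] [MeasurableSpace.CountablyGenerated E]
  {j : H →L[ℝ] E} {A : E → H →L[ℝ] H} {b : E → H}
  {μ : Measure E} [IsFiniteMeasure μ] {T : ℝ} {P : ℝ → Lp ℝ 2 μ →L[ℝ] Lp ℝ 2 μ} {α : ℝ} {l : ℕ}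
  {f : ℝ → E → EuclideanSpace ℝ (Fin l) → (Fin l → H) → EuclideanSpace ℝ (Fin l)}
  {φ : Fin l → Lp ℝ 2 μ} {C : ℝ} {m : ℝ → ℝ}

/-- The rate in the a priori estimates. -/
noncomputable def growthRate (m : ℝ → ℝ) (C : ℝ) (l : ℕ) (s : ℝ) : ℝ := 2 * |m s| + C ^ 2 * l + 1

lemma growthRate_nonneg (s : ℝ) : 0 ≤ growthRate m C l s := by
  unfold growthRate
  positivity

lemma integrableOn_growthRate (hm : IntegrableOn m (Icc 0 T)) :
    IntegrableOn (growthRate m C l) (Icc 0 T) :=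
  ((hm.abs.const_mul 2).add (integrable_const _)).add (integrable_const _)

/-- The bound for the supremum norm of solutions. -/
noncomputable def supBound (m : ℝ → ℝ) (C : ℝ) (l : ℕ) (T M N : ℝ) : ℝ :=
  √(Real.exp (∫ s in Icc 0 T, |growthRate m C l s|) * (M ^ 2 + T * N ^ 2))

/-- Existence, boundedness and energy bound of solutions of the truncated problems. -/
lemma exists_mild_trunc (S : FormSetting j A b μ T P α) (hC : 0 ≤ C)
    (hm : IntegrableOn m (Icc 0 T)) (h : CondH μ T C m f φ) {M N : ℝ} (hN : 0 ≤ N)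
    (hφ : ∀ᵐ x ∂μ, ‖vec φ x‖ ≤ M) {r ρ : ℝ} (hρ : 0 ≤ ρ) :
    ∃ g, IsNemytskii μ T (truncNonlinearity f r N ρ) (fun i => mild P T (φ i) (g i))
      (fun i t => gradA j A μ (mild P T (φ i) (g i) t)) g ∧
      (∀ t ∈ Icc 0 T, ∀ᵐ x ∂μ, ‖vec (fun i => mild P T (φ i) (g i) t) x‖ ≤
        supBound m C l T M N) ∧
      ∫ s in Icc 0 T, ∑ i, ‖gradA j A μ (mild P T (φ i) (g i) s)‖ ^ 2 ≤
        Real.exp (∫ s in Icc 0 T, |growthRate m C l s + α|) *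
          ((∑ i, ‖φ i‖ ^ 2) + ∫ _ in Icc 0 T, ∫ _, N ^ 2 ∂μ) := by
  have hT := S.time_pos
  set B := ρ + C * (l * ρ) + N
  have hB0 : 0 ≤ B := by positivity
  have hφM : ∀ i, φ i ∈ bddSet μ M := fun i => by
    filter_upwards [hφ] with x hx
    exact (abs_apply_le_norm (vec φ x) i).trans hx
  obtain ⟨g, hg⟩ := exists_mild_of_bounded S (h.measurable_trunc r N ρ) hφM
    (fun t ht => h.norm_trunc_le_const hC hN hρ ht) (fun t ht => h.lipschitz_trunc hC hρ ht)
    (fun t ht => h.continuous_trunc ht) (κ := fun s => |m s| + (ρ + C * (l * ρ)))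
    (hm.abs.add (integrable_const _)) (fun s => by positivity)
    (fun t ht => h.monotone_trunc hC hρ ht)
  refine ⟨g, hg, fun t ht => ?_, ?_⟩
  · have hgM : ∀ i, ∀ᵐ s ∂(volume.restrict (Icc 0 T)), g i s ∈ bddSet μ (max M B) := fun i => by
      filter_upwards [hg.ae, ae_restrict_mem measurableSet_Icc] with s h1 h2
      filter_upwards [h1] with x h3
      rw [h3]
      exact (abs_apply_le_norm _ _).trans ((h.norm_trunc_le_const hC hN hρ h2 _ _ _).trans
        (le_max_right _ _))
    -- The resulting bound involves neither r nor ρ, so r may afterwards be set equal to it.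
    have key := mild_ae_le_barrier S (fun i => (hg i).1) (hB0.trans (le_max_right M B))
      (fun i => bddSet_mono (le_max_left _ _) (hφM i)) hgM (integrableOn_growthRate (C := C) (l := l) hm)
      (N₀ := M ^ 2) (N := N ^ 2) (fun i => rfl) (by
        filter_upwards [hφ] with x hx
        rw [← norm_vec_sq]
        exact pow_le_pow_left₀ (norm_nonneg _) hx 2) (by
        filter_upwards [hg.ae, ae_restrict_mem measurableSet_Icc] with s h1 h2
        filter_upwards [h1] with x h3
        have h4 := h.inner_trunc_le (r := r) hN hρ h2 x (vec (fun i => mild P T (φ i) (g i) s) x)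
          fun i => gradA j A μ (mild P T (φ i) (g i) s) x
        rw [norm_vec_sq, PiLp.inner_apply] at h4
        have h5 : 0 ≤ ∑ i, ‖gradA j A μ (mild P T (φ i) (g i) s) x‖ ^ 2 :=
          Finset.sum_nonneg fun i _ => by positivity
        have h6 : ∑ i, mild P T (φ i) (g i) s x * g i s x =
            ∑ i, ⟪vec (fun i => mild P T (φ i) (g i) s) x i, truncNonlinearity f r N ρ s x
              (vec (fun i => mild P T (φ i) (g i) s) x)
              (fun i => gradA j A μ (mild P T (φ i) (g i) s) x) i⟫ :=
          Finset.sum_congr rfl fun i _ => by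
            rw [h3]
            exact mul_comm _ _
        rw [h6, growthRate]
        linarith) ht
    filter_upwards [key] with x hx
    refine Real.le_sqrt_of_sq_le ?_
    rw [norm_vec_sq]
    refine le_trans ?_ (hx.trans (barrier_le (integrableOn_growthRate hm) (by positivity)
      (by positivity) ht))
    exact le_mul_of_one_le_left (Finset.sum_nonneg fun i _ => by positivity)
      (one_le_expWeight growthRate_nonneg ht.1)
  · have key := apriori_le S (fun i => (hg i).1) (fun i t _ => rfl)
      (integrableOn_growthRate (C := C) (l := l) hm) growthRate_nonneg
      (h := fun _ => ∫ _, N ^ 2 ∂μ) continuous_const.integrableOn_Icc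
      (Eventually.of_forall fun s => integral_nonneg fun x => by positivity) (by
        filter_upwards [hg.ae, ae_restrict_mem measurableSet_Icc] with s h1 h2
        refine two_sum_inner_le_of_bracket h1 (integrable_const _) (Eventually.of_forall fun x => ?_)
        exact h.inner_trunc_le hN hρ h2 _ _ _) (t := 0) ⟨le_rfl, hT.le⟩
    have h0 : 0 ≤ ∑ i, ‖mild P T (φ i) (g i) 0‖ ^ 2 := Finset.sum_nonneg fun i _ => by positivity
    linarith

lemma eLpNorm_dominant_le {p : E → ℝ} (hp : AEStronglyMeasurable p μ) (C N : ℝ)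
    (v : Fin l → Lp H 2 μ) :
    eLpNorm (fun x => p x + C * ∑ i, ‖v i x‖ + N) 2 μ ≤
      eLpNorm p 2 μ + ‖C‖ₑ * ∑ i, ‖v i‖ₑ + eLpNorm (fun _ : E => N) 2 μ := by
  have hv : ∀ i ∈ (Finset.univ : Finset (Fin l)), AEStronglyMeasurable (fun x => ‖v i x‖) μ :=
    fun i _ => (Lp.aestronglyMeasurable (v i)).norm
  have hs : AEStronglyMeasurable (∑ i, fun x => ‖v i x‖) μ := Finset.aestronglyMeasurable_sum _ hv
  have h1 : (fun x => p x + C * ∑ i, ‖v i x‖ + N) =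
      (p + C • ∑ i, fun x => ‖v i x‖) + fun _ => N := by
    funext x
    simp
  rw [h1]
  refine (eLpNorm_add_le (hp.add (hs.const_smul C)) aestronglyMeasurable_const (by norm_num)).trans
    (add_le_add ((eLpNorm_add_le hp (hs.const_smul C) (by norm_num)).trans
      (add_le_add le_rfl ?_)) le_rfl)
  rw [eLpNorm_const_smul]
  gcongr
  refine (eLpNorm_sum_le hv (by norm_num)).trans (Finset.sum_le_sum fun i _ => ?_)
  rw [eLpNorm_norm, Lp.enorm_def]

/-- Solutions of the truncated problems converge. -/
lemma exists_limit_of_trunc (S : FormSetting j A b μ T P α) (hC : 0 ≤ C)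
    (hm : IntegrableOn m (Icc 0 T)) (h : CondH μ T C m f φ) {r N : ℝ} (hr : 0 ≤ r)
    {ρ : ℕ → ℝ} (hρ1 : ∀ n, 1 ≤ ρ n) (hρ : Monotone ρ) (hρlim : Tendsto ρ atTop atTop)
    {g u : ℕ → Fin l → ℝ → Lp ℝ 2 μ} (hu : ∀ n i, u n i = mild P T (φ i) (g n i))
    (hg : ∀ n, IsNemytskii μ T (truncNonlinearity f r N (ρ n)) (u n)
      (fun i t => gradA j A μ (u n i t)) (g n))
    (hur : ∀ n, ∀ t ∈ Icc 0 T, ∀ᵐ x ∂μ, ‖vec (fun i => u n i t) x‖ ≤ r) {Q : ℝ}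
    (hQ : ∀ n, ∫ s in Icc 0 T, ∑ i, ‖gradA j A μ (u n i s)‖ ^ 2 ≤ Q) :
    ∃ (U : Fin l → ℝ → Lp ℝ 2 μ) (V : Fin l → ℝ → Lp H 2 μ),
      (∀ i, ∀ t ∈ Icc 0 T, Tendsto (fun n => u n i t) atTop (𝓝 (U i t))) ∧
      (∀ i, MemLp (V i) 2 (volume.restrict (Icc 0 T))) ∧
      (∀ i, Tendsto (fun n => ∫ s in Icc 0 T, ‖gradA j A μ (u n i s) - V i s‖ ^ 2) atTop (𝓝 0)) ∧
      ∀ i, ∀ᵐ s ∂(volume.restrict (Icc 0 T)), HasGradA j A μ (U i s) (V i s) := by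
  have hT := S.time_pos
  obtain ⟨p, hpm, hpe, -, -, hpi⟩ := h.exists_oscSup (R := r + 1) hT.le (by linarith)
  have hp0 : ∀ᵐ q ∂((volume.restrict (Icc 0 T)).prod μ), 0 ≤ p q := by
    refine Measure.ae_prod_mem_iff_ae_ae_mem (measurableSet_le measurable_const hpm) |>.2 ?_
    filter_upwards [ae_restrict_mem measurableSet_Icc] with t ht
    refine Eventually.of_forall fun x => ?_
    simp only [hpe t ht]
    exact oscSup_nonneg x
  -- The part of the oscillation above the level ρ n; it tends to 0 in L¹ by domination.
  set q : ℕ → ℝ × E → ℝ := fun n => {y | ρ n < p y}.indicator p with hq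
  have hqi : ∀ n, Integrable (q n) ((volume.restrict (Icc 0 T)).prod μ) := fun n =>
    hpi.indicator (measurableSet_lt measurable_const hpm)
  have hq0 : Tendsto (fun n => ∫ y, q n y ∂((volume.restrict (Icc 0 T)).prod μ)) atTop (𝓝 0) := by
    refine Tendsto.mono_right ?_ (congrArg 𝓝 (integral_zero (ℝ × E) ℝ
      (μ := (volume.restrict (Icc 0 T)).prod μ))).le
    refine tendsto_integral_of_dominated_convergence (fun y => ‖p y‖) (fun n => (hqi n).1) hpi.norm
      (fun n => Eventually.of_forall fun y => norm_indicator_le_norm_self _ _)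
      (Eventually.of_forall fun y => ?_)
    refine tendsto_const_nhds.congr' ?_
    filter_upwards [hρlim.eventually_ge_atTop (p y)] with n hn
    exact (indicator_of_notMem (s := {y | ρ n < p y}) (not_lt.2 hn) p).symm
  have hF : ∀ n i, InFhat j A μ T (u n i) := fun n i => by
    rw [hu]
    exact inFhat_mild S (φ i) (hg n i).1
  have hDi : ∀ n, IntegrableOn (fun s => ∑ i, ‖gradA j A μ (u n i s)‖ ^ 2) (Icc 0 T) := fun n =>
    integrable_finsetSum _ fun i _ => (hF n i).memLp.integrable_norm_pow (by norm_num)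
  have hq1 : ∀ n, IntegrableOn (fun s => ∫ x, q n (s, x) ∂μ) (Icc 0 T) := fun n =>
    (hqi n).integral_prod_left
  have hp1 : IntegrableOn (fun s => ∫ x, p (s, x) ∂μ) (Icc 0 T) := hpi.integral_prod_left
  have hpn : ∀ᵐ s ∂(volume.restrict (Icc 0 T)), ∀ᵐ x ∂μ, 0 ≤ p (s, x) :=
    Measure.ae_ae_of_ae_prod hp0
  have hqn : ∀ n, ∀ᵐ s ∂(volume.restrict (Icc 0 T)), 0 ≤ ∫ x, q n (s, x) ∂μ := fun n => by
    filter_upwards [hpn] with s hs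
    refine integral_nonneg_of_ae ?_
    filter_upwards [hs] with x hx
    exact indicator_apply_nonneg fun _ => hx
  have hpn' : ∀ᵐ s ∂(volume.restrict (Icc 0 T)), 0 ≤ ∫ x, p (s, x) ∂μ :=
    hpn.mono fun s hs => integral_nonneg_of_ae hs
  set η : ℕ → ℝ := fun n => C / √(ρ n) with hη
  have hη0 : ∀ n, 0 ≤ η n := fun n => div_nonneg hC (Real.sqrt_nonneg _)
  have hηlim : Tendsto η atTop (𝓝 0) :=
    tendsto_const_nhds.div_atTop (Real.tendsto_sqrt_atTop.comp hρlim)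
  -- The x-integral of 4r times `truncError`. It involves only the smaller index, and its time
  -- integral is bounded by c n through the uniform energy bound Q.
  set e : ℕ → ℝ → ℝ := fun n s => 4 * r * ((∫ x, q n (s, x) ∂μ) +
    η n * (2 * (∑ i, ‖gradA j A μ (u n i s)‖ ^ 2) + l * ∫ x, p (s, x) ∂μ)) with he
  have hei : ∀ n, IntegrableOn (e n) (Icc 0 T) := fun n =>
    ((hq1 n).add ((((hDi n).const_mul 2).add (hp1.const_mul l)).const_mul (η n))).const_mul _
  set c : ℕ → ℝ := fun n => 4 * r * ((∫ y, q n y ∂((volume.restrict (Icc 0 T)).prod μ)) +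
    η n * (2 * Q + l * ∫ s in Icc 0 T, ∫ x, p (s, x) ∂μ)) with hc
  have hc0 : Tendsto c atTop (𝓝 0) := by
    have := ((hq0.add (hηlim.mul_const (2 * Q + l * ∫ s in Icc 0 T, ∫ x, p (s, x) ∂μ))).const_mul
      (4 * r))
    simpa using this
  have hki : IntegrableOn (fun s => 2 * |m s| + C ^ 2 * l) (Icc 0 T) :=
    (hm.abs.const_mul 2).add (integrable_const _)
  refine exists_limit_of_stability S (fun n i => (hg n i).1) (fun n i t _ => by rw [hu])
    (k := fun s => 2 * |m s| + C ^ 2 * l) hki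
    (fun s => by positivity) (h := fun n _ => e n) (fun n _ _ => hei n) (fun n _ _ => ?_) hc0
    (fun n _ _ => ?_) fun n k hnk => ?_
  · filter_upwards [hqn n, hpn'] with s h1 h2
    have h3 : 0 ≤ ∑ i, ‖gradA j A μ (u n i s)‖ ^ 2 := Finset.sum_nonneg fun i _ => by positivity
    have := hη0 n
    positivity
  · have h1 : ∫ s in Icc 0 T, e n s = 4 * r * ((∫ s in Icc 0 T, ∫ x, q n (s, x) ∂μ) +
        η n * (2 * (∫ s in Icc 0 T, ∑ i, ‖gradA j A μ (u n i s)‖ ^ 2) +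
          l * ∫ s in Icc 0 T, ∫ x, p (s, x) ∂μ)) := by
      have i1 : IntegrableOn (fun s => 2 * (∑ i, ‖gradA j A μ (u n i s)‖ ^ 2) +
          l * ∫ x, p (s, x) ∂μ) (Icc 0 T) := ((hDi n).const_mul 2).add (hp1.const_mul l)
      simp only [he]
      rw [integral_const_mul, integral_add (hq1 n) (Integrable.const_mul i1 (η n)),
        integral_const_mul, integral_add ((hDi n).const_mul 2) (hp1.const_mul l),
        integral_const_mul, integral_const_mul]
    rw [h1]
    simp only [hc]
    rw [integral_prod _ (hqi n)]
    have h2 := hη0 n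
    have h3 := hQ n
    gcongr
  · filter_upwards [(hg n).ae, (hg k).ae, ae_restrict_mem measurableSet_Icc,
      hpi.prod_right_ae, (hqi n).prod_right_ae] with s h1 h2 h3 h4 h5
    have hi : ∀ i, Integrable (fun x => 2 * ‖gradA j A μ (u n i s) x‖ ^ 2 + p (s, x)) μ :=
      fun i => ((Lp_integrable_norm_sq _).const_mul 2).add h4
    have hsum : Integrable (fun x => ∑ i, (2 * ‖gradA j A μ (u n i s) x‖ ^ 2 + p (s, x))) μ :=
      integrable_finsetSum _ fun i _ => hi i
    have h6 := two_sum_inner_sub_le (u := fun i => u n i s) (u' := fun i => u k i s) h1 h2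
      (e := fun i => gradA j A μ (u n i s) - gradA j A μ (u k i s)) (k := 2 * |m s| + C ^ 2 * l)
      (d := fun x => 4 * r * (q n (s, x) + η n *
        ∑ i, (2 * ‖gradA j A μ (u n i s) x‖ ^ 2 + p (s, x))))
      ((h5.add (hsum.const_mul (η n))).const_mul (4 * r)) (by
        filter_upwards [hur n s h3, hur k s h3,
          ae_coeFn_sub (fun i => gradA j A μ (u n i s)) fun i => gradA j A μ (u k i s)]
          with x e1 e2 e3
        have e4 := h.inner_trunc_sub_le (N := N) hC (hρ1 n) (hρ hnk) h3 x e1 e2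
          (fun i => gradA j A μ (u n i s) x) fun i => gradA j A μ (u k i s) x
        have e5 : truncError f C r (ρ n) s x (fun i => gradA j A μ (u n i s) x) =
            q n (s, x) + η n * ∑ i, (2 * ‖gradA j A μ (u n i s) x‖ ^ 2 + p (s, x)) := by
          simp only [truncError, hq, hη, indicator_apply, mem_ofPred_eq, hpe s h3]
        rw [e5] at e4
        simpa only [e3] using e4)
    refine h6.trans (add_le_add le_rfl (le_of_eq ?_))
    rw [integral_const_mul, integral_add h5 (hsum.const_mul (η n)), integral_const_mul,
      integral_finsetSum _ fun i _ => hi i]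
    simp only [he]
    congr 3
    have h7 : ∀ i, ∫ x, (2 * ‖gradA j A μ (u n i s) x‖ ^ 2 + p (s, x)) ∂μ =
        2 * ‖gradA j A μ (u n i s)‖ ^ 2 + ∫ x, p (s, x) ∂μ := fun i => by
      rw [integral_add ((Lp_integrable_norm_sq _).const_mul 2) h4, integral_const_mul, Lp_norm_sq]
    have h8 : ∑ i, ∫ x, (2 * ‖gradA j A μ (u n i s) x‖ ^ 2 + p (s, x)) ∂μ =
        2 * (∑ i, ‖gradA j A μ (u n i s)‖ ^ 2) + l * ∫ x, p (s, x) ∂μ := by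
      simp only [h7, Finset.sum_add_distrib, ← Finset.mul_sum, Finset.sum_const, Finset.card_univ,
        Fintype.card_fin, nsmul_eq_mul]
    exact h8

lemma norm_sq_sub_le_of_lipschitz {a a' : Lp ℝ 2 μ} {e e' : Fin l → Lp H 2 μ}
    (h : ∀ᵐ x ∂μ, |a x - a' x| ≤ C * ∑ i, ‖e i x - e' i x‖) :
    ‖a - a'‖ ^ 2 ≤ C ^ 2 * l * ∑ i, ‖e i - e' i‖ ^ 2 := by
  simp only [Lp_norm_sq]
  rw [← integral_finsetSum _ fun i _ => Lp_integrable_norm_sq _, ← integral_const_mul]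
  refine integral_mono_ae (Lp_integrable_norm_sq _)
    ((integrable_finsetSum _ fun i _ => Lp_integrable_norm_sq _).const_mul _) ?_
  filter_upwards [h, Lp.coeFn_sub a a', ae_coeFn_sub e e'] with x h1 h2 h3
  simp only [h2, h3, Pi.sub_apply, Real.norm_eq_abs]
  have h4 := sq_sum_le_card_mul_sum_sq (s := (Finset.univ : Finset (Fin l)))
    (f := fun i => ‖e i x - e' i x‖)
  rw [Finset.card_univ, Fintype.card_fin] at h4
  calc |a x - a' x| ^ 2 ≤ (C * ∑ i, ‖e i x - e' i x‖) ^ 2 :=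
        pow_le_pow_left₀ (abs_nonneg _) h1 2
    _ = C ^ 2 * (∑ i, ‖e i x - e' i x‖) ^ 2 := mul_pow _ _ _
    _ ≤ C ^ 2 * (l * ∑ i, ‖e i x - e' i x‖ ^ 2) := mul_le_mul_of_nonneg_left h4 (sq_nonneg C)
    _ = C ^ 2 * l * ∑ i, ‖e i x - e' i x‖ ^ 2 := (mul_assoc _ _ _).symm

/-- For fixed t, x and z both ρ-truncations are inactive for large n, whatever y is; what remains is
continuous in y. -/
lemma tendsto_truncNonlinearity (h : CondH μ T C m f φ) {t : ℝ} (ht : t ∈ Icc 0 T) {r N : ℝ}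
    {ρ : ℕ → ℝ} (hρ : Tendsto ρ atTop atTop) (x : E) (z : Fin l → H)
    (y : EuclideanSpace ℝ (Fin l)) :
    Tendsto (fun q : ℕ × EuclideanSpace ℝ (Fin l) => truncNonlinearity f r N (ρ q.1) t x q.2 z)
      (atTop ×ˢ 𝓝 y) (𝓝 (cutoff r y • (f t x y z - f t x 0 0) +
        if ‖f t x 0 0‖ ≤ N then f t x 0 0 else 0)) := by
  have h1 : Tendsto (fun y => cutoff r y • (f t x y z - f t x 0 0) +
      if ‖f t x 0 0‖ ≤ N then f t x 0 0 else 0) (𝓝 y) (𝓝 (cutoff r y • (f t x y z - f t x 0 0) +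
        if ‖f t x 0 0‖ ≤ N then f t x 0 0 else 0)) :=
    Continuous.tendsto ((continuous_cutoff.smul
      ((h.continuous t ht x z).sub continuous_const)).add continuous_const) y
  refine (h1.comp tendsto_snd).congr' ?_
  have h2 : ∀ᶠ n in atTop, oscSup f (r + 1) t x ≤ ρ n ∧ ∀ i, ‖z i‖ ≤ ρ n :=
    (hρ.eventually_ge_atTop _).and (eventually_all.2 fun i => hρ.eventually_ge_atTop _)
  filter_upwards [h2.prod_inl (𝓝 y)] with q hq
  exact (truncNonlinearity_eq hq.1 hq.2 _).symm

/-- Sources of the truncated problems converge. -/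
lemma exists_source_limit (S : FormSetting j A b μ T P α) (hC : 0 ≤ C)
    (h : CondH μ T C m f φ) {r N : ℝ} (hr : 0 ≤ r) (hN : 0 ≤ N)
    (hf0 : ∀ᵐ t ∂(volume.restrict (Icc 0 T)), ∀ᵐ x ∂μ, ‖f t x 0 0‖ ≤ N)
    {ρ : ℕ → ℝ} (hρ1 : ∀ n, 1 ≤ ρ n) (hρlim : Tendsto ρ atTop atTop)
    {g u : ℕ → Fin l → ℝ → Lp ℝ 2 μ} {D : ℕ → Fin l → ℝ → Lp H 2 μ}
    (hum : ∀ n i, AEStronglyMeasurable (u n i) (volume.restrict (Icc 0 T)))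
    (hD : ∀ n i, MemLp (D n i) 2 (volume.restrict (Icc 0 T)))
    (hg : ∀ n, IsNemytskii μ T (truncNonlinearity f r N (ρ n)) (u n) (D n) (g n))
    {U : Fin l → ℝ → Lp ℝ 2 μ} {V : Fin l → ℝ → Lp H 2 μ}
    (hU : ∀ i, ∀ t ∈ Icc 0 T, Tendsto (fun n => u n i t) atTop (𝓝 (U i t)))
    (hUr : ∀ t ∈ Icc 0 T, ∀ᵐ x ∂μ, ‖vec (fun i => U i t) x‖ ≤ r)
    (hV : ∀ i, MemLp (V i) 2 (volume.restrict (Icc 0 T)))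
    (hDV : ∀ i, Tendsto (fun n => ∫ s in Icc 0 T, ‖D n i s - V i s‖ ^ 2) atTop (𝓝 0)) :
    ∃ g', IsNemytskii μ T f U V g' ∧
      ∀ i, Tendsto (fun n => ∫ s in Icc 0 T, ‖g n i s - g' i s‖) atTop (𝓝 0) := by
  have hT := S.time_pos
  have hρ0 : ∀ n, 0 ≤ ρ n := fun n => zero_le_one.trans (hρ1 n)
  have hUm : ∀ i, AEStronglyMeasurable (U i) (volume.restrict (Icc 0 T)) := fun i =>
    aestronglyMeasurable_of_tendsto_ae atTop (fun n => hum n i) (by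
      filter_upwards [ae_restrict_mem measurableSet_Icc] with s hs using hU i s hs)
  obtain ⟨p, hpm, hpe, hpN, hpfin, -⟩ := h.exists_oscSup (R := r + 1) hT.le (by linarith)
  -- A dominant independent of n, whose L²-norm is integrable in time by (H4).
  set 𝔇 : ℝ → E → ℝ := fun t x => p (t, x) + C * ∑ i, ‖V i t x‖ + N with h𝔇
  set G : ℝ → ℝ≥0∞ := fun t => eLpNorm (fun x => p (t, x)) 2 μ + ‖C‖ₑ * ∑ i, ‖V i t‖ₑ +
    eLpNorm (fun _ : E => N) 2 μ with hG
  have hGm : AEMeasurable G (volume.restrict (Icc 0 T)) :=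
    (hpN.aemeasurable.add ((Finset.aemeasurable_fun_sum _ fun i _ => (hV i).1.enorm).const_mul _)).add
      aemeasurable_const
  have hGfin : ∫⁻ t in Icc 0 T, G t < ∞ := by
    simp only [hG]
    rw [lintegral_add_right' _ aemeasurable_const, lintegral_add_left hpN, lintegral_const_mul'',
      lintegral_finsetSum' _ fun i _ => (hV i).1.enorm, setLIntegral_const]
    · refine ENNReal.add_lt_top.2 ⟨ENNReal.add_lt_top.2 ⟨hpfin, ENNReal.mul_lt_top enorm_lt_top
        (ENNReal.sum_lt_top.2 fun i _ => ?_)⟩, ENNReal.mul_lt_top (memLp_const N).2 (by simp)⟩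
      exact ((hV i).integrable (by norm_num)).2
    · exact Finset.aemeasurable_fun_sum _ fun i _ => (hV i).1.enorm
  have hGlt : ∀ᵐ t ∂(volume.restrict (Icc 0 T)), G t < ∞ := ae_lt_top' hGm hGfin.ne
  have hpsm : ∀ t, AEStronglyMeasurable (fun x => p (t, x)) μ := fun t =>
    (hpm.comp measurable_prodMk_left).aestronglyMeasurable
  have h𝔇G : ∀ t, eLpNorm (𝔇 t) 2 μ ≤ G t := fun t =>
    eLpNorm_dominant_le (hpsm t) C N fun i => V i t
  have h𝔇m : ∀ t, AEStronglyMeasurable (𝔇 t) μ := fun t =>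
    ((hpsm t).add (AEStronglyMeasurable.const_mul (Finset.aestronglyMeasurable_fun_sum _
      fun i _ => (Lp.aestronglyMeasurable (V i t)).norm) C)).add aestronglyMeasurable_const
  have h𝔇0 : ∀ t ∈ Icc 0 T, ∀ x, 0 ≤ 𝔇 t x := fun t ht x => by
    simp only [h𝔇, hpe t ht]
    exact add_nonneg (add_nonneg (oscSup_nonneg x)
      (mul_nonneg hC (Finset.sum_nonneg fun i _ => norm_nonneg _))) hN
  obtain ⟨g', hg'⟩ := exists_isNemytskii hT.le h.measurable hUm (fun i => (hV i).1) hGfin (by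
    filter_upwards [hf0, ae_restrict_mem measurableSet_Icc] with t h1 h2
    refine (eLpNorm_mono_ae ?_).trans (h𝔇G t)
    filter_upwards [h1, hUr t h2] with x h3 h4
    rw [Real.norm_of_nonneg (h𝔇0 t h2 x)]
    have h5 := h.norm_sub_zero_le (R := r + 1) h2 x (h4.trans (by linarith)) fun i => V i t x
    have h6 := norm_sub_norm_le (f t x (vec (fun k => U k t) x) fun i => V i t x) (f t x 0 0)
    simp only [h𝔇, hpe t h2]
    linarith)
  refine ⟨g', hg', fun i => ?_⟩
  -- The intermediate source w n takes the solution argument from u n but the gradient from the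
  -- limit V. Lipschitz dependence on the gradient compares it with g n, dominated convergence with
  -- g'.
  choose w hw using fun n => exists_isNemytskii_of_bdd hT.le (h.measurable_trunc r N (ρ n)) (hum n)
    (fun i => (hV i).1) (B := ρ n + C * (l * ρ n) + N) (by
      filter_upwards [ae_restrict_mem measurableSet_Icc] with t ht
      exact Eventually.of_forall fun x => h.norm_trunc_le_const hC hN (hρ0 n) ht _ _ _)
  have hgw : Tendsto (fun n => ∫ s in Icc 0 T, ‖g n i s - w n i s‖) atTop (𝓝 0) := by
    have hsq : ∀ n, ∀ᵐ s ∂(volume.restrict (Icc 0 T)),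
        ‖g n i s - w n i s‖ ^ 2 ≤ C ^ 2 * l * ∑ k, ‖D n k s - V k s‖ ^ 2 := fun n => by
      filter_upwards [(hg n).ae, (hw n).ae, ae_restrict_mem measurableSet_Icc] with s h1 h2 h3
      refine norm_sq_sub_le_of_lipschitz (e := fun k => D n k s) (e' := fun k => V k s) ?_
      filter_upwards [h1, h2] with x h4 h5
      rw [h4, h5]
      exact (abs_apply_le_norm (truncNonlinearity f r N (ρ n) s x _ _ -
        truncNonlinearity f r N (ρ n) s x _ _) i).trans
        (h.lipschitz_trunc hC (hρ0 n) h3 x _ _ _)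
    have hDi : ∀ n k, IntegrableOn (fun s => ‖D n k s - V k s‖ ^ 2) (Icc 0 T) := fun n k =>
      ((hD n k).sub (hV k)).integrable_norm_pow (by norm_num)
    have hsi : ∀ n, IntegrableOn (fun s => C ^ 2 * l * ∑ k, ‖D n k s - V k s‖ ^ 2) (Icc 0 T) :=
      fun n => (integrable_finsetSum _ fun k _ => hDi n k).const_mul _
    have hmeas : ∀ n, AEStronglyMeasurable (fun s => g n i s - w n i s)
      (volume.restrict (Icc 0 T)) := fun n => ((hg n i).1.sub (hw n i).1).1
    have hgi : ∀ n, IntegrableOn (fun s => ‖g n i s - w n i s‖ ^ 2) (Icc 0 T) := fun n => by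
      refine Integrable.mono' (hsi n) ((hmeas n).norm.pow 2) ?_
      filter_upwards [hsq n] with s hs
      rwa [Real.norm_of_nonneg (by positivity)]
    refine tendsto_integral_norm_of_sq (fun n =>
      (memLp_two_iff_integrable_sq_norm (hmeas n)).2 (hgi n)) ?_
    refine squeeze_zero (fun n => integral_nonneg fun s => by positivity)
      (fun n => integral_mono_ae (hgi n) (hsi n) (hsq n)) ?_
    have h1 : ∀ n, ∫ s in Icc 0 T, C ^ 2 * l * ∑ k, ‖D n k s - V k s‖ ^ 2 =
        C ^ 2 * l * ∑ k, ∫ s in Icc 0 T, ‖D n k s - V k s‖ ^ 2 := fun n => by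
      rw [integral_const_mul, integral_finsetSum _ fun k _ => hDi n k]
    simp only [h1]
    have h2 := (tendsto_finsetSum Finset.univ fun k (_ : k ∈ Finset.univ) => hDV k).const_mul
      (C ^ 2 * (l : ℝ))
    simpa using h2
  have hwg : Tendsto (fun n => ∫ s in Icc 0 T, ‖w n i s - g' i s‖) atTop (𝓝 0) := by
    refine Tendsto.mono_right ?_
      (congrArg 𝓝 (integral_zero ℝ ℝ (μ := volume.restrict (Icc 0 T)))).le
    have hwb : ∀ n, ∀ᵐ s ∂(volume.restrict (Icc 0 T)), ∀ᵐ x ∂μ, |w n i s x| ≤ 𝔇 s x := fun n => by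
      filter_upwards [(hw n).ae, ae_restrict_mem measurableSet_Icc] with s h1 h2
      filter_upwards [h1] with x h3
      rw [h3]
      refine (abs_apply_le_norm _ _).trans ((h.norm_trunc_le hC hN (hρ0 n) h2 _ _ _).trans_eq ?_)
      simp only [h𝔇, hpe s h2]
    refine tendsto_integral_of_dominated_convergence (fun s => (G s).toReal + ‖g' i s‖)
      (fun n => ((hw n i).1.sub (hg' i).1).norm.1)
      ((integrable_toReal_of_lintegral_ne_top hGm hGfin.ne).add (hg' i).1.norm) (fun n => ?_) ?_
    · filter_upwards [hwb n, hGlt, ae_restrict_mem measurableSet_Icc] with s h1 h2 h3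
      rw [norm_norm]
      refine (norm_sub_le _ _).trans (add_le_add ?_ le_rfl)
      rw [Lp.norm_def]
      refine ENNReal.toReal_mono h2.ne ((eLpNorm_mono_ae ?_).trans (h𝔇G s))
      filter_upwards [h1] with x h4
      rwa [Real.norm_eq_abs, Real.norm_of_nonneg (h𝔇0 s h3 x)]
    · filter_upwards [ae_all_iff.2 fun n => (hw n).ae, hg'.ae, ae_all_iff.2 hwb, hGlt, hf0,
        ae_restrict_mem measurableSet_Icc] with s h1 h2 h3 h4 h5 h6
      have h7 : Tendsto (fun n => w n i s) atTop (𝓝 (g' i s)) := by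
        refine tendsto_superposition (fun i => hU i s h6)
          (f := fun n x y => truncNonlinearity f r N (ρ n) s x y (fun k => V k s x) i)
          (f' := fun x y => (cutoff r y • (f s x y (fun k => V k s x) - f s x 0 0) +
            if ‖f s x 0 0‖ ≤ N then f s x 0 0 else 0 : EuclideanSpace ℝ (Fin l)) i)
          (fun n => (h1 n).mono fun x hx => hx i) ?_
          (Eventually.of_forall fun x y => ((PiLp.continuous_apply 2 _ i).tendsto _).comp
            (tendsto_truncNonlinearity h h6 hρlim x _ y))
          ⟨h𝔇m s, (h𝔇G s).trans_lt h4⟩ h3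
        -- |U| ≤ r and |f⁰| ≤ N switch off the remaining cutoffs, so the limit is f itself.
        filter_upwards [h2, h5, hUr s h6] with x e1 e2 e3
        rw [e1, if_pos e2, cutoff_of_le e3, one_smul, sub_add_cancel]
      simpa using (h7.sub_const (g' i s)).norm
  refine squeeze_zero (fun n => integral_nonneg fun s => norm_nonneg _) (fun n => ?_)
    (by simpa using hgw.add hwg)
  have i1 : IntegrableOn (fun s => ‖g n i s - w n i s‖) (Icc 0 T) :=
    ((hg n i).1.sub (hw n i).1).norm
  have i2 : IntegrableOn (fun s => ‖w n i s - g' i s‖) (Icc 0 T) :=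
    ((hw n i).1.sub (hg' i).1).norm
  rw [← integral_add i1 i2]
  refine integral_mono ((hg n i).1.sub (hg' i).1).norm (i1.add i2) fun s => ?_
  exact norm_sub_le_norm_sub_add_norm_sub _ _ _

/-- Existence of a bounded mild solution. -/
lemma exists_mild_of_condH (S : FormSetting j A b μ T P α) (hC : 0 ≤ C)
    (hm : IntegrableOn m (Icc 0 T)) (h : CondH μ T C m f φ) {M N : ℝ} (hN : 0 ≤ N)
    (hφ : ∀ᵐ x ∂μ, ‖vec φ x‖ ≤ M)
    (hf0 : ∀ᵐ t ∂(volume.restrict (Icc 0 T)), ∀ᵐ x ∂μ, ‖f t x 0 0‖ ≤ N) :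
    ∃ g, IsNemytskii μ T f (fun i => mild P T (φ i) (g i))
      (fun i t => gradA j A μ (mild P T (φ i) (g i) t)) g ∧
      ∀ t ∈ Icc 0 T, ∀ᵐ x ∂μ, ‖vec (fun i => mild P T (φ i) (g i) t) x‖ ≤
        supBound m C l T M N := by
  -- The cutoff radius is the a priori sup bound, so neither the truncated solutions nor their limit
  -- reach the region where the cutoff acts.
  set r := supBound m C l T M N with hr
  have hr0 : 0 ≤ r := Real.sqrt_nonneg _
  set ρ : ℕ → ℝ := fun n => n + 1 with hρ
  have hρ1 : ∀ n, 1 ≤ ρ n := fun n => by simp [hρ]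
  have hρmono : Monotone ρ := fun n k hnk => by
    simp only [hρ]
    gcongr
  have hρlim : Tendsto ρ atTop atTop := tendsto_atTop_add_const_right _ _ tendsto_natCast_atTop_atTop
  choose g hg hgr hgQ using fun n => exists_mild_trunc S hC hm h hN hφ (r := r) (ρ := ρ n)
    (zero_le_one.trans (hρ1 n))
  obtain ⟨U, V, hU, hV, hDV, hUV⟩ := exists_limit_of_trunc S hC hm h hr0 hρ1 hρmono hρlim
    (u := fun n i => mild P T (φ i) (g n i)) (fun n i => rfl) hg hgr hgQ
  have hUr : ∀ t ∈ Icc 0 T, ∀ᵐ x ∂μ, ‖vec (fun i => U i t) x‖ ≤ r := fun t ht =>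
    ae_norm_vec_le_of_tendsto (fun i => hU i t ht) fun n => hgr n t ht
  obtain ⟨g', hg', hlim⟩ := exists_source_limit S hC h hr0 hN hf0 hρ1 hρlim
    (fun n i => (mild_continuousOn S.semigroup (hg n i).1).aestronglyMeasurable measurableSet_Icc)
    (fun n i => (inFhat_mild S (φ i) (hg n i).1).memLp) hg hU hUr hV hDV
  have heq : ∀ i, EqOn (U i) (mild P T (φ i) (g' i)) (Icc 0 T) := fun i =>
    eqOn_mild_of_tendsto S (fun n => (hg n i).1) (hg' i).1 (hlim i) (fun n t _ => rfl) (hU i)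
  refine ⟨g', hg'.congr (fun i => ?_) fun i => ?_, fun t ht => ?_⟩
  · filter_upwards [ae_restrict_mem measurableSet_Icc] with t ht using heq i ht
  · filter_upwards [hUV i, ae_restrict_mem measurableSet_Icc] with t h1 h2
    rw [← heq i h2]
    exact (h1.gradA_eq S.pos S.condA1).symm
  · have h1 : (fun i => mild P T (φ i) (g' i) t) = fun i => U i t := funext fun i => (heq i ht).symm
    rw [h1]
    exact hUr t ht

end Existence

/-! ### Squared norms in extended nonnegative reals -/

section EnormSq

variable {X : Type*} [NormedAddCommGroup X]

lemma sum_enorm_sq {ι : Type*} [Fintype ι] (v : ι → X) :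
    ∑ i, ‖v i‖ₑ ^ 2 = ENNReal.ofReal (∑ i, ‖v i‖ ^ 2) := by
  rw [ENNReal.ofReal_sum_of_nonneg fun i _ => by positivity]
  exact Finset.sum_congr rfl fun i _ => by rw [ENNReal.ofReal_pow (norm_nonneg _), ofReal_norm]

lemma lintegral_enorm_sq {β : Type*} [MeasurableSpace β] {ν : Measure β} {v : β → X}
    (hv : MemLp v 2 ν) : ∫⁻ t, ‖v t‖ₑ ^ 2 ∂ν = ENNReal.ofReal (∫ t, ‖v t‖ ^ 2 ∂ν) := by
  rw [ofReal_integral_eq_lintegral_ofReal (hv.integrable_norm_pow (by norm_num))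
    (Eventually.of_forall fun t => by positivity)]
  exact lintegral_congr fun t => by rw [ENNReal.ofReal_pow (norm_nonneg _), ofReal_norm]

lemma tendsto_iSup_enorm_sq {β : Type*} {v : ℕ → β → X} {w : β → X} {s : Set β}
    (h : TendstoUniformlyOn v w atTop s) :
    Tendsto (fun n => ⨆ t ∈ s, ‖v n t - w t‖ₑ ^ 2) atTop (𝓝 0) := by
  rw [ENNReal.tendsto_nhds_zero]
  intro ε hε
  filter_upwards [EMetric.tendstoUniformlyOn_iff.1 h (ε ^ (1 / 2 : ℝ))
    (ENNReal.rpow_pos_of_nonneg hε (by norm_num))] with n hn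
  refine iSup₂_le fun t ht => ?_
  have h1 := (hn t ht).le
  rw [edist_comm, edist_eq_enorm_sub] at h1
  refine (pow_le_pow_left₀ zero_le h1 2).trans_eq ?_
  rw [← ENNReal.rpow_natCast, ← ENNReal.rpow_mul]
  norm_num

end EnormSq

/-! ### Equivalence of solution notions, uniqueness and estimates -/

section Solutions

variable {E H : Type*} [NormedAddCommGroup E] [NormedSpace ℝ E]
  [NormedAddCommGroup H] [InnerProductSpace ℝ H] [CompleteSpace H]
  [TopologicalSpace.SeparableSpace H] [MeasurableSpace H] [BorelSpace H]
  [MeasurableSpace E] [BorelSpace E] [MeasurableSpace.CountablyGenerated E]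
  {j : H →L[ℝ] E} {A : E → H →L[ℝ] H} {b : E → H}
  {μ : Measure E} [IsFiniteMeasure μ] {T : ℝ} {P : ℝ → Lp ℝ 2 μ →L[ℝ] Lp ℝ 2 μ} {α : ℝ} {l : ℕ}
  {f : ℝ → E → EuclideanSpace ℝ (Fin l) → (Fin l → H) → EuclideanSpace ℝ (Fin l)}
  {φ : Fin l → Lp ℝ 2 μ} {C : ℝ} {m : ℝ → ℝ} {u v : Fin l → ℝ → Lp ℝ 2 μ}

lemma enorm_sq_le_normTSq (u : Fin l → ℝ → Lp ℝ 2 μ) (i : Fin l) {t : ℝ} (ht : t ∈ Icc 0 T) :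
    ‖u i t‖ₑ ^ 2 ≤ normTSq j A μ T u :=
  (Finset.single_le_sum (f := fun i => ‖u i t‖ₑ ^ 2) (fun _ _ => zero_le)
    (Finset.mem_univ i)).trans ((le_iSup₂ (f := fun t (_ : t ∈ Icc 0 T) => ∑ i, ‖u i t‖ₑ ^ 2)
      t ht).trans le_self_add)

/-- The strong approximants satisfy Duhamel's formula, whose two sides converge at each time: one by
convergence in the solution norm, the other by continuity of the mild solution in its data. -/
lemma IsGeneralizedSolution.isMildSolution (S : FormSetting j A b μ T P α)
    (h : IsGeneralizedSolution j A μ T P φ f u) : IsMildSolution j A μ T P φ f u := by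
  obtain ⟨hu, g, hg, φn, fn, un, gn, -, hs, hun, hφn, hgn⟩ := h
  refine ⟨hu, g, hg, fun i t ht => ?_⟩
  have h1 : ∀ n, un n i t = mild P T (φn n i) (gn n i) t := fun n => by
    obtain ⟨-, hte, du, Lu, hd, -, hL, -, heq⟩ := (hs n).2 i
    rw [eq_mild_of_strong S.semigroup S.time_pos hd hL ((hs n).1 i).1 heq ht, hte]
  have hi : ∀ n, IntegrableOn (gn n i) (Icc 0 T) := fun n => ((hs n).1 i).1
  have h2 : Tendsto (fun n => ∫ s in Icc 0 T, ‖gn n i s - g i s‖) atTop (𝓝 0) := by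
    refine ((ENNReal.tendsto_toReal ENNReal.zero_ne_top).comp (hgn i)).congr fun n => ?_
    exact (integral_norm_eq_lintegral_enorm ((hi n).sub (hg i).1).1).symm
  have h3 : Tendsto (fun n => un n i t) atTop (𝓝 (mild P T (φ i) (g i) t)) := by
    obtain ⟨M, -, hM⟩ := S.semigroup.exists_bound T
    rw [tendsto_iff_norm_sub_tendsto_zero]
    refine squeeze_zero (fun n => norm_nonneg _) (fun n => ?_)
      (by simpa using ((tendsto_iff_norm_sub_tendsto_zero.1 (hφn i)).add h2).const_mul M)
    rw [h1, ← mild_sub S.semigroup (hi n) (hg i).1 ht]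
    exact norm_mild_le S.semigroup hM ((hi n).sub (hg i).1) ht
  have h4 : Tendsto (fun n => un n i t) atTop (𝓝 (u i t)) := by
    have h5 : Tendsto (fun n => ‖un n i t - u i t‖ₑ ^ 2) atTop (𝓝 0) :=
      tendsto_of_tendsto_of_tendsto_of_le_of_le tendsto_const_nhds hun (fun _ => zero_le)
        fun n => enorm_sq_le_normTSq (fun i t => un n i t - u i t) i ht
    rw [tendsto_iff_edist_tendsto_0]
    have h6 := h5.ennrpow_const (1 / 2)
    simp only [edist_eq_enorm_sub]
    refine (h6.congr fun n => ?_).trans_eq ?_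
    · rw [← ENNReal.rpow_natCast, ← ENNReal.rpow_mul]
      norm_num
    · norm_num
  rw [tendsto_nhds_unique h4 h3, mild]

lemma NiceData.isStrongSolutionLin (S : FormSetting j A b μ T P α) {ψ : Lp ℝ 2 μ}
    {g : ℝ → Lp ℝ 2 μ} {M : ℝ} (h : NiceData P T ψ g M) :
    IsStrongSolutionLin j A μ T P ψ g (mild P T ψ g) := by
  obtain ⟨Lu, hLc, hL⟩ := h.exists_generator
  have hLi : IntegrableOn Lu (Icc 0 T) := hLc.integrableOn_Icc
  refine ⟨inFhat_mild S ψ h.integrableOn, mild_terminal S.semigroup, fun t => -(Lu t + g t), Lu,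
    fun t ht => mild_hasDerivWithinAt S.semigroup S.time_pos h.continuous hL hLc ht,
    (hLi.add h.integrableOn).neg, ?_, hLi, Eventually.of_forall fun t => ?_⟩
  · filter_upwards [ae_restrict_mem measurableSet_Icc] with t ht using hL t ht
  · rw [add_assoc, neg_add_cancel]

lemma tendsto_normTSq_of_niceApprox (S : FormSetting j A b μ T P α) {g : Fin l → ℝ → Lp ℝ 2 μ}
    (hg : ∀ i, IntegrableOn (g i) (Icc 0 T))
    (hu : ∀ i, EqOn (u i) (mild P T (φ i) (g i)) (Icc 0 T)) {φn : Fin l → ℕ → Lp ℝ 2 μ}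
    {gn : Fin l → ℕ → ℝ → Lp ℝ 2 μ} {Mn : Fin l → ℕ → ℝ}
    (hn : ∀ i, NiceApprox j A P T (φ i) (g i) (φn i) (gn i) (Mn i)) :
    Tendsto (fun n => normTSq j A μ T fun i t => mild P T (φn i n) (gn i n) t - u i t) atTop
      (𝓝 0) := by
  have hF := fun i => inFhat_mild S (φ i) (hg i)
  have hFn := fun i n => inFhat_mild S (φn i n) ((hn i).nice n).integrableOn
  have h1 : Tendsto (fun n => (∑ i, ⨆ t ∈ Icc 0 T,
      ‖mild P T (φn i n) (gn i n) t - mild P T (φ i) (g i) t‖ₑ ^ 2) +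
      ENNReal.ofReal (∑ i, ∫ t in Icc 0 T, ‖gradA j A μ (mild P T (φn i n) (gn i n) t) -
        gradA j A μ (mild P T (φ i) (g i) t)‖ ^ 2)) atTop (𝓝 0) := by
    simpa using (tendsto_finsetSum Finset.univ fun i _ =>
      tendsto_iSup_enorm_sq (hn i).tendsto_mild).add
      (ENNReal.tendsto_ofReal (tendsto_finsetSum Finset.univ fun i _ =>
        (hn i).tendsto_integral_gradA))
  refine tendsto_of_tendsto_of_tendsto_of_le_of_le tendsto_const_nhds h1 (fun _ => zero_le)
    fun n => add_le_add (iSup₂_le fun t ht => Finset.sum_le_sum fun i _ => ?_) (le_of_eq ?_)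
  · simp only [hu i ht]
    exact le_iSup₂ (f := fun t (_ : t ∈ Icc 0 T) =>
      ‖mild P T (φn i n) (gn i n) t - mild P T (φ i) (g i) t‖ₑ ^ 2) t ht
  · have h2 : ∀ i, MemLp (fun t => gradA j A μ (mild P T (φn i n) (gn i n) t) -
        gradA j A μ (mild P T (φ i) (g i) t)) 2 (volume.restrict (Icc 0 T)) := fun i =>
      (hFn i n).memLp.sub (hF i).memLp
    rw [ENNReal.ofReal_sum_of_nonneg fun i _ => integral_nonneg fun t => by positivity]
    simp only [← fun i => lintegral_enorm_sq (h2 i)]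
    rw [← lintegral_finsetSum' _ fun i _ => (h2 i).1.enorm.pow_const 2]
    refine lintegral_congr_ae ?_
    filter_upwards [ae_all_iff.2 fun i => (hFn i n).gradA_sub S (hF i),
      ae_restrict_mem measurableSet_Icc] with t h3 h4
    exact Finset.sum_congr rfl fun i _ => by rw [hu i h4, h3 i]

/-- The definition leaves the approximating nonlinearities free. They are taken independent of
(y,z), as measurable representatives of the regularized sources; the regularized mild solutions are
then strong solutions. -/
lemma IsMildSolution.isGeneralizedSolution (S : FormSetting j A b μ T P α)
    (h : IsMildSolution j A μ T P φ f u) : IsGeneralizedSolution j A μ T P φ f u := by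
  obtain ⟨hu, g, hg, heq⟩ := h
  choose φn gn Mn hn using fun i => exists_niceApprox S (φ i) (hg i).1
  choose w hwm hw using fun n i => exists_measurable_representative
    (ν := volume.restrict (Icc 0 T)) ((hn i).nice n).integrableOn.1
  refine ⟨hu, g, hg, fun n i => φn i n, fun n t x _ _ => WithLp.toLp 2 fun i => w n i (t, x),
    fun n i => mild P T (φn i n) (gn i n), fun n i => gn i n, fun n => ?_,
    fun n => ⟨fun i => ⟨((hn i).nice n).integrableOn, hw n i⟩,
      fun i => ((hn i).nice n).isStrongSolutionLin S⟩,
    tendsto_normTSq_of_niceApprox S (fun i => (hg i).1) (fun i t ht => ?_) hn,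
    fun i => (hn i).tendsto_terminal, fun i => ?_⟩
  · exact (PiLp.continuous_toLp 2 _).measurable.comp (measurable_pi_lambda _ fun i =>
      (hwm n i).comp ((measurable_subtype_coe.comp measurable_fst).prodMk
        (measurable_fst.comp measurable_snd)))
  · rw [heq i t ht, mild]
  · refine (ENNReal.tendsto_ofReal (hn i).tendsto_integral).congr (fun n => ?_) |>.trans_eq (by simp)
    exact ofReal_integral_norm_eq_lintegral_enorm (((hn i).nice n).integrableOn.sub (hg i).1)

lemma isGeneralizedSolution_iff (S : FormSetting j A b μ T P α) :
    IsGeneralizedSolution j A μ T P φ f u ↔ IsMildSolution j A μ T P φ f u :=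
  ⟨fun h => h.isMildSolution S, fun h => h.isGeneralizedSolution S⟩

lemma CondH.monotone_abs (h : CondH μ T C m f φ) {t : ℝ} (ht : t ∈ Icc 0 T) (x : E)
    (y y' : EuclideanSpace ℝ (Fin l)) (z : Fin l → H) :
    ⟪y - y', f t x y z - f t x y' z⟫ ≤ |m t| * ‖y - y'‖ ^ 2 :=
  (h.monotone t ht x y y' z).trans (by gcongr; exact le_abs_self _)

/-- Uniqueness of mild solutions. -/
lemma IsMildSolution.eqOn (S : FormSetting j A b μ T P α) (hm : IntegrableOn m (Icc 0 T))
    (h : CondH μ T C m f φ) (hv : IsMildSolution j A μ T P φ f v)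
    (hu : IsMildSolution j A μ T P φ f u) (i : Fin l) : EqOn (v i) (u i) (Icc 0 T) := by
  obtain ⟨-, g, hg, hv⟩ := hv
  obtain ⟨-, g', hg', hu⟩ := hu
  intro t ht
  have hgn : IsNemytskii μ T f v (fun i t => gradA j A μ (v i t)) g := hg
  have hgn' : IsNemytskii μ T f u (fun i t => gradA j A μ (u i t)) g' := hg'
  have h1 := stability_le S (fun i => (hg i).1) (fun i => (hg' i).1) hv hu
    (integrableOn_growthRate (C := C) (l := l) hm) growthRate_nonneg (h := fun _ => 0)
    integrableOn_zero (Eventually.of_forall fun _ => le_rfl) (by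
      filter_upwards [hgn.ae, hgn'.ae, ae_restrict_mem measurableSet_Icc] with s h1 h2 h3
      have h4 := two_sum_inner_sub_le (u := fun i => v i s) (u' := fun i => u i s) h1 h2
        (e := fun i => gradA j A μ (v i s) - gradA j A μ (u i s)) (k := growthRate m C l s)
        (d := fun _ => 0) (integrable_zero _ _ _) (by
          filter_upwards [ae_coeFn_sub (fun i => gradA j A μ (v i s))
            (fun i => gradA j A μ (u i s))] with x h5
          simp only [h5, add_zero]
          refine (two_inner_sub_le (h.monotone_abs h3 x) (h.lipschitz s h3 x) _ _ _ _).trans ?_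
          rw [growthRate]
          gcongr ?_ * _ + _
          linarith)
      simpa only [integral_zero, add_zero] using h4) ht
  simp only [sub_self, norm_zero, integral_zero, ne_eq, OfNat.ofNat_ne_zero, not_false_eq_true,
    zero_pow, Finset.sum_const_zero, add_zero, mul_zero] at h1
  have h2 : 0 ≤ ∫ s in Icc t T, ∑ i, ‖gradA j A μ (v i s) - gradA j A μ (u i s)‖ ^ 2 :=
    integral_nonneg fun s => Finset.sum_nonneg fun i _ => by positivity
  have h3 := (Finset.single_le_sum (f := fun i => ‖v i t - u i t‖ ^ 2)
    (fun i _ => by positivity) (Finset.mem_univ i)).trans (by linarith : _ ≤ (0 : ℝ))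
  exact sub_eq_zero.1 (norm_eq_zero.1 (pow_eq_zero_iff two_ne_zero |>.1
    (le_antisymm h3 (by positivity))))

/-- On a finite measure space the bound in (H5) gives square integrability. -/
lemma CondH.exists_memLp_source_zero (h : CondH μ T C m f φ) (hT : 0 ≤ T) :
    ∃ F : ℝ × E → EuclideanSpace ℝ (Fin l), Measurable F ∧
      (∀ t ∈ Icc 0 T, ∀ x, F (t, x) = f t x 0 0) ∧
      MemLp F 2 ((volume.restrict (Icc 0 T)).prod μ) := by
  set F : ℝ × E → EuclideanSpace ℝ (Fin l) := fun q => f (projIcc 0 T hT q.1) q.2 0 0 with hF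
  have hFm : Measurable F := h.measurable.comp (continuous_projIcc.measurable.comp measurable_fst)
    measurable_snd measurable_const measurable_const
  have hFe : ∀ t ∈ Icc 0 T, ∀ x, F (t, x) = f t x 0 0 := fun t ht x => by
    simp only [hF, projIcc_of_mem hT ht]
  refine ⟨F, hFm, hFe, MemLp.mono_exponent (q := ∞) ⟨hFm.aestronglyMeasurable, ?_⟩ le_top⟩
  refine lt_of_eq_of_lt (eLpNorm_congr_ae ?_) h.zero_bdd
  filter_upwards [Measure.quasiMeasurePreserving_fst.ae
    (ae_restrict_mem (μ := volume) (s := Icc 0 T) measurableSet_Icc)] with q hq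
  exact hFe q.1 hq q.2

lemma CondH.two_inner_le (h : CondH μ T C m f φ) {t : ℝ} (ht : t ∈ Icc 0 T) (x : E)
    (y : EuclideanSpace ℝ (Fin l)) (z : Fin l → H) :
    2 * ⟪y, f t x y z⟫ ≤ growthRate m C l t * ‖y‖ ^ 2 + ∑ i, ‖z i‖ ^ 2 + ‖f t x 0 0‖ ^ 2 := by
  have h1 := two_inner_sub_le (h.monotone_abs ht x) (h.lipschitz t ht x) y 0 z 0
  simp only [sub_zero, Pi.zero_apply, inner_sub_right] at h1
  have h2 := two_mul_le_add_sq ‖y‖ ‖f t x 0 0‖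
  have h3 := real_inner_le_norm y (f t x 0 0)
  rw [growthRate]
  linarith

/-- The energy estimate. -/
lemma IsMildSolution.normTSq_le (S : FormSetting j A b μ T P α) (hm : IntegrableOn m (Icc 0 T))
    (h : CondH μ T C m f φ) (hu : IsMildSolution j A μ T P φ f u) :
    normTSq j A μ T u ≤
      ENNReal.ofReal (2 * Real.exp (∫ s in Icc 0 T, |growthRate m C l s + α|)) *
        ((∑ i, ‖φ i‖ₑ ^ 2) + ∫⁻ t in Icc 0 T, ∫⁻ x, ‖f t x 0 0‖ₑ ^ 2 ∂μ) := by
  obtain ⟨hF, g, hg, hu⟩ := hu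
  have hT := S.time_pos
  have hgn : IsNemytskii μ T f u (fun i t => gradA j A μ (u i t)) g := hg
  obtain ⟨F, hFm, hFe, hF2⟩ := h.exists_memLp_source_zero hT.le
  have hFi : Integrable (fun q => ‖F q‖ ^ 2) ((volume.restrict (Icc 0 T)).prod μ) :=
    hF2.integrable_norm_pow (by norm_num)
  have hle : ∀ t ∈ Icc 0 T, (∑ i, ‖u i t‖ ^ 2) +
      ∫ s in Icc t T, ∑ i, ‖gradA j A μ (u i s)‖ ^ 2 ≤
      Real.exp (∫ s in Icc 0 T, |growthRate m C l s + α|) *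
        ((∑ i, ‖φ i‖ ^ 2) + ∫ s in Icc 0 T, ∫ x, ‖F (s, x)‖ ^ 2 ∂μ) := fun t ht =>
    apriori_le S (fun i => (hg i).1) hu (integrableOn_growthRate (C := C) (l := l) hm)
      growthRate_nonneg hFi.integral_prod_left
      (Eventually.of_forall fun s => integral_nonneg fun x => by positivity) (by
        filter_upwards [hgn.ae, hFi.prod_right_ae, ae_restrict_mem measurableSet_Icc] with s h1 h2 h3
        refine two_sum_inner_le_of_bracket h1 h2 (Eventually.of_forall fun x => ?_)
        rw [hFe s h3]
        exact h.two_inner_le h3 x _ _) ht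
  set R := Real.exp (∫ s in Icc 0 T, |growthRate m C l s + α|) *
    ((∑ i, ‖φ i‖ ^ 2) + ∫ s in Icc 0 T, ∫ x, ‖F (s, x)‖ ^ 2 ∂μ) with hR
  have hsrc : ENNReal.ofReal (∫ s in Icc 0 T, ∫ x, ‖F (s, x)‖ ^ 2 ∂μ) =
      ∫⁻ t in Icc 0 T, ∫⁻ x, ‖f t x 0 0‖ₑ ^ 2 ∂μ := by
    rw [← integral_prod _ hFi, ← lintegral_enorm_sq hF2,
      lintegral_prod _ (hFm.enorm.pow_const 2).aemeasurable]
    exact setLIntegral_congr_fun measurableSet_Icc fun t ht => by simp only [hFe t ht]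
  -- The supremum and the energy integral are each bounded by R, whence the factor 2.
  have hR2 : ENNReal.ofReal (2 * Real.exp (∫ s in Icc 0 T, |growthRate m C l s + α|)) *
      ((∑ i, ‖φ i‖ₑ ^ 2) + ∫⁻ t in Icc 0 T, ∫⁻ x, ‖f t x 0 0‖ₑ ^ 2 ∂μ) =
      ENNReal.ofReal R + ENNReal.ofReal R := by
    have h0 : 0 ≤ ∫ s in Icc 0 T, ∫ x, ‖F (s, x)‖ ^ 2 ∂μ :=
      integral_nonneg fun s => integral_nonneg fun x => by positivity
    have hR0 : 0 ≤ R := by positivity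
    rw [← hsrc, sum_enorm_sq, ← ENNReal.ofReal_add (by positivity) h0,
      ← ENNReal.ofReal_mul (by positivity), ← ENNReal.ofReal_add hR0 hR0, mul_assoc, two_mul]
  rw [hR2]
  refine add_le_add (iSup₂_le fun t ht => ?_) ?_
  · rw [sum_enorm_sq]
    refine ENNReal.ofReal_le_ofReal (le_trans ?_ (hle t ht))
    exact le_add_of_nonneg_right (integral_nonneg fun s => Finset.sum_nonneg fun i _ =>
      by positivity)
  · rw [lintegral_finsetSum' _ fun i _ => (hF i).memLp.1.enorm.pow_const 2]
    simp only [fun i => lintegral_enorm_sq (hF i).memLp]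
    rw [← ENNReal.ofReal_sum_of_nonneg fun i _ => integral_nonneg fun t => by positivity,
      ← integral_finsetSum _ fun i _ => (hF i).memLp.integrable_norm_pow (by norm_num)]
    refine ENNReal.ofReal_le_ofReal (le_trans ?_ (hle 0 ⟨le_rfl, hT.le⟩))
    exact le_add_of_nonneg_left (Finset.sum_nonneg fun i _ => by positivity)

lemma supBound_le {M N : ℝ} (hM : 0 ≤ M) (hN : 0 ≤ N) :
    supBound m C l T M N ≤
      √(Real.exp (∫ s in Icc 0 T, |growthRate m C l s|) * max 1 T) * (M + N) := by
  rw [supBound, ← Real.sqrt_sq (add_nonneg hM hN), ← Real.sqrt_mul (by positivity), mul_assoc]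
  refine Real.sqrt_le_sqrt (mul_le_mul_of_nonneg_left ?_ (Real.exp_pos _).le)
  have h1 : M ^ 2 ≤ max 1 T * M ^ 2 := le_mul_of_one_le_left (sq_nonneg M) (le_max_left _ _)
  have h2 : T * N ^ 2 ≤ max 1 T * N ^ 2 :=
    mul_le_mul_of_nonneg_right (le_max_right _ _) (sq_nonneg N)
  have h3 : 0 ≤ max 1 T * (2 * M * N) := by positivity
  linarith [show max 1 T * (M + N) ^ 2 =
    max 1 T * M ^ 2 + max 1 T * N ^ 2 + max 1 T * (2 * M * N) by ring]

lemma ae_norm_le_toReal_eLpNorm {β F : Type*} [MeasurableSpace β] [NormedAddCommGroup F]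
    {ν : Measure β} {w : β → F} (h : eLpNorm w ∞ ν < ∞) :
    ∀ᵐ x ∂ν, ‖w x‖ ≤ (eLpNorm w ∞ ν).toReal := by
  rw [eLpNorm_exponent_top] at h ⊢
  filter_upwards [enorm_ae_le_eLpNormEssSup w ν] with x hx
  rw [← toReal_enorm]
  exact ENNReal.toReal_mono h.ne hx

/-- Existence of a mild solution satisfying the maximum norm estimate. -/
lemma exists_isMildSolution (S : FormSetting j A b μ T P α) (hC : 0 ≤ C)
    (hm : IntegrableOn m (Icc 0 T)) (h : CondH μ T C m f φ) :
    ∃ u, IsMildSolution j A μ T P φ f u ∧ ∀ t ∈ Icc 0 T, eLpNorm (vec fun i => u i t) ∞ μ ≤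
      ENNReal.ofReal √(Real.exp (∫ s in Icc 0 T, |growthRate m C l s|) * max 1 T) *
        (eLpNorm (vec φ) ∞ μ + eLpNorm (fun p : ℝ × E => f p.1 p.2 0 0) ∞
          ((volume.restrict (Icc 0 T)).prod μ)) := by
  obtain ⟨g, hg, hgb⟩ := exists_mild_of_condH S hC hm h ENNReal.toReal_nonneg
    (ae_norm_le_toReal_eLpNorm h.terminal_bdd)
    (Measure.ae_ae_of_ae_prod (ae_norm_le_toReal_eLpNorm h.zero_bdd))
  refine ⟨fun i => mild P T (φ i) (g i), ⟨fun i => inFhat_mild S _ (hg i).1, g, hg,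
    fun i t _ => rfl⟩, fun t ht => ?_⟩
  rw [← ENNReal.ofReal_toReal h.terminal_bdd.ne, ← ENNReal.ofReal_toReal h.zero_bdd.ne,
    ← ENNReal.ofReal_add ENNReal.toReal_nonneg ENNReal.toReal_nonneg,
    ← ENNReal.ofReal_mul (Real.sqrt_nonneg _), eLpNorm_exponent_top]
  exact (eLpNormEssSup_le_of_ae_bound (hgb t ht)).trans (ENNReal.ofReal_le_ofReal
    (supBound_le ENNReal.toReal_nonneg ENNReal.toReal_nonneg))

end Solutions

theorem theorem3p8
    {E H : Type*}
    [NormedAddCommGroup E] [NormedSpace ℝ E] [CompleteSpace E]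
    [TopologicalSpace.SeparableSpace E] [MeasurableSpace E] [BorelSpace E]
    [NormedAddCommGroup H] [InnerProductSpace ℝ H] [CompleteSpace H]
    [TopologicalSpace.SeparableSpace H] [MeasurableSpace H] [BorelSpace H]
    (j : H →L[ℝ] E) (hj_inj : Function.Injective j) (hj_dense : DenseRange j)
    (μ : Measure E) [IsFiniteMeasure μ]
    (A : E → H →L[ℝ] H) (hA_meas : ∀ h, Measurable fun z => A z h)
    (hA_pos : ∀ z, (A z).IsPositive)
    (b : E → H) (hb_meas : Measurable b)
    (T : ℝ) (hT : 0 < T)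
    (P : ℝ → Lp ℝ 2 μ →L[ℝ] Lp ℝ 2 μ)
    (hA1 : CondA1 j A μ) (hA2 : CondA2 j A b μ) (hA3 : CondA3 j A b μ T P)
    (l : ℕ) (C : ℝ) (hC : 0 < C) (m : ℝ → ℝ) (hm : IntegrableOn m (Icc 0 T)) :
    ∃ K₁ K₂ : ℝ≥0,
      ∀ (f : ℝ → E → EuclideanSpace ℝ (Fin l) → (Fin l → H) → EuclideanSpace ℝ (Fin l))
        (φ : Fin l → Lp ℝ 2 μ), CondH μ T C m f φ →
        (∀ v : Fin l → ℝ → Lp ℝ 2 μ,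
          IsGeneralizedSolution j A μ T P φ f v ↔ IsMildSolution j A μ T P φ f v) ∧
        ∃ u : Fin l → ℝ → Lp ℝ 2 μ,
          IsGeneralizedSolution j A μ T P φ f u ∧
          (∀ v, IsGeneralizedSolution j A μ T P φ f v → ∀ i, EqOn (v i) (u i) (Icc 0 T)) ∧
          normTSq j A μ T u ≤
            K₁ * ((∑ i, ‖φ i‖ₑ ^ 2) + ∫⁻ t in Icc 0 T, ∫⁻ x, ‖f t x 0 0‖ₑ ^ 2 ∂μ) ∧
          ∀ t ∈ Icc 0 T, eLpNorm (vec fun i => u i t) ∞ μ ≤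
            K₂ * (eLpNorm (vec φ) ∞ μ + eLpNorm (fun p : ℝ × E => f p.1 p.2 0 0) ∞
              ((volume.restrict (Icc 0 T)).prod μ)) := by
  obtain ⟨α, hα0, hα⟩ := hA2.exists_driftLowerBound hA_pos
  have S : FormSetting j A b μ T P α := ⟨hA_pos, hA1, hA2, hA3, hT, hα0, hα⟩
  -- Separability makes the Borel σ-algebra of E countably generated, hence L²(μ) separable, as the
  -- measurable representatives require.
  have : SecondCountableTopology E := UniformSpace.secondCountable_of_separable E
  refine ⟨(2 * Real.exp (∫ s in Icc 0 T, |growthRate m C l s + α|)).toNNReal,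
    (√(Real.exp (∫ s in Icc 0 T, |growthRate m C l s|) * max 1 T)).toNNReal, fun f φ h =>
    ⟨fun v => isGeneralizedSolution_iff S, ?_⟩⟩
  obtain ⟨u, hu, hb⟩ := exists_isMildSolution S hC.le hm h
  exact ⟨u, hu.isGeneralizedSolution S, fun v hv => (hv.isMildSolution S).eqOn S hm h hu,
    hu.normTSq_le S hm h, hb⟩
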